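/- Let $N\ge 1$, $0<s<1$, and let $E\subset\mathbb R^N$ be an open set with smooth boundary $\Sigma=\partial E$ (near each $p\in\Sigma$, $E=\{\varphi<0\}$ with $\varphi$ smooth, $\varphi(p)=0$, $\nabla\varphi(p)\neq0$). Let $\nu$ be the unit normal of $\Sigma$ exterior to $E$, let $\sigma$ be the surface measure on $\Sigma$, and assume that $\int_\Sigma (1+|x|)^{-N-s}\,d\sigma(x)<\infty$ (so that the operator $\mathcal J^s_\Sigma$ below makes sense). Let $H=\sum_i k_i$ be the classical mean curvature of $\Sigma$ (the sum of the principal curvatures, that is, the tangential divergence of $\nu$), and for $p\in\Sigma$ put $$H^s_\Sigma(p)=\lim_{\delta\downarrow0}\int_{\mathbb R^N\setminus B_\delta(p)}\frac{\chi_E(x)-\chi_{E^c}(x)}{|x-p|^{N+s}}\,dx,$$ $$\mathcal J^s_\Sigma[h](p)=\lim_{\delta\downarrow0}\int_{\Sigma\setminus B_\delta(p)}\frac{h(x)-h(p)}{|p-x|^{N+s}}\,d\sigma(x)+h(p)\int_\Sigma\frac{\langle\nu(p)-\nu(x),\nu(p)\rangle}{|p-x|^{N+s}}\,d\sigma(x).$$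 For $\Omega\subset\mathbb R^N$ let $$Per_s(E,\Omega)=\int_{E\cap\Omega}\int_{E^c}\frac{dy\,dx}{|x-y|^{N+s}}+\int_{E\cap\Omega^c}\int_{E^c\cap\Omega}\frac{dy\,dx}{|x-y|^{N+s}}.$$ For a smooth $h:\Sigma\to\mathbb R$ and $t\in\mathbb R$, a normal perturbation $E_{th}$ is an open set with smooth boundary such that $x\mapsto x+th(x)\nu(x)$ is a regular parametrization of $\partial E_{th}$ by $\Sigma$ (a bijection $\Sigma\to\partial E_{th}$ with injective differential at every point), and such that the exterior normal of $E_{th}$ at $x+th(x)\nu(x)$ has positive inner product with $\nu(x)$ for all $x\in\Sigma$. (1) Let $\Omega\subset\mathbb R^N$ be bounded and open and $h\in C_0^\infty(\Omega\cap\Sigma)$. Then $E_{th}$ exists for all sufficiently small $|t|$; the integrals defining $H^s_\Sigma(p)$ and $\mathcal J^s_\Sigma[h](p)$ exist for every $p\in\Sigma$; the two integrands on the right-hand side below are integrable on $\Sigma$; and for every choice of the sets $E_{th}$ the function $t\mapsto Per_s(E_{th},\Omega)$ is finite and differentiable for $t$ near $0$, twice differentiable at $t=0$, and $$\frac{d^2}{dt^2}Per_s(E_{th},\Omega)\Big|_{t=0}=-2\int_\Sigma\mathcal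 J^s_\Sigma[h]\,h\,d\sigma-\int_\Sigma h^2\,H\,H^s_\Sigma\,d\sigma.$$ (2) Let $h\in C^\infty(\Sigma)\cap L^\infty(\Sigma)$ be such that the normal perturbations $E_{th}$ exist for all sufficiently small $|t|$, let $\Sigma_{th}=\partial E_{th}$, let $p\in\Sigma$ and $p_t=p+th(p)\nu(p)\in\Sigma_{th}$. Then $H^s_{\Sigma_{th}}(p_t)$ exists for $t$ near $0$, the integrals defining $\mathcal J^s_\Sigma[h](p)$ exist, $t\mapsto H^s_{\Sigma_{th}}(p_t)$ is differentiable at $t=0$, and $$\frac{d}{dt}H^s_{\Sigma_{th}}(p_t)\Big|_{t=0}=2\,\mathcal J^s_\Sigma[h](p).$$ -/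

import Mathlib

open Set Filter Topology MeasureTheory
open scoped ContDiff RealInnerProductSpace ENNReal

namespace NonlocalSurface

noncomputable section

/-- `φ` is a smooth defining function of the set `E` near the point `p`: `φ p = 0`, `∇φ(p) ≠ 0`, and
near `p` the set `E` is `{φ < 0}`. -/
def IsDefiningFunction {N : ℕ} (E : Set (EuclideanSpace ℝ (Fin N))) (p : EuclideanSpace ℝ (Fin N))
    (φ : EuclideanSpace ℝ (Fin N) → ℝ) : Prop :=
  ContDiff ℝ ∞ φ ∧ φ p = 0 ∧ gradient φ p ≠ 0 ∧ ∀ᶠ x in 𝓝 p, (x ∈ E ↔ φ x < 0)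

/-- `E` is an open set with smooth boundary. -/
def HasSmoothBoundary {N : ℕ} (E : Set (EuclideanSpace ℝ (Fin N))) : Prop :=
  IsOpen E ∧ ∀ p ∈ frontier E, ∃ φ, IsDefiningFunction E p φ

open Classical in
/-- The unit normal `ν` of `Σ = ∂E` pointing to the exterior of `E`: the normalized gradient of a
defining function (it does not depend on which one). Set to `0` at points where there is none. -/
def exteriorNormal {N : ℕ} (E : Set (EuclideanSpace ℝ (Fin N))) (p : EuclideanSpace ℝ (Fin N)) :
    EuclideanSpace ℝ (Fin N) :=
  if hp : ∃ φ, IsDefiningFunction E p φ then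
    ‖gradient hp.choose p‖⁻¹ • gradient hp.choose p
  else 0

/-- The surface measure of `Σ = ∂E`: the `(N-1)`-dimensional Hausdorff measure, in its Euclidean
normalization, restricted to `Σ`. -/
def surfaceMeasure {N : ℕ} (E : Set (EuclideanSpace ℝ (Fin N))) :
    Measure (EuclideanSpace ℝ (Fin N)) :=
  (Measure.euclideanHausdorffMeasure (N - 1)).restrict (frontier E)

/-- The classical mean curvature `H` of `Σ = ∂E` at `p`, the sum of the principal curvatures with
respect to the exterior normal: the trace on the tangent space of the differential of `ν` along `Σ`
(positive for balls). -/
def meanCurvature {N : ℕ} (E : Set (EuclideanSpace ℝ (Fin N))) (p : EuclideanSpace ℝ (Fin N)) : ℝ :=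
  let D := fderivWithin ℝ (exteriorNormal E) (frontier E) p
  LinearMap.trace ℝ (EuclideanSpace ℝ (Fin N)) D.toLinearMap
    - ⟪D (exteriorNormal E p), exteriorNormal E p⟫

/-- The integral of `f` with respect to `μ`, in the principal value sense at `p`, exists: `f` is
integrable outside each ball centred at `p`, and the integrals outside `B_δ(p)` converge as `δ ↓ 0`. -/
def HasPrincipalValue {N : ℕ} (μ : Measure (EuclideanSpace ℝ (Fin N)))
    (p : EuclideanSpace ℝ (Fin N)) (f : EuclideanSpace ℝ (Fin N) → ℝ) : Prop :=
  (∀ δ > 0, IntegrableOn f (Metric.ball p δ)ᶜ μ) ∧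
    ∃ l, Tendsto (fun δ : ℝ => ∫ x in (Metric.ball p δ)ᶜ, f x ∂μ) (𝓝[>] 0) (𝓝 l)

/-- The principal value at `p` of the integral of `f` with respect to `μ`. -/
def principalValue {N : ℕ} (μ : Measure (EuclideanSpace ℝ (Fin N)))
    (p : EuclideanSpace ℝ (Fin N)) (f : EuclideanSpace ℝ (Fin N) → ℝ) : ℝ :=
  limUnder (𝓝[>] 0) (fun δ : ℝ => ∫ x in (Metric.ball p δ)ᶜ, f x ∂μ)

/-- The integrand `(χ_E(x) - χ_{E^c}(x)) / |x - p|^{N+s}` of the fractional mean curvature. -/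
def curvatureIntegrand {N : ℕ} (s : ℝ) (E : Set (EuclideanSpace ℝ (Fin N)))
    (p x : EuclideanSpace ℝ (Fin N)) : ℝ :=
  (E.indicator 1 x - Eᶜ.indicator 1 x) / ‖x - p‖ ^ ((N : ℝ) + s)

/-- The fractional mean curvature `H^s_Σ(p)` of `Σ = ∂E`. -/
def fractionalMeanCurvature {N : ℕ} (s : ℝ) (E : Set (EuclideanSpace ℝ (Fin N)))
    (p : EuclideanSpace ℝ (Fin N)) : ℝ :=
  principalValue volume p (curvatureIntegrand s E p)

/-- The integrand `(h(x) - h(p)) / |p - x|^{N+s}`. -/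
def jacobiIntegrand₁ {N : ℕ} (s : ℝ) (h : EuclideanSpace ℝ (Fin N) → ℝ)
    (p x : EuclideanSpace ℝ (Fin N)) : ℝ :=
  (h x - h p) / ‖p - x‖ ^ ((N : ℝ) + s)

/-- The integrand `⟨ν(p) - ν(x), ν(p)⟩ / |p - x|^{N+s}`. -/
def jacobiIntegrand₂ {N : ℕ} (s : ℝ) (E : Set (EuclideanSpace ℝ (Fin N)))
    (p x : EuclideanSpace ℝ (Fin N)) : ℝ :=
  ⟪exteriorNormal E p - exteriorNormal E x, exteriorNormal E p⟫ / ‖p - x‖ ^ ((N : ℝ) + s)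

/-- The fractional Jacobi operator `J^s_Σ[h](p)` of `Σ = ∂E`. -/
def fractionalJacobi {N : ℕ} (s : ℝ) (E : Set (EuclideanSpace ℝ (Fin N)))
    (h : EuclideanSpace ℝ (Fin N) → ℝ) (p : EuclideanSpace ℝ (Fin N)) : ℝ :=
  principalValue (surfaceMeasure E) p (jacobiIntegrand₁ s h p)
    + h p * ∫ x, jacobiIntegrand₂ s E p x ∂(surfaceMeasure E)

/-- All the integrals in the definition of `J^s_Σ[h](p)` exist. -/
def FractionalJacobiExists {N : ℕ} (s : ℝ) (E : Set (EuclideanSpace ℝ (Fin N)))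
    (h : EuclideanSpace ℝ (Fin N) → ℝ) (p : EuclideanSpace ℝ (Fin N)) : Prop :=
  HasPrincipalValue (surfaceMeasure E) p (jacobiIntegrand₁ s h p) ∧
    Integrable (jacobiIntegrand₂ s E p) (surfaceMeasure E)

/-- The `s`-perimeter of `E` localized to `Ω`, with values in `[0, ∞]`. -/
def fractionalPerimeter {N : ℕ} (s : ℝ) (E Ω : Set (EuclideanSpace ℝ (Fin N))) : ℝ≥0∞ :=
  (∫⁻ x in E ∩ Ω, ∫⁻ y in Eᶜ, ENNReal.ofReal (1 / ‖x - y‖ ^ ((N : ℝ) + s)))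
    + ∫⁻ x in E ∩ Ωᶜ, ∫⁻ y in Eᶜ ∩ Ω, ENNReal.ofReal (1 / ‖x - y‖ ^ ((N : ℝ) + s))

/-- `h` is a smooth function on `S`: near each point of `S` it is the restriction to `S` of a smooth
function on the ambient space. Only the values of `h` on `S` matter. -/
def SmoothOnSurface {N : ℕ} (S : Set (EuclideanSpace ℝ (Fin N)))
    (h : EuclideanSpace ℝ (Fin N) → ℝ) : Prop :=
  ∀ p ∈ S, ∃ g : EuclideanSpace ℝ (Fin N) → ℝ, ContDiff ℝ ∞ g ∧ ∀ᶠ x in 𝓝[S] p, h x = g x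

/-- `h`, as a function on `S`, vanishes outside a compact subset of `S ∩ Ω`. -/
def CompactlySupportedIn {N : ℕ} (S Ω : Set (EuclideanSpace ℝ (Fin N)))
    (h : EuclideanSpace ℝ (Fin N) → ℝ) : Prop :=
  ∃ K : Set (EuclideanSpace ℝ (Fin N)), IsCompact K ∧ K ⊆ S ∩ Ω ∧ ∀ x ∈ S, x ∉ K → h x = 0

/-- The normal displacement `x ↦ x + t h(x) ν(x)`, where `ν` is the exterior normal of `E`. -/
def normalDisplacement {N : ℕ} (E : Set (EuclideanSpace ℝ (Fin N)))
    (h : EuclideanSpace ℝ (Fin N) → ℝ) (t : ℝ) (x : EuclideanSpace ℝ (Fin N)) :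
    EuclideanSpace ℝ (Fin N) :=
  x + (t * h x) • exteriorNormal E x

/-- `F` is the normal perturbation `E_{th}` of `E`: an open set with smooth boundary, whose boundary is
regularly parametrized by `x ↦ x + t h(x) ν(x)`, `x ∈ ∂E` (bijectively, with injective differential
on each tangent space), and whose exterior normal at `x + t h(x) ν(x)` is close to `ν(x)`, that is, on
the same side as `ν(x)`. -/
structure IsNormalPerturbation {N : ℕ} (E : Set (EuclideanSpace ℝ (Fin N)))
    (h : EuclideanSpace ℝ (Fin N) → ℝ) (t : ℝ) (F : Set (EuclideanSpace ℝ (Fin N))) : Prop where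
  smooth : HasSmoothBoundary F
  bijOn : BijOn (normalDisplacement E h t) (frontier E) (frontier F)
  immersion : ∀ x ∈ frontier E, ∀ v : EuclideanSpace ℝ (Fin N), ⟪v, exteriorNormal E x⟫ = 0 →
    fderivWithin ℝ (normalDisplacement E h t) (frontier E) x v = 0 → v = 0
  normal : ∀ x ∈ frontier E,
    0 < ⟪exteriorNormal F (normalDisplacement E h t x), exteriorNormal E x⟫

end

end NonlocalSurface

open NonlocalSurface

/-! All computations are made with the smooth kernel `kern (N + s) δ`, that is `(‖w‖² +
δ²)^(-(N+s)/2)`, and `δ → 0` is taken at the end.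

Let `h` be compactly supported. The field `h ν` extends to a compactly supported smooth field `X`,
and for small `t` the images of `E` under `x ↦ x + t X x` are normal perturbations. A normal
perturbation is determined by its boundary and by the side of its normal
(`IsNormalPerturbation.unique`), so these are the only ones, unless `∂E` is empty and all perimeters
vanish. The perimeter is the integral of `‖x - y‖^(-N-s)` over pairs separated by `∂E`. It is finite
because the pairs with difference `w` fill a volume `O(‖w‖)` near `w = 0`. Moving both points by the
flow fixes the domain and multiplies the kernel by `pairWeight`, a smooth function of `t` and of
parameters that stay in a compact set because `X` is Lipschitz. Hence one may differentiate twice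
under the integral, and the result is the limit of the expressions with regularized kernels. For
these the second derivative of the integrand is a sum of divergences (`pairVariation`). The
divergence theorem brings it to `∂E`, where the tangential divergence of `h ν` is `h H`; this gives
the formula (`HasSmoothBoundary.regularized_second_variation`). Gauss' formula is itself proved
here, by integration along transversal lines.

The limit needs bounds uniform in `δ`. If the integrals of `f` over the balls `B_r(p)` are
`O(r^(N+1))`, a layer cake formula turns the integral of `f` against the kernel into a radial
integral of order `ρ^(-s)`, so truncated and smoothed integrals converge to the same limit
(`exists_tendsto_radial`). The hypothesis on the balls is geometric. The sign function of `E` is odd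
under reflection through `p`, off a parabolic wedge of volume `O(r^(N+1))`. Up to `O(r²)`, `h x - h
p` is a tangential linear form, and the surface measure projected to the tangent plane is Lebesgue
measure up to factors `1 + O(r)`. Finally `⟪ν p - ν x, ν p⟫ = ‖ν x - ν p‖² / 2` is quadratic.

For the derivative of the curvature along a compactly supported flow, the regularized curvature is
pulled back to `E` and expanded in `t`. Gauss' formula identifies the linear term, and the same
reflection argument bounds the remainder by `O(t²)` uniformly in `δ`. A bounded `h` is truncated far
from `p`. The two perturbed sets then differ only in the region swept by the distant part of `∂E`,
and the weighted volume of this region is `|t|` times the tail of a convergent surface integral.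
That volume bound rests on two facts: a point that changes side must be crossed by the moving
boundary, and the existence of perturbations up to time `t₁` forces `|h| ‖Dν‖ ≤ 1 / t₁`. -/

namespace NonlocalSurface

open Metric (ball mem_ball ball_subset_ball mem_ball_self closedBall
  eventually_nhds_iff_ball ball_mem_nhds mem_closedBall isOpen_ball ball_subset_closedBall)
open ENNReal (ofReal ofReal_mul ofReal_ne_top ofReal_le_ofReal toReal_ofReal)
open Real (norm_eq_abs norm_of_nonneg rpow_nonneg rpow_neg rpow_add)
open MeasureTheory.Measure (euclideanHausdorffMeasure)

open scoped NNReal Manifold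

variable {N : ℕ}

local notation:max "R^" n:max => EuclideanSpace ℝ (Fin n)

local notation "V" => EuclideanSpace ℝ (Fin N)

variable {E : Set R^N}

local notation "nu" => exteriorNormal

local notation "area" => surfaceMeasure

local notation "Ψ" => normalDisplacement

/-! ### Defining functions, exterior normal and tangent vectors -/

section DefiningFunctions

lemma inner_gradient_left (φ : V → ℝ) (p v : V) : ⟪gradient φ p, v⟫ = fderiv ℝ φ p v := by
  simp [gradient, InnerProductSpace.toDual_symm_apply]

lemma contDiff_gradient {φ : V → ℝ} (h : ContDiff ℝ ∞ φ) : ContDiff ℝ ∞ (gradient φ) := by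
  unfold gradient
  exact (InnerProductSpace.toDual ℝ V).symm.toContinuousLinearEquiv.contDiff.comp
    (h.fderiv_right (by simp))

namespace IsDefiningFunction

variable {E : Set R^N} {p : R^N}
  {φ : R^N → ℝ}

lemma gradient_norm_pos (h : IsDefiningFunction E p φ) : 0 < ‖gradient φ p‖ :=
  norm_pos_iff.2 h.2.2.1

lemma differentiable (h : IsDefiningFunction E p φ) : Differentiable ℝ φ :=
  h.1.differentiable (by simp)

lemma fderiv_ne_zero (h : IsDefiningFunction E p φ) : fderiv ℝ φ p ≠ 0 := by
  intro h0
  apply h.2.2.1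
  simp [gradient, h0]

lemma hasStrictFDerivAt (h : IsDefiningFunction E p φ) (x : V) :
    HasStrictFDerivAt φ (fderiv ℝ φ x) x :=
  h.1.contDiffAt.hasStrictFDerivAt (by simp)

lemma range_eq_top (h : IsDefiningFunction E p φ) : (fderiv ℝ φ p).range = ⊤ := by
  rw [LinearMap.range_eq_top]
  apply LinearMap.surjective
  intro h0
  exact h.fderiv_ne_zero (ContinuousLinearMap.coe_injective h0)

lemma gradient_ne_zero_eventually (h : IsDefiningFunction E p φ) :
    ∀ᶠ x in 𝓝 p, gradient φ x ≠ 0 :=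
  (contDiff_gradient h.1).continuous.continuousAt.eventually_ne h.2.2.1

lemma eventually (h : IsDefiningFunction E p φ) :
    ∀ᶠ x in 𝓝 p, φ x = 0 → IsDefiningFunction E x φ := by
  filter_upwards [h.gradient_ne_zero_eventually, h.2.2.2.eventually_nhds] with x hx hx' h0
  exact ⟨h.1, h0, hx, hx'⟩

/-- Near `p`, along a direction in which `φ` increases at `p`, `φ` changes sign. -/
lemma exists_neg_pos (h : IsDefiningFunction E p φ) {e : V} (he : 0 < fderiv ℝ φ p e) :
    ∀ᶠ r in 𝓝[>] (0 : ℝ), φ (p - r • e) < 0 ∧ 0 < φ (p + r • e) := by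
  have h1 : HasDerivAt (fun r : ℝ => φ (p + r • e)) (fderiv ℝ φ p e) 0 := by
    have h2 : HasDerivAt (fun r : ℝ => p + r • e) e 0 := by
      simpa using ((hasDerivAt_id (0 : ℝ)).smul_const e).const_add p
    have h3 : HasFDerivAt φ (fderiv ℝ φ p) (p + (0 : ℝ) • e) := by
      simpa using (h.differentiable p).hasFDerivAt
    exact h3.comp_hasDerivAt 0 h2
  have h4 := hasDerivAt_iff_tendsto_slope.1 h1
  have h5 : ∀ᶠ r in 𝓝[≠] (0 : ℝ), 0 < slope (fun r : ℝ => φ (p + r • e)) 0 r :=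
    h4.eventually (lt_mem_nhds he)
  have h6 : ∀ᶠ r in 𝓝[>] (0 : ℝ), 0 < slope (fun r : ℝ => φ (p + r • e)) 0 r :=
    h5.filter_mono (nhdsWithin_mono _ (fun x hx => ne_of_gt hx))
  have h7 : Tendsto (fun r : ℝ => -r) (𝓝[>] 0) (𝓝[≠] 0) := by
    refine tendsto_nhdsWithin_iff.2 ⟨?_, ?_⟩
    · have : Tendsto (fun r : ℝ => -r) (𝓝 0) (𝓝 0) := by simpa using (continuous_neg.tendsto (0 : ℝ))
      exact this.mono_left nhdsWithin_le_nhds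
    · filter_upwards [self_mem_nhdsWithin] with r hr
      simpa using (ne_of_gt hr)
  filter_upwards [h6, h7.eventually h5, self_mem_nhdsWithin] with r h8 h9 hr
  have hr : 0 < r := hr
  simp only [slope, zero_smul, add_zero, h.2.1, vsub_eq_sub, sub_zero, smul_eq_mul] at h8 h9
  constructor
  · rw [neg_smul, ← sub_eq_add_neg] at h9
    by_contra hc
    push Not at hc
    have : (-r)⁻¹ * φ (p - r • e) ≤ 0 := mul_nonpos_of_nonpos_of_nonneg (by simp [hr.le]) hc
    linarith
  · exact pos_of_mul_pos_right h8 (inv_nonneg.2 hr.le)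

lemma fderiv_gradient_pos (h : IsDefiningFunction E p φ) : 0 < fderiv ℝ φ p (gradient φ p) := by
  rw [← inner_gradient_left, real_inner_self_eq_norm_sq]
  exact pow_pos h.gradient_norm_pos 2

lemma mem_frontier (h : IsDefiningFunction E p φ) : p ∈ frontier E := by
  rw [frontier_eq_closure_inter_closure]
  have h1 := h.exists_neg_pos h.fderiv_gradient_pos
  have ht : Tendsto (fun r : ℝ => p - r • gradient φ p) (𝓝[>] 0) (𝓝 p) := by
    have : Continuous (fun r : ℝ => p - r • gradient φ p) := by fun_prop
    simpa using (this.tendsto 0).mono_left nhdsWithin_le_nhds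
  have ht' : Tendsto (fun r : ℝ => p + r • gradient φ p) (𝓝[>] 0) (𝓝 p) := by
    have : Continuous (fun r : ℝ => p + r • gradient φ p) := by fun_prop
    simpa using (this.tendsto 0).mono_left nhdsWithin_le_nhds
  constructor
  · refine mem_closure_of_tendsto ht ?_
    filter_upwards [h1, ht.eventually h.2.2.2] with r h2 h3
    exact h3.2 h2.1
  · refine mem_closure_of_tendsto ht' ?_
    filter_upwards [h1, ht'.eventually h.2.2.2] with r h2 h3
    exact fun h4 => absurd (h3.1 h4) (not_lt.2 h2.2.le)

/-- Where `φ` has a sign, `E` or its complement is a neighbourhood; where `φ` vanishes near `p`, it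
is again a defining function and takes both signs. -/
lemma frontier_iff (h : IsDefiningFunction E p φ) :
    ∀ᶠ x in 𝓝 p, (x ∈ frontier E ↔ φ x = 0) := by
  filter_upwards [h.eventually, h.2.2.2.eventually_nhds] with x h1 h2
  refine ⟨fun h3 => ?_, fun h0 => (h1 h0).mem_frontier⟩
  by_contra h4
  rcases lt_or_gt_of_ne h4 with h5 | h5
  · have : ∀ᶠ y in 𝓝 x, y ∈ E := by
      filter_upwards [h2, h.1.continuous.continuousAt.eventually_lt_const h5] with y h6 h7
      exact h6.2 h7
    exact h3.2 (mem_interior_iff_mem_nhds.2 this)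
  · have : ∀ᶠ y in 𝓝 x, y ∉ E := by
      filter_upwards [h2, h.1.continuous.continuousAt.eventually_const_lt h5] with y h6 h7
      exact fun h8 => absurd (h6.1 h8) (not_lt.2 h7.le)
    have h9 := mem_closure_iff_frequently.1 h3.1
    exact h9 this

/-- The differential of a function that vanishes on the surface is a multiple of `dφ`. -/
lemma exists_fderiv_eq_smul (h : IsDefiningFunction E p φ) {f : V → ℝ} {f' : V →L[ℝ] ℝ}
    (hf : HasStrictFDerivAt f f' p) (h0 : ∀ᶠ x in 𝓝 p, φ x = 0 → f x = 0) :
    ∃ c : ℝ, f' = c • fderiv ℝ φ p := by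
  -- Vanishing on the level set of `φ`, `f` is trivially extremal there, so the Lagrange multiplier
  -- rule applies; `dφ ≠ 0` makes the multiplier of `f'` nonzero.
  have hext : IsLocalExtrOn f {x | φ x = φ p} p := by
    left
    have hp := h0.self_of_nhds h.2.1
    have : ∀ᶠ x in 𝓝[{x | φ x = φ p}] p, f p ≤ f x := by
      filter_upwards [nhdsWithin_le_nhds h0, self_mem_nhdsWithin] with x h1 h2
      rw [hp, h1 (by rw [h2, h.2.1])]
    exact this
  obtain ⟨a, b, hab, heq⟩ :=
    hext.exists_multipliers_of_hasStrictFDerivAt_1d (h.hasStrictFDerivAt p) hf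
  have hb : b ≠ 0 := by
    rintro rfl
    have ha : a ≠ 0 := by rintro rfl; exact hab rfl
    simp only [zero_smul, add_zero, smul_eq_zero, ha, false_or] at heq
    exact h.fderiv_ne_zero heq
  refine ⟨-(a / b), ?_⟩
  ext v
  have := congrArg (fun L => L v) heq
  simp only [add_apply, smul_apply, smul_eq_mul,
    zero_apply] at this ⊢
  field_simp
  linarith

/-- Two defining functions have the same zero set near `p`, so their differentials are proportional.
The factor is positive: otherwise they would have opposite signs along the gradient, while both are
negative exactly on `E`. -/
lemma exteriorNormal_eq (h : IsDefiningFunction E p φ) :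
    nu E p = ‖gradient φ p‖⁻¹ • gradient φ p := by
  have hex : ∃ φ, IsDefiningFunction E p φ := ⟨φ, h⟩
  have hψ := hex.choose_spec
  rw [exteriorNormal, dif_pos hex]
  generalize hex.choose = ψ at hψ ⊢
  obtain ⟨c, hc⟩ := h.exists_fderiv_eq_smul (hψ.hasStrictFDerivAt p) (by
    filter_upwards [h.frontier_iff, hψ.frontier_iff] with x h1 h2 h3
    exact h2.1 (h1.2 h3))
  have hg : gradient ψ p = c • gradient φ p := by
    simp [gradient, hc]
  have hc0 : 0 < c := by
    have h1 := h.fderiv_gradient_pos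
    by_contra hneg
    push Not at hneg
    have hcne : c ≠ 0 := by
      rintro rfl
      exact hψ.2.2.1 (by simpa using hg)
    have hcneg : c < 0 := lt_of_le_of_ne hneg hcne
    have h2 : 0 < fderiv ℝ ψ p (-gradient φ p) := by
      rw [hc]
      simp only [map_neg, smul_apply, smul_eq_mul]
      nlinarith
    have ht : Tendsto (fun r : ℝ => p + r • gradient φ p) (𝓝[>] 0) (𝓝 p) := by
      have : Continuous (fun r : ℝ => p + r • gradient φ p) := by fun_prop
      simpa using (this.tendsto 0).mono_left nhdsWithin_le_nhds
    obtain ⟨r, h3, h4, h5, h6⟩ := ((h.exists_neg_pos h1).and ((hψ.exists_neg_pos h2).and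
      ((ht.eventually h.2.2.2).and (ht.eventually hψ.2.2.2)))).exists
    have h7 : p - r • -gradient φ p = p + r • gradient φ p := by simp
    rw [h7] at h4
    exact absurd (h5.1 (h6.2 h4.1)) (not_lt.2 h3.2.le)
  rw [hg, norm_smul, norm_of_nonneg hc0.le, smul_smul]
  congr 1
  field_simp

lemma inner_exteriorNormal (h : IsDefiningFunction E p φ) (v : V) :
    ⟪nu E p, v⟫ = ‖gradient φ p‖⁻¹ * fderiv ℝ φ p v := by
  rw [h.exteriorNormal_eq, real_inner_smul_left, inner_gradient_left]

lemma fderiv_eq (h : IsDefiningFunction E p φ) (v : V) :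
    fderiv ℝ φ p v = ‖gradient φ p‖ * ⟪nu E p, v⟫ := by
  rw [h.inner_exteriorNormal, mul_inv_cancel_left₀ h.gradient_norm_pos.ne']

lemma norm_exteriorNormal (h : IsDefiningFunction E p φ) : ‖nu E p‖ = 1 := by
  rw [h.exteriorNormal_eq, norm_smul, norm_inv, norm_norm, inv_mul_cancel₀ h.gradient_norm_pos.ne']

/-- The implicit function theorem yields a curve in the surface with velocity `v`. A differential
within the surface is not unique in all directions; membership in the tangent cone is what makes its
values on tangent vectors well defined. -/
lemma mem_tangentConeAt (h : IsDefiningFunction E p φ) {v : V}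
    (hv : ⟪v, nu E p⟫ = 0) : v ∈ tangentConeAt ℝ (frontier E) p := by
  have hker : fderiv ℝ φ p v = 0 := by
    rw [h.fderiv_eq, real_inner_comm, hv, mul_zero]
  have hs := h.hasStrictFDerivAt p
  let G := hs.implicitFunction φ (fderiv ℝ φ p) h.range_eq_top (φ p)
  have hG : HasStrictFDerivAt G (fderiv ℝ φ p).ker.subtypeL 0 :=
    hs.to_implicitFunction h.range_eq_top
  have hG0 : G 0 = p := hs.implicitFunction_apply_image h.range_eq_top
  have hφG : ∀ᶠ y in 𝓝 (0 : (fderiv ℝ φ p).ker), φ (G y) = φ p := by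
    have := hs.map_implicitFunction_eq h.range_eq_top
    have h2 : Tendsto (fun y : (fderiv ℝ φ p).ker => (φ p, y)) (𝓝 0) (𝓝 (φ p, 0)) :=
      (Continuous.prodMk_right (φ p)).tendsto 0
    exact h2.eventually this
  let w : (fderiv ℝ φ p).ker := ⟨v, hker⟩
  have hcurve : HasDerivAt (fun r : ℝ => G (r • w)) v 0 := by
    have h1 : HasDerivAt (fun r : ℝ => r • w) w 0 := by
      simpa using (hasDerivAt_id (0 : ℝ)).smul_const w
    have h2 : HasFDerivAt G (fderiv ℝ φ p).ker.subtypeL ((0 : ℝ) • w) := by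
      simpa using hG.hasFDerivAt
    exact h2.comp_hasDerivAt 0 h1
  have hcont : Tendsto (fun r : ℝ => G (r • w)) (𝓝[≠] 0) (𝓝 p) := by
    have := hcurve.continuousAt.tendsto
    simp only [zero_smul, hG0] at this
    exact this.mono_left nhdsWithin_le_nhds
  refine mem_tangentConeAt_of_seq (𝓝[≠] (0 : ℝ)) (fun r => r⁻¹) (fun r => G (r • w) - p) ?_ ?_ ?_
  · simpa using hcont.sub_const p
  · have h3 : Tendsto (fun r : ℝ => r • w) (𝓝[≠] 0) (𝓝 0) := by
      have : Continuous (fun r : ℝ => r • w) := by fun_prop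
      simpa using (this.tendsto 0).mono_left nhdsWithin_le_nhds
    filter_upwards [h3.eventually hφG, hcont.eventually h.frontier_iff] with r h4 h5
    rw [add_sub_cancel]
    exact h5.2 (by rw [h4, h.2.1])
  · have := hasDerivAt_iff_tendsto_slope.1 hcurve
    exact this.congr fun r => by simp [slope, hG0]

end IsDefiningFunction

namespace HasSmoothBoundary

variable {E : Set R^N} {p : R^N}

lemma norm_exteriorNormal (hE : HasSmoothBoundary E) (hp : p ∈ frontier E) :
    ‖nu E p‖ = 1 := by
  obtain ⟨φ, h⟩ := hE.2 p hp
  exact h.norm_exteriorNormal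

/-- The exterior normal is, near each point of the surface, the restriction of a smooth field. -/
lemma exists_normal_extension (hE : HasSmoothBoundary E) (hp : p ∈ frontier E) :
    ∃ n : V → V, ContDiff ℝ ∞ n ∧ ∀ᶠ x in 𝓝 p, x ∈ frontier E → nu E x = n x := by
  obtain ⟨φ, h⟩ := hE.2 p hp
  obtain ⟨ρ, hρ, hball⟩ := eventually_nhds_iff_ball.1 h.gradient_ne_zero_eventually
  -- The normalized gradient is smooth only where the gradient does not vanish; the cutoff extends
  -- it to the whole space.
  let χ : ContDiffBump p := ⟨ρ / 3, ρ / 2, by positivity, by linarith⟩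
  refine ⟨fun x => (χ x * ‖gradient φ x‖⁻¹) • gradient φ x, ?_, ?_⟩
  · rw [contDiff_iff_contDiffAt]
    intro x
    by_cases hx : x ∈ ball p ρ
    · have h1 := (contDiff_gradient h.1).contDiffAt (x := x)
      have h2 := hball x hx
      exact (χ.contDiffAt.mul ((h1.norm ℝ h2).inv (norm_ne_zero_iff.2 h2))).smul h1
    · refine contDiffAt_const (c := (0 : V)) |>.congr_of_eventuallyEq ?_
      have h3 : x ∈ (closedBall p (ρ / 2))ᶜ := by
        simp only [mem_compl_iff, mem_closedBall, mem_ball] at hx ⊢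
        linarith
      filter_upwards [Metric.isClosed_closedBall.isOpen_compl.mem_nhds h3] with y hy
      have : χ y = 0 := χ.zero_of_le_dist (by
        simp only [mem_compl_iff, mem_closedBall] at hy
        exact (not_le.1 hy).le)
      simp [this]
  · filter_upwards [h.eventually, h.frontier_iff, Metric.closedBall_mem_nhds p (ε := ρ / 3)
      (by positivity)] with x h1 h2 h4 h3
    rw [χ.one_of_mem_closedBall h4, one_mul]
    exact (h1 (h2.1 h3)).exteriorNormal_eq

lemma continuousOn_exteriorNormal (hE : HasSmoothBoundary E) :
    ContinuousOn (nu E) (frontier E) := by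
  intro p hp
  obtain ⟨n, hn, heq⟩ := hE.exists_normal_extension hp
  refine hn.continuous.continuousWithinAt.congr_of_eventuallyEq ?_ (heq.self_of_nhds hp)
  filter_upwards [nhdsWithin_le_nhds heq, self_mem_nhdsWithin] with x h1 h2
  exact h1 h2

/-- Differentials within the surface agree on tangent vectors. -/
lemma fderiv_eq_on_tangent (hE : HasSmoothBoundary E) (hp : p ∈ frontier E)
    {F : Type*} [NormedAddCommGroup F] [NormedSpace ℝ F] {f : V → F} {A B : V →L[ℝ] F}
    (hA : HasFDerivWithinAt f A (frontier E) p) (hB : HasFDerivWithinAt f B (frontier E) p)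
    {v : V} (hv : ⟪v, nu E p⟫ = 0) : A v = B v := by
  obtain ⟨φ, h⟩ := hE.2 p hp
  exact hA.unique_on hB (h.mem_tangentConeAt hv)

end HasSmoothBoundary

end DefiningFunctions

/-! ### On which side of the boundary a point lies -/

lemma mem_iff_of_isPreconnected {X : Type*} [TopologicalSpace X] {F s : Set X} (hF : IsOpen F)
    (hs : IsPreconnected s) (hd : ∀ x ∈ s, x ∉ frontier F) {x y : X} (hx : x ∈ s) (hy : y ∈ s) :
    x ∈ F ↔ y ∈ F := by
  have key : ∀ {x y}, x ∈ s → y ∈ s → x ∈ F → y ∈ F := by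
    intro x y hx hy hxF
    refine IsPreconnected.subset_left_of_subset_union hF (isClosed_closure (s := F)).isOpen_compl
      (disjoint_compl_right_iff_subset.2 subset_closure) (fun z hz => ?_) ⟨x, hx, hxF⟩ hs hy
    by_cases hzF : z ∈ F
    · exact Or.inl hzF
    · right
      intro hzc
      exact hd z hz ⟨hzc, fun hzi => hzF (interior_subset hzi)⟩
  exact ⟨key hx hy, key hy hx⟩

/-- A line that meets the boundary of `F` once, pointing out of `F` there, leaves `F` there. -/
lemma HasSmoothBoundary.mem_iff_of_crossing {F : Set V} (hF : HasSmoothBoundary F) {z e : V}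
    {r₀ r₁ c : ℝ} (hc : c ∈ Ioo r₀ r₁)
    (hfr : ∀ r ∈ Icc r₀ r₁, (z + r • e ∈ frontier F ↔ r = c))
    (hn : 0 < ⟪nu F (z + c • e), e⟫) {r : ℝ} (hr : r ∈ Icc r₀ r₁) :
    z + r • e ∈ F ↔ r < c := by
  have hcf : z + c • e ∈ frontier F := (hfr c ⟨hc.1.le, hc.2.le⟩).2 rfl
  obtain ⟨φ, h⟩ := hF.2 _ hcf
  have he : 0 < fderiv ℝ φ (z + c • e) e := by
    rw [h.fderiv_eq]; exact mul_pos h.gradient_norm_pos hn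
  have hcont : Continuous fun r : ℝ => z + r • e := by fun_prop
  have ht1 : Tendsto (fun ρ : ℝ => z + (c - ρ) • e) (𝓝[>] 0) (𝓝 (z + c • e)) := by
    have : Continuous fun ρ : ℝ => z + (c - ρ) • e := by fun_prop
    simpa using (this.tendsto 0).mono_left nhdsWithin_le_nhds
  have ht2 : Tendsto (fun ρ : ℝ => z + (c + ρ) • e) (𝓝[>] 0) (𝓝 (z + c • e)) := by
    have : Continuous fun ρ : ℝ => z + (c + ρ) • e := by fun_prop
    simpa using (this.tendsto 0).mono_left nhdsWithin_le_nhds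
  have hsmall : ∀ᶠ ρ in 𝓝[>] (0 : ℝ), ρ < min (c - r₀) (r₁ - c) :=
    nhdsWithin_le_nhds (gt_mem_nhds (lt_min (sub_pos.2 hc.1) (sub_pos.2 hc.2)))
  obtain ⟨ρ, hρ, h1, h2, h3, hρ0⟩ := (hsmall.and ((h.exists_neg_pos he).and
    ((ht1.eventually h.2.2.2).and ((ht2.eventually h.2.2.2).and
      (self_mem_nhdsWithin : ∀ᶠ r in 𝓝[>] (0 : ℝ), r ∈ Ioi 0))))).exists
  have hρ0 : 0 < ρ := hρ0
  rw [lt_min_iff] at hρ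
  have h4 : z + (c - ρ) • e = z + c • e - ρ • e := by module
  have h5 : z + (c + ρ) • e = z + c • e + ρ • e := by module
  have hin : z + (c - ρ) • e ∈ F := h2.2 (by rw [h4]; exact h1.1)
  have hout : z + (c + ρ) • e ∉ F := fun hh => absurd (h3.1 hh) (by rw [h5]; exact not_lt.2 h1.2.le)
  rcases lt_trichotomy r c with hlt | heq | hgt
  · refine iff_of_true ?_ hlt
    have hpc : IsPreconnected ((fun r : ℝ => z + r • e) '' Ico r₀ c) :=
      isPreconnected_Ico.image _ hcont.continuousOn
    refine (mem_iff_of_isPreconnected hF.1 hpc ?_ (mem_image_of_mem _ ?_)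
      (mem_image_of_mem _ ?_)).1 hin
    · rintro _ ⟨u, hu, rfl⟩ huf
      exact hu.2.ne ((hfr u ⟨hu.1, hu.2.le.trans hc.2.le⟩).1 huf)
    · constructor <;> linarith
    · exact ⟨hr.1, hlt⟩
  · subst heq
    refine iff_of_false (fun hh => ?_) (lt_irrefl _)
    exact hcf.2 (by rw [hF.1.interior_eq]; exact hh)
  · refine iff_of_false (fun hh => ?_) (not_lt.2 hgt.le)
    have hpc : IsPreconnected ((fun r : ℝ => z + r • e) '' Ioc c r₁) :=
      isPreconnected_Ioc.image _ hcont.continuousOn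
    refine hout ((mem_iff_of_isPreconnected hF.1 hpc ?_ (mem_image_of_mem _ ?_)
      (mem_image_of_mem _ ?_)).1 hh)
    · rintro _ ⟨u, hu, rfl⟩ huf
      exact hu.1.ne' ((hfr u ⟨hc.1.le.trans hu.1.le, hu.2⟩).1 huf)
    · exact ⟨hgt, hr.2⟩
    · constructor <;> linarith

/-- If `F` is bounded by `{ψ = 0}` along a line on which `ψ` increases, and the line points out of
`F` there, then `F` is `{ψ < 0}` on it. -/
lemma HasSmoothBoundary.mem_iff_of_strictMonoOn {F : Set V} (hF : HasSmoothBoundary F) {z e : V}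
    {a : ℝ} (ha : 0 < a) {ψ : V → ℝ}
    (hcont : ContinuousOn (fun r : ℝ => ψ (z + r • e)) (Icc (-a) a))
    (hmono : StrictMonoOn (fun r : ℝ => ψ (z + r • e)) (Icc (-a) a))
    (hneg : ψ (z + (-a) • e) < 0) (hpos : 0 < ψ (z + a • e))
    (hfr : ∀ r ∈ Icc (-a) a, (z + r • e ∈ frontier F ↔ ψ (z + r • e) = 0))
    (hn : ∀ r ∈ Icc (-a) a, z + r • e ∈ frontier F → 0 < ⟪nu F (z + r • e), e⟫) :
    z ∈ F ↔ ψ z < 0 := by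
  obtain ⟨c, hc, hc0⟩ : (0 : ℝ) ∈ (fun r : ℝ => ψ (z + r • e)) '' Icc (-a) a :=
    intermediate_value_Icc (by linarith) hcont ⟨hneg.le, hpos.le⟩
  have hc0 : ψ (z + c • e) = 0 := hc0
  have hcne : c ≠ -a := by rintro rfl; linarith
  have hcne' : c ≠ a := by rintro rfl; linarith
  have hc' : c ∈ Ioo (-a) a := ⟨lt_of_le_of_ne hc.1 hcne.symm, lt_of_le_of_ne hc.2 hcne'⟩
  have h0 : (0 : ℝ) ∈ Icc (-a) a := ⟨by linarith, ha.le⟩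
  have := hF.mem_iff_of_crossing hc' (fun r hr => by
    rw [hfr r hr, ← hc0]
    exact ⟨fun h => hmono.injOn hr hc h, fun h => by rw [h]⟩) (hn c hc ((hfr c hc).2 hc0)) h0
  rw [zero_smul, add_zero] at this
  rw [this]
  have h2 := hmono.lt_iff_lt h0 hc
  simp only [zero_smul, add_zero, hc0] at h2
  exact h2.symm

lemma IsDefiningFunction.strictMonoOn_line {φ : V → ℝ} (hφ : Differentiable ℝ φ) {z e : V} {a : ℝ}
    (h : ∀ r ∈ Icc (-a) a, 0 < fderiv ℝ φ (z + r • e) e) :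
    StrictMonoOn (fun r : ℝ => φ (z + r • e)) (Icc (-a) a) := by
  have hd : ∀ r : ℝ, HasDerivAt (fun r : ℝ => φ (z + r • e)) (fderiv ℝ φ (z + r • e) e) r := by
    intro r
    have h2 : HasDerivAt (fun r : ℝ => z + r • e) e r := by
      simpa using ((hasDerivAt_id r).smul_const e).const_add z
    exact (hφ _).hasFDerivAt.comp_hasDerivAt r h2
  refine strictMonoOn_of_deriv_pos (convex_Icc _ _) (fun r _ => (hd r).continuousAt.continuousWithinAt)
    fun r hr => ?_
  rw [(hd r).deriv]
  exact h r (interior_subset hr)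

/-- A defining function is increasing along short transversal segments through nearby points, and
changes sign on them. -/
lemma IsDefiningFunction.exists_box {c e : V} {φ : V → ℝ}
    (h : IsDefiningFunction E c φ) (hn : 0 < ⟪nu E c, e⟫) {P : V → Prop}
    (hP : ∀ᶠ x in 𝓝 c, P x) {a₀ : ℝ} (ha₀ : 0 < a₀) :
    ∃ a ∈ Ioc 0 a₀, ∃ δ > 0, ∀ x ∈ ball c δ, φ (x + (-a) • e) < 0 ∧ 0 < φ (x + a • e) ∧
      (∀ r ∈ Icc (-a) a, P (x + r • e)) ∧
      StrictMonoOn (fun r : ℝ => φ (x + r • e)) (Icc (-a) a) := by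
  have he : 0 < fderiv ℝ φ c e := by
    rw [h.fderiv_eq]; exact mul_pos h.gradient_norm_pos hn
  have hcd : Continuous fun x => fderiv ℝ φ x e :=
    (h.1.continuous_fderiv (by simp)).clm_apply continuous_const
  obtain ⟨ρ, hρ, hb⟩ := eventually_nhds_iff_ball.1
    ((hcd.continuousAt.eventually (lt_mem_nhds he)).and hP)
  set a := min a₀ (ρ / (2 * (‖e‖ + 1)))
  have ha : 0 < a := by positivity
  have hae : a * ‖e‖ < ρ / 2 := by
    have h1 : a * (2 * (‖e‖ + 1)) ≤ ρ := by
      rw [← le_div_iff₀ (by positivity)]; exact min_le_right _ _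
    nlinarith
  have hin : ∀ x ∈ ball c (ρ / 2), ∀ r ∈ Icc (-a) a, x + r • e ∈ ball c ρ := by
    intro x hx r hr
    rw [mem_ball, dist_eq_norm] at hx ⊢
    rw [add_sub_right_comm]
    refine (norm_add_le _ _).trans_lt ?_
    have : |r| * ‖e‖ ≤ a * ‖e‖ := by gcongr; exact abs_le.2 hr
    rw [norm_smul, norm_eq_abs]
    linarith
  have hm : ∀ x ∈ ball c (ρ / 2), StrictMonoOn (fun r : ℝ => φ (x + r • e)) (Icc (-a) a) :=
    fun x hx => strictMonoOn_line h.differentiable fun r hr => (hb _ (hin x hx r hr)).1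
  have h0 := hm c (mem_ball_self (half_pos hρ))
  have h1 : φ (c + (-a) • e) < 0 := by
    simpa [h.2.1] using h0 ⟨le_rfl, by linarith⟩ ⟨by linarith, ha.le⟩ (neg_lt_zero.2 ha)
  have h2 : 0 < φ (c + a • e) := by
    simpa [h.2.1] using h0 ⟨by linarith, ha.le⟩ ⟨by linarith, le_rfl⟩ ha
  have hc : ∀ b : ℝ, ContinuousAt (fun x => φ (x + b • e)) c := fun b =>
    (h.1.continuous.comp (continuous_id.add continuous_const)).continuousAt
  obtain ⟨δ, hδ, hd⟩ := eventually_nhds_iff_ball.1 (((hc _).eventually (gt_mem_nhds h1)).and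
    (((hc _).eventually (lt_mem_nhds h2)).and (ball_mem_nhds c (half_pos hρ))))
  exact ⟨a, ⟨ha, min_le_left _ _⟩, δ, hδ, fun x hx => ⟨(hd x hx).1, (hd x hx).2.1,
    fun r hr => (hb _ (hin x (hd x hx).2.2 r hr)).2, hm x (hd x hx).2.2⟩⟩

/-- Two sets with the same smooth boundary near `c`, on the same side, agree near `c`. -/
lemma HasSmoothBoundary.eventually_mem_iff {F₁ F₂ : Set V} (h₁ : HasSmoothBoundary F₁)
    (h₂ : HasSmoothBoundary F₂) {c e : V} (hc : c ∈ frontier F₁)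
    (hfr : ∀ᶠ x in 𝓝 c, (x ∈ frontier F₁ ↔ x ∈ frontier F₂))
    (hn₁ : 0 < ⟪nu F₁ c, e⟫) (hn₂ : 0 < ⟪nu F₂ c, e⟫) :
    ∀ᶠ z in 𝓝 c, (z ∈ F₁ ↔ z ∈ F₂) := by
  obtain ⟨φ, h⟩ := h₁.2 c hc
  have hn2' : ∀ᶠ x in 𝓝 c, x ∈ frontier F₂ → 0 < ⟪nu F₂ x, e⟫ := by
    have h4 : Tendsto (fun x => ⟪nu F₂ x, e⟫) (𝓝[frontier F₂] c)
        (𝓝 ⟪nu F₂ c, e⟫) :=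
      (h₂.continuousOn_exteriorNormal c (hfr.self_of_nhds.1 hc)).tendsto.inner tendsto_const_nhds
    exact eventually_nhdsWithin_iff.1 (h4.eventually (lt_mem_nhds hn₂))
  obtain ⟨a, ha, δ, hδ, hbox⟩ := h.exists_box hn₁ (hn2'.and (hfr.and h.frontier_iff)) one_pos
  filter_upwards [ball_mem_nhds c hδ, h.2.2.2] with z hz hz4
  obtain ⟨hz1, hz2, hP, hm⟩ := hbox z hz
  rw [hz4, ← h₂.mem_iff_of_strictMonoOn (ψ := φ) (e := e) ha.1
    (h.1.continuous.comp (by fun_prop)).continuousOn hm hz1 hz2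
    (fun r hr => by rw [← (hP r hr).2.1, (hP r hr).2.2]) fun r hr => (hP r hr).1]

/-- The half-open segment from `z` to a nearest boundary point does not meet the boundary. -/
lemma exists_segment_to_frontier {F : Set V} {z c : V} (hc : c ∈ frontier F) :
    ∃ q ∈ frontier F, dist z q ≤ dist z c ∧
      ∀ r ∈ Ico (0 : ℝ) 1, z ∉ frontier F → z + r • (q - z) ∉ frontier F := by
  obtain ⟨q, hq, hdist⟩ := (isClosed_frontier (s := F)).exists_infDist_eq_dist ⟨c, hc⟩ z
  refine ⟨q, hq, hdist ▸ Metric.infDist_le_dist_of_mem hc, fun r hr hz hmem => ?_⟩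
  have h1 := Metric.infDist_le_dist_of_mem (x := z) hmem
  rw [hdist, dist_eq_norm, dist_eq_norm] at h1
  have h2 : z - (z + r • (q - z)) = r • (z - q) := by module
  rw [h2, norm_smul, norm_of_nonneg hr.1] at h1
  have h3 : 0 < ‖z - q‖ := by
    rw [norm_pos_iff, sub_ne_zero]; rintro rfl; exact hz hq
  nlinarith [hr.2]

/-- Sets that have the same boundary in a ball and agree near it agree in the ball of half radius. -/
lemma HasSmoothBoundary.mem_iff_of_ball {F₁ F₂ : Set V} (h₁ : IsOpen F₁) (h₂ : IsOpen F₂)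
    {c : V} {R : ℝ} (hc : c ∈ frontier F₁)
    (hfr : ∀ x ∈ ball c (2 * R), (x ∈ frontier F₁ ↔ x ∈ frontier F₂))
    (hloc : ∀ x ∈ ball c (2 * R), x ∈ frontier F₁ → ∀ᶠ z in 𝓝 x, (z ∈ F₁ ↔ z ∈ F₂))
    {z : V} (hz : z ∈ ball c R) : z ∈ F₁ ↔ z ∈ F₂ := by
  have hR : 0 < R := Metric.pos_of_mem_ball hz
  have hz2 : z ∈ ball c (2 * R) := ball_subset_ball (by linarith) hz
  by_cases hzf : z ∈ frontier F₁
  · have h3 := (hfr z hz2).1 hzf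
    rw [h₁.frontier_eq] at hzf
    rw [h₂.frontier_eq] at h3
    exact iff_of_false hzf.2 h3.2
  -- The segment from `z` to a nearest boundary point stays in the double ball and off both
  -- boundaries until it reaches `q`, where the local agreement decides.
  obtain ⟨q, hq, hd, hseg⟩ := exists_segment_to_frontier (z := z) hc
  have hqz : dist z q < R := hd.trans_lt hz
  have hqc : q ∈ ball c (2 * R) := by
    rw [mem_ball] at hz ⊢
    have := dist_triangle_left q c z
    linarith
  have hcont : Continuous fun r : ℝ => z + r • (q - z) := by fun_prop
  have hpc : IsPreconnected ((fun r : ℝ => z + r • (q - z)) '' Ico (0 : ℝ) 1) :=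
    isPreconnected_Ico.image _ hcont.continuousOn
  have hin : ∀ r ∈ Ico (0 : ℝ) 1, z + r • (q - z) ∈ ball c (2 * R) := by
    intro r hr
    rw [mem_ball, dist_eq_norm] at hz ⊢
    rw [dist_eq_norm, norm_sub_rev] at hqz
    calc ‖z + r • (q - z) - c‖ = ‖(z - c) + r • (q - z)‖ := by congr 1; abel
      _ ≤ ‖z - c‖ + r * ‖q - z‖ := by
          refine (norm_add_le _ _).trans ?_
          rw [norm_smul, norm_of_nonneg hr.1]
      _ ≤ ‖z - c‖ + 1 * ‖q - z‖ := by gcongr; exact hr.2.le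
      _ < 2 * R := by linarith
  have ht : Tendsto (fun r : ℝ => z + r • (q - z)) (𝓝[<] 1) (𝓝 q) := by
    have := (hcont.tendsto 1).mono_left (nhdsWithin_le_nhds (s := Iio 1))
    simpa using this
  have hr01 : ∀ᶠ r in 𝓝[<] (1 : ℝ), r ∈ Ico (0 : ℝ) 1 := Ico_mem_nhdsLT (by norm_num)
  obtain ⟨r, hr, hr'⟩ := ((ht.eventually (hloc q hqc hq)).and hr01).exists
  have hz0 : z = (fun r : ℝ => z + r • (q - z)) 0 := by simp
  have e1 := mem_iff_of_isPreconnected h₁ hpc (x := z) (y := z + r • (q - z))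
    (by rintro _ ⟨u, hu, rfl⟩; exact hseg u hu hzf)
    ⟨0, ⟨le_rfl, one_pos⟩, hz0.symm⟩ (mem_image_of_mem _ hr')
  have e2 := mem_iff_of_isPreconnected h₂ hpc (x := z) (y := z + r • (q - z))
    (by rintro _ ⟨u, hu, rfl⟩ hf; exact hseg u hu hzf ((hfr _ (hin u hu)).2 hf))
    ⟨0, ⟨le_rfl, one_pos⟩, hz0.symm⟩ (mem_image_of_mem _ hr')
  rw [e1, hr, e2]

lemma HasSmoothBoundary.eq_of_frontier_eq {F₁ F₂ : Set V} (h₁ : IsOpen F₁) (h₂ : IsOpen F₂)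
    (hne : (frontier F₁).Nonempty) (hfr : frontier F₁ = frontier F₂)
    (hloc : ∀ x ∈ frontier F₁, ∀ᶠ z in 𝓝 x, (z ∈ F₁ ↔ z ∈ F₂)) : F₁ = F₂ := by
  obtain ⟨c, hc⟩ := hne
  ext z
  exact HasSmoothBoundary.mem_iff_of_ball h₁ h₂ (R := dist z c + 1) hc (fun x _ => by rw [hfr])
    (fun x _ hx => hloc x hx) (by rw [mem_ball]; linarith)

/-- A normal perturbation of a set with nonempty boundary is unique. -/
lemma IsNormalPerturbation.unique {E F₁ F₂ : Set V} {h : V → ℝ} {t : ℝ}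
    (hne : (frontier E).Nonempty) (h₁ : IsNormalPerturbation E h t F₁)
    (h₂ : IsNormalPerturbation E h t F₂) : F₁ = F₂ := by
  have hfr : frontier F₁ = frontier F₂ := by rw [← h₁.bijOn.image_eq, h₂.bijOn.image_eq]
  refine HasSmoothBoundary.eq_of_frontier_eq h₁.smooth.1 h₂.smooth.1 ?_ hfr fun x hx => ?_
  · rw [← h₁.bijOn.image_eq]; exact hne.image _
  · have := hx
    rw [← h₁.bijOn.image_eq] at this
    obtain ⟨y, hy, rfl⟩ := this
    exact h₁.smooth.eventually_mem_iff h₂.smooth hx (.of_forall fun x => by rw [hfr])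
      (h₁.normal y hy) (h₂.normal y hy)

/-! ### The flow `x ↦ x + t X x` as a normal perturbation -/

section Displacement

/-- The normal field `h ν` of a surface extends to a compactly supported smooth field. -/
lemma HasSmoothBoundary.exists_field {E Ω : Set V} (hE : HasSmoothBoundary E) {h : V → ℝ}
    (hh : SmoothOnSurface (frontier E) h) (hΩ : IsOpen Ω)
    (hc : CompactlySupportedIn (frontier E) Ω h) :
    ∃ X : V → V, ContDiff ℝ ∞ X ∧ HasCompactSupport X ∧ tsupport X ⊆ Ω ∧
      ∀ x ∈ frontier E, X x = h x • nu E x := by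
  obtain ⟨K, hK, hKS, hKh⟩ := hc
  obtain ⟨K', hK', hKK', hK'Ω⟩ := exists_compact_between hK hΩ (fun x hx => (hKS hx).2)
  -- At each point the prescribed values form a convex set, so local solutions glue by a partition
  -- of unity.
  let t : V → Set V := fun x =>
    {v | (x ∈ frontier E → v = h x • nu E x) ∧ (x ∉ K' → v = 0)}
  have ht : ∀ x, Convex ℝ (t x) := by
    intro x u hu v hv a b ha hb hab
    refine ⟨fun hx => ?_, fun hx => ?_⟩
    · rw [hu.1 hx, hv.1 hx, ← add_smul, hab, one_smul]
    · rw [hu.2 hx, hv.2 hx, smul_zero, smul_zero, add_zero]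
  obtain ⟨X, hX⟩ := exists_contMDiffMap_forall_mem_convex_of_local (n := (⊤ : ℕ∞)) 𝓘(ℝ, V) (t := t) ht (by
    intro x
    by_cases hxK : x ∈ K
    · obtain ⟨g, hg, hgh⟩ := hh x (hKS hxK).1
      obtain ⟨n, hn, hnν⟩ := hE.exists_normal_extension (hKS hxK).1
      refine ⟨_, (eventually_nhdsWithin_iff.1 hgh).and (hnν.and
        (mem_interior_iff_mem_nhds.1 (hKK' hxK))), fun x => g x • n x,
        (hg.smul hn).contMDiff.contMDiffOn, fun y hy => ⟨fun hyS => ?_, fun hyK => ?_⟩⟩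
      · simp only [hy.1 hyS, hy.2.1 hyS]
      · exact absurd hy.2.2 hyK
    · refine ⟨Kᶜ, hK.isClosed.isOpen_compl.mem_nhds hxK, fun _ => 0,
        contMDiffOn_const, fun y hy => ⟨fun hyS => ?_, fun _ => rfl⟩⟩
      rw [hKh y hyS hy, zero_smul])
  have hsub : tsupport X ⊆ K' := by
    refine closure_minimal (fun x hx => ?_) hK'.isClosed
    by_contra hxK
    exact hx ((hX x).2 hxK)
  exact ⟨X, X.contMDiff.contDiff, hK'.of_isClosed_subset (isClosed_tsupport _) hsub,
    hsub.trans hK'Ω, fun x hx => (hX x).1 hx⟩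

/-- The displacement `x ↦ x + t X(x)`. -/
noncomputable def shift (X : R^N → R^N) (t : ℝ)
    (x : R^N) : R^N :=
  x + t • X x

variable {X : R^N → R^N} {L : ℝ≥0} {t : ℝ}

lemma eventually_small (L : ℝ≥0) {t₀ : ℝ} (ht₀ : 0 < t₀) :
    ∀ᶠ t in 𝓝 (0 : ℝ), |t| < t₀ ∧ |t| * L ≤ 1 / 4 ∧ |t| ≤ 1 := by
  have h (c : ℝ) : Tendsto (fun t : ℝ => |t| * c) (𝓝 0) (𝓝 0) := by
    have : Continuous fun t : ℝ => |t| * c := by fun_prop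
    simpa using this.tendsto 0
  filter_upwards [(h 1).eventually (gt_mem_nhds ht₀), (h 1).eventually (ge_mem_nhds one_pos),
    (h L).eventually (ge_mem_nhds (by norm_num : (0 : ℝ) < 1 / 4))] with t ha hb hc
  exact ⟨by linarith, hc, by linarith⟩

lemma contDiff_shift (hX : ContDiff ℝ ∞ X) : ContDiff ℝ ∞ (shift X t) :=
  contDiff_id.add (hX.const_smul t)

lemma hasFDerivAt_shift (hX : ContDiff ℝ ∞ X) (x : V) :
    HasFDerivAt (shift X t) (1 + t • fderiv ℝ X x) x :=
  (hasFDerivAt_id x).add ((hX.differentiable (by simp) x).hasFDerivAt.const_smul t)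

lemma norm_fderiv_le_of_lipschitzWith (hL : LipschitzWith L X) (x : V) : ‖fderiv ℝ X x‖ ≤ L :=
  norm_fderiv_le_of_lipschitz ℝ hL

lemma half_norm_le_shift_fderiv (hL : LipschitzWith L X) (ht : |t| * L ≤ 1 / 2) (x v : V) :
    ‖v‖ / 2 ≤ ‖(1 + t • fderiv ℝ X x : V →L[ℝ] V) v‖ := by
  have h1 : ‖t • fderiv ℝ X x v‖ ≤ 1 / 2 * ‖v‖ := by
    rw [norm_smul, norm_eq_abs]
    calc |t| * ‖fderiv ℝ X x v‖ ≤ |t| * (L * ‖v‖) := by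
          gcongr
          exact ((fderiv ℝ X x).le_opNorm v).trans
            (mul_le_mul_of_nonneg_right (norm_fderiv_le_of_lipschitzWith hL x) (norm_nonneg v))
      _ = (|t| * L) * ‖v‖ := by ring
      _ ≤ 1 / 2 * ‖v‖ := by gcongr
  have h2 : (1 + t • fderiv ℝ X x : V →L[ℝ] V) v = v + t • fderiv ℝ X x v := by simp
  rw [h2]
  have := norm_sub_le_norm_add v (t • fderiv ℝ X x v)
  linarith [norm_sub_norm_le v (t • fderiv ℝ X x v)]

/-- For small `t` the displacement is a diffeomorphism. -/
lemma exists_shift_homeomorph (hX : ContDiff ℝ ∞ X) (hL : LipschitzWith L X)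
    (ht : |t| * L ≤ 1 / 2) :
    ∃ Φ : V ≃ₜ V, (∀ x, Φ x = shift X t x) ∧ ContDiff ℝ ∞ Φ.symm := by
  -- The displacement is the identity plus a map of Lipschitz constant at most `1 / 2`, so the
  -- inverse function theorem holds globally.
  have happ : ApproximatesLinearOn (shift X t)
      ((ContinuousLinearEquiv.refl ℝ V : V ≃L[ℝ] V) : V →L[ℝ] V) univ (1 / 2 : ℝ≥0) := by
    intro x _ y _
    have h2 : shift X t x - shift X t y -
        ((ContinuousLinearEquiv.refl ℝ V : V ≃L[ℝ] V) : V →L[ℝ] V) (x - y) = t • (X x - X y) := by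
      simp only [shift, ContinuousLinearEquiv.coe_refl, ContinuousLinearMap.coe_id', id_eq]; module
    rw [h2, norm_smul, norm_eq_abs]
    calc |t| * ‖X x - X y‖ ≤ |t| * (L * ‖x - y‖) := by gcongr; exact hL.norm_sub_le x y
      _ = (|t| * L) * ‖x - y‖ := by ring
      _ ≤ (1 / 2 : ℝ≥0) * ‖x - y‖ := by gcongr; simpa using ht
  have hc : Subsingleton V ∨
      (1 / 2 : ℝ≥0) < ‖((ContinuousLinearEquiv.refl ℝ V).symm : V →L[ℝ] V)‖₊⁻¹ := by
    rcases subsingleton_or_nontrivial V with hs | hs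
    · exact Or.inl hs
    · right
      have h1 : ‖((ContinuousLinearEquiv.refl ℝ V).symm : V →L[ℝ] V)‖₊ = 1 := by
        simp
      rw [h1, inv_one]
      rw [← NNReal.coe_lt_coe]
      norm_num
  let Φ : V ≃ₜ V := happ.toHomeomorph _ hc
  have hΦ : ∀ x, Φ x = shift X t x := fun x => rfl
  refine ⟨Φ, hΦ, ?_⟩
  have hinj : ∀ x, Function.Injective
      ((1 + t • fderiv ℝ X x : V →L[ℝ] V) : V →ₗ[ℝ] V) := by
    intro x
    rw [injective_iff_map_eq_zero]
    intro v hv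
    have := half_norm_le_shift_fderiv hL ht x v
    rw [ContinuousLinearMap.coe_coe] at hv
    rw [hv, norm_zero] at this
    exact norm_le_zero_iff.1 (by linarith)
  refine Φ.contDiff_symm (f₀' := fun x =>
    (LinearEquiv.ofInjectiveEndo _ (hinj x)).toContinuousLinearEquiv) (fun x => ?_)
    (contDiff_shift hX)
  convert! hasFDerivAt_shift (t := t) hX x using 1

/-- Points outside `Ω` are fixed, so by injectivity no point of `Ω` is sent to them; surjectivity
does the rest. -/
lemma shift_image_eq_self (hL : LipschitzWith L X) (ht : |t| * L ≤ 1 / 2)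
    (hX : ContDiff ℝ ∞ X) {Ω : Set V} (hΩ : ∀ x ∉ Ω, X x = 0) : shift X t '' Ω = Ω := by
  obtain ⟨Φ, hΦ, -⟩ := exists_shift_homeomorph hX hL ht
  have hinj : ∀ x y, shift X t x = shift X t y → x = y := fun x y h =>
    Φ.injective (by rw [hΦ, hΦ, h])
  apply Subset.antisymm
  · rintro _ ⟨x, hx, rfl⟩
    by_contra hn
    have h1 : shift X t (shift X t x) = shift X t x := by
      rw [shift, hΩ _ hn, smul_zero, add_zero]
    exact hn ((hinj _ _ h1).symm ▸ hx)
  · intro y hy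
    obtain ⟨x, hx⟩ := Φ.surjective y
    rw [hΦ] at hx
    refine ⟨x, ?_, hx⟩
    by_contra hn
    rw [shift, hΩ x hn, smul_zero, add_zero] at hx
    exact hn (hx ▸ hy)

lemma normalDisplacement_eq_shift {h : V → ℝ} {x : V}
    (hx : X x = h x • nu E x) : Ψ E h t x = shift X t x := by
  rw [normalDisplacement, shift, hx, smul_smul]

lemma frontier_shift_image (hX : ContDiff ℝ ∞ X) (hL : LipschitzWith L X)
    (ht : |t| * L ≤ 1 / 2) (E : Set V) :
    frontier (shift X t '' E) = shift X t '' frontier E := by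
  obtain ⟨Φ, hΦ, -⟩ := exists_shift_homeomorph hX hL ht
  have : shift X t = Φ := funext fun x => (hΦ x).symm
  rw [this, Φ.image_frontier]

/-- Composition with the inverse diffeomorphism transports defining functions, and the chain rule
expresses the new differential through the old one. Both the immersion and the normal condition
follow from `1 + t DX` being close to the identity. -/
lemma isNormalPerturbation_shift (hE : HasSmoothBoundary E) {h : V → ℝ}
    (hX : ContDiff ℝ ∞ X) (hL : LipschitzWith L X) (ht : |t| * L ≤ 1 / 2)
    (hXh : ∀ x ∈ frontier E, X x = h x • nu E x) :
    IsNormalPerturbation E h t (shift X t '' E) := by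
  obtain ⟨Φ, hΦ, hΦs⟩ := exists_shift_homeomorph hX hL ht
  have hfun : shift X t = Φ := funext fun x => (hΦ x).symm
  have hfr := frontier_shift_image hX hL ht E
  have hdef : ∀ p φ, IsDefiningFunction E p φ →
      IsDefiningFunction (shift X t '' E) (shift X t p) (φ ∘ Φ.symm) ∧
      ∀ v, fderiv ℝ (φ ∘ Φ.symm) (shift X t p) ((1 + t • fderiv ℝ X p : V →L[ℝ] V) v) =
        fderiv ℝ φ p v := by
    intro p φ hφ
    have hsymm : Φ.symm (shift X t p) = p := by rw [← hΦ, Φ.symm_apply_apply]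
    have hd : ∀ v, fderiv ℝ (φ ∘ Φ.symm) (shift X t p)
        ((1 + t • fderiv ℝ X p : V →L[ℝ] V) v) = fderiv ℝ φ p v := by
      intro v
      have h1 : (φ ∘ Φ.symm) ∘ shift X t = φ := by
        ext x; simp [← hΦ]
      have h2 : HasFDerivAt ((φ ∘ Φ.symm) ∘ shift X t)
          ((fderiv ℝ (φ ∘ Φ.symm) (shift X t p)).comp (1 + t • fderiv ℝ X p)) p :=
        ((hφ.1.comp hΦs).differentiable (by simp) _).hasFDerivAt.comp p (hasFDerivAt_shift hX p)
      rw [h1] at h2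
      rw [h2.fderiv]; rfl
    refine ⟨⟨hφ.1.comp hΦs, ?_, ?_, ?_⟩, hd⟩
    · simp [hsymm, hφ.2.1]
    · intro h0
      apply hφ.fderiv_ne_zero
      ext v
      rw [← hd v, ← inner_gradient_left, h0]
      simp
    · have h1 : Tendsto Φ.symm (𝓝 (shift X t p)) (𝓝 p) := by
        have := Φ.symm.continuous.tendsto (shift X t p)
        rwa [hsymm] at this
      filter_upwards [h1.eventually hφ.2.2.2] with x hx
      rw [Function.comp_apply, ← hx, hfun]
      constructor
      · rintro ⟨y, hy, rfl⟩; simpa using hy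
      · intro hy; exact ⟨Φ.symm x, hy, by simp⟩
  refine ⟨⟨?_, ?_⟩, ?_, ?_, ?_⟩
  · rw [hfun]; exact Φ.isOpenMap _ hE.1
  · rw [hfr]
    rintro _ ⟨p, hp, rfl⟩
    obtain ⟨φ, hφ⟩ := hE.2 p hp
    exact ⟨_, (hdef p φ hφ).1⟩
  · rw [hfr]
    have heq : EqOn (Ψ E h t) (shift X t) (frontier E) := fun x hx =>
      normalDisplacement_eq_shift (hXh x hx)
    refine BijOn.congr ?_ heq.symm
    rw [hfun]
    exact Φ.injective.injOn.bijOn_image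
  · intro x hx v hv hD
    have heq : EqOn (Ψ E h t) (shift X t) (frontier E) := fun x hx =>
      normalDisplacement_eq_shift (hXh x hx)
    have h1 : HasFDerivWithinAt (Ψ E h t) (1 + t • fderiv ℝ X x) (frontier E) x :=
      (hasFDerivAt_shift hX x).hasFDerivWithinAt.congr heq (heq hx)
    have h2 := h1.differentiableWithinAt.hasFDerivWithinAt
    have h3 := hE.fderiv_eq_on_tangent hx h2 h1 hv
    rw [hD] at h3
    have h4 := half_norm_le_shift_fderiv hL ht x v
    rw [← h3, norm_zero] at h4
    exact norm_le_zero_iff.1 (by linarith)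
  · intro x hx
    rw [normalDisplacement_eq_shift (hXh x hx)]
    obtain ⟨φ, hφ⟩ := hE.2 x hx
    obtain ⟨h1, h2⟩ := hdef x φ hφ
    -- Writing `ν` as the image of `v` makes the inner product of the two normals a positive
    -- multiple of `⟪ν, v⟫`, which is at least `‖v‖² / 2`.
    obtain ⟨v, hv⟩ : ∃ v, (1 + t • fderiv ℝ X x : V →L[ℝ] V) v = nu E x := by
      have hinj : Function.Injective ((1 + t • fderiv ℝ X x : V →L[ℝ] V) : V →ₗ[ℝ] V) := by
        rw [injective_iff_map_eq_zero]
        intro v hv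
        have := half_norm_le_shift_fderiv hL ht x v
        rw [ContinuousLinearMap.coe_coe] at hv
        rw [hv, norm_zero] at this
        exact norm_le_zero_iff.1 (by linarith)
      exact LinearMap.surjective_of_injective hinj _
    rw [← hv, h1.inner_exteriorNormal, h2 v, hφ.fderiv_eq]
    refine mul_pos (inv_pos.2 h1.gradient_norm_pos) (mul_pos hφ.gradient_norm_pos ?_)
    have h3 : (1 + t • fderiv ℝ X x : V →L[ℝ] V) v = v + t • fderiv ℝ X x v := by simp
    rw [← hv, h3, inner_add_left, real_inner_self_eq_norm_sq]
    have h4 : ‖t • fderiv ℝ X x v‖ ≤ 1 / 2 * ‖v‖ := by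
      rw [norm_smul, norm_eq_abs]
      calc |t| * ‖fderiv ℝ X x v‖ ≤ |t| * (L * ‖v‖) := by
            gcongr
            exact ((fderiv ℝ X x).le_opNorm v).trans
              (mul_le_mul_of_nonneg_right (norm_fderiv_le_of_lipschitzWith hL x) (norm_nonneg v))
        _ = (|t| * L) * ‖v‖ := by ring
        _ ≤ 1 / 2 * ‖v‖ := by gcongr
    have h5 := abs_le.1 (abs_real_inner_le_norm (t • fderiv ℝ X x v) v)
    have h6 : 0 < ‖v‖ := by
      rw [norm_pos_iff]
      rintro rfl
      have := hE.norm_exteriorNormal hx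
      rw [← hv] at this
      simp at this
    nlinarith [mul_le_mul_of_nonneg_right h4 h6.le]

end Displacement

/-! ### Coordinates adapted to a line, and Lipschitz graphs -/

/-- Coordinates `(y, z) ↦ p + y + z e` on the space, with `y` orthogonal to the unit vector `e`. -/
noncomputable def lineEquiv (e : R^N) (he : ‖e‖ = 1)
    (p : R^N) : (ℝ ∙ e)ᗮ × ℝ ≃ᵐ R^N :=
  (MeasurableEquiv.prodComm.trans (((LinearIsometryEquiv.toSpanUnitSingleton (𝕜 := ℝ) e
    he).toHomeomorph.toMeasurableEquiv).prodCongr (MeasurableEquiv.refl _))).trans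
      ((ℝ ∙ e).measurableEquivProd p).symm

lemma lineEquiv_apply (e : V) (he : ‖e‖ = 1) (p : V) (q : (ℝ ∙ e)ᗮ × ℝ) :
    lineEquiv e he p q = p + q.1 + q.2 • e := by
  have : lineEquiv e he p q = ((ℝ ∙ e).measurableEquivProd p).symm
    (LinearIsometryEquiv.toSpanUnitSingleton (𝕜 := ℝ) e he q.2, q.1) := rfl
  rw [this, Submodule.measurableEquivProd_symm_apply,
    LinearIsometryEquiv.toSpanUnitSingleton_apply, vadd_eq_add]
  abel

lemma measurePreserving_lineEquiv (e : V) (he : ‖e‖ = 1) (p : V) :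
    MeasurePreserving (lineEquiv e he p) (volume.prod volume) volume := by
  have h1 := ((ℝ ∙ e).measurePreserving_measurableEquivProd p).symm
  rw [InnerProductSpace.euclideanHausdorffMeasure_eq_volume] at h1
  have h2 : MeasurePreserving (LinearIsometryEquiv.toSpanUnitSingleton (𝕜 := ℝ) e he) :=
    (LinearIsometryEquiv.toSpanUnitSingleton (𝕜 := ℝ) e he).measurePreserving
  have h3 : MeasurePreserving (Prod.swap : (ℝ ∙ e)ᗮ × ℝ → ℝ × (ℝ ∙ e)ᗮ)
      (volume.prod volume) (volume.prod volume) := Measure.measurePreserving_swap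
  exact h1.comp ((h2.prod (MeasurePreserving.id volume)).comp h3)

lemma integral_eq_integral_lines {F : V → ℝ} (e : V) (he : ‖e‖ = 1) (p : V)
    (hF : Integrable F) :
    ∫ x, F x = ∫ y : (ℝ ∙ e)ᗮ, ∫ z : ℝ, F (p + y + z • e) := by
  have h := measurePreserving_lineEquiv e he p
  rw [← h.integral_comp' (g := F), integral_prod]
  · simp only [lineEquiv_apply]
  · exact (h.integrable_comp_emb (MeasurableEquiv.measurableEmbedding _)).2 hF

lemma volume_image_lineEquiv_prod (e : V) (he : ‖e‖ = 1) (p : V) (B : Set (ℝ ∙ e)ᗮ)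
    (I : Set ℝ) : volume (lineEquiv e he p '' B ×ˢ I) = volume B * volume I := by
  rw [(lineEquiv e he p).image_eq_preimage_symm,
    ((measurePreserving_lineEquiv e he p).symm _).measure_preimage_equiv, Measure.prod_prod]

lemma LipschitzOnWith.euclideanHausdorffMeasure_image_le {X Y : Type*} [MetricSpace X]
    [MeasurableSpace X] [BorelSpace X] [MetricSpace Y] [MeasurableSpace Y] [BorelSpace Y]
    {f : X → Y} {K : ℝ≥0} {s : Set X} (h : LipschitzOnWith K f s) (d : ℕ) :
    euclideanHausdorffMeasure d (f '' s) ≤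
      (K : ℝ≥0∞) ^ d * euclideanHausdorffMeasure d s := by
  simp_rw [Measure.euclideanHausdorffMeasure_def, Measure.smul_apply]
  have := h.hausdorffMeasure_image_le (Nat.cast_nonneg (α := ℝ) d)
  rw [ENNReal.rpow_natCast] at this
  rw [ENNReal.smul_def, ENNReal.smul_def, smul_eq_mul, smul_eq_mul, mul_left_comm]
  gcongr

lemma finrank_orthogonal_span {e : V} (he : ‖e‖ = 1) :
    Module.finrank ℝ (ℝ ∙ e)ᗮ = N - 1 := by
  have h0 : e ≠ 0 := by rintro rfl; simp at he
  have h1 := Submodule.finrank_add_finrank_orthogonal (ℝ ∙ e)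
  rw [finrank_span_singleton h0, finrank_euclideanSpace_fin] at h1
  omega

/-- The bridge between surface measure and Lebesgue measure: with the Euclidean normalization both
agree on a hyperplane. -/
lemma volume_orthogonal_eq {e : V} (he : ‖e‖ = 1) :
    (volume : Measure (ℝ ∙ e)ᗮ) = euclideanHausdorffMeasure (N - 1) := by
  rw [← InnerProductSpace.euclideanHausdorffMeasure_eq_volume, finrank_orthogonal_span he]

/-- The orthogonal projection along `e`. -/
noncomputable abbrev projLine (e : R^N) :
    R^N →L[ℝ] (ℝ ∙ e)ᗮ := (ℝ ∙ e)ᗮ.orthogonalProjectionOnto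

lemma projLine_add_inner {e : V} (he : ‖e‖ = 1) (x : V) :
    (projLine e x : V) + ⟪x, e⟫ • e = x := by
  have h1 := Submodule.starProjection_add_starProjection_orthogonal (K := ℝ ∙ e) x
  have h2 : (ℝ ∙ e).starProjection x = ⟪x, e⟫ • e := by
    rw [Submodule.starProjection_unit_singleton ℝ he, real_inner_comm]
  rw [h2, add_comm] at h1
  exact h1

lemma inner_orthogonal_span {e : V} (y : (ℝ ∙ e)ᗮ) : ⟪(y : V), e⟫ = 0 :=
  Submodule.mem_orthogonal_singleton_iff_inner_left.1 y.2

lemma projLine_coe {e : V} (y : (ℝ ∙ e)ᗮ) : projLine e (y : V) = y :=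
  Submodule.orthogonalProjectionOnto_mem_subspace_eq_self y

lemma projLine_self {e : V} : projLine e e = 0 :=
  Submodule.orthogonalProjectionOnto_orthogonal_apply_eq_zero (Submodule.mem_span_singleton_self e)

lemma norm_sq_line {e : V} (he : ‖e‖ = 1) (y : (ℝ ∙ e)ᗮ) (z : ℝ) :
    ‖(y : V) + z • e‖ ^ 2 = ‖y‖ ^ 2 + z ^ 2 := by
  rw [norm_add_sq_real, real_inner_smul_right, inner_orthogonal_span, norm_smul, he]
  simp

/-- The surface as a Lipschitz graph over its tangent space, with small constant. -/
lemma IsDefiningFunction.exists_lipschitz_graph {p : V} {φ : V → ℝ}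
    (h : IsDefiningFunction E p φ) {ε : ℝ≥0} (hε : 0 < ε) (hε1 : ε ≤ 1) :
    ∃ r > 0, ∃ g : (ℝ ∙ nu E p)ᗮ → ℝ, LipschitzWith ε g ∧
      ∀ x ∈ frontier E ∩ ball p r,
        x = p + projLine (nu E p) (x - p) +
          g (projLine (nu E p) (x - p)) • nu E p := by
  set e := nu E p with he_def
  have he : ‖e‖ = 1 := h.norm_exteriorNormal
  have hs := h.hasStrictFDerivAt p
  have hpos : 0 < (ε : ℝ) / 2 * ‖gradient φ p‖ := by
    have := h.gradient_norm_pos; positivity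
  -- Strict differentiability with this tolerance gives `|⟪x - y, e⟫| ≤ (ε / 2) ‖x - y‖` for two
  -- boundary points, hence slope at most `ε` because `ε ≤ 1`.
  obtain ⟨r, hr, hball⟩ := eventually_nhds_iff_ball.1
    ((hs.isLittleO.def hpos).and
      (h.frontier_iff.prod_nhds h.frontier_iff))
  have hball' : ∀ x ∈ ball p r, ∀ y ∈ ball p r, (x, y) ∈ ball (p, p) r := by
    intro x hx y hy
    rw [mem_ball, Prod.dist_eq, max_lt_iff]
    exact ⟨hx, hy⟩
  have hkey : ∀ x ∈ frontier E ∩ ball p r, ∀ y ∈ frontier E ∩ ball p r,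
      |⟪x - y, e⟫| ≤ ε * ‖projLine e (x - y)‖ := by
    intro x hx y hy
    obtain ⟨h1, h2, h3⟩ := hball (x, y) (hball' x hx.2 y hy.2)
    simp only at h1 h2 h3
    rw [h2.1 hx.1, h3.1 hy.1, sub_zero, zero_sub, norm_neg, h.fderiv_eq, norm_mul, norm_norm,
      real_inner_comm, norm_eq_abs] at h1
    have h4 : |⟪x - y, e⟫| ≤ ε / 2 * ‖x - y‖ := by
      have := h.gradient_norm_pos
      refine le_of_mul_le_mul_left ?_ this
      linarith
    have h5 := norm_sq_line he (projLine e (x - y)) ⟪x - y, e⟫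
    rw [projLine_add_inner he] at h5
    have hεr : (ε : ℝ) ≤ 1 := hε1
    have hε0 : (0 : ℝ) < ε := hε
    have h6 : |⟪x - y, e⟫| ^ 2 ≤ (ε * ‖projLine e (x - y)‖) ^ 2 := by
      have h7 : |⟪x - y, e⟫| ^ 2 ≤ (ε / 2 * ‖x - y‖) ^ 2 := by gcongr
      rw [mul_pow, h5] at h7
      rw [sq_abs] at h7 ⊢
      nlinarith [sq_nonneg ⟪x - y, e⟫, sq_nonneg ‖projLine e (x - y)‖, sq_nonneg (ε : ℝ),
        mul_nonneg (sq_nonneg ⟪x - y, e⟫) (by nlinarith : (0 : ℝ) ≤ 1 - (ε : ℝ) ^ 2)]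
    exact abs_le_of_sq_le_sq' h6 (by positivity) |>.2 |> fun h => h
  have hinj : InjOn (fun x => projLine e (x - p)) (frontier E ∩ ball p r) := by
    intro x hx y hy hxy
    have h0 : projLine e (x - y) = 0 := by
      have : x - y = (x - p) - (y - p) := by abel
      rw [this, map_sub]
      exact sub_eq_zero.2 hxy
    have h1 := hkey x hx y hy
    rw [h0, norm_zero, mul_zero] at h1
    have h2 := projLine_add_inner he (x - y)
    rw [h0, abs_nonpos_iff.1 h1] at h2
    simp only [ZeroMemClass.coe_zero, zero_smul, add_zero] at h2
    exact sub_eq_zero.1 h2.symm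
  have hlip : LipschitzOnWith ε
      (fun w => ⟪Function.invFunOn (fun x => projLine e (x - p)) (frontier E ∩ ball p r) w - p,
        e⟫) ((fun x => projLine e (x - p)) '' (frontier E ∩ ball p r)) := by
    refine LipschitzOnWith.of_dist_le_mul ?_
    rintro _ ⟨x, hx, rfl⟩ _ ⟨y, hy, rfl⟩
    rw [hinj.leftInvOn_invFunOn hx, hinj.leftInvOn_invFunOn hy, Real.dist_eq, ← inner_sub_left,
      sub_sub_sub_cancel_right, dist_eq_norm, ← map_sub, sub_sub_sub_cancel_right]
    exact hkey x hx y hy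
  obtain ⟨g, hg, hgeq⟩ := hlip.extend_real
  refine ⟨r, hr, g, hg, fun x hx => ?_⟩
  rw [← hgeq (mem_image_of_mem _ hx)]
  simp only
  rw [hinj.leftInvOn_invFunOn hx, add_assoc, projLine_add_inner he, add_sub_cancel]

/-- The Hausdorff measure of a Lipschitz graph is comparable to that of its base. -/
lemma volume_le_hausdorff_graph {e : V} (he : ‖e‖ = 1) {p : V} {ε : ℝ≥0} {g : (ℝ ∙ e)ᗮ → ℝ}
    (hg : LipschitzWith ε g) (B : Set (ℝ ∙ e)ᗮ) :
    volume B ≤ euclideanHausdorffMeasure (N - 1)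
        ((fun y : (ℝ ∙ e)ᗮ => p + y + g y • e) '' B) ∧
      euclideanHausdorffMeasure (N - 1) ((fun y : (ℝ ∙ e)ᗮ => p + y + g y • e) '' B) ≤
        ((1 + ε : ℝ≥0) : ℝ≥0∞) ^ (N - 1) * volume B := by
  constructor
  · have h1 : LipschitzWith 1 (fun x : V => projLine e (x - p)) := by
      refine LipschitzWith.of_dist_le_mul fun x y => ?_
      rw [dist_eq_norm, ← map_sub, sub_sub_sub_cancel_right, dist_eq_norm, NNReal.coe_one, one_mul]
      exact Submodule.norm_orthogonalProjectionOnto_apply_le _ _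
    have h2 := LipschitzOnWith.euclideanHausdorffMeasure_image_le
      (h1.lipschitzOnWith (s := (fun y : (ℝ ∙ e)ᗮ => p + y + g y • e) '' B)) (N - 1)
    rw [← volume_orthogonal_eq he, image_image] at h2
    simp only [add_assoc, add_sub_cancel_left, map_add, map_smul, projLine_coe, projLine_self,
      smul_zero, add_zero, image_id', ENNReal.coe_one, one_pow, one_mul] at h2
    simpa only [add_assoc] using h2
  · have h1 : LipschitzWith (1 + ε) (fun y : (ℝ ∙ e)ᗮ => p + (y : V) + g y • e) := by
      refine LipschitzWith.of_dist_le_mul fun x y => ?_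
      have h3 : p + (x : V) + g x • e - (p + (y : V) + g y • e) =
          ((x - y : (ℝ ∙ e)ᗮ) : V) + (g x - g y) • e := by
        rw [Submodule.coe_sub]; module
      rw [dist_eq_norm, h3]
      refine (norm_add_le _ _).trans ?_
      rw [norm_smul, he, mul_one, ← Submodule.coe_norm, dist_eq_norm, NNReal.coe_add, NNReal.coe_one,
        add_mul, one_mul]
      gcongr
      exact hg.norm_sub_le x y
    have h2 := LipschitzOnWith.euclideanHausdorffMeasure_image_le
      (h1.lipschitzOnWith (s := B)) (N - 1)
    rwa [← volume_orthogonal_eq he] at h2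

/-! ### Gauss' formula for sets with smooth boundary -/

/-- A defining function increases along short segments in the direction `e` and changes sign on
them, so each nearby line leaves `E` through a single point. That point may lie outside the smaller
ball, hence the two radii. -/
lemma IsDefiningFunction.line_crossing {p e : V} {φ : V → ℝ}
    (h : IsDefiningFunction E p φ) (hn : 0 < ⟪nu E p, e⟫) {R : ℝ} (hR : 0 < R) :
    ∃ r > 0, r ≤ R ∧ ∀ x ∈ ball p r, ∃ b : ℝ, x + b • e ∈ frontier E ∧
      x + b • e ∈ ball p R ∧ ∀ z : ℝ, x + z • e ∈ ball p r →
        (x + z • e ∈ E ↔ z < b) := by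
  have he0 : 0 < ‖e‖ := by
    rw [norm_pos_iff]; rintro rfl; simp at hn
  obtain ⟨a, ⟨ha, -⟩, δ, hδ, hbox⟩ := h.exists_box hn
    (h.frontier_iff.and (h.2.2.2.and (ball_mem_nhds p hR))) one_pos
  refine ⟨min (min δ R) (a * ‖e‖ / 2), by positivity, (min_le_left _ _).trans (min_le_right _ _),
    fun x hx => ?_⟩
  obtain ⟨hneg, hpos, hP, hmono⟩ := hbox x
    (ball_subset_ball ((min_le_left _ _).trans (min_le_left _ _)) hx)
  obtain ⟨b, hb, hb0⟩ : (0 : ℝ) ∈ (fun r : ℝ => φ (x + r • e)) '' Icc (-a) a :=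
    intermediate_value_Icc (by linarith) (h.1.continuous.comp (by fun_prop)).continuousOn
      ⟨hneg.le, hpos.le⟩
  refine ⟨b, (hP b hb).1.2 hb0, (hP b hb).2.2, fun z hz => ?_⟩
  have hza : z ∈ Icc (-a) a := by
    have hz' := ball_subset_ball (min_le_right _ (a * ‖e‖ / 2)) hz
    have hx' := ball_subset_ball (min_le_right _ (a * ‖e‖ / 2)) hx
    rw [mem_ball, dist_eq_norm] at hz' hx'
    have h1 : z • e = (x + z • e - p) - (x - p) := by abel
    have h2 : |z| * ‖e‖ ≤ a * ‖e‖ := by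
      rw [← norm_eq_abs, ← norm_smul, h1]
      exact (norm_sub_le _ _).trans (by linarith)
    exact abs_le.1 (le_of_mul_le_mul_right h2 he0)
  rw [(hP z hza).2.1, ← hmono.lt_iff_lt hza hb]
  exact ⟨fun h => h.trans_eq hb0.symm, fun h => h.trans_eq hb0⟩

/-- The integral over `E` of a directional derivative, along one line. -/
lemma integral_line_indicator {p e : V} {r R : ℝ} (he : ‖e‖ = 1)
    (hcross : ∀ x ∈ ball p r, ∃ b : ℝ, x + b • e ∈ frontier E ∧
      x + b • e ∈ ball p R ∧ ∀ z : ℝ, x + z • e ∈ ball p r →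
        (x + z • e ∈ E ↔ z < b))
    {f : V → ℝ} (hf : ContDiff ℝ 1 f) (hfc : HasCompactSupport f)
    (hfs : tsupport f ⊆ ball p r) (x₀ : V) :
    ((∀ z : ℝ, x₀ + z • e ∉ ball p r) ∧
        ∫ z : ℝ, E.indicator (fun x => fderiv ℝ f x e) (x₀ + z • e) = 0) ∨
      ∃ c : ℝ, x₀ + c • e ∈ frontier E ∩ ball p R ∧
        ∫ z : ℝ, E.indicator (fun x => fderiv ℝ f x e) (x₀ + z • e) = f (x₀ + c • e) := by
  have hD0 : ∀ x ∉ ball p r, fderiv ℝ f x e = 0 := by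
    intro x hx
    have : x ∉ tsupport (fderiv ℝ f) := fun h => hx (hfs (tsupport_fderiv_subset ℝ h))
    rw [image_eq_zero_of_notMem_tsupport this]; rfl
  by_cases hall : ∀ z : ℝ, x₀ + z • e ∉ ball p r
  · left
    refine ⟨hall, ?_⟩
    have : ∀ z : ℝ, E.indicator (fun x => fderiv ℝ f x e) (x₀ + z • e) = 0 := by
      intro z
      by_cases hz : x₀ + z • e ∈ E
      · rw [indicator_of_mem hz, hD0 _ (hall z)]
      · rw [indicator_of_notMem hz]
    simp [this]
  · right
    push Not at hall
    obtain ⟨z₀, hz₀⟩ := hall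
    obtain ⟨b, hb1, hb2, hb3⟩ := hcross _ hz₀
    have hadd : ∀ z : ℝ, x₀ + z₀ • e + z • e = x₀ + (z₀ + z) • e := fun z => by module
    rw [hadd] at hb1 hb2
    refine ⟨z₀ + b, ⟨hb1, hb2⟩, ?_⟩
    have hcl : IsClosedEmbedding fun z : ℝ => x₀ + z • e := by
      have h0 : e ≠ 0 := by rintro rfl; simp at he
      have h1 := (LinearMap.toSpanSingleton ℝ V e).isClosedEmbedding_of_injective
        (LinearMap.ker_toSpanSingleton ℝ h0)
      exact (Homeomorph.addLeft x₀).isClosedEmbedding.comp h1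
    have hu : ContDiff ℝ 1 fun z : ℝ => f (x₀ + z • e) := by fun_prop
    have hd : ∀ z : ℝ, HasDerivAt (fun z : ℝ => f (x₀ + z • e)) (fderiv ℝ f (x₀ + z • e) e) z := by
      intro z
      have h2 : HasDerivAt (fun r : ℝ => x₀ + r • e) e z := by
        simpa using ((hasDerivAt_id z).smul_const e).const_add x₀
      exact (hf.differentiable (by simp) _).hasFDerivAt.comp_hasDerivAt z h2
    rw [← HasCompactSupport.integral_Iic_deriv_eq hu (hfc.comp_isClosedEmbedding hcl) (z₀ + b),
      ← setIntegral_congr_set Iio_ae_eq_Iic, ← integral_indicator measurableSet_Iio]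
    congr 1
    ext z
    by_cases hz : x₀ + z • e ∈ ball p r
    · have h3 := hb3 (z - z₀)
      rw [hadd, add_sub_cancel] at h3
      have h3 := h3 hz
      by_cases hzE : x₀ + z • e ∈ E
      · have h4 := h3.1 hzE
        rw [indicator_of_mem hzE, indicator_of_mem (show z ∈ Iio (z₀ + b) by
          simp only [mem_Iio]; linarith), (hd z).deriv]
      · have h4 := mt h3.2 hzE
        rw [indicator_of_notMem hzE, indicator_of_notMem (show z ∉ Iio (z₀ + b) by
          simp only [mem_Iio]; linarith)]
    · have h5 := hD0 _ hz
      have h6 : E.indicator (fun x => fderiv ℝ f x e) (x₀ + z • e) = 0 := by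
        by_cases hzE : x₀ + z • e ∈ E
        · rw [indicator_of_mem hzE, h5]
        · rw [indicator_of_notMem hzE]
      rw [h6]
      by_cases hzI : z ∈ Iio (z₀ + b)
      · rw [indicator_of_mem hzI, (hd z).deriv, h5]
      · rw [indicator_of_notMem hzI]

lemma integrable_fderiv_apply {f : V → ℝ} (hf : ContDiff ℝ 1 f) (hfc : HasCompactSupport f)
    (b : V) : Integrable fun x => fderiv ℝ f x b :=
  ((hf.continuous_fderiv (by simp)).clm_apply continuous_const).integrable_of_hasCompactSupport
    (hfc.fderiv_apply ℝ b)

lemma setIntegral_fderiv_eq_lines (hE : MeasurableSet E) {e p : V} (he : ‖e‖ = 1)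
    {f : V → ℝ} (hf : ContDiff ℝ 1 f) (hfc : HasCompactSupport f) :
    ∫ x in E, fderiv ℝ f x e = ∫ y : (ℝ ∙ e)ᗮ, ∫ z : ℝ,
      E.indicator (fun x => fderiv ℝ f x e) (p + y + z • e) := by
  rw [← integral_indicator hE, integral_eq_integral_lines e he p
    ((integrable_fderiv_apply hf hfc e).indicator hE)]

/-- Nonnegativity of `∫_E ∂_e f` for `f ≥ 0` near a point where `e` points outwards. -/
lemma IsDefiningFunction.integral_fderiv_nonneg (hEo : IsOpen E) {p e : V}
    {φ : V → ℝ} (h : IsDefiningFunction E p φ) (hn : 0 < ⟪nu E p, e⟫) :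
    ∃ r > 0, ∀ f : V → ℝ, ContDiff ℝ 1 f → HasCompactSupport f → tsupport f ⊆ ball p r →
      (∀ x, 0 ≤ f x) → 0 ≤ ∫ x in E, fderiv ℝ f x e := by
  have he0 : 0 < ‖e‖ := by
    rw [norm_pos_iff]; rintro rfl; simp at hn
  set e' := ‖e‖⁻¹ • e with he'
  have he'1 : ‖e'‖ = 1 := by
    rw [he', norm_smul, norm_inv, norm_norm, inv_mul_cancel₀ he0.ne']
  have hn' : 0 < ⟪nu E p, e'⟫ := by
    rw [he', real_inner_smul_right]; positivity
  obtain ⟨r, hr, -, hcross⟩ := h.line_crossing hn' one_pos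
  refine ⟨r, hr, fun f hf hfc hfs hf0 => ?_⟩
  have h1 : ∀ x, fderiv ℝ f x e = ‖e‖ * fderiv ℝ f x e' := by
    intro x
    rw [he', map_smul, smul_eq_mul, mul_inv_cancel_left₀ he0.ne']
  simp_rw [h1]
  rw [integral_const_mul, setIntegral_fderiv_eq_lines hEo.measurableSet he'1 hf hfc (p := p)]
  refine mul_nonneg he0.le (integral_nonneg fun y => ?_)
  rcases integral_line_indicator he'1 hcross hf hfc hfs (p + y) with h2 | ⟨c, -, h2⟩
  · exact h2.2.ge
  · exact (hf0 _).trans h2.ge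

/-- The Gauss formula in the normal direction, to first order near a point of the surface. -/
lemma IsDefiningFunction.integral_fderiv_normal (hEo : IsOpen E) {p : V}
    {φ : V → ℝ} (h : IsDefiningFunction E p φ) {δ : ℝ} (hδ : 0 < δ) :
    ∃ r > 0, area E (ball p r) < ⊤ ∧
      ∀ f : V → ℝ, ContDiff ℝ 1 f → HasCompactSupport f → tsupport f ⊆ ball p r →
      (∀ x, 0 ≤ f x) →
      |(∫ x in E, fderiv ℝ f x (nu E p)) - ∫ x, f x ∂(area E)| ≤
        δ * ∫ x, f x ∂(area E) := by
  have he : ‖nu E p‖ = 1 := h.norm_exteriorNormal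
  -- A graph of Lipschitz constant `ε` has measure between `1` and `(1 + ε)^(N-1)` times that of its
  -- base.
  obtain ⟨ε, hε, hε1, hεδ⟩ : ∃ ε : ℝ≥0, 0 < ε ∧ ε ≤ 1 ∧ ((1 + ε : ℝ≥0) : ℝ) ^ (N - 1) ≤ 1 + δ := by
    have hc : Continuous fun ε : ℝ≥0 => ((1 + ε : ℝ≥0) : ℝ) ^ (N - 1) := by fun_prop
    have h1 : ∀ᶠ ε in 𝓝 (0 : ℝ≥0), ((1 + ε : ℝ≥0) : ℝ) ^ (N - 1) < 1 + δ :=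
      hc.continuousAt.eventually (gt_mem_nhds (by simpa using hδ))
    have h2 : ∀ᶠ ε in 𝓝 (0 : ℝ≥0), ε < 1 := gt_mem_nhds one_pos
    obtain ⟨ε, ⟨h3, h4⟩, h5⟩ := (((h1.and h2).filter_mono nhdsWithin_le_nhds).and
      (self_mem_nhdsWithin : ∀ᶠ ε in 𝓝[>] (0 : ℝ≥0), ε ∈ Ioi 0)).exists
    exact ⟨ε, h5, h4.le, h3.le⟩
  have hgr := h.exists_lipschitz_graph hε hε1
  have hcr := fun R => h.line_crossing (e := nu E p)
    (by rw [real_inner_self_eq_norm_sq, he]; norm_num) (R := R)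
  generalize nu E p = e at he hgr hcr ⊢
  obtain ⟨R, hR, g, hg, hgraph⟩ := hgr
  obtain ⟨r, hr, hrR, hcross⟩ := hcr R hR
  let γ : (ℝ ∙ e)ᗮ → V := fun y => p + y + g y • e
  have hγc : Continuous γ := by
    have := hg.continuous
    fun_prop
  have hline : ∀ (y : (ℝ ∙ e)ᗮ) (c : ℝ), p + (y : V) + c • e ∈ frontier E ∩ ball p R →
      c = g y := by
    intro y c hx
    have h1 := hgraph _ hx
    have h2 : projLine e (p + (y : V) + c • e - p) = y := by
      rw [add_assoc, add_sub_cancel_left, map_add, map_smul, projLine_self, projLine_coe, smul_zero,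
        add_zero]
    rw [h2] at h1
    have h3 : c • e = g y • e := add_left_cancel h1
    exact smul_left_injective ℝ (by rintro h0; rw [h0] at he; simp at he) h3
  have hγfr : ∀ y, γ y ∈ ball p r → γ y ∈ frontier E := by
    intro y hy
    obtain ⟨b, hb1, hb2, -⟩ := hcross _ hy
    have h1 : γ y + b • e = p + y + (g y + b) • e := by simp only [γ]; module
    rw [h1] at hb1 hb2
    have h2 := hline y (g y + b) ⟨hb1, hb2⟩
    have h3 : b = 0 := by linarith
    rw [h3, add_zero] at hb1
    exact hb1
  have himage : ∀ A ⊆ ball p r, γ '' (γ ⁻¹' A) = A ∩ frontier E := by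
    intro A hA
    ext x
    constructor
    · rintro ⟨y, hy, rfl⟩
      exact ⟨hy, hγfr y (hA hy)⟩
    · rintro ⟨hxA, hxE⟩
      have := hgraph x ⟨hxE, ball_subset_ball hrR (hA hxA)⟩
      exact ⟨_, by rw [mem_preimage]; simp only [γ]; rwa [← this], this.symm⟩
  set m : Measure V := Measure.map γ volume with hm
  set C : ℝ≥0∞ := ((1 + ε : ℝ≥0) : ℝ≥0∞) ^ (N - 1) with hC
  have hσ : ∀ A, MeasurableSet A → A ⊆ ball p r →
      m A ≤ area E A ∧ area E A ≤ C * m A := by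
    intro A hA hAB
    rw [hm, Measure.map_apply hγc.measurable hA, surfaceMeasure, Measure.restrict_apply hA,
      ← himage A hAB]
    exact volume_le_hausdorff_graph he hg _
  have hCtop : C ≠ ⊤ := ENNReal.pow_ne_top ENNReal.coe_ne_top
  have hmfin : m (ball p r) < ⊤ := by
    rw [hm, Measure.map_apply hγc.measurable isOpen_ball.measurableSet]
    refine lt_of_le_of_lt (measure_mono ?_) (Metric.isBounded_ball (x := (0 : (ℝ ∙ e)ᗮ))
      (r := r)).measure_lt_top
    intro y hy
    rw [mem_preimage, mem_ball, dist_eq_norm] at hy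
    rw [mem_ball, dist_zero_right]
    refine lt_of_le_of_lt ?_ hy
    have h1 : γ y - p = (y : V) + g y • e := by simp only [γ]; abel
    rw [h1]
    have h2 := norm_sq_line he y (g y)
    exact le_of_sq_le_sq (by rw [h2]; linarith [sq_nonneg (g y)]) (norm_nonneg _)
  have hσfin : area E (ball p r) < ⊤ :=
    lt_of_le_of_lt (hσ _ isOpen_ball.measurableSet subset_rfl).2
      (ENNReal.mul_lt_top (lt_top_iff_ne_top.2 hCtop) hmfin)
  refine ⟨r, hr, hσfin, fun f hf hfc hfs hf0 => ?_⟩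
  have hf0' : ∀ x ∉ ball p r, f x = 0 := fun x hx =>
    image_eq_zero_of_notMem_tsupport fun h => hx (hfs h)
  have hle1 : m.restrict (ball p r) ≤ (area E).restrict (ball p r) := by
    refine Measure.le_iff.2 fun A hA => ?_
    rw [Measure.restrict_apply hA, Measure.restrict_apply hA]
    exact (hσ _ (hA.inter isOpen_ball.measurableSet) inter_subset_right).1
  have hle2 : (area E).restrict (ball p r) ≤
      C • m.restrict (ball p r) := by
    refine Measure.le_iff.2 fun A hA => ?_
    rw [Measure.smul_apply, Measure.restrict_apply hA, Measure.restrict_apply hA]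
    exact (hσ _ (hA.inter isOpen_ball.measurableSet) inter_subset_right).2
  obtain ⟨M, hM⟩ := hfc.exists_bound_of_continuous hf.continuous
  have hint : ∀ μ : Measure V, μ (ball p r) < ⊤ →
      Integrable f (μ.restrict (ball p r)) := by
    intro μ hμ
    have : IsFiniteMeasure (μ.restrict (ball p r)) :=
      ⟨by rw [Measure.restrict_apply_univ]; exact hμ⟩
    exact Integrable.of_bound hf.continuous.aestronglyMeasurable M (.of_forall hM)
  have e1 : ∫ x, f x ∂(area E) = ∫ x in ball p r, f x ∂(area E) :=
    (setIntegral_eq_integral_of_forall_compl_eq_zero hf0').symm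
  have e2 : ∫ y, f (γ y) = ∫ x in ball p r, f x ∂m := by
    rw [setIntegral_eq_integral_of_forall_compl_eq_zero hf0', hm,
      integral_map hγc.aemeasurable hf.continuous.aestronglyMeasurable]
  -- By Fubini and the fundamental theorem of calculus, each line contributes the value of `f` at
  -- its crossing point, which lies on the graph, or nothing if it misses the ball.
  have e3 : ∫ x in E, fderiv ℝ f x e = ∫ y, f (γ y) := by
    rw [setIntegral_fderiv_eq_lines hEo.measurableSet he hf hfc (p := p)]
    refine integral_congr_ae (.of_forall fun y => ?_)
    simp only
    rcases integral_line_indicator he hcross hf hfc hfs (p + y) with ⟨h1, h2⟩ | ⟨c, hc, h2⟩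
    · rw [h2, hf0' _ (h1 _)]
    · rw [h2, hline y c hc]
  have i1 : ∫ x in ball p r, f x ∂m ≤ ∫ x in ball p r, f x ∂(area E) :=
    integral_mono_measure hle1 (.of_forall hf0) (hint _ hσfin)
  have i2 : ∫ x in ball p r, f x ∂(area E) ≤
      ((1 + ε : ℝ≥0) : ℝ) ^ (N - 1) * ∫ x in ball p r, f x ∂m := by
    refine (integral_mono_measure hle2 (.of_forall hf0)
      ((hint _ hmfin).smul_measure hCtop)).trans ?_
    rw [integral_smul_measure, smul_eq_mul, hC, ENNReal.toReal_pow, ENNReal.coe_toReal]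
  have i0 : 0 ≤ ∫ x in ball p r, f x ∂m := integral_nonneg hf0
  rw [e3, e2, e1, abs_le]
  constructor
  · nlinarith [mul_le_mul_of_nonneg_left i1 hδ.le, mul_le_mul_of_nonneg_right hεδ i0]
  · nlinarith [mul_nonneg hδ.le (i0.trans i1)]

lemma HasSmoothBoundary.isLocallyFiniteMeasure (hE : HasSmoothBoundary E) :
    IsLocallyFiniteMeasure (area E) := by
  refine ⟨fun p => ?_⟩
  by_cases hp : p ∈ frontier E
  · obtain ⟨φ, h⟩ := hE.2 p hp
    obtain ⟨r, hr, hfin, -⟩ := h.integral_fderiv_normal hE.1 one_pos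
    exact ⟨_, ball_mem_nhds p hr, hfin⟩
  · refine ⟨(frontier E)ᶜ, isClosed_frontier.isOpen_compl.mem_nhds hp, ?_⟩
    rw [surfaceMeasure, Measure.restrict_apply isClosed_frontier.isOpen_compl.measurableSet,
      compl_inter_self, measure_empty]
    exact ENNReal.zero_lt_top

lemma ae_mem_frontier (E : Set V) : ∀ᵐ x ∂(area E), x ∈ frontier E :=
  ae_restrict_mem isClosed_frontier.measurableSet

lemma surfaceMeasure_restrict_frontier (E : Set V) :
    (area E).restrict (frontier E) = area E := by
  rw [surfaceMeasure, Measure.restrict_restrict isClosed_frontier.measurableSet, inter_self]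

lemma HasSmoothBoundary.aestronglyMeasurable_surface {F : Type*}
    [NormedAddCommGroup F] [NormedSpace ℝ F] {f : V → F} (hf : ContinuousOn f (frontier E)) :
    AEStronglyMeasurable f (area E) := by
  rw [← surfaceMeasure_restrict_frontier]
  exact hf.aestronglyMeasurable isClosed_frontier.measurableSet

lemma HasSmoothBoundary.integrable_surface (hE : HasSmoothBoundary E) {f : V → ℝ}
    (hf : ContinuousOn f (frontier E)) {K : Set V} (hK : IsCompact K)
    (h0 : ∀ x ∈ frontier E, x ∉ K → f x = 0) : Integrable f (area E) := by
  have := hE.isLocallyFiniteMeasure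
  have h1 : IntegrableOn f (frontier E ∩ K) (area E) :=
    (hf.mono inter_subset_left).integrableOn_compact (hK.inter_left isClosed_frontier)
  refine h1.integrable_of_ae_notMem_eq_zero ?_
  filter_upwards [ae_mem_frontier E] with x hx hx'
  exact h0 x hx fun h => hx' ⟨hx, h⟩

lemma HasSmoothBoundary.continuousOn_inner_normal (hE : HasSmoothBoundary E) (b : V) :
    ContinuousOn (fun x => ⟪nu E x, b⟫) (frontier E) :=
  hE.continuousOn_exteriorNormal.inner continuousOn_const

lemma integral_fderiv_eq_zero {f : V → ℝ} (hf : ContDiff ℝ 1 f) (hfc : HasCompactSupport f)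
    (b : V) : ∫ x, fderiv ℝ f x b = 0 := by
  have h := integral_mul_fderiv_eq_neg_fderiv_mul_of_integrable (μ := (volume : Measure V))
    (f := fun _ => (1 : ℝ)) (g := f) (v := b) (by simp)
    (by simpa using integrable_fderiv_apply hf hfc b)
    (by simpa using hf.continuous.integrable_of_hasCompactSupport hfc)
    (fun x _ => differentiableAt_const _) (fun x _ => hf.differentiable (by simp) x)
  simpa using h

/-- Split `b` as `τ + α n` with `n` the normal at `p`. In the direction `n` the formula is known up
to a small relative error. For `τ`, both `n + K τ` and `n - K τ` point outwards for every `K`, and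
the integrals of derivatives in outward directions are nonnegative near `p`. Hence the tangential
integral is at most `1 / K` times the normal one. -/
lemma HasSmoothBoundary.gauss_near (hE : HasSmoothBoundary E) (p b : V) {ε : ℝ}
    (hε : 0 < ε) :
    ∃ r > 0, ∀ f : V → ℝ, ContDiff ℝ 1 f → HasCompactSupport f → tsupport f ⊆ ball p r →
      (∀ x, 0 ≤ f x) →
      |(∫ x in E, fderiv ℝ f x b) - ∫ x, f x * ⟪nu E x, b⟫ ∂(area E)| ≤
        ε * ∫ x, f x ∂(area E) := by
  by_cases hp : p ∈ frontier E
  swap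
  · obtain ⟨r, hr, hball⟩ := Metric.isOpen_iff.1 (isClosed_frontier (s := E)).isOpen_compl p hp
    refine ⟨r, hr, fun f hf hfc hfs hf0 => ?_⟩
    have hf1 : ∀ x ∉ ball p r, f x = 0 := fun x hx =>
      image_eq_zero_of_notMem_tsupport fun h => hx (hfs h)
    have hD0 : ∀ x ∉ ball p r, fderiv ℝ f x b = 0 := by
      intro x hx
      have : x ∉ tsupport (fderiv ℝ f) := fun h => hx (hfs (tsupport_fderiv_subset ℝ h))
      rw [image_eq_zero_of_notMem_tsupport this]; rfl
    have hσ : ∀ᵐ x ∂(area E), f x = 0 := by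
      filter_upwards [ae_mem_frontier E] with x hx
      exact hf1 x fun h => hball h hx
    have e1 : ∫ x, f x ∂(area E) = 0 := integral_eq_zero_of_ae hσ
    have e2 : ∫ x, f x * ⟪nu E x, b⟫ ∂(area E) = 0 :=
      integral_eq_zero_of_ae (hσ.mono fun x hx => by simp [hx])
    have e3 : ∫ x in E, fderiv ℝ f x b = 0 := by
      have hpc : IsPreconnected (ball p r) := (convex_ball p r).isPreconnected
      have hsame : ∀ x ∈ ball p r, (x ∈ E ↔ p ∈ E) := fun x hx =>
        mem_iff_of_isPreconnected hE.1 hpc (fun y hy => hball hy) hx (mem_ball_self hr)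
      by_cases hpE : p ∈ E
      · rw [setIntegral_eq_integral_of_forall_compl_eq_zero, integral_fderiv_eq_zero hf hfc]
        intro x hx
        exact hD0 x fun h => hx ((hsame x h).2 hpE)
      · refine setIntegral_eq_zero_of_forall_eq_zero fun x hx => ?_
        exact hD0 x fun h => hpE ((hsame x h).1 hx)
    rw [e1, e2, e3]; simp
  obtain ⟨φ, h⟩ := hE.2 p hp
  set n := nu E p with hn
  have hn1 : ‖n‖ = 1 := h.norm_exteriorNormal
  have hnn : ⟪n, n⟫ = 1 := by rw [real_inner_self_eq_norm_sq, hn1]; norm_num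
  set α := ⟪n, b⟫ with hα
  set τ := b - α • n with hτ
  have hτn : ⟪n, τ⟫ = 0 := by
    rw [hτ, inner_sub_right, real_inner_smul_right, hnn, mul_one, hα, sub_self]
  -- The tangential integral `T` will satisfy `K |T| ≤ 2 S`, so this choice gives `|T| ≤ ε S / 3`.
  -- The choice of `δ` below bounds the normal error by `ε S / 3`, and the oscillation of the normal
  -- costs the last third.
  set K : ℝ := 6 / ε with hK
  have hKpos : 0 < K := by positivity
  set δ : ℝ := min 1 (ε / (3 * (|α| + 1))) with hδ
  have hδpos : 0 < δ := lt_min one_pos (by positivity)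
  obtain ⟨r₁, hr₁, hfin, H₁⟩ := h.integral_fderiv_normal hE.1 hδpos
  obtain ⟨r₂, hr₂, H₂⟩ := h.integral_fderiv_nonneg hE.1 (e := n + K • τ)
    (by rw [inner_add_right, real_inner_smul_right, hτn, hnn]; norm_num)
  obtain ⟨r₃, hr₃, H₃⟩ := h.integral_fderiv_nonneg hE.1 (e := n - K • τ)
    (by rw [inner_sub_right, real_inner_smul_right, hτn, hnn]; norm_num)
  obtain ⟨r₄, hr₄, H₄⟩ : ∃ r > 0, ∀ x ∈ ball p r, x ∈ frontier E →
      |α - ⟪nu E x, b⟫| ≤ ε / 3 := by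
    have h1 := hE.continuousOn_inner_normal b p hp
    have h2 := Metric.continuousWithinAt_iff.1 h1 (ε / 3) (by positivity)
    obtain ⟨r, hr, h3⟩ := h2
    refine ⟨r, hr, fun x hx hxE => ?_⟩
    have := h3 hxE hx
    rw [dist_comm, Real.dist_eq] at this
    exact this.le
  refine ⟨min (min r₁ r₂) (min r₃ r₄), by positivity, fun f hf hfc hfs hf0 => ?_⟩
  have hs1 := hfs.trans (ball_subset_ball ((min_le_left _ _).trans (min_le_left r₁ r₂)))
  have hs2 := hfs.trans (ball_subset_ball ((min_le_left _ _).trans (min_le_right r₁ r₂)))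
  have hs3 := hfs.trans (ball_subset_ball ((min_le_right _ _).trans (min_le_left r₃ r₄)))
  have hs4 := hfs.trans (ball_subset_ball ((min_le_right _ _).trans (min_le_right r₃ r₄)))
  have a1 := H₁ f hf hfc hs1 hf0
  have a2 := H₂ f hf hfc hs2 hf0
  have a3 := H₃ f hf hfc hs3 hf0
  have hint : ∀ v : V, IntegrableOn (fun x => fderiv ℝ f x v) E := fun v =>
    (integrable_fderiv_apply hf hfc v).integrableOn
  have ladd : ∀ (u v : V) (c : ℝ), ∫ x in E, fderiv ℝ f x (u + c • v) =
      (∫ x in E, fderiv ℝ f x u) + c * ∫ x in E, fderiv ℝ f x v := by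
    intro u v c
    rw [← integral_const_mul, ← integral_add (hint u) ((hint v).const_mul c)]
    simp only [map_add, map_smul, smul_eq_mul]
  have hb : b = τ + α • n := by rw [hτ]; abel
  rw [sub_eq_add_neg, ← neg_smul, ladd] at a3
  rw [ladd] at a2
  have hLb : ∫ x in E, fderiv ℝ f x b =
      (∫ x in E, fderiv ℝ f x τ) + α * ∫ x in E, fderiv ℝ f x n := by
    conv_lhs => rw [hb]
    rw [ladd]
  have hIf : Integrable f (area E) := hE.integrable_surface hf.continuous.continuousOn
    hfc.isCompact fun x _ hx => image_eq_zero_of_notMem_tsupport hx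
  have hIfb : Integrable (fun x => f x * ⟪nu E x, b⟫) (area E) :=
    hE.integrable_surface (hf.continuous.continuousOn.mul (hE.continuousOn_inner_normal b))
      hfc.isCompact fun x _ hx => by rw [image_eq_zero_of_notMem_tsupport hx, zero_mul]
  set S := ∫ x, f x ∂(area E) with hS
  have hS0 : 0 ≤ S := integral_nonneg hf0
  have a4 : |α * S - ∫ x, f x * ⟪nu E x, b⟫ ∂(area E)| ≤ ε / 3 * S := by
    rw [hS, ← integral_const_mul, ← integral_sub (hIf.const_mul α) hIfb, ← integral_const_mul,
      ← norm_eq_abs]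
    refine (norm_integral_le_integral_norm _).trans (integral_mono_ae
      ((hIf.const_mul α).sub hIfb).norm (hIf.const_mul _) ?_)
    filter_upwards [ae_mem_frontier E] with x hx
    by_cases hxb : x ∈ ball p r₄
    · have e1 : α * f x - f x * ⟪nu E x, b⟫ =
        (α - ⟪nu E x, b⟫) * f x := by ring
      rw [e1, norm_mul, norm_eq_abs, norm_of_nonneg (hf0 x)]
      exact mul_le_mul_of_nonneg_right (H₄ x hxb hx) (hf0 x)
    · have : f x = 0 := image_eq_zero_of_notMem_tsupport fun h => hxb (hs4 h)
      simp [this]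
  rw [hLb]
  set A := ∫ x in E, fderiv ℝ f x n
  set T := ∫ x in E, fderiv ℝ f x τ
  set G := ∫ x, f x * ⟪nu E x, b⟫ ∂(area E)
  have hA : A ≤ 2 * S := by
    have := (abs_le.1 a1).2
    have h5 : δ * S ≤ 1 * S := mul_le_mul_of_nonneg_right (min_le_left _ _) hS0
    linarith
  have hKT : K * |T| ≤ 2 * S := by
    rcases abs_cases T with ⟨h6, -⟩ | ⟨h6, -⟩ <;> rw [h6] <;> nlinarith
  have hT : |T| ≤ ε / 3 * S := by
    have h7 : K * |T| ≤ K * (ε / 3 * S) := by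
      have : K * (ε / 3 * S) = 2 * S := by rw [hK]; field_simp; ring
      rw [this]; exact hKT
    exact le_of_mul_le_mul_left h7 hKpos
  have hAS : |α * A - α * S| ≤ ε / 3 * S := by
    rw [← mul_sub, abs_mul]
    calc |α| * |A - S| ≤ |α| * (δ * S) := by gcongr
      _ ≤ |α| * (ε / (3 * (|α| + 1)) * S) := by gcongr; exact min_le_right _ _
      _ = (|α| / (|α| + 1)) * (ε / 3 * S) := by field_simp
      _ ≤ 1 * (ε / 3 * S) := by
          gcongr
          rw [div_le_one (by positivity)]; linarith
      _ = ε / 3 * S := one_mul _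
  rw [abs_le] at *
  constructor <;> linarith [hT.1, hT.2, hAS.1, hAS.2, a4.1, a4.2]

/-- The local errors are proportional to the surface integral of the local pieces, so over a
partition of unity they add up to `ε` times that of `f`, however many pieces there are. -/
lemma HasSmoothBoundary.gauss_of_nonneg (hE : HasSmoothBoundary E) (b : V)
    {f : V → ℝ} (hf : ContDiff ℝ 1 f) (hfc : HasCompactSupport f) (hf0 : ∀ x, 0 ≤ f x) :
    ∫ x in E, fderiv ℝ f x b = ∫ x, f x * ⟪nu E x, b⟫ ∂(area E) := by
  have key : ∀ ε > 0, |(∫ x in E, fderiv ℝ f x b) -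
      ∫ x, f x * ⟪nu E x, b⟫ ∂(area E)| ≤
        ε * ∫ x, f x ∂(area E) := by
    intro ε hε
    choose r hr H using fun p => hE.gauss_near p b hε
    obtain ⟨ρ, hρ⟩ := SmoothPartitionOfUnity.exists_isSubordinate 𝓘(ℝ, V)
      (isClosed_tsupport f) (fun p => ball p (r p)) (fun p => isOpen_ball)
      (fun x _ => mem_iUnion.2 ⟨x, mem_ball_self (hr x)⟩)
    have hfinite := ρ.locallyFinite.finite_nonempty_inter_compact hfc.isCompact
    set I := hfinite.toFinset with hI
    have hsum : ∀ x, f x = ∑ i ∈ I, ρ i x * f x := by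
      intro x
      by_cases hx : x ∈ tsupport f
      · rw [← Finset.sum_mul, ← finsum_eq_sum_of_support_subset, ρ.sum_eq_one hx, one_mul]
        intro i hi
        rw [hI, Finite.coe_toFinset]
        exact ⟨x, hi, hx⟩
      · simp [image_eq_zero_of_notMem_tsupport hx]
    have hρs : ∀ i, ContDiff ℝ 1 (ρ i) := fun i => (ρ i).contMDiff.contDiff.of_le (by simp)
    have hfi : ∀ i, ContDiff ℝ 1 fun x => ρ i x * f x := fun i => (hρs i).mul hf
    have hfic : ∀ i, HasCompactSupport fun x => ρ i x * f x := fun i => hfc.mul_left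
    have hfis : ∀ i, tsupport (fun x => ρ i x * f x) ⊆ ball i (r i) := fun i =>
      (tsupport_mul_subset_left).trans (hρ i)
    have hfi0 : ∀ i x, 0 ≤ ρ i x * f x := fun i x => mul_nonneg (ρ.nonneg i x) (hf0 x)
    have hIi : ∀ i, Integrable (fun x => ρ i x * f x) (area E) := fun i =>
      hE.integrable_surface (hfi i).continuous.continuousOn
        (hfic i).isCompact fun x _ hx =>
          image_eq_zero_of_notMem_tsupport (f := fun x => ρ i x * f x) hx
    have hIib : ∀ i, Integrable (fun x => ρ i x * f x * ⟪nu E x, b⟫)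
        (area E) := fun i =>
      hE.integrable_surface
        ((hfi i).continuous.continuousOn.mul (hE.continuousOn_inner_normal b))
        (hfic i).isCompact fun x _ hx => by
          rw [image_eq_zero_of_notMem_tsupport (f := fun x => ρ i x * f x) hx, zero_mul]
    have e1 : ∫ x in E, fderiv ℝ f x b = ∑ i ∈ I, ∫ x in E, fderiv ℝ (fun x => ρ i x * f x) x b := by
      rw [← integral_finsetSum _ fun i _ => (integrable_fderiv_apply (hfi i) (hfic i) b).integrableOn]
      refine integral_congr_ae (.of_forall fun x => ?_)
      simp only
      have : f = fun x => ∑ i ∈ I, ρ i x * f x := funext hsum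
      conv_lhs => rw [this]
      rw [fderiv_fun_sum fun i _ => (hfi i).differentiable (by simp) x]
      simp
    have e2 : ∫ x, f x * ⟪nu E x, b⟫ ∂(area E) =
        ∑ i ∈ I, ∫ x, ρ i x * f x * ⟪nu E x, b⟫ ∂(area E) := by
      rw [← integral_finsetSum _ fun i _ => hIib i]
      refine integral_congr_ae (.of_forall fun x => ?_)
      simp only
      rw [← Finset.sum_mul, ← hsum x]
    have e3 : ∫ x, f x ∂(area E) =
        ∑ i ∈ I, ∫ x, ρ i x * f x ∂(area E) := by
      rw [← integral_finsetSum _ fun i _ => hIi i]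
      exact integral_congr_ae (.of_forall hsum)
    rw [e1, e2, e3, ← Finset.sum_sub_distrib, Finset.mul_sum]
    refine (Finset.abs_sum_le_sum_abs _ _).trans (Finset.sum_le_sum fun i _ => ?_)
    exact H i _ (hfi i) (hfic i) (hfis i) (hfi0 i)
  have h0 : 0 ≤ ∫ x, f x ∂(area E) := integral_nonneg hf0
  refine sub_eq_zero.1 (abs_eq_zero.1 (le_antisymm (le_of_forall_pos_le_add fun ε hε => ?_)
    (abs_nonneg _)))
  refine (key (ε / ((∫ x, f x ∂(area E)) + 1)) (by positivity)).trans ?_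
  rw [zero_add, div_mul_eq_mul_div, div_le_iff₀ (by positivity)]
  nlinarith

/-- **Gauss' formula** for sets with smooth boundary. -/
lemma HasSmoothBoundary.gauss (hE : HasSmoothBoundary E) (b : V)
    {f : V → ℝ} (hf : ContDiff ℝ 1 f) (hfc : HasCompactSupport f) :
    ∫ x in E, fderiv ℝ f x b = ∫ x, f x * ⟪nu E x, b⟫ ∂(area E) := by
  obtain ⟨M, hM⟩ := hfc.exists_bound_of_continuous hf.continuous
  obtain ⟨R, hR⟩ := hfc.isCompact.isBounded.subset_closedBall (0 : V)
  -- A large multiple of a bump equal to `1` on the support of `f` makes the sum nonnegative; the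
  -- formula for `f` follows by difference.
  let χ : ContDiffBump (0 : V) := ⟨|R| + 1, |R| + 2, by positivity, by linarith⟩
  have hχ : ContDiff ℝ 1 χ := χ.contDiff
  have hg : ContDiff ℝ 1 fun x => |M| * χ x := contDiff_const.mul hχ
  have hgc : HasCompactSupport fun x => |M| * χ x := χ.hasCompactSupport.mul_left
  have hg0 : ∀ x, 0 ≤ |M| * χ x := fun x => mul_nonneg (abs_nonneg _) χ.nonneg
  have hfg0 : ∀ x, 0 ≤ f x + |M| * χ x := by
    intro x
    by_cases hx : x ∈ tsupport f
    · have h1 : χ x = 1 := χ.one_of_mem_closedBall (by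
        have h2 := hR hx
        rw [mem_closedBall] at h2 ⊢
        have := le_abs_self R
        exact h2.trans (by change R ≤ |R| + 1; linarith))
      rw [h1]
      have := abs_le.1 (hM x)
      linarith [le_abs_self M]
    · rw [image_eq_zero_of_notMem_tsupport hx, zero_add]; exact hg0 x
  have h1 := hE.gauss_of_nonneg b hg hgc hg0
  have h2 := hE.gauss_of_nonneg b (hf.add hg) (hfc.add hgc) hfg0
  have h3 : ∀ x, fderiv ℝ (fun x => f x + |M| * χ x) x b =
      fderiv ℝ f x b + fderiv ℝ (fun x => |M| * χ x) x b := by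
    intro x
    rw [fderiv_fun_add (hf.differentiable (by simp) x) (hg.differentiable (by simp) x)]
    rfl
  simp_rw [h3] at h2
  rw [integral_add (integrable_fderiv_apply hf hfc b).integrableOn
    (integrable_fderiv_apply hg hgc b).integrableOn, h1] at h2
  simp_rw [add_mul] at h2
  have hI1 : Integrable (fun x => f x * ⟪nu E x, b⟫) (area E) :=
    hE.integrable_surface (hf.continuous.continuousOn.mul (hE.continuousOn_inner_normal b))
      hfc.isCompact fun x _ hx => by rw [image_eq_zero_of_notMem_tsupport hx, zero_mul]
  have hI2 : Integrable (fun x => |M| * χ x * ⟪nu E x, b⟫) (area E) :=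
    hE.integrable_surface (hg.continuous.continuousOn.mul (hE.continuousOn_inner_normal b))
      hgc.isCompact fun x _ hx => by
        rw [image_eq_zero_of_notMem_tsupport (f := fun x => |M| * χ x) hx, zero_mul]
  rw [integral_add hI1 hI2] at h2
  linarith

/-- The divergence of a vector field. -/
noncomputable def divergence (Z : R^N → R^N)
    (x : R^N) : ℝ :=
  LinearMap.trace ℝ R^N (fderiv ℝ Z x).toLinearMap

lemma trace_eq_sum_inner (A : V →ₗ[ℝ] V) :
    LinearMap.trace ℝ V A = ∑ i, ⟪EuclideanSpace.basisFun (Fin N) ℝ i,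
      A (EuclideanSpace.basisFun (Fin N) ℝ i)⟫ :=
  LinearMap.trace_eq_sum_inner A (EuclideanSpace.basisFun (Fin N) ℝ)

lemma HasSmoothBoundary.divergence_theorem (hE : HasSmoothBoundary E)
    {Z : V → V} (hZ : ContDiff ℝ 1 Z) (hZc : HasCompactSupport Z) :
    ∫ x in E, divergence Z x = ∫ x, ⟪Z x, nu E x⟫ ∂(area E) := by
  set B := EuclideanSpace.basisFun (Fin N) ℝ with hB
  have hZi : ∀ i, ContDiff ℝ 1 fun x => ⟪B i, Z x⟫ := fun i => contDiff_const.inner ℝ hZ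
  have hZic : ∀ i, HasCompactSupport fun x => ⟪B i, Z x⟫ := fun i =>
    hZc.comp_left (g := fun v => ⟪B i, v⟫) (inner_zero_right _)
  have hd : ∀ i x v, fderiv ℝ (fun x => ⟪B i, Z x⟫) x v = ⟪B i, fderiv ℝ Z x v⟫ := by
    intro i x v
    rw [fderiv_inner_apply ℝ (differentiableAt_const _) (hZ.differentiable (by simp) x)]
    simp
  have e1 : ∀ x, divergence Z x = ∑ i, fderiv ℝ (fun x => ⟪B i, Z x⟫) x (B i) := by
    intro x
    rw [divergence, trace_eq_sum_inner]
    exact Finset.sum_congr rfl fun i _ => (hd i x (B i)).symm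
  have e2 : ∀ x, ⟪Z x, nu E x⟫ = ∑ i, ⟪B i, Z x⟫ * ⟪nu E x, B i⟫ := by
    intro x
    rw [← B.sum_inner_mul_inner (Z x) (nu E x)]
    exact Finset.sum_congr rfl fun i _ => by rw [real_inner_comm, real_inner_comm (B i)]
  simp_rw [e1, e2]
  rw [integral_finsetSum _ fun i _ => (integrable_fderiv_apply (hZi i) (hZic i) _).integrableOn,
    integral_finsetSum]
  · exact Finset.sum_congr rfl fun i _ => hE.gauss (B i) (hZi i) (hZic i)
  · intro i _
    exact hE.integrable_surface
      ((hZi i).continuous.continuousOn.mul (hE.continuousOn_inner_normal _))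
      (hZic i).isCompact fun x _ hx => by
        rw [image_eq_zero_of_notMem_tsupport (f := fun x => ⟪B i, Z x⟫) hx, zero_mul]

/-! ### Quadratic contact with the tangent plane -/

/-- Quantitative `C²` contact of `∂E` with its tangent plane at `p`, up to the scale `ρ`. -/
structure QuadraticContact (E : Set R^N) (p : R^N)
    (ρ C : ℝ) : Prop where
  isOpen : IsOpen E
  mem : p ∈ frontier E
  norm_normal : ‖nu E p‖ = 1
  inner_le : ∀ x ∈ ball p ρ, ∀ y ∈ ball p ρ, x ∈ frontier E → y ∈ frontier E →
    |⟪y - x, nu E p⟫| ≤ C * max ‖x - p‖ ‖y - p‖ * ‖y - x‖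
  mem_of_lt : ∀ x ∈ ball p ρ, ⟪x - p, nu E p⟫ < -(C * ‖x - p‖ ^ 2) → x ∈ E
  notMem_of_lt : ∀ x ∈ ball p ρ, C * ‖x - p‖ ^ 2 < ⟪x - p, nu E p⟫ → x ∉ E
  normal_le : ∀ x ∈ ball p ρ, x ∈ frontier E →
    ‖nu E x - nu E p‖ ≤ C * ‖x - p‖

lemma QuadraticContact.inner_le_sq {p : V} {ρ C : ℝ} (h : QuadraticContact E p ρ C)
    {x : V} (hx : x ∈ ball p ρ) (hxE : x ∈ frontier E) :
    |⟪x - p, nu E p⟫| ≤ C * ‖x - p‖ ^ 2 := by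
  have hρ : 0 < ρ := Metric.nonempty_ball.1 ⟨x, hx⟩
  have := h.inner_le p (mem_ball_self hρ) x hx h.mem hxE
  rw [sub_self, norm_zero, max_eq_right (norm_nonneg _)] at this
  linarith [sq ‖x - p‖]

lemma exists_lipschitz_ball {F G : Type*} [NormedAddCommGroup F] [NormedSpace ℝ F]
    [NormedAddCommGroup G] [NormedSpace ℝ G] {f : F → G} (hf : ContDiff ℝ 1 f) (p : F) :
    ∃ K > (0 : ℝ), ∀ᶠ r in 𝓝[>] (0 : ℝ), ∀ x ∈ ball p r, ∀ y ∈ ball p r,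
      ‖f x - f y‖ ≤ K * ‖x - y‖ := by
  obtain ⟨K, t, ht, hK⟩ := (hf.contDiffAt (x := p)).exists_lipschitzOnWith
  obtain ⟨r, hr, hrt⟩ := Metric.mem_nhds_iff.1 ht
  refine ⟨K + 1, by positivity, ?_⟩
  filter_upwards [Ioo_mem_nhdsGT hr] with r' hr' x hx y hy
  have hs := (ball_subset_ball hr'.2.le).trans hrt
  have := hK.norm_sub_le (hs hx) (hs hy)
  nlinarith [norm_nonneg (x - y)]

/-- Taylor's formula for a defining function, with constants common to all base points near `p₀`.
This uniformity is what later makes the bounds on curvature and Jacobi operator locally uniform. -/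
lemma HasSmoothBoundary.exists_quadraticContact (hE : HasSmoothBoundary E) {p₀ : V}
    (hp₀ : p₀ ∈ frontier E) :
    ∃ ρ > 0, ∃ C > 0, ∀ p ∈ ball p₀ ρ, p ∈ frontier E → QuadraticContact E p ρ C := by
  obtain ⟨φ, h⟩ := hE.2 p₀ hp₀
  obtain ⟨n, hn, hnE⟩ := hE.exists_normal_extension hp₀
  obtain ⟨K, hK, hKe⟩ := exists_lipschitz_ball ((h.1.fderiv_right (m := ((⊤ : ℕ∞) : WithTop ℕ∞)) (by simp)).of_le (by simp)) p₀
  obtain ⟨L, hL, hLe⟩ := exists_lipschitz_ball (hn.of_le (by simp) : ContDiff ℝ 1 n) p₀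
  have hg := h.gradient_norm_pos
  -- A lower bound for the gradient near `p₀`: dividing the Taylor estimates for `φ`, of constant
  -- `K`, by it gives estimates for the normal coordinate.
  set c := ‖gradient φ p₀‖ / 2 with hc
  have hcpos : 0 < c := by positivity
  have hgc : ∀ᶠ x in 𝓝 p₀, c < ‖gradient φ x‖ :=
    (contDiff_gradient h.1).continuous.norm.continuousAt.eventually
      (lt_mem_nhds (by rw [hc]; linarith : c < ‖gradient φ p₀‖))
  obtain ⟨R, hR, hball⟩ := eventually_nhds_iff_ball.1
    (((h.eventually.and h.frontier_iff).and (h.2.2.2.and hgc)).and hnE)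
  obtain ⟨r, ⟨hrK, hrL⟩, hr0, hrR⟩ := ((hKe.and hLe).and (Ioo_mem_nhdsGT hR)).exists
  have hin : ∀ p ∈ ball p₀ (r / 2), ball p (r / 2) ⊆ ball p₀ r := by
    intro p hp
    refine Metric.ball_subset_ball' ?_
    have := mem_ball.1 hp
    linarith
  refine ⟨r / 2, by linarith, max (K / c) L, lt_max_of_lt_right hL, fun p hp hpE => ?_⟩
  have hpr : p ∈ ball p₀ r := ball_subset_ball (by linarith) hp
  have hpR : p ∈ ball p₀ R := ball_subset_ball hrR.le hpr
  have hφp : φ p = 0 := (hball p hpR).1.1.2.1 hpE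
  have hdp : IsDefiningFunction E p φ := (hball p hpR).1.1.1 hφp
  have hgp : c < ‖gradient φ p‖ := (hball p hpR).1.2.2
  have taylor : ∀ x ∈ ball p (r / 2), ∀ y ∈ ball p (r / 2),
      |φ y - φ x - fderiv ℝ φ p (y - x)| ≤ K * max ‖x - p‖ ‖y - p‖ * ‖y - x‖ := by
    intro x hx y hy
    set m := max ‖x - p‖ ‖y - p‖
    have hconv : Convex ℝ (closedBall p m ∩ ball p (r / 2)) :=
      (convex_closedBall p m).inter (convex_ball _ _)
    have hb : ∀ z ∈ closedBall p m ∩ ball p (r / 2),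
        ‖fderiv ℝ φ z - fderiv ℝ φ p‖ ≤ K * m := by
      intro z hz
      refine (hrK z (hin p hp hz.2) p hpr).trans ?_
      have := hz.1
      rw [mem_closedBall, dist_eq_norm] at this
      gcongr
    have := hconv.norm_image_sub_le_of_norm_hasFDerivWithin_le' (𝕜 := ℝ) (f := φ)
      (fun z _ => (h.differentiable z).hasFDerivAt.hasFDerivWithinAt) hb
      (x := x) (y := y) ⟨by rw [mem_closedBall, dist_eq_norm]; exact le_max_left _ _, hx⟩
      ⟨by rw [mem_closedBall, dist_eq_norm]; exact le_max_right _ _, hy⟩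
    simpa [norm_eq_abs] using this
  have key : ∀ {a b : ℝ}, 0 ≤ a → ‖gradient φ p‖ * b ≤ K * a → b ≤ max (K / c) L * a := by
    intro a b ha hab
    have h1 : b ≤ K / c * a := by
      by_cases hb : b ≤ 0
      · exact hb.trans (by positivity)
      · push Not at hb
        rw [div_mul_eq_mul_div, le_div_iff₀ hcpos]
        nlinarith
    exact h1.trans (mul_le_mul_of_nonneg_right (le_max_left _ _) ha)
  have t0 : ∀ x ∈ ball p (r / 2),
      |φ x - ‖gradient φ p‖ * ⟪x - p, nu E p⟫| ≤ K * ‖x - p‖ ^ 2 := by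
    intro x hx
    have := taylor p (mem_ball_self (by linarith)) x hx
    rw [sub_self, norm_zero, max_eq_right (norm_nonneg _), hφp, sub_zero, hdp.fderiv_eq,
      real_inner_comm] at this
    linarith [sq ‖x - p‖]
  refine ⟨hE.1, hpE, hdp.norm_exteriorNormal, ?_, ?_, ?_, ?_⟩
  · intro x hx y hy hxE hyE
    have hx0 : φ x = 0 := (hball x (ball_subset_ball hrR.le (hin p hp hx))).1.1.2.1 hxE
    have hy0 : φ y = 0 := (hball y (ball_subset_ball hrR.le (hin p hp hy))).1.1.2.1 hyE
    have := taylor x hx y hy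
    rw [hx0, hy0, sub_zero, zero_sub, abs_neg, hdp.fderiv_eq, abs_mul, abs_norm,
      real_inner_comm, mul_assoc] at this
    rw [mul_assoc]
    exact key (by positivity) this
  · intro x hx hlt
    by_contra hxE
    have hx0 : 0 ≤ φ x := not_lt.1 fun h' =>
      hxE (((hball x (ball_subset_ball hrR.le (hin p hp hx))).1.2.1).2 h')
    have := (abs_le.1 (t0 x hx)).2
    have := key (a := ‖x - p‖ ^ 2) (b := -⟪x - p, nu E p⟫) (by positivity) (by nlinarith)
    linarith
  · intro x hx hlt hxE
    have hx0 : φ x < 0 :=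
      ((hball x (ball_subset_ball hrR.le (hin p hp hx))).1.2.1).1 hxE
    have := (abs_le.1 (t0 x hx)).1
    have := key (a := ‖x - p‖ ^ 2) (b := ⟪x - p, nu E p⟫) (by positivity) (by nlinarith)
    linarith
  · intro x hx hxE
    rw [(hball x (ball_subset_ball hrR.le (hin p hp hx))).2 hxE, (hball p hpR).2 hpE]
    refine (hrL x (hin p hp hx) p hpr).trans ?_
    gcongr
    exact le_max_right _ _

/-! ### Smoothed kernels and radial principal values -/

/-- The kernel `|w|^{-β}`, smoothed at the scale `δ`. -/
noncomputable def kern (β δ : ℝ) (w : R^N) : ℝ :=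
  (‖w‖ ^ 2 + δ ^ 2) ^ (-(β / 2))

lemma sq_rpow_neg_half {r : ℝ} (hr : 0 ≤ r) (β : ℝ) : (r ^ 2) ^ (-(β / 2)) = r ^ (-β) := by
  rw [← Real.rpow_natCast r 2, ← Real.rpow_mul hr]
  congr 1; push_cast; ring

lemma kern_zero (β : ℝ) (w : V) : kern β 0 w = 1 / ‖w‖ ^ β := by
  rw [kern, zero_pow two_ne_zero, add_zero, sq_rpow_neg_half (norm_nonneg _),
    rpow_neg (norm_nonneg _), one_div]

lemma kern_nonneg (β δ : ℝ) (w : V) : 0 ≤ kern β δ w := by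
  unfold kern; positivity

lemma kern_neg (β δ : ℝ) (w : V) : kern β δ (-w) = kern β δ w := by
  rw [kern, norm_neg, kern]

lemma kern_le {β : ℝ} (hβ : 0 ≤ β) (δ : ℝ) {w : V} (hw : w ≠ 0) :
    kern β δ w ≤ 1 / ‖w‖ ^ β := by
  rw [← kern_zero, kern, kern]
  have := norm_pos_iff.2 hw
  exact Real.rpow_le_rpow_of_nonpos (by positivity) (by nlinarith [sq_nonneg δ]) (by linarith)

lemma kern_le_of_pos {β : ℝ} (hβ : 0 ≤ β) {δ : ℝ} (hδ : 0 < δ) (w : V) :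
    kern β δ w ≤ δ ^ (-β) := by
  rw [kern, ← sq_rpow_neg_half hδ.le]
  exact Real.rpow_le_rpow_of_nonpos (by positivity) (by nlinarith [sq_nonneg ‖w‖]) (by linarith)

lemma measurable_kern (β δ : ℝ) : Measurable (kern β δ : V → ℝ) := by
  unfold kern
  fun_prop

lemma contDiff_kern (β : ℝ) {δ : ℝ} (hδ : 0 < δ) :
    ContDiff ℝ ∞ (kern β δ : V → ℝ) := by
  unfold kern
  refine ContDiff.rpow_const_of_ne ?_ fun w => by positivity
  exact (contDiff_norm_sq ℝ).add contDiff_const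

lemma tendsto_kern (β : ℝ) {w : V} (hw : w ≠ 0) :
    Tendsto (fun δ => kern β δ w) (𝓝[>] 0) (𝓝 (1 / ‖w‖ ^ β)) := by
  rw [← kern_zero]
  have : ContinuousAt (fun δ : ℝ => kern β δ w) 0 := by
    unfold kern
    have := norm_pos_iff.2 hw
    exact ContinuousAt.rpow_const (by fun_prop) (Or.inl (by positivity))
  exact this.tendsto.mono_left nhdsWithin_le_nhds

/-- Layer cake formula for radial kernels. -/
lemma integral_mul_radial {μ : Measure V} [SFinite μ] {p : V} {r₀ : ℝ}
    {f : V → ℝ} (hf : IntegrableOn f (ball p r₀) μ) {g : ℝ → ℝ}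
    (hg : IntegrableOn g (Ioo 0 r₀)) {κ : ℝ → ℝ} {c : ℝ}
    (hκ : ∀ r, 0 ≤ r → r < r₀ → κ r = c + ∫ ρ in Ioo 0 r₀, (Ioi r).indicator g ρ) :
    ∫ x in ball p r₀, f x * κ ‖x - p‖ ∂μ =
      c * (∫ x in ball p r₀, f x ∂μ) +
        ∫ ρ in Ioo 0 r₀, g ρ * ∫ x in ball p ρ, f x ∂μ := by
  set μ' := μ.restrict (ball p r₀)
  set ν' := (volume : Measure ℝ).restrict (Ioo 0 r₀)
  have hint : Integrable (fun z : V × ℝ => f z.1 * (Ioi ‖z.1 - p‖).indicator g z.2)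
      (μ'.prod ν') := by
    have h1 : Integrable (fun z : V × ℝ => f z.1 * g z.2) (μ'.prod ν') := hf.mul_prod hg
    have hm : MeasurableSet {z : V × ℝ | ‖z.1 - p‖ < z.2} :=
      measurableSet_lt (by fun_prop) (by fun_prop)
    refine (h1.indicator hm).congr (.of_forall fun z => ?_)
    by_cases hz : ‖z.1 - p‖ < z.2
    · simp [indicator, hz]
    · simp [indicator, hz]
  have e1 : ∫ x in ball p r₀, f x * κ ‖x - p‖ ∂μ =
      ∫ x, (c * f x + ∫ ρ, f x * (Ioi ‖x - p‖).indicator g ρ ∂ν') ∂μ' := by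
    refine setIntegral_congr_fun measurableSet_ball fun x hx => ?_
    rw [mem_ball, dist_eq_norm] at hx
    rw [hκ _ (norm_nonneg _) hx, integral_const_mul]
    ring
  rw [e1, integral_add (hf.const_mul c) hint.integral_prod_left, integral_const_mul,
    integral_integral_swap hint]
  congr 1
  refine setIntegral_congr_fun measurableSet_Ioo fun ρ hρ => ?_
  have hsub : ball p ρ ⊆ ball p r₀ := ball_subset_ball hρ.2.le
  have : ∀ x, f x * (Ioi ‖x - p‖).indicator g ρ = (ball p ρ).indicator (fun x => g ρ * f x) x := by
    intro x
    by_cases hx : ‖x - p‖ < ρ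
    · have hx' : x ∈ ball p ρ := by rwa [mem_ball, dist_eq_norm]
      rw [indicator_of_mem (mem_Ioi.2 hx), indicator_of_mem hx', mul_comm]
    · have hx' : x ∉ ball p ρ := by rwa [mem_ball, dist_eq_norm]
      rw [indicator_of_notMem (s := Ioi ‖x - p‖) (fun h => hx h), indicator_of_notMem hx', mul_zero]
  simp only [this]
  rw [integral_indicator measurableSet_ball, Measure.restrict_restrict measurableSet_ball,
    inter_eq_self_of_subset_left hsub, integral_const_mul]

/-- The fundamental theorem of calculus, in the form in which a decreasing radial profile enters the
layer cake formula. -/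
lemma integral_indicator_Ioi_of_hasDerivAt {κ κ' : ℝ → ℝ} {a r₀ r : ℝ} (har : a ≤ r)
    (hr : r < r₀) (ha : 0 ≤ a) (hc : ContinuousOn κ (Icc r r₀))
    (hd : ∀ ρ ∈ Ioo r r₀, HasDerivAt κ (-κ' ρ) ρ) (hi : IntegrableOn κ' (Ioo r r₀)) :
    κ r = κ r₀ + ∫ ρ in Ioo 0 r₀, (Ioi r).indicator κ' ρ := by
  have h := intervalIntegral.integral_eq_sub_of_hasDerivAt_of_le hr.le hc hd
    ((intervalIntegrable_iff_integrableOn_Ioo_of_le hr.le).2 hi.neg)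
  rw [intervalIntegral.integral_of_le hr.le, integral_Ioc_eq_integral_Ioo] at h
  rw [setIntegral_indicator measurableSet_Ioi, Ioo_inter_Ioi, sup_eq_right.2 (ha.trans har)]
  rw [integral_neg] at h
  linarith

/-- Integrals of a function with small means over balls, against singular radial kernels. -/
lemma exists_tendsto_radial {μ : Measure V} [SFinite μ] {p : V} {r₀ s C : ℝ} (hr₀ : 0 < r₀)
    (hs0 : 0 < s) (hs1 : s < 1) {f : V → ℝ} (hf : IntegrableOn f (ball p r₀) μ)
    (hF : ∀ r, 0 < r → r ≤ r₀ → |∫ x in ball p r, f x ∂μ| ≤ C * r ^ ((N : ℝ) + 1)) :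
    (∃ l, Tendsto (fun ρ => ∫ x in ball p r₀ \ ball p ρ,
        f x / ‖x - p‖ ^ (N + s) ∂μ) (𝓝[>] 0) (𝓝 l) ∧
      Tendsto (fun δ => ∫ x in ball p r₀, f x * kern (N + s) δ (x - p) ∂μ)
        (𝓝[>] 0) (𝓝 l)) ∧
    ∀ δ > 0, |∫ x in ball p r₀, f x * kern (N + s) δ (x - p) ∂μ| ≤
      C * (r₀ ^ (1 - s) + (N + s) * (r₀ ^ (1 - s) / (1 - s))) := by
  set β := (N : ℝ) + s with hβ
  have hβ0 : 0 < β := by positivity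
  have hC : 0 ≤ C := by
    have := (abs_nonneg _).trans (hF r₀ hr₀ le_rfl)
    exact nonneg_of_mul_nonneg_left this (by positivity)
  set F : ℝ → ℝ := fun r => ∫ x in ball p r, f x ∂μ with hFdef
  have hFm : AEStronglyMeasurable F (volume.restrict (Ioo 0 r₀)) := by
    have h1 : StronglyMeasurable (fun z : ℝ × V =>
        (ball p r₀).indicator (hf.1.mk f) z.2 * {z : ℝ × V | ‖z.2 - p‖ < z.1}.indicator 1 z) := by
      refine StronglyMeasurable.mul ?_ ?_
      · exact (hf.1.stronglyMeasurable_mk.indicator measurableSet_ball).comp_measurable measurable_snd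
      · exact stronglyMeasurable_one.indicator (measurableSet_lt (by fun_prop) (by fun_prop))
    refine (h1.integral_prod_right' (ν := μ)).aestronglyMeasurable.congr ?_
    refine (ae_restrict_mem measurableSet_Ioo).mono fun ρ hρ => ?_
    simp only [hFdef]
    rw [← integral_indicator measurableSet_ball]
    refine integral_congr_ae ?_
    have h2 := (ae_restrict_iff' measurableSet_ball).1 hf.1.ae_eq_mk
    filter_upwards [h2] with x hx
    by_cases hxρ : ‖x - p‖ < ρ
    · have hx' : x ∈ ball p ρ := by rwa [mem_ball, dist_eq_norm]
      have hx2 : x ∈ ball p r₀ := ball_subset_ball hρ.2.le hx'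
      rw [indicator_of_mem hx', indicator_of_mem hx2, hx hx2, indicator_of_mem (by exact hxρ)]
      simp
    · have hx' : x ∉ ball p ρ := by rwa [mem_ball, dist_eq_norm]
      rw [indicator_of_notMem hx', indicator_of_notMem (s := {z : ℝ × V | ‖z.2 - p‖ < z.1})
        (by exact hxρ), mul_zero]
  -- The common majorant of the radial integrands: `β ρ^(-β-1)` comes from the derivative of the
  -- kernel and `C ρ^(N+1)` from the hypothesis on balls, which leaves `ρ^(-s)`.
  set b : ℝ → ℝ := fun ρ => C * β * ρ ^ (-s) with hb
  have hbi : IntegrableOn b (Ioo 0 r₀) := by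
    refine Integrable.const_mul ?_ _
    rw [← IntegrableOn, ← intervalIntegrable_iff_integrableOn_Ioo_of_le hr₀.le]
    exact intervalIntegral.intervalIntegrable_rpow' (by linarith)
  have hbval : ∫ ρ in Ioo 0 r₀, b ρ = C * β * (r₀ ^ (1 - s) / (1 - s)) := by
    rw [integral_const_mul, ← integral_Ioc_eq_integral_Ioo, ← intervalIntegral.integral_of_le hr₀.le,
      integral_rpow (Or.inl (by linarith)), Real.zero_rpow (by linarith)]
    rw [show -s + 1 = 1 - s by ring, sub_zero]
  have hbound : ∀ g : ℝ → ℝ, (∀ ρ ∈ Ioo 0 r₀, |g ρ| ≤ β * ρ ^ (-β - 1)) → ∀ ρ ∈ Ioo 0 r₀,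
      ‖g ρ * F ρ‖ ≤ b ρ := by
    intro g hg ρ hρ
    rw [norm_mul, norm_eq_abs, norm_eq_abs]
    calc |g ρ| * |F ρ| ≤ (β * ρ ^ (-β - 1)) * (C * ρ ^ ((N : ℝ) + 1)) :=
          mul_le_mul (hg ρ hρ) (hF ρ hρ.1 hρ.2.le) (abs_nonneg _)
            (mul_nonneg hβ0.le (rpow_nonneg hρ.1.le _))
      _ = C * β * (ρ ^ (-β - 1) * ρ ^ ((N : ℝ) + 1)) := by ring
      _ = b ρ := by
          rw [← rpow_add hρ.1, hb, hβ]
          simp only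
          congr 2; ring
  have hgm : Measurable fun ρ : ℝ => β * ρ ^ (-β - 1) := by fun_prop
  -- the smoothed kernels
  set gs : ℝ → ℝ → ℝ := fun δ ρ => β * ρ * (ρ ^ 2 + δ ^ 2) ^ (-(β / 2) - 1) with hgs
  have hgs_le : ∀ δ, ∀ ρ ∈ Ioo 0 r₀, |gs δ ρ| ≤ β * ρ ^ (-β - 1) := by
    intro δ ρ hρ
    have hρ0 : 0 < ρ := hρ.1
    have h1 : (ρ ^ 2 + δ ^ 2) ^ (-(β / 2) - 1) ≤ (ρ ^ 2) ^ (-(β / 2) - 1) :=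
      Real.rpow_le_rpow_of_nonpos (by positivity) (by nlinarith [sq_nonneg δ]) (by linarith)
    rw [hgs, abs_of_nonneg (by positivity)]
    have h2 : (ρ ^ 2) ^ (-(β / 2) - 1) = ρ ^ (-β - 2) := by
      rw [show -(β / 2) - 1 = -((β + 2) / 2) by ring, sq_rpow_neg_half hρ0.le]
      congr 1; ring
    calc β * ρ * (ρ ^ 2 + δ ^ 2) ^ (-(β / 2) - 1) ≤ β * ρ * ρ ^ (-β - 2) := by
          rw [← h2]; gcongr
      _ = β * ρ ^ (-β - 1) := by
          rw [mul_assoc, ← Real.rpow_one_add' hρ0.le (by linarith)]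
          congr 2; ring
  have hgs_cont : ∀ δ > 0, Continuous (gs δ) := fun δ hδ =>
    (continuous_const.mul continuous_id).mul
      (Continuous.rpow_const (by fun_prop) fun ρ => Or.inl (by positivity))
  have formula : ∀ δ > 0, ∫ x in ball p r₀, f x * kern β δ (x - p) ∂μ =
      (r₀ ^ 2 + δ ^ 2) ^ (-(β / 2)) * F r₀ + ∫ ρ in Ioo 0 r₀, gs δ ρ * F ρ := by
    intro δ hδ
    refine integral_mul_radial (κ := fun r => (r ^ 2 + δ ^ 2) ^ (-(β / 2))) hf
      ((hgs_cont δ hδ).continuousOn.integrableOn_Icc.mono_set Ioo_subset_Icc_self) ?_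
    intro r hr hrr
    refine integral_indicator_Ioi_of_hasDerivAt (κ := fun r => (r ^ 2 + δ ^ 2) ^ (-(β / 2)))
      (a := 0) hr hrr le_rfl ?_ ?_ ?_
    · exact (Continuous.rpow_const (by fun_prop) fun ρ => Or.inl (by positivity)).continuousOn
    · intro ρ hρ
      have h1 : HasDerivAt (fun ρ : ℝ => ρ ^ 2 + δ ^ 2) (2 * ρ) ρ := by
        simpa using ((hasDerivAt_id ρ).pow 2).add_const (δ ^ 2)
      have h2 := h1.rpow_const (p := -(β / 2)) (Or.inl (by positivity))
      convert h2 using 1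
      simp only [hgs]; ring
    · exact (hgs_cont δ hδ).continuousOn.integrableOn_Icc.mono_set Ioo_subset_Icc_self
  -- The common limit is the layer cake expression of the singular kernel, whose radial integral
  -- converges absolutely.
  set l := r₀ ^ (-β) * F r₀ + ∫ ρ in Ioo 0 r₀, β * ρ ^ (-β - 1) * F ρ with hl
  refine ⟨⟨l, ?_, ?_⟩, ?_⟩
  · -- truncated kernels
    have formula2 : ∀ ρ₀ ∈ Ioo 0 r₀, ∫ x in ball p r₀ \ ball p ρ₀,
        f x / ‖x - p‖ ^ β ∂μ = r₀ ^ (-β) * F r₀ +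
          (∫ ρ in Ioo 0 r₀, (Ioi ρ₀).indicator (fun ρ => β * ρ ^ (-β - 1)) ρ * F ρ) -
            ρ₀ ^ (-β) * F ρ₀ := by
      intro ρ₀ hρ₀
      have hcontg : ContinuousOn (fun ρ : ℝ => β * ρ ^ (-β - 1)) (Icc ρ₀ r₀) :=
        continuousOn_const.mul (continuousOn_id.rpow_const fun x hx =>
          Or.inl (hρ₀.1.trans_le hx.1).ne')
      -- Inside the small ball the kernel is frozen at its value at radius `ρ₀`. The frozen part is
      -- subtracted afterwards and is `O(ρ₀^(1-s))`.
      have h1 := integral_mul_radial (κ := fun r => (max r ρ₀) ^ (-β)) (c := r₀ ^ (-β)) hf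
        (g := (Ioi ρ₀).indicator fun ρ => β * ρ ^ (-β - 1)) (by
          rw [integrableOn_indicator_iff measurableSet_Ioi]
          exact hcontg.integrableOn_Icc.mono_set
            fun x hx => ⟨le_of_lt hx.1, le_of_lt hx.2.2⟩) (by
          intro r hr hrr
          have h2 := integral_indicator_Ioi_of_hasDerivAt (κ := fun r : ℝ => r ^ (-β))
            (κ' := fun ρ => β * ρ ^ (-β - 1)) (r := max r ρ₀) (r₀ := r₀) (a := 0)
            (le_max_of_le_left hr) (max_lt hrr hρ₀.2) le_rfl
            (continuousOn_id.rpow_const fun x hx =>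
              Or.inl ((hρ₀.1.trans_le ((le_max_right _ _).trans hx.1)).ne'))
            (by
              intro ρ hρ
              have hρ' : ρ ≠ 0 := (hρ₀.1.trans ((le_max_right _ _).trans_lt hρ.1)).ne'
              have := Real.hasDerivAt_rpow_const (p := -β) (Or.inl hρ')
              convert this using 1; ring)
            (hcontg.integrableOn_Icc.mono_set fun x hx =>
              ⟨((le_max_right _ _).trans_lt hx.1).le, hx.2.le⟩)
          rw [h2, indicator_indicator, Ioi_inter_Ioi])
      have h3 : ∫ x in ball p r₀ \ ball p ρ₀, f x / ‖x - p‖ ^ β ∂μ =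
          ∫ x in ball p r₀ \ ball p ρ₀, f x * (max ‖x - p‖ ρ₀) ^ (-β) ∂μ := by
        refine setIntegral_congr_fun (measurableSet_ball.diff measurableSet_ball) fun x hx => ?_
        have hx' : ρ₀ ≤ ‖x - p‖ := by
          have := hx.2
          rwa [mem_ball, dist_eq_norm, not_lt] at this
        rw [max_eq_left hx', rpow_neg (norm_nonneg _), div_eq_mul_inv]
      have h4 : ∫ x in ball p ρ₀, f x * (max ‖x - p‖ ρ₀) ^ (-β) ∂μ = ρ₀ ^ (-β) * F ρ₀ := by
        rw [hFdef, ← integral_const_mul]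
        refine setIntegral_congr_fun measurableSet_ball fun x hx => ?_
        have hx' : ‖x - p‖ ≤ ρ₀ := by
          rw [mem_ball, dist_eq_norm] at hx
          exact hx.le
        rw [max_eq_right hx', mul_comm]
      have h5 : IntegrableOn (fun x => f x * (max ‖x - p‖ ρ₀) ^ (-β)) (ball p r₀) μ := by
        refine Integrable.mul_bdd (c := ρ₀ ^ (-β)) hf (Measurable.aestronglyMeasurable (by fun_prop))
          (.of_forall fun x => ?_)
        have := hρ₀.1
        rw [norm_of_nonneg (by positivity)]
        exact Real.rpow_le_rpow_of_nonpos this (le_max_right _ _) (by linarith)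
      rw [h3, setIntegral_sdiff measurableSet_ball h5 (ball_subset_ball hρ₀.2.le), h4, h1]
    have hlim1 : Tendsto (fun ρ₀ => ∫ ρ in Ioo 0 r₀,
        (Ioi ρ₀).indicator (fun ρ => β * ρ ^ (-β - 1)) ρ * F ρ) (𝓝[>] 0)
        (𝓝 (∫ ρ in Ioo 0 r₀, β * ρ ^ (-β - 1) * F ρ)) := by
      refine tendsto_integral_filter_of_dominated_convergence b ?_ ?_ hbi ?_
      · exact Eventually.of_forall fun ρ₀ =>
          ((hgm.indicator measurableSet_Ioi).aestronglyMeasurable).mul hFm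
      · refine Eventually.of_forall fun ρ₀ => (ae_restrict_mem measurableSet_Ioo).mono fun ρ hρ => ?_
        refine hbound ((Ioi ρ₀).indicator fun ρ => β * ρ ^ (-β - 1)) (fun ρ hρ => ?_) ρ hρ
        have hρ0 := hρ.1
        by_cases h' : ρ ∈ Ioi ρ₀
        · rw [indicator_of_mem h', abs_of_nonneg (by positivity)]
        · rw [indicator_of_notMem h', abs_zero]; positivity
      · refine (ae_restrict_mem measurableSet_Ioo).mono fun ρ hρ => ?_
        refine tendsto_const_nhds.congr' ?_
        filter_upwards [Ioo_mem_nhdsGT hρ.1] with ρ₀ hρ₀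
        rw [indicator_of_mem (mem_Ioi.2 hρ₀.2)]
    have hlim2 : Tendsto (fun ρ₀ => ρ₀ ^ (-β) * F ρ₀) (𝓝[>] 0) (𝓝 0) := by
      have hz : Tendsto (fun ρ₀ : ℝ => C * ρ₀ ^ (1 - s)) (𝓝[>] 0) (𝓝 0) := by
        have : ContinuousAt (fun ρ₀ : ℝ => C * ρ₀ ^ (1 - s)) 0 :=
          continuousAt_const.mul (Real.continuousAt_rpow_const _ _ (Or.inr (by linarith)))
        have h2 := this.tendsto.mono_left (nhdsWithin_le_nhds (s := Ioi 0))
        rwa [Real.zero_rpow (by linarith), mul_zero] at h2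
      refine squeeze_zero_norm' ?_ hz
      filter_upwards [Ioo_mem_nhdsGT hr₀] with ρ hρ
      have hρ0 := hρ.1
      rw [norm_mul, norm_of_nonneg (by positivity), norm_eq_abs]
      calc ρ ^ (-β) * |F ρ| ≤ ρ ^ (-β) * (C * ρ ^ ((N : ℝ) + 1)) := by
            gcongr; exact hF ρ hρ.1 hρ.2.le
        _ = C * (ρ ^ (-β) * ρ ^ ((N : ℝ) + 1)) := by ring
        _ = C * ρ ^ (1 - s) := by rw [← rpow_add hρ0, hβ]; congr 2; ring
    have := (hlim1.const_add (r₀ ^ (-β) * F r₀)).sub hlim2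
    rw [sub_zero] at this
    refine this.congr' ?_
    filter_upwards [Ioo_mem_nhdsGT hr₀] with ρ hρ
    exact (formula2 ρ hρ).symm
  · have hlim1 : Tendsto (fun δ => ∫ ρ in Ioo 0 r₀, gs δ ρ * F ρ) (𝓝[>] 0)
        (𝓝 (∫ ρ in Ioo 0 r₀, β * ρ ^ (-β - 1) * F ρ)) := by
      refine tendsto_integral_filter_of_dominated_convergence b ?_ ?_ hbi ?_
      · filter_upwards [self_mem_nhdsWithin] with δ hδ
        exact (hgs_cont δ hδ).aestronglyMeasurable.mul hFm
      · exact Eventually.of_forall fun δ => (ae_restrict_mem measurableSet_Ioo).mono fun ρ hρ =>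
          hbound _ (hgs_le δ) ρ hρ
      · refine (ae_restrict_mem measurableSet_Ioo).mono fun ρ hρ => ?_
        have hρ0 : 0 < ρ := hρ.1
        refine Tendsto.mul_const _ ?_
        have hc : ContinuousAt (fun δ => gs δ ρ) 0 :=
          continuousAt_const.mul (ContinuousAt.rpow_const (by fun_prop) (Or.inl (by positivity)))
        have h2 := hc.tendsto.mono_left (nhdsWithin_le_nhds (s := Ioi 0))
        convert h2 using 2
        simp only [hgs]
        rw [zero_pow two_ne_zero, add_zero, show -(β / 2) - 1 = -((β + 2) / 2) by ring,
          sq_rpow_neg_half hρ0.le, mul_assoc, ← Real.rpow_one_add' hρ0.le (by linarith)]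
        congr 2; ring
    have hlim2 : Tendsto (fun δ : ℝ => (r₀ ^ 2 + δ ^ 2) ^ (-(β / 2)) * F r₀) (𝓝[>] 0)
        (𝓝 (r₀ ^ (-β) * F r₀)) := by
      have hc : ContinuousAt (fun δ : ℝ => (r₀ ^ 2 + δ ^ 2) ^ (-(β / 2)) * F r₀) 0 :=
        (ContinuousAt.rpow_const (by fun_prop) (Or.inl (by positivity))).mul_const _
      have h2 := hc.tendsto.mono_left (nhdsWithin_le_nhds (s := Ioi 0))
      simp only [zero_pow two_ne_zero, add_zero] at h2
      rwa [sq_rpow_neg_half hr₀.le] at h2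
    refine (hlim2.add hlim1).congr' ?_
    filter_upwards [self_mem_nhdsWithin] with δ hδ
    exact (formula δ hδ).symm
  · intro δ hδ
    rw [formula δ hδ]
    have h1 : |(r₀ ^ 2 + δ ^ 2) ^ (-(β / 2)) * F r₀| ≤ C * r₀ ^ (1 - s) := by
      rw [abs_mul, abs_of_nonneg (by positivity)]
      calc (r₀ ^ 2 + δ ^ 2) ^ (-(β / 2)) * |F r₀| ≤
          (r₀ ^ 2) ^ (-(β / 2)) * (C * r₀ ^ ((N : ℝ) + 1)) := by
            gcongr ?_ * ?_
            · exact Real.rpow_le_rpow_of_nonpos (by positivity) (by nlinarith [sq_nonneg δ])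
                (by linarith)
            · exact hF r₀ hr₀ le_rfl
        _ = C * (r₀ ^ (-β) * r₀ ^ ((N : ℝ) + 1)) := by rw [sq_rpow_neg_half hr₀.le]; ring
        _ = C * r₀ ^ (1 - s) := by rw [← rpow_add hr₀, hβ]; congr 2; ring
    have h2 : |∫ ρ in Ioo 0 r₀, gs δ ρ * F ρ| ≤ C * β * (r₀ ^ (1 - s) / (1 - s)) := by
      rw [← hbval, ← norm_eq_abs]
      exact norm_integral_le_of_norm_le hbi
        ((ae_restrict_mem measurableSet_Ioo).mono fun ρ hρ => hbound _ (hgs_le δ) ρ hρ)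
    calc _ ≤ _ := abs_add_le _ _
      _ ≤ C * r₀ ^ (1 - s) + C * β * (r₀ ^ (1 - s) / (1 - s)) := add_le_add h1 h2
      _ = _ := by ring

/-- Fatou's lemma along smoothed kernels, whose integrals are bounded uniformly in `δ`. The
hypothesis `f p = 0` gives pointwise convergence at `p`, where those kernels blow up. -/
lemma integrableOn_div_radial {μ : Measure V} [SFinite μ] {p : V} {r₀ s C : ℝ} (hr₀ : 0 < r₀)
    (hs0 : 0 < s) (hs1 : s < 1) {f : V → ℝ} (hf : IntegrableOn f (ball p r₀) μ)
    (hf0 : ∀ x, 0 ≤ f x) (hfp : f p = 0)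
    (hF : ∀ r, 0 < r → r ≤ r₀ → ∫ x in ball p r, f x ∂μ ≤ C * r ^ ((N : ℝ) + 1)) :
    IntegrableOn (fun x => f x / ‖x - p‖ ^ (N + s)) (ball p r₀) μ ∧
    ∫ x in ball p r₀, f x / ‖x - p‖ ^ (N + s) ∂μ ≤
      C * (r₀ ^ (1 - s) + (N + s) * (r₀ ^ (1 - s) / (1 - s))) := by
  obtain ⟨-, hb⟩ := exists_tendsto_radial hr₀ hs0 hs1 hf (C := C) fun r hr hrr => by
    rw [abs_of_nonneg (integral_nonneg hf0)]; exact hF r hr hrr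
  set β := (N : ℝ) + s with hβ
  have hβ0 : 0 < β := by positivity
  set B := C * (r₀ ^ (1 - s) + β * (r₀ ^ (1 - s) / (1 - s)))
  set δ : ℕ → ℝ := fun n => 1 / ((n : ℝ) + 1)
  have hδ : ∀ n, 0 < δ n := fun n => by positivity
  have hδlim : Tendsto δ atTop (𝓝[>] 0) :=
    tendsto_nhdsWithin_iff.2 ⟨tendsto_one_div_add_atTop_nhds_zero_nat, Eventually.of_forall hδ⟩
  have hpt : ∀ x, Tendsto (fun n => f x * kern β (δ n) (x - p)) atTop
      (𝓝 (f x / ‖x - p‖ ^ β)) := by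
    intro x
    by_cases hx : x = p
    · simp [hx, hfp]
    · have := ((tendsto_kern β (sub_ne_zero.2 hx)).comp hδlim).const_mul (f x)
      simpa [div_eq_mul_inv] using this
  have hnn : ∀ x, 0 ≤ f x / ‖x - p‖ ^ β := fun x => div_nonneg (hf0 x) (by positivity)
  have hmeas : AEStronglyMeasurable (fun x => f x / ‖x - p‖ ^ β) (μ.restrict (ball p r₀)) :=
    AEMeasurable.aestronglyMeasurable (hf.1.aemeasurable.div (by fun_prop))
  have hint : ∀ n, IntegrableOn (fun x => f x * kern β (δ n) (x - p))
      (ball p r₀) μ := by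
    intro n
    refine Integrable.mul_bdd (c := (δ n) ^ (-β)) hf
      ((measurable_kern β _).comp (measurable_id.sub_const p)).aestronglyMeasurable
      (.of_forall fun x => ?_)
    rw [norm_of_nonneg (kern_nonneg _ _ _)]
    exact kern_le_of_pos hβ0.le (hδ n) _
  have hle : ∫⁻ x in ball p r₀, ofReal (f x / ‖x - p‖ ^ β) ∂μ ≤ ofReal B := by
    calc ∫⁻ x in ball p r₀, ofReal (f x / ‖x - p‖ ^ β) ∂μ
        = ∫⁻ x in ball p r₀, liminf (fun n =>
            ofReal (f x * kern β (δ n) (x - p))) atTop ∂μ := by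
          refine lintegral_congr fun x => ?_
          exact ((ENNReal.continuous_ofReal.tendsto _).comp (hpt x)).liminf_eq.symm
      _ ≤ liminf (fun n => ∫⁻ x in ball p r₀,
            ofReal (f x * kern β (δ n) (x - p)) ∂μ) atTop :=
          lintegral_liminf_le' fun n => (hint n).1.aemeasurable.ennreal_ofReal
      _ ≤ ofReal B := by
          refine liminf_le_of_le (by isBoundedDefault) fun b hbev => ?_
          obtain ⟨n, hn⟩ := hbev.exists
          refine hn.trans ?_
          rw [← ofReal_integral_eq_lintegral_ofReal (hint n) (.of_forall fun x =>
            mul_nonneg (hf0 x) (kern_nonneg _ _ _))]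
          exact ofReal_le_ofReal ((le_abs_self _).trans (hb _ (hδ n)))
  refine ⟨⟨hmeas, ?_⟩, ?_⟩
  · rw [hasFiniteIntegral_iff_ofReal (.of_forall hnn)]
    exact hle.trans_lt ENNReal.ofReal_lt_top
  · have hB : 0 ≤ B := (abs_nonneg _).trans (hb 1 one_pos)
    rw [integral_eq_lintegral_of_nonneg_ae (.of_forall hnn) hmeas]
    exact ENNReal.toReal_le_of_le_ofReal hB hle

/-! ### The surface measure projected to the tangent plane -/

section TangentProjection

/-- The volume of the unit ball of dimension `N - 1`. -/
noncomputable def crossSection (N : ℕ) : ℝ :=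
  (volume (ball (0 : EuclideanSpace ℝ (Fin (N - 1))) 1)).toReal

lemma crossSection_nonneg (N : ℕ) : 0 ≤ crossSection N := ENNReal.toReal_nonneg

lemma volume_ball_orthogonal {e : V} (he : ‖e‖ = 1) {r : ℝ} (hr : 0 < r) :
    volume (ball (0 : (ℝ ∙ e)ᗮ) r) = ofReal (crossSection N * r ^ (N - 1)) := by
  have hfr := finrank_orthogonal_span he
  have h1 : volume (ball (0 : (ℝ ∙ e)ᗮ) 1) = ofReal (crossSection N) := by
    let b := (stdOrthonormalBasis ℝ (ℝ ∙ e)ᗮ).reindex (finCongr hfr)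
    have h2 := b.measurePreserving_repr.measure_preimage
      (s := ball (0 : EuclideanSpace ℝ (Fin (N - 1))) 1) measurableSet_ball.nullMeasurableSet
    rw [LinearIsometryEquiv.preimage_ball, map_zero] at h2
    rw [h2, crossSection, ENNReal.ofReal_toReal measure_ball_lt_top.ne]
  rw [Measure.addHaar_ball_of_pos _ _ hr, h1, hfr, ← ofReal_mul (by positivity), mul_comm]

lemma norm_projLine_le {e : V} (x : V) : ‖projLine e x‖ ≤ ‖x‖ :=
  Submodule.norm_orthogonalProjectionOnto_apply_le _ _

lemma norm_le_projLine_add {e : V} (he : ‖e‖ = 1) (x : V) :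
    ‖x‖ ≤ ‖projLine e x‖ + |⟪x, e⟫| := by
  conv_lhs => rw [← projLine_add_inner he x]
  refine (norm_add_le _ _).trans ?_
  rw [norm_smul, he, mul_one, norm_eq_abs]
  rfl

variable {E : Set R^N} {p : R^N} {ρ C : ℝ}

/-- A secant inside the ball has normal component at most `C r` times its length, and `1 / (1 - C r)
≤ 1 + 2 C r` since `C r ≤ 1 / 4`. -/
lemma QuadraticContact.norm_sub_le (h : QuadraticContact E p ρ C) (hC : 0 < C) {r : ℝ}
    (hrρ : r ≤ ρ) (hr : C * r ≤ 1 / 4) {x y : V}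
    (hx : x ∈ ball p r) (hy : y ∈ ball p r) (hxE : x ∈ frontier E)
    (hyE : y ∈ frontier E) :
    ‖x - y‖ ≤ (1 + 2 * C * r) * ‖projLine (nu E p) (x - p) -
      projLine (nu E p) (y - p)‖ := by
  rw [← map_sub, sub_sub_sub_cancel_right]
  have h1 := norm_le_projLine_add h.norm_normal (x - y)
  have h2 := h.inner_le y (ball_subset_ball hrρ hy) x (ball_subset_ball hrρ hx) hyE hxE
  rw [mem_ball, dist_eq_norm] at hx hy
  have hr0 : 0 < r := (norm_nonneg _).trans_lt hx
  have h3 : C * max ‖y - p‖ ‖x - p‖ * ‖x - y‖ ≤ C * r * ‖x - y‖ := by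
    gcongr
    exact max_le hy.le hx.le
  set P := ‖projLine (nu E p) (x - y)‖
  have hn := norm_nonneg (x - y)
  have hP : 0 ≤ P := norm_nonneg _
  have hCr : 0 < C * r := by positivity
  have h4 : ‖x - y‖ * (1 - C * r) ≤ P := by linarith
  nlinarith [mul_le_mul_of_nonneg_left h4 (by positivity : (0:ℝ) ≤ 1 + 2 * C * r),
    mul_nonneg hn (mul_nonneg hCr.le (by linarith : (0:ℝ) ≤ 1 / 4 - C * r)),
    mul_nonneg hn hCr.le]

/-- The vertical segment over `y` of half-length `2 C ‖y‖²` starts below and ends above the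
parabolic region that contains `∂E`, so it goes from `E` to its complement and must meet `∂E`. -/
lemma QuadraticContact.exists_over (h : QuadraticContact E p ρ C) (hC : 0 < C) {r : ℝ}
    (hr0 : 0 < r) (hrρ : r ≤ ρ) (hr : C * r ≤ 1 / 4)
    {y : (ℝ ∙ nu E p)ᗮ} (hy : ‖y‖ < r / (1 + 2 * C * r)) :
    ∃ x ∈ frontier E ∩ ball p r, projLine (nu E p) (x - p) = y := by
  have hCr : 0 < C * r := by positivity
  have hy' : ‖y‖ * (1 + 2 * C * r) < r := by rwa [lt_div_iff₀ (by positivity)] at hy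
  have hyr : ‖y‖ < r := by nlinarith [norm_nonneg y]
  by_cases hy0 : y = 0
  · exact ⟨p, ⟨h.mem, mem_ball_self hr0⟩, by rw [sub_self, map_zero, hy0]⟩
  have hypos : 0 < ‖y‖ := norm_pos_iff.2 hy0
  set z := 2 * C * ‖y‖ ^ 2 with hz
  have hzpos : 0 < z := by positivity
  have hzy : z ≤ 2 * (C * r) * ‖y‖ := by
    rw [hz]; nlinarith [mul_pos hC hypos]
  have hnorm : ∀ u : ℝ, |u| ≤ z → ‖(y : V) + u • nu E p‖ < r := by
    intro u hu
    calc ‖(y : V) + u • nu E p‖ ≤ ‖(y : V)‖ + ‖u • nu E p‖ := norm_add_le _ _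
      _ ≤ ‖y‖ + z := by
          rw [norm_smul, h.norm_normal, mul_one, norm_eq_abs]; gcongr; exact le_rfl
      _ < r := by nlinarith
  have hball : ∀ u : ℝ, |u| ≤ z → p + ((y : V) + u • nu E p) ∈ ball p r := by
    intro u hu
    rw [mem_ball, dist_eq_norm, add_sub_cancel_left]
    exact hnorm u hu
  have hin : ∀ u : ℝ, ⟪p + ((y : V) + u • nu E p) - p, nu E p⟫ = u := by
    intro u
    rw [add_sub_cancel_left, inner_add_left, inner_orthogonal_span, real_inner_smul_left,
      real_inner_self_eq_norm_sq, h.norm_normal]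
    ring
  have hsq : C * (‖y‖ ^ 2 + z ^ 2) < z := by
    have h1 : z * z ≤ (2 * (C * r) * ‖y‖) * (2 * (C * r) * ‖y‖) := by gcongr
    have h2 : (C * r) * (C * r) ≤ 1 / 4 * (1 / 4) := by gcongr
    have h3 : z ^ 2 ≤ ‖y‖ ^ 2 / 4 := by nlinarith [sq_nonneg ‖y‖]
    have h4 : 0 < C * ‖y‖ ^ 2 := by positivity
    rw [hz] at h3 ⊢
    nlinarith
  have hmem : p + ((y : V) + (-z) • nu E p) ∈ E := by
    refine h.mem_of_lt _ (ball_subset_ball hrρ (hball _ (by rw [abs_neg, abs_of_pos hzpos]))) ?_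
    rw [hin, add_sub_cancel_left, norm_sq_line h.norm_normal, neg_sq]
    linarith
  have hnmem : p + ((y : V) + z • nu E p) ∉ E := by
    refine h.notMem_of_lt _ (ball_subset_ball hrρ (hball _ (by rw [abs_of_pos hzpos]))) ?_
    rw [hin, add_sub_cancel_left, norm_sq_line h.norm_normal]
    linarith
  have hpre : IsPreconnected ((fun u : ℝ => p + ((y : V) + u • nu E p)) '' Icc (-z) z) :=
    isPreconnected_Icc.image _ (by fun_prop)
  obtain ⟨x, hx, hxE⟩ : ∃ x ∈ (fun u : ℝ => p + ((y : V) + u • nu E p)) '' Icc (-z) z,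
      x ∈ frontier E := by
    by_contra! hno
    exact hnmem ((mem_iff_of_isPreconnected h.isOpen hpre hno ⟨-z, ⟨le_rfl, by linarith⟩, rfl⟩
      ⟨z, ⟨by linarith, le_rfl⟩, rfl⟩).1 hmem)
  obtain ⟨u, hu, rfl⟩ := hx
  refine ⟨_, ⟨hxE, hball u (abs_le.2 hu)⟩, ?_⟩
  rw [add_sub_cancel_left, map_add, map_smul, projLine_coe, projLine_self, smul_zero, add_zero]

/-- The projection to the tangent plane of the surface measure near `p`. -/
noncomputable def tangentMeasure (E : Set R^N)
    (p : R^N) (r : ℝ) : Measure (ℝ ∙ nu E p)ᗮ :=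
  ((area E).restrict (ball p r)).map
    fun x => projLine (nu E p) (x - p)

lemma measurable_projLine_sub (e p : V) : Measurable fun x : V => projLine e (x - p) := by
  exact (projLine e).continuous.measurable.comp (measurable_id.sub_const p)

lemma tangentMeasure_apply {r : ℝ} {A : Set (ℝ ∙ nu E p)ᗮ} (hA : MeasurableSet A) :
    tangentMeasure E p r A = euclideanHausdorffMeasure (N - 1)
      ((fun x => projLine (nu E p) (x - p)) ⁻¹' A ∩ ball p r ∩ frontier E) := by
  have hm := measurable_projLine_sub (nu E p) p
  rw [tangentMeasure, Measure.map_apply hm hA, Measure.restrict_apply (hm hA), surfaceMeasure,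
    Measure.restrict_apply ((hm hA).inter measurableSet_ball)]

/-- On the surface the projection has an inverse of Lipschitz constant `1 + 2 C r`, and Hausdorff
measure grows at most by the power `N - 1` of it. -/
lemma QuadraticContact.tangentMeasure_le (h : QuadraticContact E p ρ C) (hC : 0 < C) {r : ℝ}
    (hr0 : 0 < r) (hrρ : r ≤ ρ) (hr : C * r ≤ 1 / 4) :
    tangentMeasure E p r ≤ ofReal ((1 + 2 * C * r) ^ (N - 1)) •
      (volume.restrict (ball 0 r)) := by
  refine Measure.le_iff.2 fun A hA => ?_
  rw [tangentMeasure_apply hA, Measure.smul_apply, Measure.restrict_apply hA, smul_eq_mul]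
  set P : V → (ℝ ∙ nu E p)ᗮ := fun x => projLine (nu E p) (x - p) with hP
  set Q := P ⁻¹' A ∩ ball p r ∩ frontier E
  have hlip : ∀ x ∈ Q, ∀ y ∈ Q, ‖x - y‖ ≤ (1 + 2 * C * r) * ‖P x - P y‖ := fun x hx y hy =>
    h.norm_sub_le hC hrρ hr hx.1.2 hy.1.2 hx.2 hy.2
  have hinj : InjOn P Q := by
    intro x hx y hy hxy
    have := hlip x hx y hy
    rw [hxy, sub_self, norm_zero, mul_zero] at this
    exact sub_eq_zero.1 (norm_le_zero_iff.1 this)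
  have hL : (0 : ℝ) ≤ 1 + 2 * C * r := by positivity
  have hG : LipschitzOnWith (Real.toNNReal (1 + 2 * C * r)) (Function.invFunOn P Q) (P '' Q) := by
    refine LipschitzOnWith.of_dist_le_mul ?_
    rintro _ ⟨x, hx, rfl⟩ _ ⟨y, hy, rfl⟩
    rw [hinj.leftInvOn_invFunOn hx, hinj.leftInvOn_invFunOn hy, dist_eq_norm, dist_eq_norm,
      Real.coe_toNNReal _ hL]
    exact hlip x hx y hy
  have h1 := LipschitzOnWith.euclideanHausdorffMeasure_image_le hG (N - 1)
  rw [hinj.invFunOn_image Subset.rfl, ← volume_orthogonal_eq h.norm_normal] at h1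
  refine h1.trans ?_
  rw [ENNReal.ofReal_pow hL]
  gcongr
  · exact le_rfl
  · rintro _ ⟨x, hx, rfl⟩
    refine ⟨hx.1.1, ?_⟩
    rw [mem_ball_zero_iff]
    have := hx.1.2
    rw [mem_ball, dist_eq_norm] at this
    exact (norm_projLine_le _).trans_lt this

/-- The projection does not increase Hausdorff measure, and it covers the smaller ball. With the
upper bound, the projected measure is Lebesgue measure up to factors `1 + O(r)`. -/
lemma QuadraticContact.le_tangentMeasure (h : QuadraticContact E p ρ C) (hC : 0 < C) {r : ℝ}
    (hr0 : 0 < r) (hrρ : r ≤ ρ) (hr : C * r ≤ 1 / 4) :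
    volume.restrict (ball 0 (r / (1 + 2 * C * r))) ≤ tangentMeasure E p r := by
  refine Measure.le_iff.2 fun A hA => ?_
  rw [tangentMeasure_apply hA, Measure.restrict_apply hA]
  set P : V → (ℝ ∙ nu E p)ᗮ := fun x => projLine (nu E p) (x - p) with hP
  set Q := P ⁻¹' A ∩ ball p r ∩ frontier E
  have hlip : LipschitzOnWith 1 P Q := by
    refine LipschitzOnWith.of_dist_le_mul fun x _ y _ => ?_
    rw [dist_eq_norm, dist_eq_norm, NNReal.coe_one, one_mul, hP]
    simp only
    rw [← map_sub, sub_sub_sub_cancel_right]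
    exact norm_projLine_le _
  have h1 := LipschitzOnWith.euclideanHausdorffMeasure_image_le hlip (N - 1)
  rw [ENNReal.coe_one, one_pow, one_mul, ← volume_orthogonal_eq h.norm_normal] at h1
  refine (measure_mono ?_).trans h1
  rintro y ⟨hyA, hy⟩
  obtain ⟨x, ⟨hxE, hxb⟩, hx⟩ := h.exists_over hC hr0 hrρ hr (mem_ball_zero_iff.1 hy)
  exact ⟨x, ⟨⟨by rw [mem_preimage, hP]; simp only; rw [hx]; exact hyA, hxb⟩, hxE⟩, hx⟩

lemma one_add_pow_le {u : ℝ} (h0 : 0 ≤ u) (h1 : u ≤ 1) (n : ℕ) : (1 + u) ^ n ≤ 1 + 2 ^ n * u := by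
  suffices h : (1 + u) ^ n ≤ 1 + (2 ^ n - 1) * u by linarith
  induction n with
  | zero => simp
  | succ k ih =>
    have h2 : (0 : ℝ) ≤ 2 ^ k - 1 := sub_nonneg.2 (one_le_pow₀ (by norm_num))
    calc (1 + u) ^ (k + 1) = (1 + u) ^ k * (1 + u) := pow_succ _ _
      _ ≤ (1 + (2 ^ k - 1) * u) * (1 + u) := by gcongr
      _ ≤ 1 + (2 ^ (k + 1) - 1) * u := by
        rw [pow_succ]
        nlinarith [mul_nonneg h2 (mul_nonneg h0 (sub_nonneg.2 h1))]

lemma QuadraticContact.surfaceMeasure_ball_le (h : QuadraticContact E p ρ C) (hC : 0 < C) {r : ℝ}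
    (hr0 : 0 < r) (hrρ : r ≤ ρ) (hr : C * r ≤ 1 / 4) :
    area E (ball p r) ≤
      ofReal (2 ^ (N - 1) * crossSection N * r ^ (N - 1)) := by
  have h1 := Measure.le_iff.1 (h.tangentMeasure_le hC hr0 hrρ hr) univ MeasurableSet.univ
  rw [tangentMeasure, Measure.map_apply (measurable_projLine_sub _ _) MeasurableSet.univ,
    preimage_univ, Measure.restrict_apply_univ, Measure.smul_apply, Measure.restrict_apply_univ,
    volume_ball_orthogonal h.norm_normal hr0, smul_eq_mul,
    ← ofReal_mul (by positivity)] at h1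
  refine h1.trans (ofReal_le_ofReal ?_)
  rw [← mul_assoc]
  have := crossSection_nonneg N
  gcongr
  linarith

/-- For Lebesgue measure on a centred ball the positive and negative parts of a linear form have
equal integrals. Comparing the projected measure with Lebesgue measure from both sides, on each
part, costs a relative error `O(r)` on a quantity of order `‖a‖ r · r^(N-1)`. -/
lemma QuadraticContact.integral_inner_le (h : QuadraticContact E p ρ C) (hC : 0 < C) {r : ℝ}
    (hr0 : 0 < r) (hrρ : r ≤ ρ) (hr : C * r ≤ 1 / 4) {a : V}
    (ha : ⟪a, nu E p⟫ = 0) :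
    |∫ x in ball p r, ⟪a, x - p⟫ ∂(area E)| ≤
      2 ^ (N + 1) * C * crossSection N * ‖a‖ * r * r * r ^ (N - 1) := by
  set e := nu E p with he
  set m := tangentMeasure E p r with hm
  have hω := crossSection_nonneg N
  set u := 2 * C * r with hu
  have hu0 : 0 ≤ u := by positivity
  have hu1 : u ≤ 1 := by rw [hu]; linarith
  have hL : 0 < 1 + u := by linarith
  set V' : ℝ → ℝ := fun ρ => crossSection N * ρ ^ (N - 1) with hV
  have e1 : ∫ x in ball p r, ⟪a, x - p⟫ ∂(area E) = ∫ y, ⟪a, (y : V)⟫ ∂m := by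
    rw [hm, tangentMeasure, integral_map (measurable_projLine_sub _ _).aemeasurable
      (by exact (continuous_const.inner continuous_subtype_val).aestronglyMeasurable)]
    refine integral_congr_ae (.of_forall fun x => ?_)
    simp only
    conv_lhs => rw [← projLine_add_inner h.norm_normal (x - p)]
    rw [inner_add_right, real_inner_smul_right, ha, mul_zero, add_zero]
  have hcont : Continuous fun y : (ℝ ∙ e)ᗮ => ⟪a, (y : V)⟫ :=
    continuous_const.inner continuous_subtype_val
  have hup := h.tangentMeasure_le hC hr0 hrρ hr
  have hlow := h.le_tangentMeasure hC hr0 hrρ hr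
  rw [← hm, ← hu] at hup hlow
  have hloc : ∀ {g : (ℝ ∙ e)ᗮ → ℝ}, Continuous g → ∀ ρ, IntegrableOn g (ball 0 ρ) :=
    fun hg ρ => hg.locallyIntegrable.integrableOn_isCompact (isCompact_closedBall 0 ρ)
      |>.mono_set ball_subset_closedBall
  have hint : ∀ {g : (ℝ ∙ e)ᗮ → ℝ}, Continuous g → Integrable g m := fun hg =>
    ((hloc hg r).integrable.smul_measure ofReal_ne_top).mono_measure hup
  have hupI : ∀ {g : (ℝ ∙ e)ᗮ → ℝ}, Continuous g → (∀ y, 0 ≤ g y) →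
      ∫ y, g y ∂m ≤ (1 + u) ^ (N - 1) * ∫ y in ball 0 r, g y := by
    intro g hg hg0
    have h1 := integral_mono_measure hup (.of_forall hg0)
      ((hloc hg r).integrable.smul_measure ofReal_ne_top)
    rwa [integral_smul_measure, toReal_ofReal (by positivity), smul_eq_mul] at h1
  have hlowI : ∀ {g : (ℝ ∙ e)ᗮ → ℝ}, Continuous g → (∀ y, 0 ≤ g y) →
      ∫ y in ball 0 (r / (1 + u)), g y ≤ ∫ y, g y ∂m := fun hg hg0 =>
    integral_mono_measure hlow (.of_forall hg0) (hint hg)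
  -- the positive part of a linear form
  have key : ∀ b : V, ‖b‖ = ‖a‖ → 
      (1 + u) ^ (N - 1) * (∫ y in ball 0 r, max ⟪b, ((y : (ℝ ∙ e)ᗮ) : V)⟫ 0) -
        (∫ y in ball 0 (r / (1 + u)), max ⟪b, ((y : (ℝ ∙ e)ᗮ) : V)⟫ 0) ≤
      2 ^ (N + 1) * C * crossSection N * ‖a‖ * r * r * r ^ (N - 1) := by
    intro b hb
    set g : (ℝ ∙ e)ᗮ → ℝ := fun y => max ⟪b, (y : V)⟫ 0 with hg
    have hgc : Continuous g := (continuous_const.inner continuous_subtype_val).max continuous_const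
    have hg0 : ∀ y, 0 ≤ g y := fun y => le_max_right _ _
    have hgb : ∀ y ∈ ball (0 : (ℝ ∙ e)ᗮ) r, g y ≤ ‖a‖ * r := by
      intro y hy
      refine max_le ?_ (by positivity)
      refine (real_inner_le_norm _ _).trans ?_
      rw [hb]
      gcongr
      exact (mem_ball_zero_iff.1 hy).le
    have hsub : ball (0 : (ℝ ∙ e)ᗮ) (r / (1 + u)) ⊆ ball 0 r :=
      ball_subset_ball (div_le_self hr0.le (by linarith))
    have hvol : ∀ ρ, 0 < ρ → volume.real (ball (0 : (ℝ ∙ e)ᗮ) ρ) = V' ρ := fun ρ hρ => by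
      rw [Measure.real, volume_ball_orthogonal h.norm_normal hρ, toReal_ofReal (by positivity)]
    have hI1 : ∫ y in ball 0 r, g y ≤ ‖a‖ * r * V' r := by
      calc ∫ y in ball 0 r, g y ≤ ∫ y in ball (0 : (ℝ ∙ e)ᗮ) r, ‖a‖ * r :=
            setIntegral_mono_on (hloc hgc r) (integrableOn_const measure_ball_lt_top.ne)
              measurableSet_ball hgb
        _ = ‖a‖ * r * V' r := by rw [setIntegral_const, hvol r hr0, smul_eq_mul, mul_comm]
    have hI2 : (∫ y in ball 0 r, g y) - ∫ y in ball 0 (r / (1 + u)), g y ≤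
        ‖a‖ * r * (V' r - V' (r / (1 + u))) := by
      rw [← setIntegral_sdiff measurableSet_ball (hloc hgc r) hsub]
      calc ∫ y in ball 0 r \ ball 0 (r / (1 + u)), g y ≤
          ∫ y in ball (0 : (ℝ ∙ e)ᗮ) r \ ball 0 (r / (1 + u)), ‖a‖ * r :=
            setIntegral_mono_on ((hloc hgc r).mono_set sdiff_subset)
              (integrableOn_const ((measure_mono sdiff_subset).trans_lt measure_ball_lt_top).ne)
              (measurableSet_ball.diff measurableSet_ball) fun y hy => hgb y hy.1
        _ = ‖a‖ * r * (V' r - V' (r / (1 + u))) := by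
            rw [setIntegral_const, measureReal_sdiff hsub measurableSet_ball, hvol r hr0,
              hvol _ (by positivity), smul_eq_mul, mul_comm]
    have hpow : (1 + u) ^ (N - 1) ≤ 1 + 2 ^ (N - 1) * u := one_add_pow_le hu0 hu1 _
    have hVr : 0 ≤ V' r := by positivity
    have hV2 : V' r - V' (r / (1 + u)) ≤ 2 ^ (N - 1) * u * V' r := by
      have h1 : V' (r / (1 + u)) * (1 + u) ^ (N - 1) = V' r := by
        simp only [hV, div_pow]; field_simp
      have h2 : 0 ≤ V' (r / (1 + u)) := by positivity
      have h3 : V' (r / (1 + u)) ≤ V' r := by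
        simp only [hV]; gcongr; exact div_le_self hr0.le (by linarith)
      have h4 : V' r ≤ V' (r / (1 + u)) * (1 + 2 ^ (N - 1) * u) := by
        rw [← h1]; gcongr
      nlinarith [mul_nonneg (by positivity : (0:ℝ) ≤ 2 ^ (N - 1) * u) (sub_nonneg.2 h3)]
    have har : 0 ≤ ‖a‖ * r := by positivity
    have hI0 : 0 ≤ ∫ y in ball 0 r, g y := integral_nonneg hg0
    calc (1 + u) ^ (N - 1) * (∫ y in ball 0 r, g y) -
          ∫ y in ball 0 (r / (1 + u)), g y
        ≤ (1 + 2 ^ (N - 1) * u) * (∫ y in ball 0 r, g y) -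
          ∫ y in ball 0 (r / (1 + u)), g y := by gcongr
      _ = 2 ^ (N - 1) * u * (∫ y in ball 0 r, g y) + ((∫ y in ball 0 r, g y) -
          ∫ y in ball 0 (r / (1 + u)), g y) := by ring
      _ ≤ 2 ^ (N - 1) * u * (‖a‖ * r * V' r) + ‖a‖ * r * (2 ^ (N - 1) * u * V' r) := by
          gcongr
          exact hI2.trans (by gcongr)
      _ ≤ _ := by
          rw [hu, hV]
          simp only
          -- In dimension `0` there is no unit normal, so the truncated subtraction `N - 1` does no
          -- harm.
          have hN : (2 : ℝ) ^ (N + 1) = 4 * 2 ^ (N - 1) ∨ N = 0 := by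
            rcases N with _ | n
            · exact Or.inr rfl
            · left; rw [Nat.add_sub_cancel, pow_succ, pow_succ]; ring
          rcases hN with hN | hN
          · rw [hN]
            apply le_of_eq; ring
          · subst hN
            have := h.norm_normal
            rw [Subsingleton.elim (nu E p) 0, norm_zero] at this
            norm_num at this
  have hsymm : ∀ (b : V) (ρ : ℝ), ∫ y in ball 0 ρ, max ⟪-b, ((y : (ℝ ∙ e)ᗮ) : V)⟫ 0 =
      ∫ y in ball 0 ρ, max ⟪b, ((y : (ℝ ∙ e)ᗮ) : V)⟫ 0 := by
    intro b ρ
    have h1 := (Measure.measurePreserving_neg (volume : Measure (ℝ ∙ e)ᗮ)).setIntegral_preimage_emb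
      (MeasurableEquiv.neg _).measurableEmbedding (fun y => max ⟪b, (y : V)⟫ 0) (ball 0 ρ)
    rw [← h1]
    have h2 : Neg.neg ⁻¹' ball (0 : (ℝ ∙ e)ᗮ) ρ = ball 0 ρ := by
      ext y; simp
    rw [h2]
    refine setIntegral_congr_fun measurableSet_ball fun y _ => ?_
    simp
  have dec : ∫ y, ⟪a, (y : V)⟫ ∂m =
      (∫ y, max ⟪a, (y : V)⟫ 0 ∂m) - ∫ y, max ⟪-a, (y : V)⟫ 0 ∂m := by
    rw [← integral_sub (hint (hcont.max continuous_const))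
      (hint ((continuous_const.inner continuous_subtype_val).max continuous_const))]
    refine integral_congr_ae (.of_forall fun y => ?_)
    simp only [inner_neg_left]
    rcases le_total ⟪a, (y : V)⟫ 0 with h0 | h0
    · rw [max_eq_right h0, max_eq_left (by linarith)]; ring
    · rw [max_eq_left h0, max_eq_right (by linarith)]; ring
  have hc1 : ∀ b : V, Continuous fun y : (ℝ ∙ e)ᗮ => max ⟪b, (y : V)⟫ 0 := fun b =>
    (continuous_const.inner continuous_subtype_val).max continuous_const
  have u1 := hupI (hc1 a) fun y => le_max_right _ _
  have u2 := hupI (hc1 (-a)) fun y => le_max_right _ _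
  have l1 := hlowI (hc1 a) fun y => le_max_right _ _
  have l2 := hlowI (hc1 (-a)) fun y => le_max_right _ _
  have k := key a rfl
  rw [hsymm] at u2 l2
  rw [e1, dec, abs_le]
  constructor <;> linarith

end TangentProjection

/-! ### Existence and uniform bounds of principal values -/

section PrincipalValues

lemma one_div_norm_rpow_le {β : ℝ} (hβ : 0 ≤ β) {p x : V} {r : ℝ} (hr : 0 < r)
    (hx : x ∉ ball p r) :
    1 / ‖x - p‖ ^ β ≤ (1 + (1 + ‖p‖) / r) ^ β * (1 + ‖x‖) ^ (-β) := by
  rw [mem_ball, dist_eq_norm, not_lt] at hx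
  have h0 : 0 < ‖x - p‖ := hr.trans_le hx
  have h1 : 1 + ‖x‖ ≤ (1 + (1 + ‖p‖) / r) * ‖x - p‖ := by
    have h2 : ‖x‖ ≤ ‖x - p‖ + ‖p‖ := by simpa using norm_add_le (x - p) p
    have h3 : 1 + ‖p‖ ≤ (1 + ‖p‖) / r * ‖x - p‖ := by
      rw [div_mul_eq_mul_div, le_div_iff₀ hr]
      gcongr
    linarith
  rw [rpow_neg (by positivity), ← div_eq_mul_inv, div_le_div_iff₀ (by positivity) (by positivity),
    one_mul, ← Real.mul_rpow (by positivity) (by positivity)]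
  exact Real.rpow_le_rpow (by positivity) h1 hβ

/-- Near `p` the radial estimate applies; away from `p` all the kernels are dominated by a multiple
of `(1 + ‖x‖)^(-(N+s))`. The resulting bound is independent of `δ` and depends on the base point
only through `‖p‖` and the given constants. -/
lemma exists_principalValue {μ : Measure V} [SFinite μ] {p : V} {r₀ s C M : ℝ} (hr₀ : 0 < r₀)
    (hs0 : 0 < s) (hs1 : s < 1)
    (hμ : Integrable (fun x : V => (1 + ‖x‖) ^ (-(N + s))) μ) {f : V → ℝ}
    (hfm : AEStronglyMeasurable f μ) (hM : 0 ≤ M) (hfb : ∀ᵐ x ∂μ, |f x| ≤ M)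
    (hF : ∀ r, 0 < r → r ≤ r₀ → |∫ x in ball p r, f x ∂μ| ≤ C * r ^ ((N : ℝ) + 1)) :
    HasPrincipalValue μ p (fun x => f x / ‖x - p‖ ^ (N + s)) ∧
    Tendsto (fun δ => ∫ x, f x * kern (N + s) δ (x - p) ∂μ) (𝓝[>] 0)
      (𝓝 (principalValue μ p fun x => f x / ‖x - p‖ ^ (N + s))) ∧
    ∀ δ > 0, Integrable (fun x => f x * kern (N + s) δ (x - p)) μ ∧
      |∫ x, f x * kern (N + s) δ (x - p) ∂μ| ≤
        C * (r₀ ^ (1 - s) + (N + s) * (r₀ ^ (1 - s) / (1 - s))) +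
          M * (1 + (1 + ‖p‖) / r₀) ^ (N + s) * ∫ x, (1 + ‖x‖) ^ (-(N + s)) ∂μ := by
  set β := (N : ℝ) + s with hβ
  have hβ0 : 0 < β := by positivity
  have hball : ∀ r, IntegrableOn f (ball p r) μ := by
    intro r
    have h1 : Integrable (fun x => f x * (1 + ‖x‖) ^ (-β)) μ := by
      have := hμ.bdd_mul hfm (hfb.mono fun x hx => by rwa [norm_eq_abs])
      exact this
    have h2 : IntegrableOn (fun x => f x * (1 + ‖x‖) ^ (-β) * (1 + ‖x‖) ^ β) (ball p r) μ := by
      refine Integrable.mul_bdd (c := (1 + (‖p‖ + |r|)) ^ β) h1.integrableOn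
        (Measurable.aestronglyMeasurable (by fun_prop)) ?_
      refine (ae_restrict_mem measurableSet_ball).mono fun x hx => ?_
      rw [mem_ball, dist_eq_norm] at hx
      rw [norm_of_nonneg (by positivity)]
      have : ‖x‖ ≤ ‖p‖ + |r| := by
        have := norm_add_le (x - p) p
        rw [sub_add_cancel] at this
        linarith [le_abs_self r]
      gcongr
    refine h2.congr (.of_forall fun x => ?_)
    simp only
    rw [mul_assoc, ← rpow_add (by positivity), neg_add_cancel, Real.rpow_zero, mul_one]
  obtain ⟨⟨l, hl1, hl2⟩, hb⟩ := exists_tendsto_radial hr₀ hs0 hs1 (hball r₀) hF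
  rw [← hβ] at hb
  simp only [← hβ] at hl1 hl2
  have hcompl : ∀ δ, MeasurableSet (ball p δ)ᶜ := fun δ => measurableSet_ball.compl
  set A : ℝ → ℝ := fun r => (1 + (1 + ‖p‖) / r) ^ β with hA
  have hdom : ∀ r : ℝ, IntegrableOn (fun x : V => M * A r * (1 + ‖x‖) ^ (-β)) (ball p r)ᶜ μ :=
    fun r => (hμ.const_mul _).integrableOn
  have hle : ∀ r > 0, ∀ (k : V → ℝ), (∀ x, x ∉ ball p r → |k x| ≤ 1 / ‖x - p‖ ^ β) →
      ∀ᵐ x ∂(μ.restrict (ball p r)ᶜ), ‖f x * k x‖ ≤ M * A r * (1 + ‖x‖) ^ (-β) := by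
    intro r hr k hk
    filter_upwards [ae_restrict_mem (hcompl r), ae_restrict_of_ae hfb] with x hx hfx
    rw [norm_mul, norm_eq_abs, norm_eq_abs, mul_assoc]
    exact mul_le_mul hfx ((hk x hx).trans (one_div_norm_rpow_le hβ0.le hr hx)) (abs_nonneg _) hM
  have hne : ∀ r > 0, ∀ x, x ∉ ball p r → x - p ≠ 0 := by
    rintro r hr x hx h0
    rw [sub_eq_zero] at h0
    exact hx (h0 ▸ mem_ball_self hr)
  have hK0 : ∀ x : V, |1 / ‖x - p‖ ^ β| ≤ 1 / ‖x - p‖ ^ β := fun x => by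
    rw [abs_of_nonneg (by positivity)]
  have hKδ : ∀ r > 0, ∀ δ, ∀ x, x ∉ ball p r →
      |kern β δ (x - p)| ≤ 1 / ‖x - p‖ ^ β := fun r hr δ x hx => by
    rw [abs_of_nonneg (kern_nonneg _ _ _)]
    exact kern_le hβ0.le δ (hne r hr x hx)
  have hKm : ∀ δ, AEStronglyMeasurable (fun x => kern β δ (x - p)) μ := fun δ =>
    ((measurable_kern β δ).comp (measurable_id.sub_const p)).aestronglyMeasurable
  have hK0m : AEStronglyMeasurable (fun x : V => 1 / ‖x - p‖ ^ β) μ :=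
    Measurable.aestronglyMeasurable (by fun_prop)
  have hint0 : ∀ r > 0, IntegrableOn (fun x => f x / ‖x - p‖ ^ β) (ball p r)ᶜ μ := by
    intro r hr
    simp_rw [div_eq_mul_one_div (f _)]
    exact (hdom r).mono' (hfm.mul hK0m).restrict (hle r hr _ fun x _ => hK0 x)
  have hintδ : ∀ r > 0, ∀ δ, IntegrableOn (fun x => f x * kern β δ (x - p))
      (ball p r)ᶜ μ := fun r hr δ =>
    (hdom r).mono' (hfm.mul (hKm δ)).restrict (hle r hr _ (hKδ r hr δ))
  have hintball : ∀ δ > 0, IntegrableOn (fun x => f x * kern β δ (x - p))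
      (ball p r₀) μ := by
    intro δ hδ
    refine Integrable.mul_bdd (c := δ ^ (-β)) (hball r₀) (hKm δ).restrict
      (.of_forall fun x => ?_)
    rw [norm_of_nonneg (kern_nonneg _ _ _)]
    exact kern_le_of_pos hβ0.le hδ _
  have hintall : ∀ δ > 0, Integrable (fun x => f x * kern β δ (x - p)) μ := fun δ hδ => by
    rw [← integrableOn_univ, ← union_compl_self (ball p r₀)]
    exact (hintball δ hδ).union (hintδ r₀ hr₀ δ)
  set F := ∫ x in (ball p r₀)ᶜ, f x / ‖x - p‖ ^ β ∂μ with hFdef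
  have hpv : Tendsto (fun ρ : ℝ => ∫ x in (ball p ρ)ᶜ, f x / ‖x - p‖ ^ β ∂μ) (𝓝[>] 0)
      (𝓝 (l + F)) := by
    refine (hl1.add_const F).congr' ?_
    filter_upwards [Ioo_mem_nhdsGT hr₀] with ρ hρ
    have hsub : (ball p r₀)ᶜ ⊆ (ball p ρ)ᶜ :=
      compl_subset_compl.2 (ball_subset_ball hρ.2.le)
    have hdiff : ball p r₀ \ ball p ρ = (ball p ρ)ᶜ \ (ball p r₀)ᶜ := by
      ext x; simp only [Set.mem_sdiff, mem_compl_iff, not_not]; tauto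
    rw [hdiff, setIntegral_sdiff (hcompl r₀) (hint0 ρ hρ.1) hsub]
    ring
  have hlim : principalValue μ p (fun x => f x / ‖x - p‖ ^ β) = l + F := hpv.limUnder_eq
  refine ⟨⟨hint0, l + F, hpv⟩, ?_, fun δ hδ => ⟨hintall δ hδ, ?_⟩⟩
  · rw [hlim]
    have hfar : Tendsto (fun δ => ∫ x in (ball p r₀)ᶜ, f x * kern β δ (x - p) ∂μ)
        (𝓝[>] 0) (𝓝 F) := by
      simp_rw [hFdef, div_eq_mul_one_div (f _)]
      refine tendsto_integral_filter_of_dominated_convergence _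
        (.of_forall fun δ => (hfm.mul (hKm δ)).restrict)
        (.of_forall fun δ => hle r₀ hr₀ _ (hKδ r₀ hr₀ δ)) (hdom r₀) ?_
      refine (ae_restrict_mem (hcompl r₀)).mono fun x hx => ?_
      exact (tendsto_kern β (hne r₀ hr₀ x hx)).const_mul _
    refine (hl2.add hfar).congr' ?_
    filter_upwards [self_mem_nhdsWithin] with δ hδ
    exact integral_add_compl measurableSet_ball (hintall δ hδ)
  · rw [← integral_add_compl (measurableSet_ball (x := p) (ε := r₀)) (hintall δ hδ)]
    refine (abs_add_le _ _).trans (add_le_add (hb δ hδ) ?_)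
    calc |∫ x in (ball p r₀)ᶜ, f x * kern β δ (x - p) ∂μ|
        ≤ ∫ x in (ball p r₀)ᶜ, M * A r₀ * (1 + ‖x‖) ^ (-β) ∂μ :=
          norm_integral_le_of_norm_le (hdom r₀) (hle r₀ hr₀ _ (hKδ r₀ hr₀ δ))
      _ ≤ ∫ x, M * A r₀ * (1 + ‖x‖) ^ (-β) ∂μ :=
          setIntegral_le_integral (hμ.const_mul _) (.of_forall fun x => by positivity)
      _ = _ := integral_const_mul _ _

/-- The function equal to `1` on `E` and `-1` off `E`. -/
noncomputable def sgnInd (E : Set R^N)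
    (x : R^N) : ℝ :=
  E.indicator 1 x - Eᶜ.indicator 1 x

lemma sgnInd_of_mem {x : V} (hx : x ∈ E) : sgnInd E x = 1 := by
  simp [sgnInd, hx]

lemma sgnInd_of_notMem {x : V} (hx : x ∉ E) :
    sgnInd E x = -1 := by
  simp [sgnInd, hx]

lemma abs_sgnInd (E : Set V) (x : V) : |sgnInd E x| = 1 := by
  by_cases hx : x ∈ E
  · simp [sgnInd_of_mem hx]
  · simp [sgnInd_of_notMem hx]

lemma measurable_sgnInd (hE : MeasurableSet E) :
    Measurable (sgnInd E) :=
  (measurable_one.indicator hE).sub (measurable_one.indicator hE.compl)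

/-- The points close to the plane through `p` orthogonal to `e`, to second order at `p`. -/
def parabolicWedge (p e : R^N) (C : ℝ) : Set R^N :=
  {x | |⟪x - p, e⟫| ≤ C * ‖x - p‖ ^ 2}

lemma measurableSet_parabolicWedge (p e : V) (C : ℝ) : MeasurableSet (parabolicWedge p e C) :=
  measurableSet_le (by fun_prop) (by fun_prop)

lemma one_le_of_norm_eq_one {e : V} (he : ‖e‖ = 1) : 1 ≤ N := by
  rcases N with _ | n
  · rw [Subsingleton.elim e 0, norm_zero] at he
    norm_num at he
  · omega

lemma rpow_add_one_eq (hN : 1 ≤ N) (r : ℝ) :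
    r * r * r ^ (N - 1) = r ^ ((N : ℝ) + 1) := by
  rw [show (N : ℝ) + 1 = ((N + 1 : ℕ) : ℝ) by push_cast; ring, Real.rpow_natCast]
  obtain ⟨n, rfl⟩ := Nat.exists_eq_add_of_le' hN
  rw [Nat.add_sub_cancel]; ring

/-- Within the ball the wedge is contained in a cylinder of height `2 C r²` over an
`(N-1)`-dimensional ball of radius `r`. -/
lemma volume_parabolicWedge_inter_ball_le {p e : V} (he : ‖e‖ = 1) {C r : ℝ} (hC : 0 ≤ C)
    (hr : 0 < r) :
    volume.real (parabolicWedge p e C ∩ ball p r) ≤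
      2 * C * crossSection N * r ^ ((N : ℝ) + 1) := by
  have hω := crossSection_nonneg N
  have hsub : parabolicWedge p e C ∩ ball p r ⊆
      lineEquiv e he p '' ball 0 r ×ˢ Icc (-(C * r ^ 2)) (C * r ^ 2) := by
    rintro x ⟨hx, hxr⟩
    rw [mem_ball, dist_eq_norm] at hxr
    refine ⟨(projLine e (x - p), ⟪x - p, e⟫), ⟨?_, ?_⟩, ?_⟩
    · rw [mem_ball_zero_iff]
      exact (norm_projLine_le _).trans_lt hxr
    · refine abs_le.1 (le_trans hx ?_)
      gcongr
    · rw [lineEquiv_apply, add_assoc, projLine_add_inner he, add_sub_cancel]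
  have h1 := (measure_mono hsub).trans_eq (volume_image_lineEquiv_prod e he p _ _)
  rw [volume_ball_orthogonal he hr, Real.volume_Icc, ← ofReal_mul (by positivity)] at h1
  refine (ENNReal.toReal_le_of_le_ofReal (by
    have : 0 ≤ C * r ^ 2 := by positivity
    exact mul_nonneg (by positivity) (by linarith)) h1).trans_eq ?_
  rw [← rpow_add_one_eq (one_le_of_norm_eq_one he) r]
  ring

variable {E : Set R^N} {p : R^N} {ρ C : ℝ}

/-- `E` and its reflection through `p` are complementary off the wedge. -/
lemma QuadraticContact.sgnInd_add_reflection (h : QuadraticContact E p ρ C) {x : V}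
    (hx : x ∈ ball p ρ) (hxW : x ∉ parabolicWedge p (nu E p) C) :
    sgnInd E x + sgnInd E (p + p - x) = 0 := by
  have hx' : p + p - x ∈ ball p ρ := by
    rw [mem_ball, dist_eq_norm] at hx ⊢
    rw [show p + p - x - p = -(x - p) by abel, norm_neg]
    exact hx
  have e1 : p + p - x - p = -(x - p) := by abel
  rw [parabolicWedge, mem_ofPred_eq, not_le, lt_abs] at hxW
  rcases hxW with h1 | h1
  · rw [sgnInd_of_notMem (h.notMem_of_lt x hx h1), sgnInd_of_mem
      (h.mem_of_lt _ hx' (by rw [e1, norm_neg, inner_neg_left]; linarith))]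
    norm_num
  · rw [sgnInd_of_mem (h.mem_of_lt x hx (by linarith)), sgnInd_of_notMem
      (h.notMem_of_lt _ hx' (by rw [e1, norm_neg, inner_neg_left]; linarith))]
    norm_num

lemma setIntegral_ball_reflection (p : V) (r : ℝ) (f : V → ℝ) :
    ∫ x in ball p r, f (p + p - x) = ∫ x in ball p r, f x := by
  have h1 := (Measure.measurePreserving_sub_left (volume : Measure V) (p + p)).setIntegral_preimage_emb
    (MeasurableEquiv.subLeft (p + p)).measurableEmbedding f (ball p r)
  rw [← h1]
  have h2 : (fun x => p + p - x) ⁻¹' ball p r = ball p r := by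
    ext x
    rw [mem_preimage, mem_ball, mem_ball, dist_eq_norm, dist_eq_norm,
      show p + p - x - p = -(x - p) by abel, norm_neg]
  rw [h2]

/-- Average the integrand with its reflection through `p`. Off the wedge the signs are opposite,
which leaves `g x - g (p + p - x)`, of size `B r`; the wedge itself has volume `O(r^(N+1))`. The
weight `g = 1` serves for the fractional mean curvature, general weights for the Taylor remainders
along a flow. -/
lemma QuadraticContact.integral_sgnInd_mul_le (h : QuadraticContact E p ρ C) (hC : 0 < C) {g : V → ℝ} (hg : AEStronglyMeasurable g volume)
    {B : ℝ} (hB : 0 ≤ B) (hgB : ∀ x, |g x| ≤ B) (hodd : ∀ x, |g x - g (p + p - x)| ≤ B * ‖x - p‖)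
    {r : ℝ} (hr0 : 0 < r) (hrρ : r ≤ ρ) :
    |∫ x in ball p r, sgnInd E x * g x| ≤
      B * (2 * C * crossSection N + volume.real (ball (0 : V) 1)) * r ^ ((N : ℝ) + 1) := by
  set e := nu E p
  have hEm := h.isOpen.measurableSet
  have hb : ∀ x, ‖sgnInd E x * g x‖ ≤ B := fun x => by
    rw [norm_mul, norm_eq_abs, abs_sgnInd, one_mul]; exact hgB x
  have hmr : MeasurePreserving (fun x : V => p + p - x) volume volume :=
    Measure.measurePreserving_sub_left volume (p + p)
  have hi0 : AEStronglyMeasurable (fun x => sgnInd E x * g x) volume :=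
    (measurable_sgnInd hEm).aestronglyMeasurable.mul hg
  have hi : IntegrableOn (fun x => sgnInd E x * g x) (ball p r) :=
    Measure.integrableOn_of_bounded measure_ball_lt_top.ne hi0 (.of_forall hb)
  have hi' : IntegrableOn (fun x => sgnInd E (p + p - x) * g (p + p - x))
      (ball p r) :=
    Measure.integrableOn_of_bounded measure_ball_lt_top.ne
      (hi0.comp_measurePreserving hmr) (.of_forall fun x => hb _)
  have e1 : 2 * ∫ x in ball p r, sgnInd E x * g x =
      ∫ x in ball p r, (sgnInd E x * g x +
        sgnInd E (p + p - x) * g (p + p - x)) := by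
    rw [integral_add hi hi', setIntegral_ball_reflection p r fun x => sgnInd E x * g x]
    ring
  have hw := measurableSet_parabolicWedge p e C
  have i2 : IntegrableOn (fun _ : V => B * r) (ball p r) :=
    integrableOn_const measure_ball_lt_top.ne
  have i1 : IntegrableOn ((parabolicWedge p e C).indicator fun _ => 2 * B) (ball p r) :=
    (integrableOn_const measure_ball_lt_top.ne).indicator hw
  have e2 : |∫ x in ball p r, (sgnInd E x * g x +
        sgnInd E (p + p - x) * g (p + p - x))| ≤
      ∫ x in ball p r, ((parabolicWedge p e C).indicator (fun _ => 2 * B) x + B * r) := by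
    rw [← norm_eq_abs]
    refine norm_integral_le_of_norm_le (i1.add i2)
      ((ae_restrict_mem measurableSet_ball).mono fun x hx => ?_)
    by_cases hxW : x ∈ parabolicWedge p e C
    · rw [indicator_of_mem hxW]
      have h1 : 0 ≤ B * r := by positivity
      linarith [norm_add_le (sgnInd E x * g x)
        (sgnInd E (p + p - x) * g (p + p - x)), hb x, hb (p + p - x)]
    · have h1 := h.sgnInd_add_reflection (ball_subset_ball hrρ hx) hxW
      rw [indicator_of_notMem hxW, zero_add, show sgnInd E (p + p - x) =
        -sgnInd E x by linarith, neg_mul, ← sub_eq_add_neg, ← mul_sub, norm_mul,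
        norm_eq_abs, abs_sgnInd, one_mul]
      exact (hodd x).trans (mul_le_mul_of_nonneg_left (mem_ball_iff_norm.1 hx).le hB)
  rw [integral_add i1 i2, setIntegral_indicator hw, setIntegral_const, setIntegral_const, inter_comm,
    ← e1, abs_mul, abs_two, smul_eq_mul, smul_eq_mul] at e2
  have h3 := volume_parabolicWedge_inter_ball_le (p := p) h.norm_normal hC.le hr0
  have h4 : volume.real (ball p r) = r ^ N * volume.real (ball (0 : V) 1) := by
    rw [Measure.real, Measure.addHaar_ball_of_pos _ _ hr0, ENNReal.toReal_mul,
      toReal_ofReal (by positivity), finrank_euclideanSpace_fin]; rfl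
  have h5 : r ^ N * r = r ^ ((N : ℝ) + 1) := by
    rw [rpow_add hr0, Real.rpow_natCast, Real.rpow_one]
  rw [h4] at e2
  have h6 : r ^ N * volume.real (ball (0 : V) 1) * (B * r) =
      B * volume.real (ball (0 : V) 1) * r ^ ((N : ℝ) + 1) := by rw [← h5]; ring
  have h7 : 0 ≤ B * volume.real (ball (0 : V) 1) * r ^ ((N : ℝ) + 1) := by positivity
  have h8 := mul_le_mul_of_nonneg_right h3 (by positivity : 0 ≤ 2 * B)
  linarith

end PrincipalValues

/-! ### Regularized curvature and regularized Jacobi operator -/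

/-- The fractional mean curvature with the smoothed kernel. -/
noncomputable def smoothedCurvature (s : ℝ) (E : Set R^N) (δ : ℝ)
    (p : R^N) : ℝ :=
  ∫ x, sgnInd E x * kern (N + s) δ (x - p)

/-- The fractional Jacobi operator with the smoothed kernel. -/
noncomputable def smoothedJacobi (s : ℝ) (E : Set R^N)
    (h : R^N → ℝ) (δ : ℝ) (p : R^N) : ℝ :=
  ∫ x, (h x - h p * ⟪nu E p, nu E x⟫) *
    kern (N + s) δ (x - p) ∂(area E)

lemma integrable_japanese {s : ℝ} (hs0 : 0 < s) :
    Integrable (fun x : V => (1 + ‖x‖) ^ (-(N + s))) :=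
  integrable_one_add_norm (by rw [finrank_euclideanSpace_fin]; linarith)

lemma factor_le {p p₀ : V} {r₀ ρ β : ℝ} (hr₀ : 0 < r₀) (hβ : 0 ≤ β) (hp : p ∈ ball p₀ ρ) :
    (1 + (1 + ‖p‖) / r₀) ^ β ≤ (1 + (1 + (‖p₀‖ + ρ)) / r₀) ^ β := by
  rw [mem_ball, dist_eq_norm] at hp
  have : ‖p‖ ≤ ‖p₀‖ + ρ := by
    have := norm_add_le (p - p₀) p₀
    rw [sub_add_cancel] at this
    linarith
  gcongr

/-- The reflection estimate with weight `1`; the contact constants are common to the base points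
near `p₀`, so the bound is too. -/
lemma HasSmoothBoundary.curvature_estimates (hE : HasSmoothBoundary E) {s : ℝ}
    (hs0 : 0 < s) (hs1 : s < 1) {p₀ : V} (hp₀ : p₀ ∈ frontier E) :
    ∃ ρ > 0, ∃ B : ℝ, ∀ p ∈ ball p₀ ρ, p ∈ frontier E →
      HasPrincipalValue volume p (curvatureIntegrand s E p) ∧
      Tendsto (fun δ => smoothedCurvature s E δ p) (𝓝[>] 0) (𝓝 (fractionalMeanCurvature s E p)) ∧
      (∀ δ > 0, |smoothedCurvature s E δ p| ≤ B) ∧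
      ∀ δ > 0, Integrable fun x => sgnInd E x * kern (N + s) δ (x - p) := by
  obtain ⟨ρ, hρ, C, hC, H⟩ := hE.exists_quadraticContact hp₀
  have hβ : 0 ≤ (N : ℝ) + s := by positivity
  set I := ∫ x : V, (1 + ‖x‖) ^ (-(N + s))
  have hI : 0 ≤ I := integral_nonneg fun x => by positivity
  refine ⟨ρ, hρ, (2 * C * crossSection N + volume.real (ball (0 : V) 1)) *
      (ρ ^ (1 - s) + (N + s) * (ρ ^ (1 - s) / (1 - s))) + 1 * (1 + (1 + (‖p₀‖ + ρ)) / ρ) ^ (N + s) * I, fun p hp hpE => ?_⟩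
  have h := H p hp hpE
  obtain ⟨h1, h2, h3⟩ := exists_principalValue (μ := (volume : Measure V)) (p := p) hρ hs0 hs1
    (integrable_japanese hs0) (measurable_sgnInd hE.1.measurableSet).aestronglyMeasurable
    zero_le_one (.of_forall fun x => (abs_sgnInd E x).le)
    (fun r hr hrρ => by
      simpa using h.integral_sgnInd_mul_le hC (g := 1) aestronglyMeasurable_one zero_le_one
        (by simp) (by simp) hr hrρ)
  refine ⟨h1, h2, fun δ hδ => (h3 δ hδ).2.trans ?_, fun δ hδ => (h3 δ hδ).1⟩
  gcongr _ + 1 * ?_ * _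
  exact factor_le hρ hβ hp

lemma SmoothOnSurface.continuousOn {S : Set V} {h : V → ℝ} (hh : SmoothOnSurface S h) :
    ContinuousOn h S := by
  intro p hp
  obtain ⟨g, hg, hgh⟩ := hh p hp
  exact (hg.continuous.continuousWithinAt).congr_of_eventuallyEq hgh (hgh.self_of_nhdsWithin hp)

lemma QuadraticContact.surfaceMeasure_real_le {p : V} {ρ C : ℝ}
    (h : QuadraticContact E p ρ C) (hC : 0 < C) {r : ℝ}
    (hr0 : 0 < r) (hrρ : r ≤ ρ) (hr : C * r ≤ 1 / 4) :
    (area E).real (ball p r) ≤ 2 ^ (N - 1) * crossSection N * r ^ (N - 1) :=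
  ENNReal.toReal_le_of_le_ofReal (by have := crossSection_nonneg N; positivity)
    (h.surfaceMeasure_ball_le hC hr0 hrρ hr)

lemma QuadraticContact.setIntegral_le {p : V} {ρ C : ℝ}
    (h : QuadraticContact E p ρ C) (hC : 0 < C) {r : ℝ}
    (hr0 : 0 < r) (hrρ : r ≤ ρ) (hr : C * r ≤ 1 / 4) {f : V → ℝ} {B : ℝ} (hB : 0 ≤ B)
    (hf : ∀ x ∈ ball p r, x ∈ frontier E → |f x| ≤ B * r ^ 2) :
    |∫ x in ball p r, f x ∂(area E)| ≤
      2 ^ (N - 1) * crossSection N * B * r ^ ((N : ℝ) + 1) := by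
  have hfin : area E (ball p r) < ⊤ :=
    (h.surfaceMeasure_ball_le hC hr0 hrρ hr).trans_lt ENNReal.ofReal_lt_top
  have h1 : ‖∫ x in ball p r, f x ∂(area E)‖ ≤
      B * r ^ 2 * (area E).real (ball p r) := by
    refine norm_setIntegral_le_of_norm_le_const_ae hfin ?_
    filter_upwards [ae_restrict_of_ae (ae_mem_frontier E), ae_restrict_mem measurableSet_ball]
      with x hx hxb
    exact hf x hxb hx
  rw [norm_eq_abs] at h1
  refine h1.trans ?_
  calc B * r ^ 2 * (area E).real (ball p r)
      ≤ B * r ^ 2 * (2 ^ (N - 1) * crossSection N * r ^ (N - 1)) := by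
        gcongr; exact h.surfaceMeasure_real_le hC hr0 hrρ hr
    _ = _ := by
        rw [← rpow_add_one_eq (one_le_of_norm_eq_one h.norm_normal) r]; ring

/-- Up to `O(r²)` the increment of `h` is a linear form in the tangential part of the gradient: the
Taylor remainder is quadratic, and so is the normal part because of the contact with the tangent
plane. The linear form integrates to `O(r^(N+1))` by the near symmetry of the projected measure, the
rest because balls have surface measure `O(r^(N-1))`. -/
lemma HasSmoothBoundary.integral_sub_estimate (hE : HasSmoothBoundary E) {h : V → ℝ}
    (hh : SmoothOnSurface (frontier E) h) {p₀ : V} (hp₀ : p₀ ∈ frontier E) :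
    ∃ ρ > 0, ∃ C > 0, ∃ B : ℝ, C * ρ ≤ 1 / 4 ∧ ∀ p ∈ ball p₀ ρ, p ∈ frontier E →
      QuadraticContact E p ρ C ∧ ∀ r, 0 < r → r ≤ ρ →
        |∫ x in ball p r, (h x - h p) ∂(area E)| ≤ B * r ^ ((N : ℝ) + 1) := by
  obtain ⟨ρ₁, hρ₁, C, hC, H⟩ := hE.exists_quadraticContact hp₀
  obtain ⟨g, hg, hgh⟩ := hh p₀ hp₀
  rw [eventually_nhdsWithin_iff, eventually_nhds_iff_ball] at hgh
  obtain ⟨ρ₂, hρ₂, hgh⟩ := hgh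
  obtain ⟨K, hK, hKe⟩ := exists_lipschitz_ball
    ((hg.fderiv_right (m := ((⊤ : ℕ∞) : WithTop ℕ∞)) (by simp)).of_le (by simp) :
      ContDiff ℝ 1 (fderiv ℝ g)) p₀
  have hρ₃ : 0 < min (min ρ₁ ρ₂) (1 / (4 * C)) := by positivity
  obtain ⟨r, hrK, hr0, hrR⟩ := (hKe.and (Ioo_mem_nhdsGT hρ₃)).exists
  have hr1 : r < ρ₁ := hrR.trans_le ((min_le_left _ _).trans (min_le_left _ _))
  have hr2 : r < ρ₂ := hrR.trans_le ((min_le_left _ _).trans (min_le_right _ _))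
  have hr3 : C * r ≤ 1 / 4 := by
    have h1 := (hrR.trans_le (min_le_right _ _)).le
    rw [le_div_iff₀ (by positivity)] at h1
    linarith
  set G := ‖gradient g p₀‖ + K * r with hG
  have hG0 : 0 ≤ G := by positivity
  have hω := crossSection_nonneg N
  refine ⟨r / 2, by linarith, C, hC, 2 ^ (N + 1) * C * crossSection N * G +
    2 ^ (N - 1) * crossSection N * (K + G * C), by nlinarith, fun p hp hpE => ?_⟩
  have hpr : p ∈ ball p₀ r := ball_subset_ball (by linarith) hp
  have hsub : ball p (r / 2) ⊆ ball p₀ r := by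
    refine Metric.ball_subset_ball' ?_
    have := mem_ball.1 hp
    linarith
  have hc₁ := H p (ball_subset_ball hr1.le hpr) hpE
  have hc : QuadraticContact E p (r / 2) C := by
    have hs : ball p (r / 2) ⊆ ball p ρ₁ := ball_subset_ball (by linarith)
    exact ⟨hc₁.isOpen, hc₁.mem, hc₁.norm_normal,
      fun x hx y hy => hc₁.inner_le x (hs hx) y (hs hy), fun x hx => hc₁.mem_of_lt x (hs hx),
      fun x hx => hc₁.notMem_of_lt x (hs hx), fun x hx => hc₁.normal_le x (hs hx)⟩
  refine ⟨hc, fun r' hr' hrr' => ?_⟩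
  set e := nu E p
  have hgrad : ‖gradient g p‖ ≤ G := by
    have h1 := hrK p hpr p₀ (mem_ball_self hr0)
    rw [mem_ball, dist_eq_norm] at hpr
    have h2 : ‖gradient g p - gradient g p₀‖ ≤ K * ‖p - p₀‖ := by
      rw [gradient, gradient, ← map_sub, LinearIsometryEquiv.norm_map]
      exact h1
    have h3 : ‖gradient g p‖ ≤ ‖gradient g p - gradient g p₀‖ + ‖gradient g p₀‖ := by
      simpa using norm_add_le (gradient g p - gradient g p₀) (gradient g p₀)
    have h4 : K * ‖p - p₀‖ ≤ K * r := by gcongr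
    rw [hG]; linarith
  set c := ⟪gradient g p, e⟫ with hcdef
  set a := gradient g p - c • e with ha
  have hae : ⟪a, e⟫ = 0 := by
    rw [ha, inner_sub_left, real_inner_smul_left, real_inner_self_eq_norm_sq, hc.norm_normal]
    simp [hcdef]
  have hcG : |c| ≤ G := by
    refine (abs_real_inner_le_norm _ _).trans ?_
    rw [hc.norm_normal, mul_one]; exact hgrad
  have hanorm : ‖a‖ ≤ G := by
    have h1 : ‖gradient g p‖ ^ 2 = ‖a‖ ^ 2 + c ^ 2 := by
      have h2 : gradient g p = a + c • e := by rw [ha]; abel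
      rw [h2, norm_add_sq_real, real_inner_smul_right, hae, norm_smul, hc.norm_normal,
        norm_eq_abs, mul_one, sq_abs]
      ring
    have h3 : ‖a‖ ^ 2 ≤ G ^ 2 := by nlinarith [norm_nonneg (gradient g p), sq_nonneg c]
    exact abs_le_of_sq_le_sq' h3 hG0 |>.2
  have hCr' : C * r' ≤ 1 / 4 := by
    have : C * r' ≤ C * r := by gcongr; linarith
    linarith
  have hb' : ball p r' ⊆ ball p (r / 2) := ball_subset_ball hrr'
  have hrem : ∀ x ∈ ball p r', x ∈ frontier E →
      |h x - h p - ⟪a, x - p⟫| ≤ (K + G * C) * r' ^ 2 := by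
    intro x hx hxE
    have hx' := hb' hx
    rw [hgh x (ball_subset_ball hr2.le (hsub hx')) hxE,
      hgh p (ball_subset_ball hr2.le hpr) hpE]
    have hconv : Convex ℝ (ball p r') := convex_ball p r'
    have h1 := hconv.norm_image_sub_le_of_norm_hasFDerivWithin_le' (𝕜 := ℝ) (f := g)
      (f' := fderiv ℝ g) (φ := fderiv ℝ g p) (C := K * r')
      (fun z _ => (hg.differentiable (by simp) z).hasFDerivAt.hasFDerivWithinAt)
      (fun z hz => (hrK z (hsub (hb' hz)) p hpr).trans (by
        have := mem_ball.1 hz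
        rw [dist_eq_norm] at this
        gcongr)) (mem_ball_self hr') hx
    have h2 := hc.inner_le_sq hx' hxE
    have hxn : ‖x - p‖ ≤ r' := by
      rw [← dist_eq_norm]; exact (mem_ball.1 hx).le
    have h3 : fderiv ℝ g p (x - p) = ⟪a, x - p⟫ + c * ⟪x - p, e⟫ := by
      rw [← inner_gradient_left, ha, inner_sub_left, real_inner_smul_left, real_inner_comm e]
      ring
    rw [h3, norm_eq_abs] at h1
    have h4 : |c * ⟪x - p, e⟫| ≤ G * (C * r' ^ 2) := by
      rw [abs_mul]
      gcongr
      exact h2.trans (by gcongr)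
    have h5 : K * r' * ‖x - p‖ ≤ K * r' ^ 2 := by
      rw [mul_assoc, sq]; gcongr
    calc |g x - g p - ⟪a, x - p⟫| =
        |(g x - g p - (⟪a, x - p⟫ + c * ⟪x - p, e⟫)) + c * ⟪x - p, e⟫| := by ring_nf
      _ ≤ K * r' ^ 2 + G * (C * r' ^ 2) := (abs_add_le _ _).trans (add_le_add (h1.trans h5) h4)
      _ = _ := by ring
  have hlin := hc.integral_inner_le hC hr' hrr' hCr' hae
  have hq := hc.setIntegral_le hC hr' hrr' hCr' (B := K + G * C) (by positivity) hrem
  have hfin := hE.isLocallyFiniteMeasure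
  have hi1 : IntegrableOn (fun x => ⟪a, x - p⟫) (ball p r') (area E) :=
    (Continuous.locallyIntegrable (by fun_prop)).integrableOn_isCompact (isCompact_closedBall p r')
      |>.mono_set ball_subset_closedBall
  have hi2 : IntegrableOn (fun x => h x - h p) (ball p r') (area E) := by
    have h1 : IntegrableOn (fun x => h x - h p) (frontier E ∩ closedBall p r')
        (area E) :=
      ((hh.continuousOn.sub continuousOn_const).mono inter_subset_left).integrableOn_compact
        ((isCompact_closedBall p r').inter_left isClosed_frontier)
    rw [← surfaceMeasure_restrict_frontier, IntegrableOn, Measure.restrict_restrict measurableSet_ball,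
      inter_comm]
    exact h1.mono_set (inter_subset_inter_right _ ball_subset_closedBall)
  have heq : ∫ x in ball p r', (h x - h p) ∂(area E) =
      (∫ x in ball p r', ⟪a, x - p⟫ ∂(area E)) +
        ∫ x in ball p r', (h x - h p - ⟪a, x - p⟫) ∂(area E) := by
    have h1 := integral_add hi1 (hi2.sub hi1)
    simp only [Pi.sub_apply] at h1
    rw [← h1]
    exact integral_congr_ae (.of_forall fun x => by simp)
  rw [heq, add_mul]
  refine (abs_add_le _ _).trans (add_le_add (hlin.trans ?_) hq)
  rw [← rpow_add_one_eq (one_le_of_norm_eq_one hc.norm_normal) r', ← mul_assoc, ← mul_assoc]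
  gcongr

/-- Shows that the second integrand of the Jacobi operator is nonnegative and, the normal being
Lipschitz, quadratic at `p` before division. -/
lemma inner_sub_normal_eq {u v : V} (hu : ‖u‖ = 1) (hv : ‖v‖ = 1) :
    ⟪u - v, u⟫ = ‖v - u‖ ^ 2 / 2 := by
  rw [norm_sub_sq_real, hu, hv, inner_sub_left, real_inner_self_eq_norm_sq, hu]; ring

/-- The smoothed integrand splits as `h x - h p` plus `h p * (1 - ⟪ν p, ν x⟫)`, and both parts have
integrals `O(r^(N+1))` over balls. The second part has a sign, so it is absolutely integrable
against the kernel and its principal value is an ordinary integral. -/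
lemma HasSmoothBoundary.jacobi_estimates (hE : HasSmoothBoundary E) {s : ℝ}
    (hs0 : 0 < s) (hs1 : s < 1)
    (hArea : Integrable (fun x : V => (1 + ‖x‖) ^ (-(N + s))) (area E))
    {h : V → ℝ} (hh : SmoothOnSurface (frontier E) h) {M : ℝ} (hM : ∀ x ∈ frontier E, |h x| ≤ M)
    {p₀ : V} (hp₀ : p₀ ∈ frontier E) :
    ∃ ρ > 0, ∃ B : ℝ, ∀ p ∈ ball p₀ ρ, p ∈ frontier E →
      FractionalJacobiExists s E h p ∧
      Tendsto (fun δ => smoothedJacobi s E h δ p) (𝓝[>] 0) (𝓝 (fractionalJacobi s E h p)) ∧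
      ∀ δ > 0, |smoothedJacobi s E h δ p| ≤ B := by
  have := hE.isLocallyFiniteMeasure
  obtain ⟨ρ, hρ, C, hC, B₁, hCρ, H⟩ := hE.integral_sub_estimate hh hp₀
  set β := (N : ℝ) + s with hβdef
  have hβ : 0 ≤ β := by positivity
  set I := ∫ x : V, (1 + ‖x‖) ^ (-β) ∂(area E)
  have hI : 0 ≤ I := integral_nonneg fun x => by positivity
  have hM0 : 0 ≤ M := (abs_nonneg _).trans (hM p₀ hp₀)
  set T := ρ ^ (1 - s) + β * (ρ ^ (1 - s) / (1 - s))
  set A := (1 + (1 + (‖p₀‖ + ρ)) / ρ) ^ β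
  set B₂ := 2 ^ (N - 1) * crossSection N * (C ^ 2 / 2)
  refine ⟨ρ, hρ, (B₁ * T + 2 * M * A * I) + M * (B₂ * T + 2 * A * I), fun p hp hpE => ?_⟩
  obtain ⟨hc, hB₁⟩ := H p hp hpE
  set ν := nu E with hν
  have hν1 : ∀ x ∈ frontier E, ‖ν x‖ = 1 := fun x hx => hE.norm_exteriorNormal hx
  set f₂ : V → ℝ := fun x => ‖ν x - ν p‖ ^ 2 / 2 with hf₂
  have hf₁m : AEStronglyMeasurable (fun x => h x - h p) (area E) :=
    HasSmoothBoundary.aestronglyMeasurable_surface (hh.continuousOn.sub continuousOn_const)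
  have hf₂m : AEStronglyMeasurable f₂ (area E) :=
    HasSmoothBoundary.aestronglyMeasurable_surface
      ((((hE.continuousOn_exteriorNormal.sub continuousOn_const).norm).pow 2).div_const 2)
  have hf₂F : ∀ r, 0 < r → r ≤ ρ →
      |∫ x in ball p r, f₂ x ∂(area E)| ≤ B₂ * r ^ ((N : ℝ) + 1) := by
    intro r hr hrρ
    refine hc.setIntegral_le hC hr hrρ (by nlinarith) (B := C ^ 2 / 2) (by positivity) ?_
    intro x hx hxE
    have h1 := hc.normal_le x (ball_subset_ball hrρ hx) hxE
    have h2 : ‖x - p‖ ≤ r := by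
      rw [← dist_eq_norm]; exact (mem_ball.1 hx).le
    rw [hf₂, abs_of_nonneg (by positivity)]
    have h3 : ‖ν x - ν p‖ ≤ C * r := h1.trans (by gcongr)
    have h4 : ‖ν x - ν p‖ ^ 2 ≤ (C * r) ^ 2 := by gcongr
    linarith [mul_pow C r 2]
  obtain ⟨a1, a2, a3⟩ := exists_principalValue (M := 2 * M) hρ hs0 hs1 hArea hf₁m (by positivity)
    ((ae_mem_frontier E).mono fun x hx => by
      refine (abs_sub _ _).trans ?_
      linarith [hM x hx, hM p hpE]) hB₁
  obtain ⟨b1, b2, b3⟩ := exists_principalValue (M := 2) hρ hs0 hs1 hArea hf₂m (by positivity)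
    ((ae_mem_frontier E).mono fun x hx => by
      have h1 := norm_sub_le (ν x) (ν p)
      rw [hν1 x hx, hν1 p hpE] at h1
      rw [hf₂, abs_of_nonneg (by positivity)]
      nlinarith [norm_nonneg (ν x - ν p)]) hf₂F
  have hj1 : jacobiIntegrand₁ s h p = fun x => (h x - h p) / ‖x - p‖ ^ β := by
    funext x; rw [jacobiIntegrand₁, norm_sub_rev]
  have hj2 : ∀ᵐ x ∂(area E), f₂ x / ‖x - p‖ ^ β = jacobiIntegrand₂ s E p x := by
    filter_upwards [ae_mem_frontier E] with x hx
    rw [jacobiIntegrand₂, norm_sub_rev, inner_sub_normal_eq (hν1 p hpE) (hν1 x hx)]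
  have hi2 : Integrable (fun x => f₂ x / ‖x - p‖ ^ β) (area E) := by
    rw [← integrableOn_univ, ← union_compl_self (ball p ρ)]
    refine (integrableOn_div_radial hρ hs0 hs1 ?_ (fun x => by positivity) (by simp [hf₂])
      (fun r hr hrρ => (le_abs_self _).trans (hf₂F r hr hrρ))).1.union (b1.1 ρ hρ)
    refine Measure.integrableOn_of_bounded (M := 2) measure_ball_lt_top.ne hf₂m ?_
    refine ae_restrict_of_ae ((ae_mem_frontier E).mono fun x hx => ?_)
    have h1 := norm_sub_le (ν x) (ν p)
    rw [hν1 x hx, hν1 p hpE] at h1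
    rw [hf₂, norm_of_nonneg (by positivity)]
    nlinarith [norm_nonneg (ν x - ν p)]
  have hpv2 : principalValue (area E) p (fun x => f₂ x / ‖x - p‖ ^ β) =
      ∫ x, jacobiIntegrand₂ s E p x ∂(area E) := by
    rw [← integral_congr_ae hj2]
    refine tendsto_nhds_unique b2 ?_
    refine tendsto_integral_filter_of_dominated_convergence _
      (.of_forall fun δ => hf₂m.mul
        ((measurable_kern β δ).comp (measurable_id.sub_const p)).aestronglyMeasurable)
      (.of_forall fun δ => Eventually.of_forall fun x => ?_) hi2
      (.of_forall fun x => ?_)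
    · rw [norm_of_nonneg (mul_nonneg (by positivity) (kern_nonneg _ _ _)),
        div_eq_mul_one_div]
      by_cases hx : x = p
      · simp [hf₂, hx]
      · gcongr
        exact kern_le hβ δ (sub_ne_zero.2 hx)
    · by_cases hx : x = p
      · simp [hf₂, hx]
      · rw [div_eq_mul_one_div]
        exact (tendsto_kern β (sub_ne_zero.2 hx)).const_mul _
  have hsplit : ∀ δ > 0, smoothedJacobi s E h δ p =
      (∫ x, (h x - h p) * kern β δ (x - p) ∂(area E)) +
        h p * ∫ x, f₂ x * kern β δ (x - p) ∂(area E) := by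
    intro δ hδ
    rw [smoothedJacobi, ← integral_const_mul, ← integral_add (a3 δ hδ).1 ((b3 δ hδ).1.const_mul _)]
    refine integral_congr_ae ((ae_mem_frontier E).mono fun x hx => ?_)
    simp only [hf₂]
    rw [← inner_sub_normal_eq (hν1 p hpE) (hν1 x hx), inner_sub_left, real_inner_self_eq_norm_sq,
      hν1 p hpE, real_inner_comm (ν p) (ν x)]
    ring
  refine ⟨⟨by rw [hj1]; exact a1, hi2.congr hj2⟩, ?_, fun δ hδ => ?_⟩
  · have h1 := a2.add (b2.const_mul (h p))
    rw [hpv2] at h1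
    rw [fractionalJacobi, hj1]
    refine h1.congr' ?_
    filter_upwards [self_mem_nhdsWithin] with δ hδ
    exact (hsplit δ hδ).symm
  · rw [hsplit δ hδ]
    have hA : (1 + (1 + ‖p‖) / ρ) ^ β ≤ A := factor_le hρ hβ hp
    refine (abs_add_le _ _).trans (add_le_add ((a3 δ hδ).2.trans ?_) ?_)
    · gcongr
    · rw [abs_mul]
      refine mul_le_mul (hM p hpE) ((b3 δ hδ).2.trans ?_) (abs_nonneg _) hM0
      gcongr

/-! ### Derivatives and decay of the smoothed kernel -/

/-- A factor `‖w‖² + δ²` becomes a shift of the exponent. This bounds the first and second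
derivatives by multiples of the kernel itself, with constants depending on `δ`. -/
lemma kern_add_two (β : ℝ) {δ : ℝ} (hδ : 0 < δ) (w : V) :
    kern (β + 2) δ w * (‖w‖ ^ 2 + δ ^ 2) = kern β δ w := by
  have h : 0 < ‖w‖ ^ 2 + δ ^ 2 := by positivity
  rw [kern, ← Real.rpow_add_one h.ne', kern]
  congr 1; ring

/-- Both `‖y - x‖` and `δ` are at most `q = √(‖y - x‖² + δ²)`, so `1 + ‖y‖` is at most a constant
times `q`. -/
lemma kern_le_japanese {β : ℝ} (hβ : 0 ≤ β) {δ : ℝ} (hδ : 0 < δ) (x y : V) :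
    kern β δ (y - x) ≤ (1 + (1 + ‖x‖) / δ) ^ β * (1 + ‖y‖) ^ (-β) := by
  set q := √(‖y - x‖ ^ 2 + δ ^ 2) with hq
  have hq0 : 0 < q := Real.sqrt_pos.2 (by positivity)
  have hqsq : q ^ 2 = ‖y - x‖ ^ 2 + δ ^ 2 := Real.sq_sqrt (by positivity)
  have h1 : ‖y - x‖ ≤ q := by nlinarith [norm_nonneg (y - x), sq_nonneg δ]
  have h2 : δ ≤ q := by nlinarith [sq_nonneg ‖y - x‖]
  rw [kern, ← hqsq, sq_rpow_neg_half hq0.le]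
  have h3 : 1 + ‖y‖ ≤ (1 + (1 + ‖x‖) / δ) * q := by
    have h4 : ‖y‖ ≤ ‖y - x‖ + ‖x‖ := by simpa using norm_add_le (y - x) x
    have h5 : 1 + ‖x‖ ≤ (1 + ‖x‖) / δ * q := by
      rw [div_mul_eq_mul_div, le_div_iff₀ hδ]; gcongr
    linarith
  rw [rpow_neg hq0.le, rpow_neg (by positivity), ← div_eq_mul_inv,
    le_div_iff₀ (by positivity), inv_mul_le_iff₀ (by positivity), mul_comm (q ^ β),
    ← Real.mul_rpow (by positivity) hq0.le]
  exact Real.rpow_le_rpow (by positivity) h3 hβ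

lemma hasFDerivAt_kern (β : ℝ) {δ : ℝ} (hδ : 0 < δ) (w : V) :
    HasFDerivAt (kern β δ) ((-β * kern (β + 2) δ w) • innerSL ℝ w) w := by
  have h1 : HasFDerivAt (fun w : V => ‖w‖ ^ 2 + δ ^ 2) (2 • innerSL ℝ w) w :=
    (hasStrictFDerivAt_norm_sq w).hasFDerivAt.add_const _
  have h2 := h1.rpow_const (p := -(β / 2)) (Or.inl (by positivity))
  refine h2.congr_fderiv ?_
  ext v
  have : -(β / 2) - 1 = -((β + 2) / 2) := by ring
  simp only [smul_apply, smul_eq_mul, kern, this, nsmul_eq_mul, Nat.cast_ofNat]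
  ring

lemma fderiv_kern (β : ℝ) {δ : ℝ} (hδ : 0 < δ) (w v : V) :
    fderiv ℝ (kern β δ) w v = -β * kern (β + 2) δ w * ⟪w, v⟫ := by
  rw [(hasFDerivAt_kern β hδ w).fderiv]
  simp

lemma kern_add_two_le (β : ℝ) {δ : ℝ} (hδ : 0 < δ) (w : V) :
    kern (β + 2) δ w ≤ kern β δ w / δ ^ 2 := by
  rw [le_div_iff₀ (by positivity), ← kern_add_two β hδ]
  have := kern_nonneg (β + 2) δ w
  gcongr
  nlinarith [sq_nonneg ‖w‖]

lemma kern_add_two_mul_norm_le (β : ℝ) {δ : ℝ} (hδ : 0 < δ) (w : V) :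
    kern (β + 2) δ w * ‖w‖ ≤ kern β δ w / δ := by
  rw [le_div_iff₀ hδ, ← kern_add_two β hδ, mul_assoc]
  have := kern_nonneg (β + 2) δ w
  gcongr
  nlinarith [sq_nonneg (‖w‖ - δ)]

lemma abs_fderiv_kern_le {β : ℝ} (hβ : 0 ≤ β) {δ : ℝ} (hδ : 0 < δ) (w v : V) :
    |fderiv ℝ (kern β δ) w v| ≤ β / δ * kern β δ w * ‖v‖ := by
  rw [fderiv_kern β hδ, abs_mul, abs_mul, abs_neg, abs_of_nonneg hβ,
    abs_of_nonneg (kern_nonneg _ _ _)]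
  have h1 := kern_add_two_mul_norm_le β hδ w
  have h2 := abs_real_inner_le_norm w v
  have h3 := kern_nonneg (β + 2) δ w
  calc β * kern (β + 2) δ w * |⟪w, v⟫|
      ≤ β * kern (β + 2) δ w * (‖w‖ * ‖v‖) := by gcongr
    _ = β * (kern (β + 2) δ w * ‖w‖) * ‖v‖ := by ring
    _ ≤ β * (kern β δ w / δ) * ‖v‖ := by gcongr
    _ = _ := by ring

lemma fderiv_fderiv_kern (β : ℝ) {δ : ℝ} (hδ : 0 < δ) (w v u : V) :
    fderiv ℝ (fderiv ℝ (kern β δ)) w v u =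
      -β * (kern (β + 2) δ w * ⟪v, u⟫ -
        (β + 2) * kern (β + 2 + 2) δ w * ⟪w, v⟫ * ⟪w, u⟫) := by
  have hd : DifferentiableAt ℝ (fderiv ℝ (kern β δ : V → ℝ)) w :=
    ((contDiff_kern β hδ).fderiv_right (m := ((⊤ : ℕ∞) : WithTop ℕ∞)) (by simp)).differentiable
      (by simp) w
  have h1 : fderiv ℝ (fun w => fderiv ℝ (kern β δ) w u) w v =
      fderiv ℝ (fderiv ℝ (kern β δ)) w v u := by
    rw [fderiv_clm_apply hd (differentiableAt_const u)]
    simp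
  rw [← h1]
  have h2 : (fun w => fderiv ℝ (kern β δ) w u) =
      fun w => -β * (kern (β + 2) δ w * ⟪w, u⟫) := by
    funext w; rw [fderiv_kern β hδ]; ring
  have h3 : HasFDerivAt (fun w : V => ⟪w, u⟫) (innerSL ℝ u) w := by
    have := (innerSL ℝ u).hasFDerivAt (x := w)
    refine this.congr_of_eventuallyEq (.of_forall fun w => ?_)
    simp [real_inner_comm]
  have h4 := ((hasFDerivAt_kern (β + 2) hδ w).mul h3).const_mul (-β)
  have h5 : fderiv ℝ (fun w : V => -β * (kern (β + 2) δ w * ⟪w, u⟫)) w = _ := h4.fderiv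
  rw [h2, h5]
  simp only [smul_apply, add_apply, innerSL_apply_apply, smul_eq_mul]
  rw [real_inner_comm v u]
  ring

lemma abs_fderiv_fderiv_kern_le {β : ℝ} (hβ : 0 ≤ β) {δ : ℝ} (hδ : 0 < δ) (w v u : V) :
    |fderiv ℝ (fderiv ℝ (kern β δ)) w v u| ≤
      β * (β + 3) / δ ^ 2 * kern β δ w * (‖v‖ * ‖u‖) := by
  rw [fderiv_fderiv_kern β hδ, abs_mul, abs_neg, abs_of_nonneg hβ]
  set k := kern β δ w
  set k2 := kern (β + 2) δ w
  set k4 := kern (β + 2 + 2) δ w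
  have hk2 : 0 ≤ k2 := kern_nonneg _ _ _
  have hk4 : 0 ≤ k4 := kern_nonneg _ _ _
  have h1 : k2 ≤ k / δ ^ 2 := kern_add_two_le β hδ w
  have h2 : k4 * ‖w‖ ^ 2 ≤ k2 := by
    have h := kern_add_two (β + 2) hδ w
    change k4 * _ = k2 at h
    nlinarith [mul_nonneg hk4 (sq_nonneg δ)]
  have hvu := abs_real_inner_le_norm v u
  have hwv := abs_real_inner_le_norm w v
  have hwu := abs_real_inner_le_norm w u
  have h3 : |k2 * ⟪v, u⟫ - (β + 2) * k4 * ⟪w, v⟫ * ⟪w, u⟫| ≤ (β + 3) * k2 * (‖v‖ * ‖u‖) := by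
    refine (abs_sub _ _).trans ?_
    rw [abs_mul, abs_mul, abs_mul, abs_of_nonneg hk2, abs_of_nonneg (by positivity : 0 ≤ (β + 2) * k4)]
    calc k2 * |⟪v, u⟫| + (β + 2) * k4 * |⟪w, v⟫| * |⟪w, u⟫|
        ≤ k2 * (‖v‖ * ‖u‖) + (β + 2) * k4 * (‖w‖ * ‖v‖) * (‖w‖ * ‖u‖) := by gcongr
      _ = k2 * (‖v‖ * ‖u‖) + (β + 2) * (k4 * ‖w‖ ^ 2) * (‖v‖ * ‖u‖) := by ring
      _ ≤ k2 * (‖v‖ * ‖u‖) + (β + 2) * k2 * (‖v‖ * ‖u‖) := by gcongr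
      _ = _ := by ring
  calc β * |k2 * ⟪v, u⟫ - (β + 2) * k4 * ⟪w, v⟫ * ⟪w, u⟫|
      ≤ β * ((β + 3) * (k / δ ^ 2) * (‖v‖ * ‖u‖)) := by
        gcongr
        exact h3.trans (by gcongr)
    _ = _ := by ring

/-! ### Gauss' formula for decaying functions and with signs -/

/-- The whole space has empty boundary; applied to it, the formulas for sets say that derivatives
and divergences have integral zero. -/
lemma hasSmoothBoundary_univ : HasSmoothBoundary (univ : Set V) :=
  ⟨isOpen_univ, fun p hp => by rw [frontier_univ] at hp; exact hp.elim⟩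

lemma surfaceMeasure_univ : area (univ : Set V) = 0 := by
  rw [surfaceMeasure, frontier_univ, Measure.restrict_empty]

/-- Cut off by `χ (x / (n + 1))` and let `n → ∞`. The derivative of the cutoff is `O(1 / (n + 1))`,
and the decay dominates everything both in the space and on the surface. -/
lemma HasSmoothBoundary.gauss_of_decay (hE : HasSmoothBoundary E) {s : ℝ}
    (hs0 : 0 < s)
    (hArea : Integrable (fun x : V => (1 + ‖x‖) ^ (-(N + s))) (area E))
    (b : V) {f : V → ℝ} (hf : ContDiff ℝ 1 f) {A : ℝ}
    (h0 : ∀ x, |f x| ≤ A * (1 + ‖x‖) ^ (-(N + s)))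
    (h1 : ∀ x, |fderiv ℝ f x b| ≤ A * (1 + ‖x‖) ^ (-(N + s))) :
    Integrable (fun x => fderiv ℝ f x b) ∧
    Integrable (fun x => f x * ⟪nu E x, b⟫) (area E) ∧
    ∫ x in E, fderiv ℝ f x b = ∫ x, f x * ⟪nu E x, b⟫ ∂(area E) := by
  set β := (N : ℝ) + s
  have hA : 0 ≤ A := by
    have := (abs_nonneg _).trans (h0 0)
    rw [norm_zero, add_zero, Real.one_rpow, mul_one] at this
    exact this
  have hfd : Continuous fun x => fderiv ℝ f x b := (hf.continuous_fderiv (by simp)).clm_apply continuous_const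
  have hi1 : Integrable (fun x => fderiv ℝ f x b) :=
    ((integrable_japanese hs0).const_mul A).mono' hfd.aestronglyMeasurable
      (.of_forall h1)
  have hνm : AEStronglyMeasurable (fun x => ⟪nu E x, b⟫) (area E) :=
    HasSmoothBoundary.aestronglyMeasurable_surface (hE.continuousOn_inner_normal b)
  have hνb : ∀ᵐ x ∂(area E), |⟪nu E x, b⟫| ≤ ‖b‖ := by
    filter_upwards [ae_mem_frontier E] with x hx
    refine (abs_real_inner_le_norm _ _).trans ?_
    rw [hE.norm_exteriorNormal hx, one_mul]
  have hi2' : Integrable (fun x => A * (1 + ‖x‖) ^ (-β) * ‖b‖) (area E) :=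
    (hArea.const_mul A).mul_const _
  have hi2 : Integrable (fun x => f x * ⟪nu E x, b⟫) (area E) := by
    refine hi2'.mono' (hf.continuous.aestronglyMeasurable.mul hνm) (hνb.mono fun x hx => ?_)
    rw [norm_mul, norm_eq_abs, norm_eq_abs]
    exact mul_le_mul (h0 x) hx (abs_nonneg _) (by positivity)
  refine ⟨hi1, hi2, ?_⟩
  let χ : ContDiffBump (0 : V) := ⟨1, 2, one_pos, one_lt_two⟩
  have hχ : ContDiff ℝ 1 χ := χ.contDiff
  have hχ1 : ∀ x, |χ x| ≤ 1 := fun x => by rw [abs_of_nonneg χ.nonneg]; exact χ.le_one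
  obtain ⟨D, hD⟩ := (χ.hasCompactSupport.fderiv (𝕜 := ℝ)).exists_bound_of_continuous
    (hχ.continuous_fderiv (by simp))
  have hD0 : 0 ≤ D := (norm_nonneg _).trans (hD 0)
  set c : ℕ → ℝ := fun n => 1 / ((n : ℝ) + 1)
  have hc0 : ∀ n, 0 < c n := fun n => by positivity
  have hc1 : ∀ n, c n ≤ 1 := fun n => by
    rw [div_le_one (by positivity)]; linarith [n.cast_nonneg (α := ℝ)]
  have hclim : Tendsto c atTop (𝓝 0) := tendsto_one_div_add_atTop_nhds_zero_nat
  set g : ℕ → V → ℝ := fun n x => χ (c n • x)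
  have hg : ∀ n, ContDiff ℝ 1 (g n) := fun n => hχ.comp (contDiff_const_smul (c n))
  have hgc : ∀ n, HasCompactSupport (g n) := fun n =>
    χ.hasCompactSupport.comp_isClosedEmbedding (Homeomorph.smulOfNeZero (c n) (hc0 n).ne').isClosedEmbedding
  have hgd : ∀ n x, fderiv ℝ (g n) x b = c n * fderiv ℝ χ (c n • x) b := by
    intro n x
    have h2 : HasFDerivAt (fun x : V => c n • x) (c n • ContinuousLinearMap.id ℝ V) x :=
      (hasFDerivAt_id x).const_smul (c n)
    have h3 := (hχ.differentiable (by simp) (c n • x)).hasFDerivAt.comp x h2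
    have h4 : fderiv ℝ (g n) x = _ := h3.fderiv
    rw [h4]
    simp
  have hgd' : ∀ n x, |fderiv ℝ (g n) x b| ≤ c n * (D * ‖b‖) := fun n x => by
    rw [hgd, abs_mul, abs_of_pos (hc0 n)]
    have := (fderiv ℝ χ (c n • x)).le_of_opNorm_le (hD _) b
    exact mul_le_mul_of_nonneg_left this (hc0 n).le
  have hg1 : ∀ x, ∀ᶠ n in atTop, g n x = 1 := by
    intro x
    have h2 : Tendsto (fun n => c n • x) atTop (𝓝 0) := by
      simpa using hclim.smul_const x
    filter_upwards [h2.eventually (Metric.closedBall_mem_nhds 0 one_pos)] with n hn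
    exact χ.one_of_mem_closedBall hn
  have hdprod : ∀ n x, fderiv ℝ (fun x => g n x * f x) x b =
      g n x * fderiv ℝ f x b + f x * fderiv ℝ (g n) x b := by
    intro n x
    rw [fderiv_fun_mul ((hg n).differentiable (by simp) x) (hf.differentiable (by simp) x)]
    simp
  have key : ∀ n, ∫ x in E, (g n x * fderiv ℝ f x b + f x * fderiv ℝ (g n) x b) =
      ∫ x, g n x * f x * ⟪nu E x, b⟫ ∂(area E) := by
    intro n
    rw [← hE.gauss b ((hg n).mul hf) ((hgc n).mul_right)]
    exact integral_congr_ae (.of_forall fun x => (hdprod n x).symm)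
  have lim1 : Tendsto (fun n => ∫ x in E, (g n x * fderiv ℝ f x b + f x * fderiv ℝ (g n) x b)) atTop
      (𝓝 (∫ x in E, fderiv ℝ f x b)) := by
    refine tendsto_integral_of_dominated_convergence
      (fun x => A * (1 + ‖x‖) ^ (-β) + A * (1 + ‖x‖) ^ (-β) * (D * ‖b‖)) (fun n => ?_) ?_ (fun n => ?_) ?_
    · exact (((hg n).continuous.mul hfd).add (hf.continuous.mul
        (((hg n).continuous_fderiv (by simp)).clm_apply continuous_const))).aestronglyMeasurable
    · have := (integrable_japanese (N := N) hs0).const_mul A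
      exact (this.add (this.mul_const _)).integrableOn
    · refine Eventually.of_forall fun x => (norm_add_le _ _).trans ?_
      rw [norm_mul, norm_mul, norm_eq_abs, norm_eq_abs, norm_eq_abs, norm_eq_abs]
      refine add_le_add ?_ ?_
      · have := mul_le_mul (hχ1 (c n • x)) (h1 x) (abs_nonneg _) zero_le_one
        rwa [one_mul] at this
      · refine mul_le_mul (h0 x) ((hgd' n x).trans ?_) (abs_nonneg _) (by positivity)
        exact mul_le_of_le_one_left (by positivity) (hc1 n)
    · refine Eventually.of_forall fun x => ?_
      have h2 : Tendsto (fun n => g n x * fderiv ℝ f x b) atTop (𝓝 (fderiv ℝ f x b)) :=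
        tendsto_const_nhds.congr' ((hg1 x).mono fun n hn => by simp only [hn, one_mul])
      have h3 : Tendsto (fun n => f x * fderiv ℝ (g n) x b) atTop (𝓝 (f x * 0)) := by
        refine Tendsto.const_mul _ ?_
        refine squeeze_zero_norm (hgd' · x) ?_
        simpa using hclim.mul_const (D * ‖b‖)
      simpa using h2.add h3
  have lim2 : Tendsto (fun n => ∫ x, g n x * f x * ⟪nu E x, b⟫ ∂(area E)) atTop
      (𝓝 (∫ x, f x * ⟪nu E x, b⟫ ∂(area E))) := by
    refine tendsto_integral_of_dominated_convergence _ (fun n => ?_) hi2.norm (fun n => ?_) ?_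
    · exact ((hg n).continuous.mul hf.continuous).aestronglyMeasurable.mul hνm
    · refine Eventually.of_forall fun x => ?_
      rw [mul_assoc, norm_mul]
      exact mul_le_of_le_one_left (norm_nonneg _) (hχ1 _)
    · refine Eventually.of_forall fun x => tendsto_const_nhds.congr' ?_
      filter_upwards [hg1 x] with n hn
      rw [hn, one_mul]
  exact tendsto_nhds_unique (lim1.congr key) lim2

lemma integral_sgnInd_mul (hE : MeasurableSet E) {f : V → ℝ}
    (hf : Integrable f) : ∫ x, sgnInd E x * f x = 2 * (∫ x in E, f x) - ∫ x, f x := by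
  have h : ∀ x, sgnInd E x * f x = 2 * E.indicator f x - f x := by
    intro x
    by_cases hx : x ∈ E
    · rw [sgnInd_of_mem hx, indicator_of_mem hx]; ring
    · rw [sgnInd_of_notMem hx, indicator_of_notMem hx]; ring
  simp_rw [h]
  rw [integral_sub ((hf.indicator hE).const_mul 2) hf, integral_const_mul, integral_indicator hE]

lemma HasSmoothBoundary.signed_gauss_of_decay (hE : HasSmoothBoundary E) {s : ℝ}
    (hs0 : 0 < s)
    (hArea : Integrable (fun x : V => (1 + ‖x‖) ^ (-(N + s))) (area E))
    (b : V) {f : V → ℝ} (hf : ContDiff ℝ 1 f) {A : ℝ}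
    (h0 : ∀ x, |f x| ≤ A * (1 + ‖x‖) ^ (-(N + s)))
    (h1 : ∀ x, |fderiv ℝ f x b| ≤ A * (1 + ‖x‖) ^ (-(N + s))) :
    ∫ x, sgnInd E x * fderiv ℝ f x b =
      2 * ∫ x, f x * ⟪nu E x, b⟫ ∂(area E) := by
  obtain ⟨i1, -, e1⟩ := hE.gauss_of_decay hs0 hArea b hf h0 h1
  obtain ⟨-, -, e2⟩ := (hasSmoothBoundary_univ (N := N)).gauss_of_decay hs0
    (by rw [surfaceMeasure_univ]; exact integrable_zero_measure) b hf h0 h1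
  rw [surfaceMeasure_univ, integral_zero_measure, setIntegral_univ] at e2
  rw [integral_sgnInd_mul hE.1.measurableSet i1, e1, e2, sub_zero]

lemma integrable_divergence {Z : V → V} (hZ : ContDiff ℝ 1 Z) (hZc : HasCompactSupport Z) :
    Integrable (divergence Z) := by
  have hcont : Continuous (divergence Z) :=
    (LinearMap.continuous_of_finiteDimensional
      ((LinearMap.trace ℝ V) ∘ₗ (ContinuousLinearMap.coeLM ℝ : (V →L[ℝ] V) →ₗ[ℝ] _))).comp
      (hZ.continuous_fderiv (by simp))
  refine hcont.integrable_of_hasCompactSupport ((hZc.fderiv (𝕜 := ℝ)).mono fun x hx => ?_)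
  rw [Function.mem_support] at hx ⊢
  intro h
  exact hx (by rw [divergence, h]; simp)

lemma integral_divergence_eq_zero {Z : V → V} (hZ : ContDiff ℝ 1 Z) (hZc : HasCompactSupport Z) :
    ∫ x, divergence Z x = 0 := by
  have := (hasSmoothBoundary_univ (N := N)).divergence_theorem hZ hZc
  rwa [surfaceMeasure_univ, integral_zero_measure, setIntegral_univ] at this

lemma HasSmoothBoundary.divergence_theorem_compl (hE : HasSmoothBoundary E)
    {Z : V → V} (hZ : ContDiff ℝ 1 Z) (hZc : HasCompactSupport Z) :
    ∫ x in Eᶜ, divergence Z x = -∫ x, ⟪Z x, nu E x⟫ ∂(area E) := by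
  have h := integral_add_compl hE.1.measurableSet (integrable_divergence hZ hZc)
  rw [hE.divergence_theorem hZ hZc, integral_divergence_eq_zero hZ hZc] at h
  linarith

lemma HasSmoothBoundary.signed_divergence_theorem (hE : HasSmoothBoundary E)
    {Z : V → V} (hZ : ContDiff ℝ 1 Z) (hZc : HasCompactSupport Z) :
    ∫ x, sgnInd E x * divergence Z x =
      2 * ∫ x, ⟪Z x, nu E x⟫ ∂(area E) := by
  rw [integral_sgnInd_mul hE.1.measurableSet (integrable_divergence hZ hZc),
    hE.divergence_theorem hZ hZc, integral_divergence_eq_zero hZ hZc, sub_zero]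

/-! ### Finiteness of the localized perimeter -/

/-- The set swept out by `A` when it is translated along `w`. -/
def sweep (A : Set R^N) (w : R^N) :
    Set R^N :=
  {x | ∃ y ∈ A, ∃ τ ∈ Icc (0 : ℝ) 1, x = y + τ • w}

/-- Seen from a point of `A`, the sweep lies in a cylinder of height `3 ‖w‖` over the projection of
`A` along `w`, and projections do not increase Hausdorff measure. -/
lemma volume_sweep_le_of_diam {A : Set V} {w : V} (hw : w ≠ 0)
    (hA : ∀ x ∈ A, ∀ y ∈ A, ‖x - y‖ ≤ ‖w‖) :
    volume (sweep A w) ≤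
      euclideanHausdorffMeasure (N - 1) A * ofReal (3 * ‖w‖) := by
  rcases A.eq_empty_or_nonempty with rfl | ⟨a, ha⟩
  · have : sweep (∅ : Set V) w = ∅ := by ext x; simp [sweep]
    simp [this]
  have hw0 : 0 < ‖w‖ := norm_pos_iff.2 hw
  set e := ‖w‖⁻¹ • w with he'
  have he : ‖e‖ = 1 := by
    rw [he', norm_smul, norm_inv, norm_norm, inv_mul_cancel₀ hw0.ne']
  have hwe : w = ‖w‖ • e := by rw [he', smul_smul, mul_inv_cancel₀ hw0.ne', one_smul]
  set P : V → (ℝ ∙ e)ᗮ := fun x => projLine e (x - a)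
  have hsub : sweep A w ⊆ lineEquiv e he a '' (P '' A) ×ˢ Icc (-‖w‖) (2 * ‖w‖) := by
    rintro x ⟨y, hy, τ, hτ, rfl⟩
    refine ⟨(P y, ⟪y - a, e⟫ + τ * ‖w‖), ⟨⟨y, hy, rfl⟩, ?_⟩, ?_⟩
    · have h1 := abs_real_inner_le_norm (y - a) e
      rw [he, mul_one] at h1
      have h2 := abs_le.1 (h1.trans (hA y hy a ha))
      have h3 : τ * ‖w‖ ≤ ‖w‖ := mul_le_of_le_one_left hw0.le hτ.2
      have h4 : 0 ≤ τ * ‖w‖ := mul_nonneg hτ.1 hw0.le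
      constructor <;> simp only <;> linarith
    · rw [lineEquiv_apply]
      simp only
      rw [add_smul, ← add_assoc, add_assoc a, projLine_add_inner he, add_sub_cancel, mul_smul, ← hwe]
  have hlip : LipschitzOnWith 1 P A := by
    refine LipschitzOnWith.of_dist_le_mul fun x _ y _ => ?_
    rw [dist_eq_norm, dist_eq_norm, NNReal.coe_one, one_mul]
    simp only [P]
    rw [← map_sub, sub_sub_sub_cancel_right]
    exact norm_projLine_le _
  have h1 := LipschitzOnWith.euclideanHausdorffMeasure_image_le hlip (N - 1)
  rw [ENNReal.coe_one, one_pow, one_mul, ← volume_orthogonal_eq he] at h1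
  refine (measure_mono hsub).trans ?_
  rw [volume_image_lineEquiv_prod, Real.volume_Icc]
  gcongr
  linarith

lemma exists_countable_partition {r : ℝ} (hr : 0 < r) :
    ∃ D : ℕ → Set V, (∀ n, MeasurableSet (D n)) ∧ Pairwise (Function.onFun Disjoint D) ∧
      (⋃ n, D n) = univ ∧ ∀ n, ∃ c, D n ⊆ ball c r := by
  refine ⟨disjointed fun n => ball (TopologicalSpace.denseSeq V n) r,
    fun n => MeasurableSet.disjointed (fun n => measurableSet_ball) n, disjoint_disjointed _, ?_,
    fun n => ⟨_, disjointed_subset _ n⟩⟩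
  rw [iUnion_disjointed, eq_univ_iff_forall]
  intro x
  obtain ⟨n, hn⟩ := (TopologicalSpace.denseRange_denseSeq V).exists_dist_lt x hr
  exact mem_iUnion.2 ⟨n, hn⟩

/-- The bound is additive over a partition of `A` into pieces of diameter at most `‖w‖`. -/
lemma volume_sweep_le {A : Set V} (hA : MeasurableSet A) {w : V} (hw : w ≠ 0) :
    volume (sweep A w) ≤
      euclideanHausdorffMeasure (N - 1) A * ofReal (3 * ‖w‖) := by
  obtain ⟨D, hDm, hDd, hDu, hDb⟩ := exists_countable_partition (N := N)
    (half_pos (norm_pos_iff.2 hw))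
  have hsub : sweep A w ⊆ ⋃ n, sweep (A ∩ D n) w := by
    rintro x ⟨y, hy, τ, hτ, rfl⟩
    obtain ⟨n, hn⟩ := mem_iUnion.1 (hDu ▸ mem_univ y)
    exact mem_iUnion.2 ⟨n, y, ⟨hy, hn⟩, τ, hτ, rfl⟩
  have hAe : euclideanHausdorffMeasure (N - 1) A =
      ∑' n, euclideanHausdorffMeasure (N - 1) (A ∩ D n) := by
    rw [← measure_iUnion (fun i j hij => (hDd hij).mono inter_subset_right inter_subset_right)
      (fun n => hA.inter (hDm n)), ← inter_iUnion, hDu, inter_univ]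
  rw [hAe, ← ENNReal.tsum_mul_right]
  refine (measure_mono hsub).trans ((measure_iUnion_le _).trans (ENNReal.tsum_le_tsum fun n => ?_))
  refine volume_sweep_le_of_diam hw fun x hx y hy => ?_
  obtain ⟨c, hc⟩ := hDb n
  have h1 := mem_ball.1 (hc hx.2)
  have h2 := mem_ball.1 (hc hy.2)
  rw [← dist_eq_norm]
  linarith [dist_triangle_right x y c]

/-- The pairs of points on different sides of `∂E` that interact in the perimeter localized to `Ω`. -/
def crossingPairs (E Ω : Set R^N) :
    Set (R^N × R^N) :=
  {z | z.1 ∈ E ∧ z.2 ∉ E ∧ (z.1 ∈ Ω ∨ z.2 ∈ Ω)}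

lemma measurableSet_crossingPairs {E Ω : Set V} (hE : MeasurableSet E) (hΩ : MeasurableSet Ω) :
    MeasurableSet (crossingPairs E Ω) :=
  (measurable_fst hE).inter ((measurable_snd hE).compl.inter
    ((measurable_fst hΩ).union (measurable_snd hΩ)))

lemma fractionalPerimeter_eq {E Ω : Set V} (hE : MeasurableSet E) (hΩ : MeasurableSet Ω) (s : ℝ) :
    fractionalPerimeter s E Ω = ∫⁻ z in crossingPairs E Ω,
      ofReal (1 / ‖z.1 - z.2‖ ^ (N + s)) ∂(volume.prod volume) := by
  have hm : Measurable fun z : V × V => ofReal (1 / ‖z.1 - z.2‖ ^ (N + s)) := by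
    fun_prop
  have hset : crossingPairs E Ω = (E ∩ Ω) ×ˢ Eᶜ ∪ (E ∩ Ωᶜ) ×ˢ (Eᶜ ∩ Ω) := by
    ext z
    simp only [crossingPairs, mem_ofPred_eq, mem_union, mem_prod, mem_inter_iff, mem_compl_iff]
    tauto
  rw [hset, lintegral_union (((hE.inter hΩ.compl).prod (hE.compl.inter hΩ))), ← Measure.prod_restrict,
    ← Measure.prod_restrict, lintegral_prod _ hm.aemeasurable, lintegral_prod _ hm.aemeasurable]
  · rfl
  · rw [disjoint_left]
    rintro z hz hz'
    exact hz'.1.2 hz.1.2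

lemma lintegral_norm_rpow_lt_top {s : ℝ} (hs0 : 0 < s) (hs1 : s < 1) (A B : ℝ≥0∞) (hA : A ≠ ⊤)
    (hB : B ≠ ⊤) :
    ∫⁻ w : V, ofReal (1 / ‖w‖ ^ (N + s)) *
      (if ‖w‖ < 1 then A * ofReal ‖w‖ else B) < ⊤ := by
  set β := (N : ℝ) + s with hβ
  have hβ0 : 0 < β := by positivity
  have h1 : IntegrableOn (fun w : V => ‖w‖ / ‖w - 0‖ ^ β) (ball 0 1) := by
    refine (integrableOn_div_radial (f := fun w : V => ‖w‖) (p := 0)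
      (C := (volume (ball (0 : V) 1)).toReal) one_pos hs0 hs1 ?_ (fun w => norm_nonneg w)
      norm_zero ?_).1
    · exact (continuous_norm.locallyIntegrable.integrableOn_isCompact (isCompact_closedBall 0 1)).mono_set
        ball_subset_closedBall
    · intro r hr _
      have h2 : ∫ w in ball (0 : V) r, ‖w‖ ≤ ∫ w in ball (0 : V) r, r := by
        refine setIntegral_mono_on ?_ (integrableOn_const measure_ball_lt_top.ne) measurableSet_ball
          fun w hw => (mem_ball_zero_iff.1 hw).le
        exact (continuous_norm.locallyIntegrable.integrableOn_isCompact
          (isCompact_closedBall 0 r)).mono_set ball_subset_closedBall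
      refine h2.trans_eq ?_
      rw [setIntegral_const, Measure.real, Measure.addHaar_ball_of_pos _ _ hr,
        finrank_euclideanSpace_fin, ENNReal.toReal_mul, toReal_ofReal (by positivity),
        Real.rpow_add_one hr.ne', Real.rpow_natCast, smul_eq_mul]
      ring
  have h3 : IntegrableOn (fun w : V => 1 / ‖w - 0‖ ^ β) (ball 0 1)ᶜ := by
    refine ((integrable_japanese hs0).const_mul ((1 + (1 + ‖(0 : V)‖) / 1) ^ β)).integrableOn.mono'
      (Measurable.aestronglyMeasurable (by fun_prop)) ?_
    refine (ae_restrict_mem measurableSet_ball.compl).mono fun w hw => ?_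
    rw [norm_of_nonneg (by positivity)]
    exact one_div_norm_rpow_le hβ0.le one_pos hw
  rw [← lintegral_add_compl _ (measurableSet_ball (x := (0 : V)) (ε := 1))]
  refine ENNReal.add_lt_top.2 ⟨?_, ?_⟩
  · have e1 : ∫⁻ w in ball (0 : V) 1, ofReal (1 / ‖w‖ ^ β) *
        (if ‖w‖ < 1 then A * ofReal ‖w‖ else B) =
        ∫⁻ w in ball (0 : V) 1, A * ofReal (‖w‖ / ‖w - 0‖ ^ β) := by
      refine setLIntegral_congr_fun measurableSet_ball fun w hw => ?_
      rw [if_pos (mem_ball_zero_iff.1 hw), sub_zero, mul_left_comm, ← ofReal_mul (by positivity)]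
      congr 2; ring
    rw [e1, lintegral_const_mul' _ _ hA]
    refine ENNReal.mul_lt_top hA.lt_top ?_
    exact (hasFiniteIntegral_iff_ofReal (.of_forall fun w => by positivity)).1 h1.2
  · have e1 : ∫⁻ w in (ball (0 : V) 1)ᶜ, ofReal (1 / ‖w‖ ^ β) *
        (if ‖w‖ < 1 then A * ofReal ‖w‖ else B) =
        ∫⁻ w in (ball (0 : V) 1)ᶜ, B * ofReal (1 / ‖w - 0‖ ^ β) := by
      refine setLIntegral_congr_fun measurableSet_ball.compl fun w hw => ?_
      rw [if_neg (fun h => hw (mem_ball_zero_iff.2 h)), sub_zero, mul_comm]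
    rw [e1, lintegral_const_mul' _ _ hB]
    refine ENNReal.mul_lt_top hB.lt_top ?_
    exact (hasFiniteIntegral_iff_ofReal (.of_forall fun w => by positivity)).1 h3.2

/-- Fix the difference `w = x - y`. The segment from `x` to `y` crosses `∂E`, so for `‖w‖ < 1` the
point `x` is in the sweep of a bounded piece of `∂E` along `w`, of volume `O(‖w‖)`; for larger `w`
the boundedness of `Ω` suffices. It remains to integrate `‖w‖^(-N-s) min(‖w‖, 1)`, which is finite
for `0 < s < 1`. -/
lemma HasSmoothBoundary.lintegral_crossingPairs_lt_top {E Ω : Set V} (hE : HasSmoothBoundary E)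
    (hΩ : IsOpen Ω) (hΩb : Bornology.IsBounded Ω) {s : ℝ} (hs0 : 0 < s) (hs1 : s < 1) :
    ∫⁻ z in crossingPairs E Ω, ofReal (1 / ‖z.1 - z.2‖ ^ (N + s))
      ∂(volume.prod volume) < ⊤ := by
  have := hE.isLocallyFiniteMeasure
  set β := (N : ℝ) + s
  have hD := measurableSet_crossingPairs hE.1.measurableSet hΩ.measurableSet
  obtain ⟨R, hR⟩ := hΩb.subset_closedBall (0 : V)
  -- One of `x`, `x - w` has norm at most `R` and `‖w‖ < 1`, so `x` has norm at most `R + 1` and the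
  -- crossing point at most `R + 2`.
  set S : Set V := frontier E ∩ closedBall 0 (R + 2)
  have hSm : MeasurableSet S := isClosed_frontier.measurableSet.inter measurableSet_closedBall
  have hSfin : euclideanHausdorffMeasure (N - 1) S ≠ ⊤ := by
    have h1 : area E (closedBall 0 (R + 2)) < ⊤ :=
      (isCompact_closedBall 0 (R + 2)).measure_lt_top
    rw [surfaceMeasure, Measure.restrict_apply measurableSet_closedBall, inter_comm] at h1
    exact h1.ne
  rw [← lintegral_indicator hD]
  have hm : Measurable fun z : V × V => (crossingPairs E Ω).indicator
      (fun z => ofReal (1 / ‖z.1 - z.2‖ ^ β)) z :=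
    Measurable.indicator (by fun_prop) hD
  rw [lintegral_prod _ hm.aemeasurable]
  have hpre : ∀ w : V, MeasurableSet {x : V | (x, x - w) ∈ crossingPairs E Ω} := fun w =>
    (measurable_id.prodMk (measurable_id.sub_const w)) hD
  calc ∫⁻ x, ∫⁻ y, (crossingPairs E Ω).indicator
        (fun z => ofReal (1 / ‖z.1 - z.2‖ ^ β)) (x, y)
      = ∫⁻ x, ∫⁻ w, (crossingPairs E Ω).indicator
        (fun z => ofReal (1 / ‖z.1 - z.2‖ ^ β)) (x, x - w) := by
        refine lintegral_congr fun x => ?_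
        exact (lintegral_sub_left_eq_self (fun y => (crossingPairs E Ω).indicator
          (fun z => ofReal (1 / ‖z.1 - z.2‖ ^ β)) (x, y)) x).symm
    _ = ∫⁻ w, ∫⁻ x, (crossingPairs E Ω).indicator
        (fun z => ofReal (1 / ‖z.1 - z.2‖ ^ β)) (x, x - w) := by
        refine lintegral_lintegral_swap (Measurable.aemeasurable ?_)
        exact hm.comp (measurable_fst.prodMk (measurable_fst.sub measurable_snd))
    _ = ∫⁻ w : V, ofReal (1 / ‖w‖ ^ β) *
          volume {x : V | (x, x - w) ∈ crossingPairs E Ω} := by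
        refine lintegral_congr fun w => ?_
        rw [← setLIntegral_const, ← lintegral_indicator (hpre w)]
        refine lintegral_congr fun x => ?_
        by_cases hx : (x, x - w) ∈ crossingPairs E Ω
        · rw [indicator_of_mem hx, indicator_of_mem (by exact hx), sub_sub_cancel]
        · rw [indicator_of_notMem hx, indicator_of_notMem (by exact hx)]
    _ ≤ ∫⁻ w : V, ofReal (1 / ‖w‖ ^ β) * (if ‖w‖ < 1 then
          (euclideanHausdorffMeasure (N - 1) S * 3) * ofReal ‖w‖
          else 2 * volume (closedBall (0 : V) R)) := by
        refine lintegral_mono fun w => ?_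
        by_cases hw0 : w = 0
        · have : ∀ x, (x, x - w) ∉ crossingPairs E Ω := fun x hx => hx.2.1 (by simpa [hw0] using hx.1)
          simp [this]
        simp only
        gcongr
        split_ifs with hw
        · rw [mul_assoc, show (3 : ℝ≥0∞) = ofReal 3 by simp,
            ← ofReal_mul (by norm_num)]
          refine le_trans (measure_mono ?_) (volume_sweep_le hSm hw0)
          intro x hx
          have hpreseg : IsPreconnected ((fun τ : ℝ => x - τ • w) '' Icc (0 : ℝ) 1) :=
            isPreconnected_Icc.image _ (by fun_prop)
          obtain ⟨y, ⟨τ, hτ, rfl⟩, hy⟩ : ∃ y ∈ (fun τ : ℝ => x - τ • w) '' Icc (0 : ℝ) 1,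
              y ∈ frontier E := by
            by_contra! hno
            have hiff := mem_iff_of_isPreconnected hE.1 hpreseg hno (x := x - (0 : ℝ) • w)
              (y := x - (1 : ℝ) • w) ⟨0, ⟨le_rfl, zero_le_one⟩, rfl⟩ ⟨1, ⟨zero_le_one, le_rfl⟩, rfl⟩
            rw [zero_smul, sub_zero, one_smul] at hiff
            exact hx.2.1 (hiff.1 hx.1)
          refine ⟨_, ⟨hy, ?_⟩, τ, hτ, by simp⟩
          have hxR : ‖x‖ ≤ R + 1 := by
            rcases hx.2.2 with h | h
            · have := mem_closedBall_zero_iff.1 (hR h)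
              simp only at this
              linarith
            · have h2 := mem_closedBall_zero_iff.1 (hR h)
              simp only at h2
              have := norm_add_le (x - w) w
              rw [sub_add_cancel] at this
              linarith
          rw [mem_closedBall_zero_iff]
          refine (norm_sub_le _ _).trans ?_
          rw [norm_smul, norm_eq_abs, abs_of_nonneg hτ.1]
          nlinarith [hτ.2, norm_nonneg w]
        · have hsub : {x : V | (x, x - w) ∈ crossingPairs E Ω} ⊆
              closedBall 0 R ∪ (fun x => x - w) ⁻¹' closedBall 0 R := by
            intro x hx
            exact hx.2.2.imp (fun h => hR h) (fun h => hR h)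
          refine (measure_mono hsub).trans ((measure_union_le _ _).trans_eq ?_)
          rw [(measurePreserving_sub_right volume w).measure_preimage
            measurableSet_closedBall.nullMeasurableSet, two_mul]
    _ < ⊤ := lintegral_norm_rpow_lt_top hs0 hs1 _ _ (ENNReal.mul_ne_top hSfin (by norm_num))
        (ENNReal.mul_ne_top (by norm_num) measure_closedBall_lt_top.ne)

lemma HasSmoothBoundary.integrableOn_crossingPairs {E Ω : Set V} (hE : HasSmoothBoundary E)
    (hΩ : IsOpen Ω) (hΩb : Bornology.IsBounded Ω) {s : ℝ} (hs0 : 0 < s) (hs1 : s < 1) :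
    IntegrableOn (fun z : V × V => 1 / ‖z.1 - z.2‖ ^ (N + s)) (crossingPairs E Ω)
      (volume.prod volume) := by
  refine ⟨Measurable.aestronglyMeasurable (by fun_prop), ?_⟩
  rw [hasFiniteIntegral_iff_ofReal (.of_forall fun z => by positivity)]
  exact hE.lintegral_crossingPairs_lt_top hΩ hΩb hs0 hs1

/-! ### Determinants and smooth dependence on time -/

section Calculus

lemma det_eq_det_inner (A : V →L[ℝ] V) :
    A.det = (Matrix.of fun i j => ⟪EuclideanSpace.basisFun (Fin N) ℝ i,
      A (EuclideanSpace.basisFun (Fin N) ℝ j)⟫).det := by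
  rw [ContinuousLinearMap.det, ← LinearMap.det_toMatrix (EuclideanSpace.basisFun (Fin N) ℝ).toBasis]
  congr 1
  ext i j
  rw [LinearMap.toMatrix_apply]
  simp [EuclideanSpace.inner_single_left]

lemma contDiff_det : ContDiff ℝ ∞ (fun A : V →L[ℝ] V => A.det) := by
  simp_rw [det_eq_det_inner, Matrix.det_apply]
  refine ContDiff.sum fun σ _ => ContDiff.const_smul _ (contDiff_prod fun i _ => ?_)
  simp only [Matrix.of_apply]
  exact contDiff_const.inner ℝ (contDiff_id.clm_apply contDiff_const)

/-- The linear coefficient is the trace. The quadratic one comes from comparing the coefficients of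
`t²` in `det (1 + tA) det (1 - tA) = det (1 - t² A²)`. -/
lemma exists_det_polynomial (A : V →L[ℝ] V) :
    ∃ P : Polynomial ℝ, (∀ t : ℝ, (1 + t • A).det = P.eval t) ∧ P.eval 0 = 1 ∧
      P.derivative.eval 0 = LinearMap.trace ℝ V A.toLinearMap ∧
      P.derivative.derivative.eval 0 = LinearMap.trace ℝ V A.toLinearMap ^ 2 -
        LinearMap.trace ℝ V (A * A).toLinearMap := by
  set b := (EuclideanSpace.basisFun (Fin N) ℝ).toBasis
  have hdet : ∀ (B : V →L[ℝ] V) (t : ℝ), (1 + t • B).det =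
      (1 + t • LinearMap.toMatrix b b B.toLinearMap).det := by
    intro B t
    rw [ContinuousLinearMap.det, ← LinearMap.det_toMatrix b]
    congr 1
    have : ((1 + t • B : V →L[ℝ] V) : V →ₗ[ℝ] V) = LinearMap.id + t • (B : V →ₗ[ℝ] V) := rfl
    rw [this, map_add, map_smul, LinearMap.toMatrix_id]
  have htr : ∀ B : V →L[ℝ] V, LinearMap.trace ℝ V B.toLinearMap =
      (LinearMap.toMatrix b b B.toLinearMap).trace := fun B => LinearMap.trace_eq_matrix_trace ℝ b _
  have hexp : ∀ B : V →L[ℝ] V, ∃ Q : Polynomial ℝ, ∀ t : ℝ, (1 + t • B).det =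
      1 + LinearMap.trace ℝ V B.toLinearMap * t + Q.eval t * t ^ 2 := by
    intro B
    refine ⟨(Matrix.det (1 + (Polynomial.X : Polynomial ℝ) •
      (LinearMap.toMatrix b b B.toLinearMap).map Polynomial.C)).divX.divX, fun t => ?_⟩
    rw [hdet, Matrix.det_one_add_smul, htr]
  obtain ⟨Q, hQ⟩ := hexp A
  obtain ⟨Q₂, hQ₂⟩ := hexp (A * A)
  set a := LinearMap.trace ℝ V A.toLinearMap
  set c := LinearMap.trace ℝ V (A * A).toLinearMap
  have hprod : ∀ t : ℝ, (1 + t • A).det * (1 + (-t) • A).det = (1 + (-t ^ 2) • (A * A)).det := by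
    intro t
    have h1 : (1 + (-t ^ 2) • (A * A) : V →L[ℝ] V) = (1 + t • A) * (1 + (-t) • A) := by
      ext1 v
      change v + (-t ^ 2) • A (A v) = (v + (-t) • A v) + t • A (v + (-t) • A v)
      rw [map_add, map_smul]
      module
    rw [h1]
    exact (LinearMap.det_comp _ _).symm
  have hpoly : ∀ t : ℝ, t ≠ 0 → Q.eval t + Q.eval (-t) - a ^ 2 + a * t * (Q.eval (-t) - Q.eval t) +
      t ^ 2 * (Q.eval t * Q.eval (-t)) = -c + Q₂.eval (-t ^ 2) * t ^ 2 := by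
    intro t ht
    have h1 := hprod t
    rw [hQ, hQ, hQ₂] at h1
    have h2 : t ^ 2 * (Q.eval t + Q.eval (-t) - a ^ 2 + a * t * (Q.eval (-t) - Q.eval t) +
      t ^ 2 * (Q.eval t * Q.eval (-t))) = t ^ 2 * (-c + Q₂.eval (-t ^ 2) * t ^ 2) := by
      linear_combination h1
    exact mul_left_cancel₀ (pow_ne_zero 2 ht) h2
  -- After division by `t²` the identity holds only for `t ≠ 0`; both sides are continuous, so `t →
  -- 0` gives the value at `0`.
  have hQ0 : 2 * Q.eval 0 = a ^ 2 - c := by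
    have h1 : Tendsto (fun t : ℝ => Q.eval t + Q.eval (-t) - a ^ 2 +
        a * t * (Q.eval (-t) - Q.eval t) + t ^ 2 * (Q.eval t * Q.eval (-t))) (𝓝[≠] 0)
        (𝓝 (Q.eval 0 + Q.eval (-0) - a ^ 2 +
        a * 0 * (Q.eval (-0) - Q.eval 0) + 0 ^ 2 * (Q.eval 0 * Q.eval (-0)))) :=
      (Continuous.tendsto (by fun_prop) 0).mono_left nhdsWithin_le_nhds
    have h2 : Tendsto (fun t : ℝ => -c + Q₂.eval (-t ^ 2) * t ^ 2) (𝓝[≠] 0)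
        (𝓝 (-c + Q₂.eval (-0 ^ 2) * 0 ^ 2)) :=
      (Continuous.tendsto (by fun_prop) 0).mono_left nhdsWithin_le_nhds
    have h3 := tendsto_nhds_unique (h1.congr' (eventually_nhdsWithin_of_forall (s := {0}ᶜ)
      fun t ht => hpoly t ht)) h2
    simp only [neg_zero, mul_zero, zero_mul, ne_eq, OfNat.ofNat_ne_zero, not_false_eq_true,
      zero_pow, add_zero] at h3
    linarith
  refine ⟨1 + Polynomial.C a * Polynomial.X + Q * Polynomial.X ^ 2, fun t => ?_, ?_, ?_, ?_⟩
  · rw [hQ]; simp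
  · simp
  · simp
  · rw [← hQ0]
    simp [Polynomial.derivative_mul]
    ring

/-- A smooth function on `ℝ` equal to `u ^ (-γ)` for `u ≥ 1 / 2`. -/
noncomputable def regularPower (γ u : ℝ) : ℝ :=
  (1 + Real.smoothTransition (4 * u - 1) * (u - 1)) ^ (-γ)

lemma contDiff_regularPower (γ : ℝ) : ContDiff ℝ ∞ (regularPower γ) := by
  unfold regularPower
  refine ContDiff.rpow_const_of_ne ?_ fun u => ?_
  · exact contDiff_const.add ((Real.smoothTransition.contDiff.comp
      ((contDiff_const.mul contDiff_id).sub contDiff_const)).mul (contDiff_id.sub contDiff_const))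
  -- The base is `(1 - θ) + θ u` with `θ ∈ [0, 1]`, and `θ = 0` for `u ≤ 1 / 4`.
  · apply ne_of_gt
    rcases le_or_gt u (1 / 4) with hu | hu
    · rw [Real.smoothTransition.zero_of_nonpos (by linarith)]; norm_num
    · have h1 := Real.smoothTransition.le_one (4 * u - 1)
      have h0 := Real.smoothTransition.nonneg (4 * u - 1)
      nlinarith

lemma regularPower_eq {γ u : ℝ} (hu : 1 / 2 ≤ u) : regularPower γ u = u ^ (-γ) := by
  rw [regularPower, Real.smoothTransition.one_of_one_le (by linarith)]
  congr 1; ring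

variable {P : Type*} [NormedAddCommGroup P]

lemma exists_bound_time {M : ℝ × P → ℝ} (hM : Continuous M) {K : Set P} (hK : IsCompact K) :
    ∃ C > 0, ∀ t ∈ Icc (-1 : ℝ) 1, ∀ θ ∈ K, |M (t, θ)| ≤ C := by
  obtain ⟨C, hC⟩ := (isCompact_Icc.prod hK).exists_bound_of_continuousOn (f := M) hM.continuousOn
  exact ⟨max C 1, by positivity, fun t ht θ hθ => (hC (t, θ) ⟨ht, hθ⟩).trans (le_max_left _ _)⟩

variable [NormedSpace ℝ P]

/-- The derivative with respect to the first variable. -/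
noncomputable def timeDeriv (M : ℝ × P → ℝ) (q : ℝ × P) : ℝ := fderiv ℝ M q (1, 0)

lemma contDiff_timeDeriv {M : ℝ × P → ℝ} (hM : ContDiff ℝ ∞ M) : ContDiff ℝ ∞ (timeDeriv M) :=
  (hM.fderiv_right (m := ((⊤ : ℕ∞) : WithTop ℕ∞)) (by simp)).clm_apply contDiff_const

lemma hasDerivAt_time {M : ℝ × P → ℝ} (hM : ContDiff ℝ ∞ M) (t : ℝ) (θ : P) :
    HasDerivAt (fun τ => M (τ, θ)) (timeDeriv M (t, θ)) t := by
  have h1 := (hM.differentiable (by simp) (t, θ)).hasFDerivAt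
  exact h1.comp_hasDerivAt t ((hasDerivAt_id t).prodMk (hasDerivAt_const t θ))

/-- First order Taylor expansion in time, with a remainder Lipschitz in the parameter. -/
lemma exists_taylor_time {M : ℝ × P → ℝ} (hM : ContDiff ℝ ∞ M) {K : Set P} (hK : IsCompact K)
    (hKc : Convex ℝ K) :
    ∃ C > 0, ∀ t ∈ Icc (-1 : ℝ) 1, (∀ θ ∈ K, |M (t, θ) - M (0, θ) - t * timeDeriv M (0, θ)| ≤
      C * t ^ 2) ∧ ∀ θ ∈ K, ∀ θ' ∈ K,
        |(M (t, θ) - M (0, θ) - t * timeDeriv M (0, θ)) -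
          (M (t, θ') - M (0, θ') - t * timeDeriv M (0, θ'))| ≤ C * t ^ 2 * ‖θ - θ'‖ := by
  have hM1 := contDiff_timeDeriv hM
  have hM2 := contDiff_timeDeriv hM1
  obtain ⟨C₁, hC₁, hb⟩ := exists_bound_time hM2.continuous hK
  obtain ⟨C₂, hC₂'⟩ := (isCompact_Icc.prod hK).exists_bound_of_continuousOn (f := fderiv ℝ (timeDeriv (timeDeriv M)))
    (hM2.continuous_fderiv (by simp)).continuousOn (s := Icc (-1 : ℝ) 1 ×ˢ K)
  have hlip : ∀ t ∈ Icc (-1 : ℝ) 1, ∀ θ ∈ K, ∀ θ' ∈ K,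
      |timeDeriv (timeDeriv M) (t, θ) - timeDeriv (timeDeriv M) (t, θ')| ≤ |C₂| * ‖θ - θ'‖ := by
    intro t ht θ hθ θ' hθ'
    have h1 := (((convex_Icc (-1 : ℝ) 1).prod hKc)).norm_image_sub_le_of_norm_fderiv_le (𝕜 := ℝ)
      (f := timeDeriv (timeDeriv M)) (C := |C₂|)
      (fun q _ => hM2.differentiable (by simp) q) (fun q hq => (hC₂' q hq).trans (le_abs_self _))
      (x := (t, θ')) (y := (t, θ)) ⟨ht, hθ'⟩ ⟨ht, hθ⟩
    simpa [Prod.norm_def] using h1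
  -- twice the mean value inequality
  have mv : ∀ (f f' f'' : ℝ → ℝ) (B : ℝ), 0 ≤ B → (∀ t, HasDerivAt f (f' t) t) →
      (∀ t, HasDerivAt f' (f'' t) t) → (∀ t ∈ Icc (-1 : ℝ) 1, |f'' t| ≤ B) →
      ∀ t ∈ Icc (-1 : ℝ) 1, |f t - f 0 - t * f' 0| ≤ B * t ^ 2 := by
    intro f f' f'' B hB hf hf' hB' t ht
    have h0 : (0 : ℝ) ∈ Icc (-1 : ℝ) 1 := ⟨by norm_num, by norm_num⟩
    have hsub : uIcc 0 t ⊆ Icc (-1 : ℝ) 1 := by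
      rw [← uIcc_of_le (by norm_num : (-1 : ℝ) ≤ 1)]
      exact uIcc_subset_uIcc (by rw [uIcc_of_le (by norm_num)]; exact h0)
        (by rw [uIcc_of_le (by norm_num)]; exact ht)
    have habs : ∀ τ ∈ uIcc 0 t, |τ| ≤ |t| := fun τ hτ => by
      have := abs_sub_left_of_mem_uIcc hτ
      simpa using this
    have h1 : ∀ τ ∈ uIcc 0 t, |f' τ - f' 0| ≤ B * |t| := by
      intro τ hτ
      have := (convex_uIcc 0 t).norm_image_sub_le_of_norm_hasDerivWithin_le (f := f') (f' := f'')
        (C := B) (fun x _ => (hf' x).hasDerivWithinAt) (fun x hx => hB' x (hsub hx))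
        left_mem_uIcc hτ
      rw [norm_eq_abs, norm_eq_abs, sub_zero] at this
      exact this.trans (mul_le_mul_of_nonneg_left (habs τ hτ) hB)
    have h2 := (convex_uIcc 0 t).norm_image_sub_le_of_norm_hasDerivWithin_le
      (f := fun τ => f τ - τ * f' 0) (f' := fun τ => f' τ - 1 * f' 0) (C := B * |t|)
      (fun x _ => ((hf x).sub ((hasDerivAt_id x).mul_const _)).hasDerivWithinAt)
      (fun x hx => by rw [one_mul]; exact h1 x hx) left_mem_uIcc right_mem_uIcc
    rw [norm_eq_abs, norm_eq_abs, sub_zero, mul_assoc, ← sq, sq_abs] at h2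
    convert h2 using 2
    ring
  refine ⟨max C₁ (|C₂|), lt_max_of_lt_left hC₁, fun t ht => ⟨fun θ hθ => ?_, fun θ hθ θ' hθ' => ?_⟩⟩
  · refine (mv _ _ _ C₁ hC₁.le (fun t => hasDerivAt_time hM t θ) (fun t => hasDerivAt_time hM1 t θ)
      (fun t ht => hb t ht θ hθ) t ht).trans ?_
    gcongr
    exact le_max_left _ _
  · have h1 := mv _ _ _ (|C₂| * ‖θ - θ'‖) (by positivity)
      (fun t => (hasDerivAt_time hM t θ).sub (hasDerivAt_time hM t θ'))
      (fun t => (hasDerivAt_time hM1 t θ).sub (hasDerivAt_time hM1 t θ'))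
      (fun t ht => hlip t ht θ hθ θ' hθ') t ht
    simp only [Pi.sub_apply] at h1
    calc _ = |M (t, θ) - M (t, θ') - (M (0, θ) - M (0, θ')) -
          t * (timeDeriv M (0, θ) - timeDeriv M (0, θ'))| := by congr 1; ring
      _ ≤ |C₂| * ‖θ - θ'‖ * t ^ 2 := h1
      _ = |C₂| * t ^ 2 * ‖θ - θ'‖ := by ring
      _ ≤ _ := by gcongr; exact le_max_right _ _

/-- Differentiation under the integral sign for smooth functions of time and of a parameter that
ranges in a compact set. -/
lemma hasDerivAt_integral_time {α : Type*} [MeasurableSpace α] {μ : Measure α}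
    {M : ℝ × P → ℝ} (hM : ContDiff ℝ ∞ M) {K : Set P} (hK : IsCompact K) {θ : α → P}
    (hθ : AEStronglyMeasurable θ μ) (hθK : ∀ a, θ a ∈ K) {wt : α → ℝ} (hwt : Integrable wt μ) {t : ℝ}
    (ht : t ∈ Ioo (-1 : ℝ) 1) :
    Integrable (fun a => wt a * timeDeriv M (t, θ a)) μ ∧
    HasDerivAt (fun τ => ∫ a, wt a * M (τ, θ a) ∂μ) (∫ a, wt a * timeDeriv M (t, θ a) ∂μ) t := by
  have hM1 := contDiff_timeDeriv hM
  obtain ⟨C, hC, hb⟩ := exists_bound_time hM1.continuous hK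
  obtain ⟨C₀, hC₀, hb₀⟩ := exists_bound_time hM.continuous hK
  have hmeas : ∀ {G : ℝ × P → ℝ}, Continuous G → ∀ τ,
      AEStronglyMeasurable (fun a => wt a * G (τ, θ a)) μ := fun hG τ =>
    hwt.1.mul ((hG.comp (Continuous.prodMk_right τ)).comp_aestronglyMeasurable hθ)
  refine hasDerivAt_integral_of_dominated_loc_of_deriv_le (s := Ioo (-1 : ℝ) 1)
    (bound := fun a => ‖wt a‖ * C) (F := fun τ a => wt a * M (τ, θ a))
    (F' := fun τ a => wt a * timeDeriv M (τ, θ a)) (Ioo_mem_nhds ht.1 ht.2)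
    (.of_forall fun τ => hmeas hM.continuous τ) ?_
    (hmeas hM1.continuous t) ?_ (hwt.norm.mul_const C) ?_
  · refine (hwt.norm.mul_const C₀).mono' (hmeas hM.continuous t) (.of_forall fun a => ?_)
    rw [norm_mul]
    exact mul_le_mul_of_nonneg_left (hb₀ t ⟨ht.1.le, ht.2.le⟩ _ (hθK a)) (norm_nonneg _)
  · refine Eventually.of_forall fun a τ hτ => ?_
    rw [norm_mul]
    exact mul_le_mul_of_nonneg_left (hb τ ⟨hτ.1.le, hτ.2.le⟩ _ (hθK a)) (norm_nonneg _)
  · exact Eventually.of_forall fun a τ _ => (hasDerivAt_time hM τ (θ a)).const_mul _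

end Calculus

/-! ### Differentiation of the perimeter along the flow -/

section PerimeterPath

/-- The ratio of the weights at two points moved by a flow and at their initial positions, as a
function of time and of first order data of the flow. -/
noncomputable def pairWeight (γ : ℝ)
    (q : ℝ × ℝ × ℝ × (R^N →L[ℝ] R^N) ×
      (R^N →L[ℝ] R^N)) : ℝ :=
  regularPower γ (1 + 2 * q.1 * q.2.1 + q.1 ^ 2 * q.2.2.1) *
    ((1 + q.1 • q.2.2.2.1).det * (1 + q.1 • q.2.2.2.2).det)

/-- The first order data of the flow `x ↦ x + t X x` at a pair of points. -/
noncomputable def pairParam (X : R^N → R^N) (δ : ℝ)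
    (z : R^N × R^N) :
    ℝ × ℝ × (R^N →L[ℝ] R^N) ×
      (R^N →L[ℝ] R^N) :=
  (⟪z.1 - z.2, X z.1 - X z.2⟫ / (‖z.1 - z.2‖ ^ 2 + δ ^ 2),
    ‖X z.1 - X z.2‖ ^ 2 / (‖z.1 - z.2‖ ^ 2 + δ ^ 2), fderiv ℝ X z.1, fderiv ℝ X z.2)

lemma contDiff_pairWeight (γ : ℝ) : ContDiff ℝ ∞ (pairWeight (N := N) γ) := by
  unfold pairWeight
  refine ((contDiff_regularPower γ).comp (by fun_prop)).mul
    ((contDiff_det.comp (contDiff_const.add (contDiff_fst.smul ?_))).mul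
      (contDiff_det.comp (contDiff_const.add (contDiff_fst.smul ?_)))) <;> fun_prop

/-- A compact convex set of parameters. -/
def pairParamSet (N : ℕ) (L : ℝ) : Set (ℝ × ℝ ×
    (R^N →L[ℝ] R^N) ×
      (R^N →L[ℝ] R^N)) :=
  Icc (-L) L ×ˢ Icc 0 (L ^ 2) ×ˢ closedBall 0 L ×ˢ closedBall 0 L

lemma isCompact_pairParamSet (L : ℝ) : IsCompact (pairParamSet N L) := by
  have : ProperSpace (V →L[ℝ] V) := FiniteDimensional.proper_real _
  exact isCompact_Icc.prod (isCompact_Icc.prod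
    ((isCompact_closedBall _ _).prod (isCompact_closedBall _ _)))

variable {X : R^N → R^N} {L : NNReal}

lemma pairParam_mem (hL : LipschitzWith L X) (δ : ℝ) (z : V × V) :
    pairParam X δ z ∈ pairParamSet N L := by
  have hW : ‖X z.1 - X z.2‖ ≤ L * ‖z.1 - z.2‖ := by
    simpa [dist_eq_norm] using hL.dist_le_mul z.1 z.2
  have h0 : (0 : ℝ) ≤ ‖z.1 - z.2‖ ^ 2 + δ ^ 2 := by positivity
  have hb : |⟪z.1 - z.2, X z.1 - X z.2⟫| ≤ L * (‖z.1 - z.2‖ ^ 2 + δ ^ 2) := by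
    refine (abs_real_inner_le_norm _ _).trans ?_
    have := mul_le_mul_of_nonneg_left hW (norm_nonneg (z.1 - z.2))
    have h2 : (0 : ℝ) ≤ L * δ ^ 2 := by positivity
    nlinarith
  have hc : ‖X z.1 - X z.2‖ ^ 2 ≤ L ^ 2 * (‖z.1 - z.2‖ ^ 2 + δ ^ 2) := by
    have := pow_le_pow_left₀ (norm_nonneg _) hW 2
    have h2 : (0 : ℝ) ≤ (L : ℝ) ^ 2 * δ ^ 2 := by positivity
    nlinarith
  refine ⟨abs_le.1 ?_, ⟨div_nonneg (sq_nonneg _) h0, div_le_of_le_mul₀ h0 (by positivity) hc⟩, ?_, ?_⟩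
  · rw [pairParam, abs_div, abs_of_nonneg h0]
    exact div_le_of_le_mul₀ h0 L.2 hb
  · simpa [pairParam] using norm_fderiv_le_of_lipschitzWith hL z.1
  · simpa [pairParam] using norm_fderiv_le_of_lipschitzWith hL z.2

lemma aestronglyMeasurable_pairParam (hX : ContDiff ℝ ∞ X) (δ : ℝ) (μ : Measure (V × V)) :
    AEStronglyMeasurable (pairParam X δ) μ := by
  have hXc := hX.continuous
  have hDX : Continuous (fderiv ℝ X) := hX.continuous_fderiv (by simp)
  have h1 : Continuous fun z : V × V => ‖z.1 - z.2‖ ^ 2 + δ ^ 2 := by fun_prop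
  unfold pairParam
  refine AEStronglyMeasurable.prodMk ?_ (AEStronglyMeasurable.prodMk ?_
    (AEStronglyMeasurable.prodMk ?_ ?_))
  · exact (Measurable.div (Continuous.measurable (by fun_prop)) h1.measurable).aestronglyMeasurable
  · exact (Measurable.div (Continuous.measurable (by fun_prop)) h1.measurable).aestronglyMeasurable
  · exact (hDX.comp continuous_fst).aestronglyMeasurable
  · exact (hDX.comp continuous_snd).aestronglyMeasurable

/-- In terms of the parameters `b`, `c`, the ratio of `‖w‖² + δ²` after and before the displacement
is `1 + 2 t b + t² c`. The condition `|t| L ≤ 1 / 4` keeps it above `1 / 2`, where `regularPower` is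
a genuine power. The identity covers the singular kernel as the case `δ = 0`. -/
lemma kern_shift (hL : LipschitzWith L X) {t : ℝ} (ht : |t| * L ≤ 1 / 4) (β δ : ℝ)
    (z : V × V) :
    kern β δ (shift X t z.1 - shift X t z.2) * ((1 + t • fderiv ℝ X z.1).det *
      (1 + t • fderiv ℝ X z.2).det) =
      kern β δ (z.1 - z.2) * pairWeight (β / 2) (t, pairParam X δ z) := by
  have hmem := pairParam_mem hL δ z
  have hu : 1 / 2 ≤ 1 + 2 * t * (pairParam X δ z).1 + t ^ 2 * (pairParam X δ z).2.1 := by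
    have h1 : |t * (pairParam X δ z).1| ≤ 1 / 4 := by
      rw [abs_mul]
      exact (mul_le_mul_of_nonneg_left (abs_le.2 hmem.1) (abs_nonneg t)).trans ht
    have h2 : 0 ≤ t ^ 2 * (pairParam X δ z).2.1 := mul_nonneg (sq_nonneg t) hmem.2.1.1
    linarith [(abs_le.1 h1).1]
  have hw : shift X t z.1 - shift X t z.2 = (z.1 - z.2) + t • (X z.1 - X z.2) := by
    simp only [shift]; module
  rw [pairWeight, ← mul_assoc (kern β δ (z.1 - z.2))]
  congr 1
  rw [regularPower_eq hu, hw]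
  rcases eq_or_ne (‖z.1 - z.2‖ ^ 2 + δ ^ 2) 0 with h0 | h0
  -- For `x = y` and `δ = 0` the quotients are `0 / 0 = 0`, so the ratio factor is `1` and both
  -- sides have the same kernel value.
  · have hz : z.1 - z.2 = 0 := by
      rw [← norm_eq_zero]; nlinarith [sq_nonneg δ, norm_nonneg (z.1 - z.2)]
    simp [pairParam, sub_eq_zero.1 hz]
  · rw [kern, kern, ← Real.mul_rpow (by positivity) (by linarith)]
    congr 1
    rw [norm_add_sq_real, norm_smul, mul_pow, norm_eq_abs, sq_abs, inner_smul_right]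
    simp only [pairParam]
    field_simp
    ring

lemma exists_det_pos (L : ℝ) : ∃ t₀ > 0, ∀ t : ℝ, |t| < t₀ → ∀ A : V →L[ℝ] V, ‖A‖ ≤ L →
    0 < (1 + t • A).det := by
  have h1 : Tendsto (fun A : V →L[ℝ] V => A.det) (𝓝 1) (𝓝 1) := by
    have := (contDiff_det (N := N)).continuous.tendsto 1
    rwa [show (1 : V →L[ℝ] V).det = 1 from LinearMap.det_id] at this
  obtain ⟨ε, hε, hb⟩ := Metric.eventually_nhds_iff.1 (h1.eventually (lt_mem_nhds zero_lt_one))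
  refine ⟨ε / (|L| + 1), by positivity, fun t ht A hA => hb ?_⟩
  rw [dist_eq_norm, add_sub_cancel_left, norm_smul, norm_eq_abs]
  rw [lt_div_iff₀ (by positivity)] at ht
  exact (mul_le_mul_of_nonneg_left (hA.trans ((le_abs_self L).trans (by linarith)))
    (abs_nonneg t)).trans_lt ht

lemma crossingPairs_shift (hX : ContDiff ℝ ∞ X) (hL : LipschitzWith L X) {t : ℝ}
    (ht : |t| * L ≤ 1 / 2) {Ω : Set V} (hΩ : ∀ x ∉ Ω, X x = 0) (E : Set V) :
    crossingPairs (shift X t '' E) Ω = Prod.map (shift X t) (shift X t) '' crossingPairs E Ω := by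
  obtain ⟨Φ, hΦ, -⟩ := exists_shift_homeomorph hX hL ht
  have hΦ' : shift X t = Φ := funext fun x => (hΦ x).symm
  have hΩ' := shift_image_eq_self hL ht hX hΩ
  rw [hΦ'] at hΩ' ⊢
  have hm : ∀ (S : Set V) x, Φ x ∈ Φ '' S ↔ x ∈ S := fun S x => Φ.injective.mem_set_image
  ext ⟨x, y⟩
  obtain ⟨x, rfl⟩ := Φ.surjective x
  obtain ⟨y, rfl⟩ := Φ.surjective y
  rw [show ((Φ x, Φ y) : V × V) = Prod.map Φ Φ (x, y) from rfl,
    (Φ.injective.prodMap Φ.injective).mem_set_image]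
  conv_lhs => rw [← hΩ']
  simp only [crossingPairs, mem_ofPred_eq, Prod.map, hm]

/-- Change variables by the flow in both points. The Jacobian is a product of two determinants
which, with the ratio of the kernels, makes up `pairWeight`; the domain no longer depends on `t`. -/
lemma fractionalPerimeter_shift (hX : ContDiff ℝ ∞ X) (hL : LipschitzWith L X) {E Ω : Set V}
    (hE : HasSmoothBoundary E) (hΩ : IsOpen Ω) (hΩb : Bornology.IsBounded Ω) {s : ℝ}
    (hs0 : 0 < s) (hs1 : s < 1) (hXΩ : ∀ x ∉ Ω, X x = 0) :
    ∀ᶠ t in 𝓝 (0 : ℝ), fractionalPerimeter s (shift X t '' E) Ω ≠ ⊤ ∧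
      (fractionalPerimeter s (shift X t '' E) Ω).toReal =
        ∫ z in crossingPairs E Ω, 1 / ‖z.1 - z.2‖ ^ (N + s) *
          pairWeight ((N + s) / 2) (t, pairParam X 0 z) ∂(volume.prod volume) := by
  obtain ⟨t₀, ht₀, hdet⟩ := exists_det_pos (N := N) L
  filter_upwards [eventually_small L ht₀] with t ⟨ht1, ht2, ht3⟩
  obtain ⟨Φ, hΦ, -⟩ := exists_shift_homeomorph hX hL (ht2.trans (by norm_num))
  have hΦ' : shift X t = Φ := funext fun x => (hΦ x).symm
  have hopen : IsOpen (shift X t '' E) := by rw [hΦ']; exact Φ.isOpenMap _ hE.1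
  have hD := measurableSet_crossingPairs hE.1.measurableSet hΩ.measurableSet
  have hpos : ∀ x, 0 < (1 + t • fderiv ℝ X x).det := fun x =>
    hdet t ht1 _ (norm_fderiv_le_of_lipschitzWith hL x)
  have heq : fractionalPerimeter s (shift X t '' E) Ω = ∫⁻ z in crossingPairs E Ω,
      ofReal (1 / ‖z.1 - z.2‖ ^ (N + s) *
          pairWeight ((N + s) / 2) (t, pairParam X 0 z)) ∂(volume.prod volume) := by
    rw [fractionalPerimeter_eq hopen.measurableSet hΩ.measurableSet,
      crossingPairs_shift hX hL (ht2.trans (by norm_num)) hXΩ]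
    rw [lintegral_image_eq_lintegral_abs_det_fderiv_mul (volume.prod volume) hD
      (fun z _ => ((hasFDerivAt_shift hX z.1).prodMap z
        (hasFDerivAt_shift hX z.2)).hasFDerivWithinAt)
      (by rw [hΦ']; exact (Φ.injective.prodMap Φ.injective).injOn)]
    refine lintegral_congr fun z => ?_
    have h1 : (ContinuousLinearMap.prodMap (1 + t • fderiv ℝ X z.1)
        (1 + t • fderiv ℝ X z.2)).det = (1 + t • fderiv ℝ X z.1).det *
        (1 + t • fderiv ℝ X z.2).det := LinearMap.det_prodMap _ _
    have hp : 0 < (1 + t • fderiv ℝ X z.1).det * (1 + t • fderiv ℝ X z.2).det :=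
      mul_pos (hpos _) (hpos _)
    rw [h1, abs_of_pos hp, ← ofReal_mul hp.le, mul_comm]
    congr 1
    have h2 := kern_shift hL ht2 (N + s) 0 z
    rw [kern_zero, kern_zero] at h2
    exact h2
  have hwt := hE.integrableOn_crossingPairs hΩ hΩb hs0 hs1
  obtain ⟨C, hC, hb⟩ := exists_bound_time (contDiff_pairWeight (N := N) ((N + s) / 2)).continuous
    (isCompact_pairParamSet (N := N) L)
  have hint : IntegrableOn (fun z : V × V => 1 / ‖z.1 - z.2‖ ^ (N + s) *
      pairWeight ((N + s) / 2) (t, pairParam X 0 z)) (crossingPairs E Ω)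
      (volume.prod volume) := by
    refine (hwt.norm.mul_const C).mono' (hwt.1.mul
      (((contDiff_pairWeight (N := N) _).continuous.comp (Continuous.prodMk_right t)).comp_aestronglyMeasurable
        (aestronglyMeasurable_pairParam hX 0 _))) (.of_forall fun z => ?_)
    rw [norm_mul]
    exact mul_le_mul_of_nonneg_left (hb t (abs_le.1 ht3) _ (pairParam_mem hL 0 z)) (norm_nonneg _)
  have hnn : ∀ z : V × V, 0 ≤ 1 / ‖z.1 - z.2‖ ^ (N + s) *
      pairWeight ((N + s) / 2) (t, pairParam X 0 z) := fun z => by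
    have h2 := kern_shift hL ht2 (N + s) 0 z
    rw [kern_zero, kern_zero] at h2
    rw [← h2]
    exact mul_nonneg (by positivity) (mul_pos (hpos _) (hpos _)).le
  rw [heq, ← ofReal_integral_eq_lintegral_ofReal hint (.of_forall hnn)]
  exact ⟨ofReal_ne_top, toReal_ofReal (integral_nonneg hnn)⟩

/-- The perimeter is twice differentiable along the flow `x ↦ x + t X x`, and its second derivative
is the limit of the second derivatives associated to the regularized kernels. -/
lemma HasSmoothBoundary.second_derivative_perimeter {E Ω : Set V} (hE : HasSmoothBoundary E)
    (hX : ContDiff ℝ ∞ X) (hL : LipschitzWith L X)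
    (hΩ : IsOpen Ω) (hΩb : Bornology.IsBounded Ω) {s : ℝ}
    (hs0 : 0 < s) (hs1 : s < 1) (hXΩ : ∀ x ∉ Ω, X x = 0) :
    ∃ q : ℝ, (∀ᶠ t in 𝓝 (0 : ℝ), fractionalPerimeter s (shift X t '' E) Ω ≠ ⊤ ∧
      DifferentiableAt ℝ (fun τ => (fractionalPerimeter s (shift X τ '' E) Ω).toReal) t) ∧
    HasDerivAt (deriv fun τ => (fractionalPerimeter s (shift X τ '' E) Ω).toReal) q 0 ∧
    Tendsto (fun δ => ∫ z in crossingPairs E Ω, kern (N + s) δ (z.1 - z.2) *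
      timeDeriv (timeDeriv (pairWeight ((N + s) / 2))) (0, pairParam X δ z)
        ∂(volume.prod volume)) (𝓝[>] 0) (𝓝 q) := by
  have hM := contDiff_pairWeight (N := N) ((N + s) / 2)
  have hM1 := contDiff_timeDeriv hM
  have hM2 := contDiff_timeDeriv hM1
  have hK := isCompact_pairParamSet (N := N) L
  have hwt := hE.integrableOn_crossingPairs hΩ hΩb hs0 hs1
  have hD := measurableSet_crossingPairs hE.1.measurableSet hΩ.measurableSet
  have hd1 := fun {t : ℝ} (ht : t ∈ Ioo (-1 : ℝ) 1) => (hasDerivAt_integral_time hM hK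
    (aestronglyMeasurable_pairParam hX 0 _) (pairParam_mem hL 0) hwt ht).2
  have hd2 := (hasDerivAt_integral_time hM1 hK
    (aestronglyMeasurable_pairParam hX 0 _) (pairParam_mem hL 0) hwt
    (⟨by norm_num, by norm_num⟩ : (0 : ℝ) ∈ Ioo (-1 : ℝ) 1)).2
  have hper := fractionalPerimeter_shift hX hL hE hΩ hΩb hs0 hs1 hXΩ
  have hI : ∀ᶠ t in 𝓝 (0 : ℝ), t ∈ Ioo (-1 : ℝ) 1 := Ioo_mem_nhds (by norm_num) (by norm_num)
  have hev : ∀ᶠ t in 𝓝 (0 : ℝ), HasDerivAt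
      (fun τ => (fractionalPerimeter s (shift X τ '' E) Ω).toReal)
      (∫ z in crossingPairs E Ω, 1 / ‖z.1 - z.2‖ ^ (N + s) *
          timeDeriv (pairWeight ((N + s) / 2)) (t, pairParam X 0 z) ∂(volume.prod volume))
      t := by
    filter_upwards [hper.eventually_nhds, hI] with t ht htI
    exact (hd1 htI).congr_of_eventuallyEq (ht.mono fun τ hτ => hτ.2)
  refine ⟨_, ?_, hd2.congr_of_eventuallyEq (hev.mono fun t ht => ht.deriv), ?_⟩
  · filter_upwards [hev, hper] with t h1 h2 using ⟨h2.1, h1.differentiableAt⟩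
  obtain ⟨C, hC, hb⟩ := exists_bound_time hM2.continuous hK
  -- The parameters stay in one compact set for all `δ`, so a multiple of the singular kernel,
  -- integrable on the separated pairs, dominates.
  refine tendsto_integral_filter_of_dominated_convergence
    (fun z => ‖1 / ‖z.1 - z.2‖ ^ (N + s)‖ * C) ?_ ?_ (hwt.norm.mul_const C) ?_
  · refine Eventually.of_forall fun δ => AEStronglyMeasurable.mul ?_
      ((hM2.continuous.comp (Continuous.prodMk_right 0)).comp_aestronglyMeasurable
        (aestronglyMeasurable_pairParam hX δ _))
    exact ((measurable_kern _ δ).comp (measurable_fst.sub measurable_snd)).aestronglyMeasurable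
  · refine Eventually.of_forall fun δ => (ae_restrict_iff' hD).2 (.of_forall fun z hz => ?_)
    have hne : z.1 - z.2 ≠ 0 := sub_ne_zero.2 fun h => hz.2.1 (h ▸ hz.1)
    rw [norm_mul]
    refine mul_le_mul ?_ (hb 0 ⟨by norm_num, by norm_num⟩ _ (pairParam_mem hL δ z))
      (norm_nonneg _) (norm_nonneg _)
    rw [norm_of_nonneg (kern_nonneg _ _ _)]
    exact (kern_le (by positivity) δ hne).trans (le_abs_self _)
  · refine (ae_restrict_iff' hD).2 (.of_forall fun z hz => ?_)
    have hne : z.1 - z.2 ≠ 0 := sub_ne_zero.2 fun h => hz.2.1 (h ▸ hz.1)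
    refine (tendsto_kern _ hne).mul ?_
    have hcont : ContinuousAt (fun δ => pairParam X δ z) 0 := by
      have hd : ‖z.1 - z.2‖ ^ 2 + (0 : ℝ) ^ 2 ≠ 0 := by
        have := norm_pos_iff.2 hne
        positivity
      unfold pairParam
      refine ContinuousAt.prodMk ?_ (ContinuousAt.prodMk ?_ continuousAt_const)
      · exact continuousAt_const.div (by fun_prop) hd
      · exact continuousAt_const.div (by fun_prop) hd
    have h2 : Tendsto (fun δ => ((0 : ℝ), pairParam X δ z)) (𝓝[>] 0) (𝓝 (0, pairParam X 0 z)) :=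
      (tendsto_const_nhds.prodMk_nhds hcont).mono_left nhdsWithin_le_nhds
    exact (hM2.continuous.tendsto _).comp h2

end PerimeterPath

/-! ### The second variation of the integrand as a sum of divergences -/

section Divergence

variable {X : R^N → R^N}

/-- The trace, as a continuous linear form. -/
noncomputable def traceCLM (N : ℕ) :
    (R^N →L[ℝ] R^N) →L[ℝ] ℝ :=
  LinearMap.toContinuousLinearMap (LinearMap.trace ℝ R^N ∘ₗ
    (ContinuousLinearMap.coeLM ℝ : (R^N →L[ℝ] R^N) →ₗ[ℝ] _))

lemma traceCLM_apply (A : V →L[ℝ] V) :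
    traceCLM N A = LinearMap.trace ℝ V A.toLinearMap := rfl

lemma divergence_eq (Z : V → V) (x : V) : divergence Z x = traceCLM N (fderiv ℝ Z x) := rfl

lemma traceCLM_smulRight (c : V →L[ℝ] ℝ) (u : V) : traceCLM N (c.smulRight u) = c u := by
  rw [traceCLM_apply, trace_eq_sum_inner]
  conv_rhs => rw [← (EuclideanSpace.basisFun (Fin N) ℝ).sum_repr' u, map_sum]
  refine Finset.sum_congr rfl fun i _ => ?_
  rw [map_smul, smul_eq_mul, mul_comm]
  simp [inner_smul_right]

lemma HasFDerivAt.divergence_smul {a : V → ℝ} {a' : V →L[ℝ] ℝ} {Z : V → V} {x : V}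
    (ha : HasFDerivAt a a' x) (hZ : DifferentiableAt ℝ Z x) :
    divergence (fun x => a x • Z x) x = a' (Z x) + a x * divergence Z x := by
  have h : fderiv ℝ (fun x => a x • Z x) x = _ := (ha.smul hZ.hasFDerivAt).fderiv
  rw [divergence_eq, h, map_add, map_smul, traceCLM_smulRight, smul_eq_mul, divergence_eq, add_comm]

lemma contDiff_divergence (hX : ContDiff ℝ ∞ X) : ContDiff ℝ ∞ (divergence X) :=
  (traceCLM N).contDiff.comp (hX.fderiv_right (m := ((⊤ : ℕ∞) : WithTop ℕ∞)) (by simp))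

lemma differentiable_fderiv {F : Type*} [NormedAddCommGroup F] [NormedSpace ℝ F] {f : V → F}
    (hf : ContDiff ℝ ∞ f) : Differentiable ℝ (fderiv ℝ f) :=
  (hf.fderiv_right (m := ((⊤ : ℕ∞) : WithTop ℕ∞)) (by simp)).differentiable (by simp)

lemma fderiv_fderiv_comm {F : Type*} [NormedAddCommGroup F] [NormedSpace ℝ F] {f : V → F}
    (hf : ContDiff ℝ ∞ f) (x u v : V) :
    fderiv ℝ (fderiv ℝ f) x u v = fderiv ℝ (fderiv ℝ f) x v u :=
  (hf.contDiffAt.isSymmSndFDerivAt (by simpa using WithTop.coe_le_coe.2 (le_top : (2 : ℕ∞) ≤ ⊤))) u v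

lemma fderiv_divergence (hX : ContDiff ℝ ∞ X) (x v : V) :
    fderiv ℝ (divergence X) x v = traceCLM N (fderiv ℝ (fderiv ℝ X) x v) := by
  have h : fderiv ℝ (divergence X) x = _ :=
    ((traceCLM N).hasFDerivAt.comp x (differentiable_fderiv hX x).hasFDerivAt).fderiv
  rw [h]; rfl

lemma divergence_convection (hX : ContDiff ℝ ∞ X) (x : V) :
    divergence (fun x => fderiv ℝ X x (X x)) x =
      fderiv ℝ (divergence X) x (X x) + traceCLM N (fderiv ℝ X x * fderiv ℝ X x) := by
  have h : fderiv ℝ (fun x => fderiv ℝ X x (X x)) x = _ :=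
    ((differentiable_fderiv hX x).hasFDerivAt.clm_apply
      (hX.differentiable (by simp) x).hasFDerivAt).fderiv
  rw [divergence_eq, h, map_add, fderiv_divergence hX, add_comm]
  congr 2
  ext1 v
  exact fderiv_fderiv_comm hX x v (X x)

/-- The divergence of the field `k (· - q) X`. -/
noncomputable def kernelFlux (k : R^N → ℝ)
    (X : R^N → R^N) (q x : R^N) : ℝ :=
  fderiv ℝ k (x - q) (X x) + k (x - q) * divergence X x

/-- The field whose divergence is the second variation of `k (· - q)` transported by `X`. -/
noncomputable def secondField (k : R^N → ℝ)
    (X : R^N → R^N) (q x : R^N) :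
    R^N :=
  kernelFlux k X q x • X x - k (x - q) • fderiv ℝ X x (X x)

/-- The second variation of `k (x - y)` when `x` and `y` are transported by `X`. -/
noncomputable def pairVariation (k : R^N → ℝ)
    (X : R^N → R^N) (x y : R^N) : ℝ :=
  divergence (secondField k X y) x + divergence (secondField k X x) y +
    2 * divergence (fun x => kernelFlux k X x y • X x) x

variable {k : R^N → ℝ}

lemma hasFDerivAt_sub_right (hk : ContDiff ℝ ∞ k) (q x : V) :
    HasFDerivAt (fun x => k (x - q)) (fderiv ℝ k (x - q)) x := by
  have h := (hk.differentiable (by simp) (x - q)).hasFDerivAt.comp x ((hasFDerivAt_id x).sub_const q)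
  simpa [Function.comp_def] using h

lemma hasFDerivAt_sub_left (hk : ContDiff ℝ ∞ k) (q x : V) :
    HasFDerivAt (fun x => k (q - x)) (-fderiv ℝ k (q - x)) x := by
  have h := (hk.differentiable (by simp) (q - x)).hasFDerivAt.comp x ((hasFDerivAt_id x).const_sub q)
  simpa [Function.comp_def] using h

lemma contDiff_kernelFlux (hk : ContDiff ℝ ∞ k) (hX : ContDiff ℝ ∞ X) (q : V) :
    ContDiff ℝ ∞ (kernelFlux k X q) := by
  have hs : ContDiff ℝ ∞ fun x : V => x - q := contDiff_id.sub contDiff_const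
  exact (((hk.fderiv_right (m := ((⊤ : ℕ∞) : WithTop ℕ∞)) (by simp)).comp hs).clm_apply hX).add
    ((hk.comp hs).mul (contDiff_divergence hX))

lemma contDiff_secondField (hk : ContDiff ℝ ∞ k) (hX : ContDiff ℝ ∞ X) (q : V) :
    ContDiff ℝ ∞ (secondField k X q) := by
  have hs : ContDiff ℝ ∞ fun x : V => x - q := contDiff_id.sub contDiff_const
  exact ((contDiff_kernelFlux hk hX q).smul hX).sub ((hk.comp hs).smul
    ((hX.fderiv_right (m := ((⊤ : ℕ∞) : WithTop ℕ∞)) (by simp)).clm_apply hX))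

lemma divergence_kernel_smul (hk : ContDiff ℝ ∞ k) (hX : ContDiff ℝ ∞ X) (q x : V) :
    divergence (fun x => k (x - q) • X x) x = kernelFlux k X q x :=
  HasFDerivAt.divergence_smul (hasFDerivAt_sub_right hk q x) (hX.differentiable (by simp) x)

lemma fderiv_kernelFlux_apply (hk : ContDiff ℝ ∞ k) (hX : ContDiff ℝ ∞ X) (q x v : V) :
    fderiv ℝ (kernelFlux k X q) x v = fderiv ℝ (fderiv ℝ k) (x - q) v (X x) +
      fderiv ℝ k (x - q) (fderiv ℝ X x v) + fderiv ℝ k (x - q) v * divergence X x +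
        k (x - q) * fderiv ℝ (divergence X) x v := by
  have hDk : HasFDerivAt (fun x => fderiv ℝ k (x - q)) (fderiv ℝ (fderiv ℝ k) (x - q)) x := by
    have h := (differentiable_fderiv hk (x - q)).hasFDerivAt.comp x ((hasFDerivAt_id x).sub_const q)
    simpa [Function.comp_def] using h
  have h : fderiv ℝ (kernelFlux k X q) x = _ :=
    ((hDk.clm_apply (hX.differentiable (by simp) x).hasFDerivAt).add
      ((hasFDerivAt_sub_right hk q x).mul
        ((contDiff_divergence hX).differentiable (by simp) x).hasFDerivAt)).fderiv
  rw [h]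
  simp
  ring

/-- The terms containing `DX X` or second derivatives of `X` cancel between the flux and the
convection term; this is what the convection term of `secondField` is for. -/
lemma divergence_secondField (hk : ContDiff ℝ ∞ k) (hX : ContDiff ℝ ∞ X) (q x : V) :
    divergence (secondField k X q) x = fderiv ℝ (fderiv ℝ k) (x - q) (X x) (X x) +
      2 * fderiv ℝ k (x - q) (X x) * divergence X x +
      k (x - q) * (divergence X x ^ 2 - traceCLM N (fderiv ℝ X x * fderiv ℝ X x)) := by
  have hF : Differentiable ℝ fun x => fderiv ℝ X x (X x) :=
    (differentiable_fderiv hX).clm_apply (hX.differentiable (by simp))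
  have hd1 : Differentiable ℝ fun x => kernelFlux k X q x • X x :=
    ((contDiff_kernelFlux hk hX q).smul hX).differentiable (by simp)
  have hd2 : Differentiable ℝ fun x => k (x - q) • fderiv ℝ X x (X x) := fun x =>
    (hasFDerivAt_sub_right hk q x).differentiableAt.smul (hF x)
  have h1 : divergence (secondField k X q) x = divergence (fun x => kernelFlux k X q x • X x) x -
      divergence (fun x => k (x - q) • fderiv ℝ X x (X x)) x := by
    rw [divergence_eq, divergence_eq, divergence_eq, ← map_sub]
    congr 1
    exact fderiv_fun_sub (hd1 x) (hd2 x)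
  rw [h1, HasFDerivAt.divergence_smul
    ((contDiff_kernelFlux hk hX q).differentiable (by simp) x).hasFDerivAt
      (hX.differentiable (by simp) x), HasFDerivAt.divergence_smul (hasFDerivAt_sub_right hk q x) (hF x),
    divergence_convection hX, fderiv_kernelFlux_apply hk hX, kernelFlux]
  ring

lemma fderiv_neg_of_even (hk : ContDiff ℝ ∞ k) (he : ∀ w, k (-w) = k w) (w v : V) :
    fderiv ℝ k (-w) v = -fderiv ℝ k w v := by
  have h := hasFDerivAt_sub_left hk 0 w
  simp only [zero_sub, he] at h
  rw [h.fderiv]; simp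

lemma fderiv_fderiv_neg_of_even (hk : ContDiff ℝ ∞ k) (he : ∀ w, k (-w) = k w) (w u v : V) :
    fderiv ℝ (fderiv ℝ k) (-w) u v = fderiv ℝ (fderiv ℝ k) w u v := by
  have h1 : (fun x => fderiv ℝ k (-x)) = fun x => -fderiv ℝ k x := by
    ext x v; exact fderiv_neg_of_even hk he x v
  have h2 : HasFDerivAt (fun x => fderiv ℝ k (-x)) (-fderiv ℝ (fderiv ℝ k) (-w)) w := by
    have h := (differentiable_fderiv hk (-w)).hasFDerivAt.comp w (hasFDerivAt_id w).neg
    simpa [Function.comp_def] using h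
  rw [h1] at h2
  have h3 := h2.unique (differentiable_fderiv hk w).hasFDerivAt.neg
  rw [neg_inj] at h3
  rw [h3]

lemma divergence_flux_smul (hk : ContDiff ℝ ∞ k) (he : ∀ w, k (-w) = k w) (hX : ContDiff ℝ ∞ X)
    (x y : V) :
    divergence (fun x => kernelFlux k X x y • X x) x =
      -fderiv ℝ (fderiv ℝ k) (x - y) (X x) (X y) + fderiv ℝ k (x - y) (X x) * divergence X y
        - fderiv ℝ k (x - y) (X y) * divergence X x
        + k (x - y) * divergence X x * divergence X y := by
  have hDk : HasFDerivAt (fun x => fderiv ℝ k (y - x)) (-fderiv ℝ (fderiv ℝ k) (y - x)) x := by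
    have h := (differentiable_fderiv hk (y - x)).hasFDerivAt.comp x ((hasFDerivAt_id x).const_sub y)
    simpa [Function.comp_def] using h
  have h := (hDk.clm_apply (hasFDerivAt_const (X y) x)).fun_add
      ((hasFDerivAt_sub_left hk y x).mul_const (divergence X y))
  rw [show (fun x => kernelFlux k X x y • X x) = fun x => (fderiv ℝ k (y - x) (X y) +
    k (y - x) * divergence X y) • X x from rfl,
    HasFDerivAt.divergence_smul h (hX.differentiable (by simp) x)]
  have e : y - x = -(x - y) := by abel
  simp [-neg_sub, e, fderiv_neg_of_even hk he, fderiv_fderiv_neg_of_even hk he, he]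
  ring

lemma pairVariation_eq (hk : ContDiff ℝ ∞ k) (he : ∀ w, k (-w) = k w) (hX : ContDiff ℝ ∞ X)
    (x y : V) :
    pairVariation k X x y = fderiv ℝ (fderiv ℝ k) (x - y) (X x - X y) (X x - X y) +
      2 * fderiv ℝ k (x - y) (X x - X y) * (divergence X x + divergence X y) +
      k (x - y) * (divergence X x ^ 2 - traceCLM N (fderiv ℝ X x * fderiv ℝ X x) +
        (divergence X y ^ 2 - traceCLM N (fderiv ℝ X y * fderiv ℝ X y)) +
        2 * (divergence X x * divergence X y)) := by
  rw [pairVariation, divergence_secondField hk hX, divergence_secondField hk hX,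
    divergence_flux_smul hk he hX]
  have e : y - x = -(x - y) := by abel
  rw [e, fderiv_neg_of_even hk he, fderiv_fderiv_neg_of_even hk he, he, map_sub, map_sub, map_sub,
    sub_apply, sub_apply, fderiv_fderiv_comm hk (x - y) (X y) (X x)]
  ring

/-- For `t` near `0`, `k (w + t W) det (1 + t DX x) det (1 + t DX y)` equals `k w` times
`pairWeight`. Differentiating once and twice, with the expansions of the determinants, gives both
identities. -/
lemma kern_mul_timeDeriv {L : NNReal} (hX : ContDiff ℝ ∞ X) (hL : LipschitzWith L X)
    (β : ℝ) {δ : ℝ} (hδ : 0 < δ) (x y : V) :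
    kern β δ (x - y) * timeDeriv (pairWeight (β / 2)) (0, pairParam X δ (x, y)) =
      fderiv ℝ (kern β δ) (x - y) (X x - X y) +
        kern β δ (x - y) * (divergence X x + divergence X y) ∧
    kern β δ (x - y) * timeDeriv (timeDeriv (pairWeight (β / 2))) (0, pairParam X δ (x, y)) =
      pairVariation (kern β δ) X x y := by
  have hk := contDiff_kern (N := N) β hδ
  rw [pairVariation_eq hk (kern_neg β δ) hX]
  have hM := contDiff_pairWeight (N := N) (β / 2)
  set k : V → ℝ := kern β δ with hkdef
  set w := x - y
  set W := X x - X y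
  obtain ⟨P, hP, hP0, hP1, hP2⟩ := exists_det_polynomial (fderiv ℝ X x)
  obtain ⟨Q, hQ, hQ0, hQ1, hQ2⟩ := exists_det_polynomial (fderiv ℝ X y)
  have hev : ∀ᶠ t in 𝓝 (0 : ℝ), k (w + t • W) * ((P * Q).eval t) =
      k w * pairWeight (β / 2) (t, pairParam X δ (x, y)) := by
    filter_upwards [eventually_small L one_pos] with t ⟨_, ht, _⟩
    refine Eq.trans ?_ (kern_shift hL ht β δ (x, y))
    rw [Polynomial.eval_mul, ← hP, ← hQ]
    congr 2
    simp only [shift, w, W]; module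
  have hl : ∀ t : ℝ, HasDerivAt (fun t : ℝ => w + t • W) W t := fun t => by
    simpa using ((hasDerivAt_id t).smul_const W).const_add w
  have hk1 : ∀ t : ℝ, HasDerivAt (fun t : ℝ => k (w + t • W)) (fderiv ℝ k (w + t • W) W) t := fun t =>
    (hk.differentiable (by simp) _).hasFDerivAt.comp_hasDerivAt t (hl t)
  have hk2 : HasDerivAt (fun t : ℝ => fderiv ℝ k (w + t • W) W)
      (fderiv ℝ (fderiv ℝ k) (w + (0 : ℝ) • W) W W) 0 := by
    have := ((differentiable_fderiv hk _).hasFDerivAt.comp_hasDerivAt (0 : ℝ) (hl 0)).clm_apply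
      (hasDerivAt_const (0 : ℝ) W)
    simpa using this
  have hd1 : ∀ t : ℝ, HasDerivAt (fun t : ℝ => k (w + t • W) * ((P * Q).eval t))
      (fderiv ℝ k (w + t • W) W * (P * Q).eval t + k (w + t • W) * (P * Q).derivative.eval t) t :=
    fun t => (hk1 t).mul ((P * Q).hasDerivAt t)
  have hd2 := (hk2.mul ((P * Q).hasDerivAt 0)).add ((hk1 0).mul ((P * Q).derivative.hasDerivAt 0))
  have he1 : ∀ᶠ t in 𝓝 (0 : ℝ),
      k w * timeDeriv (pairWeight (β / 2)) (t, pairParam X δ (x, y)) =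
      fderiv ℝ k (w + t • W) W * (P * Q).eval t + k (w + t • W) * (P * Q).derivative.eval t := by
    filter_upwards [hev.eventually_nhds] with t ht
    exact ((hasDerivAt_time hM t _).const_mul (k w)).unique
      ((hd1 t).congr_of_eventuallyEq (ht.mono fun τ hτ => hτ.symm))
  have he2 := ((hasDerivAt_time (contDiff_timeDeriv hM) 0 (pairParam X δ (x, y))).const_mul
    (k w)).unique (hd2.congr_of_eventuallyEq he1)
  rw [he1.self_of_nhds, he2]
  constructor <;> simp only [zero_smul, add_zero, Polynomial.derivative_mul, Polynomial.eval_mul,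
    Polynomial.eval_add, Polynomial.derivative_add, hP0, hP1, hP2, hQ0, hQ1, hQ2, divergence_eq,
    traceCLM_apply] <;> ring

/-- Trace minus normal entry depends only on the values on tangent vectors, so `X` may be replaced
by `g n`, with `g`, `n` smooth extensions of `h` and `ν`. The derivative of `g` contributes equally
to the trace and to the normal entry. For the same reason the choice of differential made in
`meanCurvature` is immaterial. -/
lemma HasSmoothBoundary.divergence_sub_inner (hE : HasSmoothBoundary E)
    (hX : ContDiff ℝ ∞ X) {h : V → ℝ}
    (hXh : ∀ x ∈ frontier E, X x = h x • nu E x) {x : V} (hx : x ∈ frontier E) :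
    divergence X x - ⟪fderiv ℝ X x (nu E x), nu E x⟫ =
      h x * meanCurvature E x := by
  obtain ⟨n, hn, hev⟩ := hE.exists_normal_extension hx
  have hnx : nu E x = n x := hev.self_of_nhds hx
  have hn1 : ‖n x‖ = 1 := hnx ▸ hE.norm_exteriorNormal hx
  have key : ∀ A B : V →L[ℝ] V, (∀ v, ⟪v, nu E x⟫ = 0 → A v = B v) →
      traceCLM N A - ⟪A (n x), n x⟫ = traceCLM N B - ⟪B (n x), n x⟫ := by
    intro A B hAB
    have h1 : A - B = (innerSL ℝ (n x)).smulRight ((A - B) (n x)) := by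
      ext1 v
      have h2 := hAB (v - ⟪n x, v⟫ • n x) (by
        rw [hnx, inner_sub_left, inner_smul_left, real_inner_self_eq_norm_sq, hn1,
          real_inner_comm (n x) v]; simp)
      rw [map_sub, map_sub, map_smul, map_smul] at h2
      simp only [sub_apply, ContinuousLinearMap.smulRight_apply, innerSL_apply_apply, smul_sub]
      rw [← sub_eq_zero] at h2 ⊢
      rw [← h2]; abel
    have h3 := congrArg (traceCLM N) h1
    rw [traceCLM_smulRight, map_sub, innerSL_apply_apply, sub_apply, inner_sub_right] at h3
    rw [real_inner_comm (n x) (A (n x)), real_inner_comm (n x) (B (n x))]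
    linarith
  set g : V → ℝ := fun z => ⟪X z, n z⟫
  have hg : Differentiable ℝ g := (hX.differentiable (by simp)).inner ℝ (hn.differentiable (by simp))
  have hev' : ∀ᶠ z in 𝓝[frontier E] x, X z = g z • n z := by
    filter_upwards [self_mem_nhdsWithin, hev.filter_mono nhdsWithin_le_nhds] with z hz h1
    have h2 := hE.norm_exteriorNormal hz
    rw [h1 hz] at h2
    simp only [g]
    rw [hXh z hz, h1 hz, inner_smul_left, real_inner_self_eq_norm_sq, h2]; simp
  have hgx : g x = h x := by
    simp only [g]
    rw [hXh x hx, hnx, inner_smul_left, real_inner_self_eq_norm_sq, hn1]; simp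
  have hgn := (hg x).hasFDerivAt.smul (hn.differentiable (by simp) x).hasFDerivAt
  have e1 := key _ _ fun v hv => hE.fderiv_eq_on_tangent hx
    (hX.differentiable (by simp) x).hasFDerivAt.hasFDerivWithinAt
    (hgn.hasFDerivWithinAt.congr_of_eventuallyEq hev' (hev'.self_of_nhdsWithin hx)) hv
  have hnw : HasFDerivWithinAt (nu E) (fderiv ℝ n x) (frontier E) x :=
    (hn.differentiable (by simp) x).hasFDerivAt.hasFDerivWithinAt.congr_of_eventuallyEq
      (by filter_upwards [self_mem_nhdsWithin, hev.filter_mono nhdsWithin_le_nhds] with z hz h1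
          using h1 hz) hnx
  have e2 := key _ _ fun v hv => hE.fderiv_eq_on_tangent hx
    hnw.differentiableWithinAt.hasFDerivWithinAt hnw hv
  rw [meanCurvature, divergence_eq]
  rw [← traceCLM_apply, hnx, e1, e2, map_add, map_smul, traceCLM_smulRight, hgx]
  simp only [add_apply, smul_apply, ContinuousLinearMap.smulRight_apply,
    inner_add_left, inner_smul_left, real_inner_self_eq_norm_sq, hn1, smul_eq_mul]
  simp
  ring

end Divergence

/-! ### Integrability of the regularized second variation -/

section SecondVariation

variable {X : R^N → R^N}

/-- A kernel cut off to a compact set in one variable is integrable on the product. -/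
lemma integrable_prod_of_kernel_bound {s : ℝ} (hs0 : 0 < s) {δ : ℝ} (hδ : 0 < δ) {μ ν : Measure V}
    [IsLocallyFiniteMeasure μ] [SFinite ν]
    (hν : Integrable (fun x : V => (1 + ‖x‖) ^ (-(N + s))) ν) {F : V × V → ℝ}
    (hF : AEStronglyMeasurable F (μ.prod ν)) {K : Set V} (hK : IsCompact K) {C : ℝ}
    (h0 : ∀ z : V × V, z.1 ∉ K → F z = 0)
    (hb : ∀ z : V × V, |F z| ≤ C * kern (N + s) δ (z.1 - z.2)) :
    Integrable F (μ.prod ν) := by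
  have hβ : 0 ≤ (N : ℝ) + s := by positivity
  obtain ⟨R, hR⟩ := hK.isBounded.exists_norm_le
  have h1 : Integrable (K.indicator fun _ => |C| * (1 + (1 + R) / δ) ^ (N + s)) μ :=
    (integrableOn_const (hs := hK.measure_lt_top.ne)).integrable_indicator hK.measurableSet
  refine (h1.mul_prod hν).mono' hF (.of_forall fun z => ?_)
  by_cases hz : z.1 ∈ K
  · rw [indicator_of_mem hz, mul_assoc]
    refine (hb z).trans ((mul_le_mul_of_nonneg_right (le_abs_self C)
      (kern_nonneg _ _ _)).trans (mul_le_mul_of_nonneg_left ?_ (abs_nonneg C)))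
    rw [← neg_sub, kern_neg]
    refine (kern_le_japanese hβ hδ _ _).trans ?_
    gcongr
    exact hR _ hz
  · rw [h0 z hz, indicator_of_notMem hz]; simp

lemma exists_bound_of_compactSupport {f : V → ℝ} (hf : Continuous f) (h0 : ∀ x ∉ tsupport X, f x = 0)
    (hXc : HasCompactSupport X) : ∃ M : ℝ, 0 ≤ M ∧ ∀ x, |f x| ≤ M := by
  obtain ⟨M, hM⟩ := hXc.isCompact.exists_bound_of_continuousOn hf.continuousOn
  refine ⟨max M 0, le_max_right _ _, fun x => ?_⟩
  by_cases hx : x ∈ tsupport X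
  · exact (hM x hx).trans (le_max_left _ _)
  · rw [h0 x hx]; simp

lemma exists_field_bound (hX : ContDiff ℝ ∞ X) (hXc : HasCompactSupport X) :
    ∃ M : ℝ, 0 ≤ M ∧ ∀ x, ‖X x‖ ≤ M ∧ |divergence X x| ≤ M ∧
      |traceCLM N (fderiv ℝ X x * fderiv ℝ X x)| ≤ M ∧ ‖fderiv ℝ X x (X x)‖ ≤ M := by
  have hDX : Continuous (fderiv ℝ X) := hX.continuous_fderiv (by simp)
  have hX0 : ∀ x ∉ tsupport X, X x = 0 := fun x hx => image_eq_zero_of_notMem_tsupport hx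
  have hD0 : ∀ x ∉ tsupport X, fderiv ℝ X x = 0 := fun x hx => fderiv_of_notMem_tsupport ℝ hx
  obtain ⟨M₁, h₁, hM₁⟩ := exists_bound_of_compactSupport (X := X) (f := fun x => ‖X x‖)
    hX.continuous.norm (fun x hx => by simp [hX0 x hx]) hXc
  obtain ⟨M₂, h₂, hM₂⟩ := exists_bound_of_compactSupport (X := X) (f := divergence X)
    (contDiff_divergence hX).continuous (fun x hx => by simp [divergence_eq, hD0 x hx]) hXc
  obtain ⟨M₃, h₃, hM₃⟩ := exists_bound_of_compactSupport (X := X)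
    (f := fun x => traceCLM N (fderiv ℝ X x * fderiv ℝ X x))
    ((traceCLM N).continuous.comp (hDX.mul hDX)) (fun x hx => by simp [hD0 x hx]) hXc
  obtain ⟨M₄, h₄, hM₄⟩ := exists_bound_of_compactSupport (X := X) (f := fun x => ‖fderiv ℝ X x (X x)‖)
    (hDX.clm_apply hX.continuous).norm (fun x hx => by simp [hX0 x hx]) hXc
  simp only [abs_norm] at hM₁ hM₄
  refine ⟨M₁ + M₂ + M₃ + M₄, by positivity, fun x => ⟨?_, ?_, ?_, ?_⟩⟩
  · linarith [hM₁ x]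
  · linarith [hM₂ x]
  · linarith [hM₃ x]
  · linarith [hM₄ x]

/-- Every term is a derivative of order at most two of the kernel times bounded coefficients, and
for fixed `δ` these derivatives are bounded by multiples of the kernel. -/
lemma exists_kernel_bounds (hX : ContDiff ℝ ∞ X) (hXc : HasCompactSupport X) {β : ℝ} (hβ : 0 ≤ β)
    {δ : ℝ} (hδ : 0 < δ) :
    ∃ C : ℝ, ∀ x y, |kernelFlux (kern β δ) X y x| ≤ C * kern β δ (x - y) ∧
      ‖secondField (kern β δ) X y x‖ ≤ C * kern β δ (x - y) ∧
      |divergence (secondField (kern β δ) X y) x| ≤ C * kern β δ (x - y) ∧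
      |divergence (fun x => kernelFlux (kern β δ) X x y • X x) x| ≤
        C * kern β δ (x - y) := by
  obtain ⟨M, hM0, hM⟩ := exists_field_bound hX hXc
  have hk := contDiff_kern (N := N) β hδ
  set a := β / δ
  set b := β * (β + 3) / δ ^ 2
  have ha : 0 ≤ a := by positivity
  have hb : 0 ≤ b := by positivity
  refine ⟨(b * M ^ 2 + 2 * a * M * M + M ^ 2 + M) + (a * M + M) * M + M + (a * M + M),
    fun x y => ?_⟩
  obtain ⟨h1, h2, h3, h4⟩ := hM x
  obtain ⟨h1', h2', h3', h4'⟩ := hM y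
  have hk0 := kern_nonneg β δ (x - y)
  have hD : ∀ v : V, ‖v‖ ≤ M → |fderiv ℝ (kern β δ) (x - y) v| ≤
      a * M * kern β δ (x - y) := fun v hv => by
    refine (abs_fderiv_kern_le hβ hδ _ _).trans ?_
    calc _ ≤ a * kern β δ (x - y) * M := mul_le_mul_of_nonneg_left hv (by positivity)
      _ = _ := by ring
  have hDD : ∀ v u : V, ‖v‖ ≤ M → ‖u‖ ≤ M →
      |fderiv ℝ (fderiv ℝ (kern β δ)) (x - y) v u| ≤
      b * M ^ 2 * kern β δ (x - y) := fun v u hv hu => by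
    refine (abs_fderiv_fderiv_kern_le hβ hδ _ _ _).trans ?_
    calc _ ≤ b * kern β δ (x - y) * (M * M) := mul_le_mul_of_nonneg_left
          (mul_le_mul hv hu (norm_nonneg _) hM0) (by positivity)
      _ = _ := by ring
  set κ := kern β δ (x - y)
  have hprod : ∀ {u v A : ℝ}, |u| ≤ A → |v| ≤ M → |u * v| ≤ A * M := fun hu hv => by
    rw [abs_mul]
    exact mul_le_mul hu hv (abs_nonneg _) ((abs_nonneg _).trans hu)
  have hκM : ∀ {v : ℝ}, |v| ≤ M → |κ * v| ≤ κ * M := fun hv =>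
    hprod (abs_of_nonneg hk0).le hv
  have hflux : |kernelFlux (kern β δ) X y x| ≤ (a * M + M) * κ := by
    have := (abs_add_le _ _).trans (add_le_add (hD _ h1) (hκM h2))
    rw [kernelFlux]
    linarith
  have p1 : 0 ≤ b * M ^ 2 * κ := by positivity
  have p2 : 0 ≤ a * M * M * κ := by positivity
  have p3 : 0 ≤ M ^ 2 * κ := by positivity
  have p4 : 0 ≤ M * κ := by positivity
  have p5 : 0 ≤ a * M * κ := by positivity
  refine ⟨by linarith, ?_, ?_, ?_⟩
  · rw [secondField]
    refine (norm_sub_le _ _).trans ?_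
    rw [norm_smul, norm_smul, norm_eq_abs, norm_eq_abs, abs_of_nonneg hk0]
    have e1 := mul_le_mul hflux h1 (norm_nonneg _) (by positivity)
    have e2 := mul_le_mul_of_nonneg_left h4 hk0
    linarith
  · rw [divergence_secondField hk hX]
    have e1 := hDD _ _ h1 h1
    have e2 := hprod (hD _ h1) h2
    have e3 := hprod (hκM h2) h2
    have e4 := hκM h3
    rw [abs_le] at e1 e2 e3 e4 ⊢
    constructor <;> linarith [e1.1, e1.2, e2.1, e2.2, e3.1, e3.2, e4.1, e4.2]
  · rw [divergence_flux_smul hk (kern_neg β δ) hX]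
    have e1 := hDD _ _ h1 h1'
    have e2 := hprod (hD _ h1) h2'
    have e3 := hprod (hD _ h1') h2
    have e4 := hprod (hκM h2) h2'
    rw [abs_le] at e1 e2 e3 e4 ⊢
    constructor <;> linarith [e1.1, e1.2, e2.1, e2.2, e3.1, e3.2, e4.1, e4.2]

variable {k : R^N → ℝ}

lemma continuous_kernelFlux (hk : ContDiff ℝ ∞ k) (hX : ContDiff ℝ ∞ X) :
    Continuous fun z : V × V => kernelFlux k X z.2 z.1 := by
  have hs : Continuous fun z : V × V => z.1 - z.2 := continuous_fst.sub continuous_snd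
  exact (((hk.continuous_fderiv (by simp)).comp hs).clm_apply (hX.continuous.comp continuous_fst)).add
    ((hk.continuous.comp hs).mul ((contDiff_divergence hX).continuous.comp continuous_fst))

lemma continuous_secondField (hk : ContDiff ℝ ∞ k) (hX : ContDiff ℝ ∞ X) :
    Continuous fun z : V × V => secondField k X z.2 z.1 := by
  have hs : Continuous fun z : V × V => z.1 - z.2 := continuous_fst.sub continuous_snd
  exact ((continuous_kernelFlux hk hX).smul (hX.continuous.comp continuous_fst)).sub
    ((hk.continuous.comp hs).smul (((hX.continuous_fderiv (by simp)).clm_apply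
      hX.continuous).comp continuous_fst))

lemma continuous_divergence_secondField (hk : ContDiff ℝ ∞ k) (hX : ContDiff ℝ ∞ X) :
    Continuous fun z : V × V => divergence (secondField k X z.2) z.1 := by
  simp_rw [divergence_secondField hk hX]
  have hs : Continuous fun z : V × V => z.1 - z.2 := continuous_fst.sub continuous_snd
  have h1 : Continuous fun z : V × V => X z.1 := hX.continuous.comp continuous_fst
  have h2 : Continuous fun z : V × V => fderiv ℝ X z.1 :=
    (hX.continuous_fderiv (by simp)).comp continuous_fst
  have h3 : Continuous fun z : V × V => divergence X z.1 :=
    (contDiff_divergence hX).continuous.comp continuous_fst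
  have h4 : Continuous fun z : V × V => fderiv ℝ (fderiv ℝ k) (z.1 - z.2) :=
    ((hk.fderiv_right (m := ((⊤ : ℕ∞) : WithTop ℕ∞)) (by simp)).continuous_fderiv (by simp)).comp hs
  have h5 : Continuous fun z : V × V => fderiv ℝ k (z.1 - z.2) :=
    (hk.continuous_fderiv (by simp)).comp hs
  exact (((h4.clm_apply h1).clm_apply h1).add ((continuous_const.mul (h5.clm_apply h1)).mul h3)).add
    ((hk.continuous.comp hs).mul ((h3.pow 2).sub ((traceCLM N).continuous.comp (h2.mul h2))))

lemma continuous_divergence_flux_smul (hk : ContDiff ℝ ∞ k) (he : ∀ w, k (-w) = k w)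
    (hX : ContDiff ℝ ∞ X) :
    Continuous fun z : V × V => divergence (fun x => kernelFlux k X x z.2 • X x) z.1 := by
  simp_rw [divergence_flux_smul hk he hX]
  have hs : Continuous fun z : V × V => z.1 - z.2 := continuous_fst.sub continuous_snd
  have h1 : Continuous fun z : V × V => X z.1 := hX.continuous.comp continuous_fst
  have h2 : Continuous fun z : V × V => X z.2 := hX.continuous.comp continuous_snd
  have h3 : Continuous fun z : V × V => divergence X z.1 :=
    (contDiff_divergence hX).continuous.comp continuous_fst
  have h3' : Continuous fun z : V × V => divergence X z.2 :=
    (contDiff_divergence hX).continuous.comp continuous_snd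
  have h4 : Continuous fun z : V × V => fderiv ℝ (fderiv ℝ k) (z.1 - z.2) :=
    ((hk.fderiv_right (m := ((⊤ : ℕ∞) : WithTop ℕ∞)) (by simp)).continuous_fderiv (by simp)).comp hs
  have h5 : Continuous fun z : V × V => fderiv ℝ k (z.1 - z.2) :=
    (hk.continuous_fderiv (by simp)).comp hs
  exact ((((h4.clm_apply h1).clm_apply h2).neg.add ((h5.clm_apply h1).mul h3')).sub
    ((h5.clm_apply h2).mul h3)).add (((hk.continuous.comp hs).mul h3).mul h3')

lemma hasCompactSupport_secondField (hXc : HasCompactSupport X) (q : V) :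
    HasCompactSupport (secondField k X q) := by
  refine hXc.mono fun x hx h0 => hx ?_
  simp [secondField, h0]

lemma divergence_eq_zero_of_notMem {Z : V → V} (h : ∀ x, X x = 0 → Z x = 0) {x : V}
    (hx : x ∉ tsupport X) : divergence Z x = 0 := by
  have h1 : x ∉ tsupport Z := fun h' => hx (closure_mono (show Function.support Z ⊆ Function.support X from
    fun z hz h0 => hz (h z h0)) h')
  rw [divergence_eq, fderiv_of_notMem_tsupport ℝ h1, map_zero]

/-- The Gauss formula for the derivative of the regularized kernel. -/
lemma HasSmoothBoundary.signed_gauss_kernel (hE : HasSmoothBoundary E) {s : ℝ}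
    (hs0 : 0 < s)
    (hArea : Integrable (fun x : V => (1 + ‖x‖) ^ (-(N + s))) (area E))
    {δ : ℝ} (hδ : 0 < δ) (x b : V) :
    Integrable (fun y => sgnInd E y * fderiv ℝ (kern (N + s) δ) (x - y) b) ∧
    Integrable (fun y => kern (N + s) δ (y - x) * ⟪nu E y, b⟫)
      (area E) ∧
    ∫ y, sgnInd E y * fderiv ℝ (kern (N + s) δ) (x - y) b =
      -2 * ∫ y, kern (N + s) δ (y - x) * ⟪nu E y, b⟫
        ∂(area E) := by
  have hβ : 0 ≤ (N : ℝ) + s := by positivity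
  set β := (N : ℝ) + s
  have hk := contDiff_kern (N := N) β hδ
  have hf : ContDiff ℝ 1 fun y : V => kern β δ (y - x) :=
    (hk.comp (contDiff_id.sub contDiff_const)).of_le (by simp)
  have hfd : ∀ y, fderiv ℝ (fun y : V => kern β δ (y - x)) y b =
      -fderiv ℝ (kern β δ) (x - y) b := fun y => by
    rw [(hasFDerivAt_sub_right hk x y).fderiv, ← neg_sub x y,
      fderiv_neg_of_even hk (kern_neg β δ)]
  set A := (1 + (1 + ‖x‖) / δ) ^ β
  have hA : 0 ≤ A := by positivity
  have hk0 : ∀ y, |kern β δ (y - x)| ≤ A * (1 + ‖y‖) ^ (-β) := fun y => by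
    rw [abs_of_nonneg (kern_nonneg _ _ _)]
    exact kern_le_japanese hβ hδ x y
  have h0 : ∀ y, |kern β δ (y - x)| ≤
      (A + β / δ * A * ‖b‖) * (1 + ‖y‖) ^ (-β) := fun y => (hk0 y).trans (by
    gcongr
    exact le_add_of_nonneg_right (by positivity))
  have h1 : ∀ y, |fderiv ℝ (fun y : V => kern β δ (y - x)) y b| ≤
      (A + β / δ * A * ‖b‖) * (1 + ‖y‖) ^ (-β) := fun y => by
    rw [(hasFDerivAt_sub_right hk x y).fderiv]
    refine (abs_fderiv_kern_le hβ hδ _ b).trans ?_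
    have := hk0 y
    rw [abs_of_nonneg (kern_nonneg _ _ _)] at this
    calc β / δ * kern β δ (y - x) * ‖b‖ ≤ β / δ * (A * (1 + ‖y‖) ^ (-β)) * ‖b‖ := by gcongr
      _ = (β / δ * A * ‖b‖) * (1 + ‖y‖) ^ (-β) := by ring
      _ ≤ _ := by gcongr; exact le_add_of_nonneg_left hA
  obtain ⟨i1, i2, -⟩ := hE.gauss_of_decay hs0 hArea b hf h0 h1
  have e := hE.signed_gauss_of_decay hs0 hArea b hf h0 h1
  simp_rw [hfd] at e i1
  refine ⟨?_, i2, ?_⟩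
  · refine i1.neg.norm.mono' ((measurable_sgnInd hE.1.measurableSet).aestronglyMeasurable.mul
      (i1.neg.1.congr (.of_forall fun y => by simp))) (.of_forall fun y => ?_)
    rw [norm_mul, norm_eq_abs, abs_sgnInd, one_mul]
    simp
  · simp_rw [mul_neg] at e
    rw [integral_neg] at e
    linarith

end SecondVariation

/-! ### The second variation with a smoothed kernel -/

section SecondVariationFormula

variable {X : R^N → R^N}

lemma norm_exteriorNormal_le (E : Set V) (x : V) : ‖nu E x‖ ≤ 1 := by
  rw [exteriorNormal]
  split_ifs with h
  · rw [norm_smul, norm_inv, norm_norm]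
    exact inv_mul_le_one
  · simp

/-- This is where `H` enters: the normal component of the field combines `div X` and `⟪DX ν, ν⟫`
into the tangential divergence `h H`. -/
lemma HasSmoothBoundary.inner_secondField (hE : HasSmoothBoundary E)
    (hX : ContDiff ℝ ∞ X) {h : V → ℝ}
    (hXh : ∀ x ∈ frontier E, X x = h x • nu E x) {k : V → ℝ} {x : V}
    (hx : x ∈ frontier E) (y : V) :
    ⟪secondField k X y x, nu E x⟫ =
      h x ^ 2 * fderiv ℝ k (x - y) (nu E x) +
        h x ^ 2 * meanCurvature E x * k (x - y) := by
  have h1 := hE.divergence_sub_inner hX hXh hx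
  have hn : ⟪nu E x, nu E x⟫ = 1 := by
    rw [real_inner_self_eq_norm_sq, hE.norm_exteriorNormal hx, one_pow]
  rw [secondField, kernelFlux, hXh x hx, inner_sub_left, inner_smul_left, inner_smul_left, map_smul,
    map_smul, inner_smul_left, inner_smul_left, hn]
  simp only [conj_trivial, smul_eq_mul]
  linear_combination (k (x - y) * h x) * h1

/-- The second variation with a regularized kernel. -/
lemma HasSmoothBoundary.regularized_second_variation {E Ω : Set V} (hE : HasSmoothBoundary E)
    {s : ℝ} (hs0 : 0 < s)
    (hArea : Integrable (fun x : V => (1 + ‖x‖) ^ (-(N + s))) (area E))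
    (hX : ContDiff ℝ ∞ X) (hXc : HasCompactSupport X) (hXΩ : tsupport X ⊆ Ω)
    {h : V → ℝ} (hXh : ∀ x ∈ frontier E, X x = h x • nu E x) {δ : ℝ} (hδ : 0 < δ) :
    ∫ z in crossingPairs E Ω, pairVariation (kern (N + s) δ) X z.1 z.2
        ∂(volume.prod volume) =
      ∫ x, (-2 * (smoothedJacobi s E h δ x * h x) -
        h x ^ 2 * meanCurvature E x * smoothedCurvature s E δ x) ∂(area E) := by
  have hβ : 0 ≤ (N : ℝ) + s := by positivity
  have hJ := integrable_japanese (N := N) hs0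
  have hk := contDiff_kern (N := N) (N + s) hδ
  have he := kern_neg (N := N) (N + s) δ
  obtain ⟨C, hC⟩ := exists_kernel_bounds hX hXc hβ hδ
  have hEm := hE.1.measurableSet
  have := hE.isLocallyFiniteMeasure
  set k : V → ℝ := kern (N + s) δ with hkdef
  set σ := area E
  have hK : IsCompact (tsupport X) := hXc
  have hνm : AEStronglyMeasurable (nu E) σ :=
    HasSmoothBoundary.aestronglyMeasurable_surface hE.continuousOn_exteriorNormal
  have hX0 : ∀ x ∉ tsupport X, X x = 0 := fun x hx => image_eq_zero_of_notMem_tsupport hx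
  have hZ0 : ∀ q x, X x = 0 → secondField k X q x = 0 := fun q x h0 => by simp [secondField, h0]
  have hV0 : ∀ q x, X x = 0 → kernelFlux k X x q • X x = 0 := fun q x h0 => by simp [h0]
  have hF0 : ∀ q x, x ∉ tsupport X → kernelFlux k X q x = 0 := fun q x hx => by
    rw [← divergence_kernel_smul hk hX]
    exact divergence_eq_zero_of_notMem (fun z h0 => by simp [h0]) hx
  -- the three terms of the integrand
  set G₁ : V × V → ℝ := fun z => divergence (secondField k X z.2) z.1 with hG₁
  set G₃ : V × V → ℝ := fun z => divergence (fun x => kernelFlux k X x z.2 • X x) z.1 with hG₃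
  have hG₁0 : ∀ z : V × V, z.1 ∉ tsupport X → G₁ z = 0 := fun z hz =>
    divergence_eq_zero_of_notMem (hZ0 z.2) hz
  have hG₃0 : ∀ z : V × V, z.1 ∉ tsupport X → G₃ z = 0 := fun z hz =>
    divergence_eq_zero_of_notMem (hV0 z.2) hz
  have hi₁ : Integrable G₁ (volume.prod volume) := integrable_prod_of_kernel_bound hs0 hδ hJ
    (continuous_divergence_secondField hk hX).aestronglyMeasurable hK hG₁0
    fun z => (hC z.1 z.2).2.2.1
  have hi₃ : Integrable G₃ (volume.prod volume) := integrable_prod_of_kernel_bound hs0 hδ hJ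
    (continuous_divergence_flux_smul hk he hX).aestronglyMeasurable hK hG₃0
    fun z => (hC z.1 z.2).2.2.2
  -- restriction to `E × Eᶜ`
  have hstep : ∫ z in crossingPairs E Ω, pairVariation k X z.1 z.2 ∂(volume.prod volume) =
      ∫ z in E ×ˢ Eᶜ, (G₁ z + G₁ z.swap + 2 * G₃ z) ∂(volume.prod volume) := by
    change ∫ z in crossingPairs E Ω, (G₁ z + G₁ z.swap + 2 * G₃ z) ∂(volume.prod volume) = _
    refine (setIntegral_eq_of_subset_of_forall_sdiff_eq_zero (hEm.prod hEm.compl)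
      (fun z hz => ⟨hz.1, hz.2.1⟩) fun z hz => ?_).symm
    have h1 : z.1 ∉ Ω := fun h1 => hz.2 ⟨hz.1.1, hz.1.2, Or.inl h1⟩
    have h2 : z.2 ∉ Ω := fun h1 => hz.2 ⟨hz.1.1, hz.1.2, Or.inr h1⟩
    rw [hG₁0 z fun h => h1 (hXΩ h), hG₁0 z.swap fun h => h2 (hXΩ h), hG₃0 z fun h => h1 (hXΩ h)]
    simp
  have hr : ∀ {F : V × V → ℝ}, Integrable F (volume.prod volume) →
      Integrable F ((volume.restrict E).prod (volume.restrict Eᶜ)) := fun hF => by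
    rw [Measure.prod_restrict]; exact hF.integrableOn
  have his : Integrable (fun z : V × V => G₁ z.swap) (volume.prod volume) := hi₁.swap
  have hi₁s : Integrable (fun z : V × V => G₁ z + G₁ z.swap) (volume.prod volume) := hi₁.add his
  rw [hstep, integral_add hi₁s.integrableOn (hi₃.const_mul 2).integrableOn,
    integral_add hi₁.integrableOn his.integrableOn, integral_const_mul]
  -- the diagonal terms
  set T : V × V → ℝ := fun z => ⟪secondField k X z.2 z.1, nu E z.1⟫
  have hT : Integrable T (σ.prod volume) := by
    refine integrable_prod_of_kernel_bound hs0 hδ hJ (C := |C|)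
      ((continuous_secondField hk hX).aestronglyMeasurable.inner hνm.comp_fst) hK
      (fun z hz => by simp [T, hZ0 z.2 z.1 (hX0 _ hz)]) fun z => ?_
    have h1 := norm_exteriorNormal_le E z.1
    refine (abs_real_inner_le_norm _ _).trans ((mul_le_mul (hC z.1 z.2).2.1 h1 (norm_nonneg _)
      ((norm_nonneg _).trans (hC z.1 z.2).2.1)).trans ?_)
    rw [mul_one]
    exact mul_le_mul_of_nonneg_right (le_abs_self C) (kern_nonneg _ _ _)
  have hZd : ∀ q, ContDiff ℝ 1 (secondField k X q) := fun q =>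
    (contDiff_secondField hk hX q).of_le (by simp)
  have e1 : ∫ z in E ×ˢ Eᶜ, G₁ z ∂(volume.prod volume) = ∫ y in Eᶜ, ∫ x, T (x, y) ∂σ := by
    rw [setIntegral_prod _ hi₁.integrableOn, integral_integral_swap (f := fun x y => G₁ (x, y)) (hr hi₁)]
    refine integral_congr_ae (.of_forall fun y => ?_)
    exact hE.divergence_theorem (hZd y) (hasCompactSupport_secondField hXc y)
  have e2 : ∫ z in E ×ˢ Eᶜ, G₁ z.swap ∂(volume.prod volume) = -∫ y in E, ∫ x, T (x, y) ∂σ := by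
    rw [setIntegral_prod _ his.integrableOn, ← integral_neg]
    refine integral_congr_ae (.of_forall fun y => ?_)
    exact hE.divergence_theorem_compl (hZd y) (hasCompactSupport_secondField hXc y)
  have hg := hT.integral_prod_right
  have hsT : Integrable (fun z : V × V => sgnInd E z.2 * T z) (σ.prod volume) := by
    refine hT.norm.mono' (((measurable_sgnInd hEm).comp
      measurable_snd).aestronglyMeasurable.mul hT.1) (.of_forall fun z => ?_)
    rw [norm_mul, norm_eq_abs (sgnInd E z.2), abs_sgnInd, one_mul]
  -- The integrals of one function over `Eᶜ` and over `E` enter with opposite signs, which makes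
  -- minus its integral against `sgnInd E`.
  have e12 : (∫ z in E ×ˢ Eᶜ, G₁ z ∂(volume.prod volume)) +
      ∫ z in E ×ˢ Eᶜ, G₁ z.swap ∂(volume.prod volume) =
      -∫ x, (∫ y, sgnInd E y * T (x, y)) ∂σ := by
    rw [e1, e2, integral_integral_swap (f := fun x y => sgnInd E y * T (x, y)) hsT]
    have h1 := integral_sgnInd_mul hEm hg
    have h2 := integral_add_compl hEm hg
    simp_rw [integral_const_mul]
    linarith
  -- the cross term
  set V' : V × V → ℝ := fun z => kernelFlux k X z.1 z.2 * ⟪X z.1, nu E z.1⟫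
  obtain ⟨M, hM0, hM⟩ := exists_field_bound hX hXc
  have hV : Integrable V' (σ.prod volume) := by
    refine integrable_prod_of_kernel_bound hs0 hδ hJ (C := |C| * M)
      (((continuous_kernelFlux hk hX).comp continuous_swap).aestronglyMeasurable.mul
        ((hX.continuous.comp continuous_fst).aestronglyMeasurable.inner hνm.comp_fst)) hK
      (fun z hz => by simp [V', hX0 _ hz]) fun z => ?_
    have h1 := norm_exteriorNormal_le E z.1
    have h2 : |⟪X z.1, nu E z.1⟫| ≤ M := (abs_real_inner_le_norm _ _).trans
      ((mul_le_mul (hM z.1).1 h1 (norm_nonneg _) hM0).trans (mul_one M).le)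
    have h3 := (hC z.2 z.1).1
    rw [← neg_sub, he] at h3
    have h4 := h3.trans (mul_le_mul_of_nonneg_right (le_abs_self C) (kern_nonneg _ _ _))
    rw [abs_mul]
    refine (mul_le_mul h4 h2 (abs_nonneg _) ((abs_nonneg _).trans h4)).trans (le_of_eq ?_)
    ring
  have hVr : Integrable V' (σ.prod (volume.restrict Eᶜ)) := by
    rw [← Measure.restrict_univ (μ := σ), Measure.prod_restrict]; exact hV.integrableOn
  -- Only the first variable is integrated by parts here; the divergence in the second one, hidden
  -- in `kernelFlux`, is used in `hVx`.
  have e3 : ∫ z in E ×ˢ Eᶜ, G₃ z ∂(volume.prod volume) =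
      ∫ x, (∫ y in Eᶜ, V' (x, y)) ∂σ := by
    rw [setIntegral_prod _ hi₃.integrableOn, integral_integral_swap (f := fun x y => G₃ (x, y)) (hr hi₃),
      integral_integral_swap (f := fun x y => V' (x, y)) hVr]
    refine integral_congr_ae (.of_forall fun y => ?_)
    have hd : ContDiff ℝ 1 fun x => kernelFlux k X x y • X x := by
      refine ContDiff.of_le (n := ∞) ?_ (by simp)
      exact (((((hk.fderiv_right (m := ((⊤ : ℕ∞) : WithTop ℕ∞)) (by simp)).comp
        (contDiff_const.sub contDiff_id)).clm_apply contDiff_const)).add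
        ((hk.comp (contDiff_const.sub contDiff_id)).mul contDiff_const)).smul hX
    refine (hE.divergence_theorem hd (hXc.mono fun x hx h0 => hx (hV0 y x h0))).trans ?_
    refine integral_congr_ae (.of_forall fun x => ?_)
    simp only [V', inner_smul_left, conj_trivial]
  -- evaluation of the inner integrals
  have hinner : ∀ᵐ x ∂σ, -(∫ y, sgnInd E y * T (x, y)) + 2 * ∫ y in Eᶜ, V' (x, y) =
      -2 * (smoothedJacobi s E h δ x * h x) -
        h x ^ 2 * meanCurvature E x * smoothedCurvature s E δ x := by
    filter_upwards [ae_mem_frontier E] with x hx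
    have hn : ⟪nu E x, nu E x⟫ = 1 := by
      rw [real_inner_self_eq_norm_sq, hE.norm_exteriorNormal hx, one_pow]
    obtain ⟨g1, g2, g3⟩ := hE.signed_gauss_kernel hs0 hArea hδ x (nu E x)
    have hc : Integrable fun y => sgnInd E y * k (y - x) := by
      refine (hJ.const_mul ((1 + (1 + ‖x‖) / δ) ^ (N + s))).mono'
        ((measurable_sgnInd hEm).aestronglyMeasurable.mul
          (hk.continuous.comp (continuous_id.sub continuous_const)).aestronglyMeasurable)
        (.of_forall fun y => ?_)
      rw [norm_mul, norm_eq_abs, abs_sgnInd, one_mul,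
        norm_of_nonneg (kern_nonneg _ _ _)]
      exact kern_le_japanese hβ hδ x y
    have hT' : ∫ y, sgnInd E y * T (x, y) =
        h x ^ 2 * (-2 * ∫ y, k (y - x) * ⟪nu E y, nu E x⟫ ∂σ) +
          h x ^ 2 * meanCurvature E x * smoothedCurvature s E δ x := by
      rw [← g3, smoothedCurvature, ← integral_const_mul, ← integral_const_mul, ← integral_add
        (g1.const_mul _) (hc.const_mul _)]
      refine integral_congr_ae (.of_forall fun y => ?_)
      simp only [T]
      rw [hE.inner_secondField hX hXh hx, ← neg_sub x y, ← hkdef, he]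
      ring
    have hVx : ∫ y in Eᶜ, V' (x, y) = -(h x * ∫ y, h y * k (y - x) ∂σ) := by
      have h1 : ∫ y in Eᶜ, kernelFlux k X x y = -∫ y, ⟪k (y - x) • X y, nu E y⟫ ∂σ := by
        simp_rw [← divergence_kernel_smul hk hX]
        exact hE.divergence_theorem_compl (((hk.comp (contDiff_id.sub contDiff_const)).smul hX).of_le
          (by simp)) (hXc.mono fun y hy h0 => hy (by simp [h0]))
      simp only [V']
      rw [integral_mul_const, h1, hXh x hx, inner_smul_left, hn, mul_one, conj_trivial, neg_mul,
        mul_comm]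
      congr 2
      refine integral_congr_ae ?_
      filter_upwards [ae_mem_frontier E] with y hy
      rw [hXh y hy, inner_smul_left, inner_smul_left, real_inner_self_eq_norm_sq,
        hE.norm_exteriorNormal hy]
      simp [mul_comm]
    have hJx : smoothedJacobi s E h δ x = (∫ y, h y * k (y - x) ∂σ) -
        h x * ∫ y, k (y - x) * ⟪nu E y, nu E x⟫ ∂σ := by
      have hi : Integrable (fun y => h y * k (y - x)) σ := by
        have h1 : Integrable (fun y => ⟪X y, nu E y⟫ * k (y - x)) σ :=
          hE.integrable_surface ((hX.continuous.continuousOn.inner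
            hE.continuousOn_exteriorNormal).mul
              (hk.continuous.comp (continuous_id.sub continuous_const)).continuousOn) hK
            fun y _ hy => by simp [hX0 y hy]
        refine h1.congr ?_
        filter_upwards [ae_mem_frontier E] with y hy
        rw [hXh y hy, inner_smul_left, real_inner_self_eq_norm_sq, hE.norm_exteriorNormal hy]
        simp
      rw [smoothedJacobi, ← integral_const_mul, ← integral_sub hi (g2.const_mul _)]
      refine integral_congr_ae (.of_forall fun y => ?_)
      simp only [real_inner_comm (nu E x) (nu E y)]
      ring
    rw [hT', hVx, hJx]
    ring
  have hA : Integrable (fun x => -∫ y, sgnInd E y * T (x, y)) σ :=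
    hsT.integral_prod_left.neg
  rw [e12, e3, ← integral_neg, ← integral_const_mul, ← integral_add hA
    (hVr.integral_prod_left.const_mul 2)]
  exact integral_congr_ae hinner

end SecondVariationFormula

/-! ### Passage to the limit in the second variation -/

section PerimeterTheorem

variable {X : R^N → R^N}

/-- Besides dominated convergence, the limit function itself inherits measurability and the bound
from a sequence `δ → 0`. -/
lemma integrable_and_tendsto_integral {μ : Measure V} {f : ℝ → V → ℝ} {f₀ g : V → ℝ}
    (hf : ∀ δ > 0, AEStronglyMeasurable (f δ) μ) (hg : Integrable g μ)
    (hb : ∀ δ > 0, ∀ᵐ x ∂μ, |f δ x| ≤ g x)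
    (hl : ∀ᵐ x ∂μ, Tendsto (fun δ => f δ x) (𝓝[>] 0) (𝓝 (f₀ x))) :
    Integrable f₀ μ ∧ Tendsto (fun δ => ∫ x, f δ x ∂μ) (𝓝[>] 0) (𝓝 (∫ x, f₀ x ∂μ)) := by
  have hpos : ∀ᶠ δ in 𝓝[>] (0 : ℝ), 0 < δ := self_mem_nhdsWithin
  refine ⟨?_, tendsto_integral_filter_of_dominated_convergence g (hpos.mono fun δ h => hf δ h)
    (hpos.mono fun δ h => hb δ h) hg hl⟩
  obtain ⟨u, hu⟩ := exists_seq_tendsto (𝓝[>] (0 : ℝ))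
  have hu' : ∀ᶠ n in atTop, 0 < u n := hu.eventually hpos
  obtain ⟨n₀, hn₀⟩ := eventually_atTop.1 hu'
  have hlim : ∀ᵐ x ∂μ, Tendsto (fun n => f (u (n + n₀)) x) atTop (𝓝 (f₀ x)) := by
    filter_upwards [hl] with x hx
    exact (hx.comp hu).comp (tendsto_add_atTop_nat n₀)
  have hall : ∀ᵐ x ∂μ, ∀ n, |f (u (n + n₀)) x| ≤ g x :=
    ae_all_iff.2 fun n => hb _ (hn₀ _ (by omega))
  refine hg.mono' (aestronglyMeasurable_of_tendsto_ae atTop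
    (fun n => hf _ (hn₀ _ (Nat.le_add_left _ _))) hlim) ?_
  filter_upwards [hlim, hall] with x h1 h2
  exact le_of_tendsto h1.norm (.of_forall h2)

lemma exists_uniform_bound {K : Set V} (hK : IsCompact K) {f : ℝ → V → ℝ}
    (hloc : ∀ p₀ ∈ K, ∃ ρ > 0, ∃ B : ℝ, ∀ p ∈ ball p₀ ρ, p ∈ K → ∀ δ > 0, |f δ p| ≤ B) :
    ∃ B : ℝ, 0 ≤ B ∧ ∀ p ∈ K, ∀ δ > 0, |f δ p| ≤ B := by
  choose! ρ hρ B hB using hloc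
  obtain ⟨t, htK, ht⟩ := hK.elim_nhds_subcover (fun p => ball p (ρ p))
    fun p hp => ball_mem_nhds p (hρ p hp)
  refine ⟨∑ q ∈ t, |B q|, Finset.sum_nonneg fun _ _ => abs_nonneg _, fun p hp δ hδ => ?_⟩
  obtain ⟨q, hq, hpq⟩ := mem_iUnion₂.1 (ht hp)
  exact (hB q (htK q hq) p hpq hp δ hδ).trans ((le_abs_self _).trans
    (Finset.single_le_sum (f := fun q => |B q|) (fun _ _ => abs_nonneg _) hq))

lemma aestronglyMeasurable_smoothedCurvature (hE : HasSmoothBoundary E) (s δ : ℝ)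
    (μ : Measure V) : AEStronglyMeasurable (smoothedCurvature s E δ) μ := by
  have h : StronglyMeasurable fun z : V × V =>
      sgnInd E z.2 * kern (N + s) δ (z.2 - z.1) :=
    (((measurable_sgnInd hE.1.measurableSet).comp measurable_snd).mul
      ((measurable_kern _ δ).comp (measurable_snd.sub measurable_fst))).stronglyMeasurable
  exact h.integral_prod_right'.aestronglyMeasurable

lemma HasSmoothBoundary.aestronglyMeasurable_smoothedJacobi (hE : HasSmoothBoundary E)
    {h : V → ℝ} (hh : ContinuousOn h (frontier E)) (s δ : ℝ) :
    AEStronglyMeasurable (smoothedJacobi s E h δ) (area E) := by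
  have := hE.isLocallyFiniteMeasure
  have hν : AEStronglyMeasurable (nu E) (area E) :=
    HasSmoothBoundary.aestronglyMeasurable_surface hE.continuousOn_exteriorNormal
  have hhm : AEStronglyMeasurable h (area E) :=
    HasSmoothBoundary.aestronglyMeasurable_surface hh
  have h1 : AEStronglyMeasurable (fun z : V × V =>
      (h z.2 - h z.1 * ⟪nu E z.1, nu E z.2⟫) *
        kern (N + s) δ (z.2 - z.1)) ((area E).prod (area E)) :=
    (hhm.comp_snd.sub (hhm.comp_fst.mul (hν.comp_fst.inner hν.comp_snd))).mul
      ((measurable_kern _ δ).comp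
        (measurable_snd.sub measurable_fst)).aestronglyMeasurable
  exact h1.integral_prod_right'

/-- Passage to the limit in the regularized second variation. -/
lemma HasSmoothBoundary.tendsto_second_variation (hE : HasSmoothBoundary E)
    {s : ℝ} (hs0 : 0 < s) (hs1 : s < 1)
    (hArea : Integrable (fun x : V => (1 + ‖x‖) ^ (-(N + s))) (area E))
    (hX : ContDiff ℝ ∞ X) (hXc : HasCompactSupport X) {h : V → ℝ}
    (hh : SmoothOnSurface (frontier E) h) (hXh : ∀ x ∈ frontier E, X x = h x • nu E x) :
    (∀ p ∈ frontier E, HasPrincipalValue volume p (curvatureIntegrand s E p) ∧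
      FractionalJacobiExists s E h p) ∧
    Integrable (fun p => fractionalJacobi s E h p * h p) (area E) ∧
    Integrable (fun p => h p ^ 2 * meanCurvature E p * fractionalMeanCurvature s E p)
      (area E) ∧
    Tendsto (fun δ => ∫ x, (-2 * (smoothedJacobi s E h δ x * h x) -
        h x ^ 2 * meanCurvature E x * smoothedCurvature s E δ x) ∂(area E)) (𝓝[>] 0)
      (𝓝 (-2 * (∫ p, fractionalJacobi s E h p * h p ∂(area E))
        - ∫ p, h p ^ 2 * meanCurvature E p * fractionalMeanCurvature s E p
          ∂(area E))) := by
  have := hE.isLocallyFiniteMeasure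
  obtain ⟨M, hM0, hM⟩ := exists_field_bound hX hXc
  have hhM : ∀ x ∈ frontier E, |h x| ≤ M := fun x hx => by
    have h1 := (hM x).1
    rwa [hXh x hx, norm_smul, hE.norm_exteriorNormal hx, mul_one, norm_eq_abs] at h1
  have hJ := fun p₀ (hp₀ : p₀ ∈ frontier E) => hE.jacobi_estimates hs0 hs1 hArea hh hhM hp₀
  have hC := fun p₀ (hp₀ : p₀ ∈ frontier E) => hE.curvature_estimates hs0 hs1 hp₀
  have hK : IsCompact (tsupport X ∩ frontier E) := hXc.isCompact.inter_right isClosed_frontier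
  have hh0 : ∀ x ∈ frontier E, x ∉ tsupport X → h x = 0 := fun x hx hxt => by
    have h1 := hXh x hx
    rw [image_eq_zero_of_notMem_tsupport hxt] at h1
    exact (smul_eq_zero.1 h1.symm).resolve_right fun h2 => by
      have := hE.norm_exteriorNormal hx
      rw [h2, norm_zero] at this
      exact zero_ne_one this
  obtain ⟨BJ, hBJ0, hBJ⟩ := exists_uniform_bound hK (f := fun δ p => smoothedJacobi s E h δ p)
    fun p₀ hp₀ => by
      obtain ⟨ρ, hρ, B, hB⟩ := hJ p₀ hp₀.2
      exact ⟨ρ, hρ, B, fun p hp hpK => (hB p hp hpK.2).2.2⟩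
  obtain ⟨BC, hBC0, hBC⟩ := exists_uniform_bound hK (f := fun δ p => smoothedCurvature s E δ p)
    fun p₀ hp₀ => by
      obtain ⟨ρ, hρ, B, hB⟩ := hC p₀ hp₀.2
      exact ⟨ρ, hρ, B, fun p hp hpK => (hB p hp hpK.2).2.2.1⟩
  set σ := area E
  have hhc := hh.continuousOn
  have hhm : AEStronglyMeasurable h σ := HasSmoothBoundary.aestronglyMeasurable_surface hhc
  -- the weight `h² H`
  set wt : V → ℝ := fun x =>
    h x * (divergence X x - ⟪fderiv ℝ X x (nu E x), nu E x⟫) with hwt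
  have hwtc : ContinuousOn wt (frontier E) := by
    have h1 : ContinuousOn (fun x => fderiv ℝ X x (nu E x)) (frontier E) :=
      (hX.continuous_fderiv (by simp)).continuousOn.clm_apply hE.continuousOn_exteriorNormal
    exact hhc.mul ((contDiff_divergence hX).continuous.continuousOn.sub
      (h1.inner hE.continuousOn_exteriorNormal))
  -- Expressed through the extension `X`, the weight is visibly continuous on the surface;
  -- measurability and integrability follow without studying `meanCurvature` as a function.
  have hwt_eq : ∀ x ∈ frontier E, h x ^ 2 * meanCurvature E x = wt x := fun x hx => by
    rw [hwt]; dsimp only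
    rw [hE.divergence_sub_inner hX hXh hx]; ring
  have hwtm : AEStronglyMeasurable (fun x => h x ^ 2 * meanCurvature E x) σ :=
    (HasSmoothBoundary.aestronglyMeasurable_surface hwtc).congr (by
      filter_upwards [ae_mem_frontier E] with x hx using (hwt_eq x hx).symm)
  have hgh : Integrable (fun x => BJ * |h x|) σ := (hE.integrable_surface hhc.abs hXc.isCompact
    fun x hx hxt => by simp [hh0 x hx hxt]).const_mul BJ
  have hgw : Integrable (fun x => BC * |wt x|) σ := (hE.integrable_surface hwtc.abs hXc.isCompact
    fun x hx hxt => by simp [hwt, hh0 x hx hxt]).const_mul BC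
  obtain ⟨iJ, tJ⟩ := integrable_and_tendsto_integral (μ := σ)
    (f := fun δ x => smoothedJacobi s E h δ x * h x)
    (f₀ := fun x => fractionalJacobi s E h x * h x)
    (fun δ _ => (hE.aestronglyMeasurable_smoothedJacobi hhc s δ).mul hhm) hgh
    (fun δ hδ => by
      filter_upwards [ae_mem_frontier E] with x hx
      rw [abs_mul]
      by_cases hxt : x ∈ tsupport X
      · exact mul_le_mul_of_nonneg_right (hBJ x ⟨hxt, hx⟩ δ hδ) (abs_nonneg _)
      · simp [hh0 x hx hxt])
    (by
      filter_upwards [ae_mem_frontier E] with x hx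
      obtain ⟨ρ, hρ, B, hB⟩ := hJ x hx
      exact (hB x (mem_ball_self hρ) hx).2.1.mul_const _)
  obtain ⟨iC, tC⟩ := integrable_and_tendsto_integral (μ := σ)
    (f := fun δ x => h x ^ 2 * meanCurvature E x * smoothedCurvature s E δ x)
    (f₀ := fun x => h x ^ 2 * meanCurvature E x * fractionalMeanCurvature s E x)
    (fun δ _ => hwtm.mul (aestronglyMeasurable_smoothedCurvature hE s δ σ)) hgw
    (fun δ hδ => by
      filter_upwards [ae_mem_frontier E] with x hx
      rw [abs_mul, hwt_eq x hx, mul_comm]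
      by_cases hxt : x ∈ tsupport X
      · exact mul_le_mul_of_nonneg_right (hBC x ⟨hxt, hx⟩ δ hδ) (abs_nonneg _)
      · simp [hwt, hh0 x hx hxt])
    (by
      filter_upwards [ae_mem_frontier E] with x hx
      obtain ⟨ρ, hρ, B, hB⟩ := hC x hx
      exact (hB x (mem_ball_self hρ) hx).2.1.const_mul _)
  refine ⟨fun p hp => ?_, iJ, iC, ?_⟩
  · obtain ⟨ρ, hρ, B, hB⟩ := hJ p hp
    obtain ⟨ρ', hρ', B', hB'⟩ := hC p hp
    exact ⟨(hB' p (mem_ball_self hρ') hp).1, (hB p (mem_ball_self hρ) hp).1⟩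
  refine ((tJ.const_mul (-2)).sub tC).congr' ?_
  filter_upwards [self_mem_nhdsWithin] with δ hδ
  have i1 : Integrable (fun x => smoothedJacobi s E h δ x * h x) σ :=
    hgh.mono' ((hE.aestronglyMeasurable_smoothedJacobi hhc s δ).mul hhm) (by
      filter_upwards [ae_mem_frontier E] with x hx
      rw [norm_mul]
      by_cases hxt : x ∈ tsupport X
      · exact mul_le_mul_of_nonneg_right (hBJ x ⟨hxt, hx⟩ δ hδ) (abs_nonneg _)
      · simp [hh0 x hx hxt])
  have i2 : Integrable (fun x => h x ^ 2 * meanCurvature E x * smoothedCurvature s E δ x) σ :=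
    hgw.mono' (hwtm.mul (aestronglyMeasurable_smoothedCurvature hE s δ σ)) (by
      filter_upwards [ae_mem_frontier E] with x hx
      rw [norm_mul, hwt_eq x hx, mul_comm]
      by_cases hxt : x ∈ tsupport X
      · exact mul_le_mul_of_nonneg_right (hBC x ⟨hxt, hx⟩ δ hδ) (abs_nonneg _)
      · simp [hwt, hh0 x hx hxt])
  rw [integral_sub (i1.const_mul (-2)) i2, integral_const_mul]

/-- The space is connected, so an open set with empty boundary is empty or everything. This handles
`∂E = ∅`, where normal perturbations are not unique. -/
lemma fractionalPerimeter_eq_zero {F Ω : Set V} (s : ℝ) (hF : IsOpen F) (hfr : frontier F = ∅) :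
    fractionalPerimeter s F Ω = 0 := by
  have hclopen : IsClopen F := isClopen_iff_frontier_eq_empty.2 hfr
  rcases isClopen_iff.1 hclopen with rfl | rfl
  · simp [fractionalPerimeter]
  · simp [fractionalPerimeter]

end PerimeterTheorem

/-! ### The curvature along a compactly supported flow -/

section CurvatureFlow

lemma integrable_sgnInd_mul (hE : MeasurableSet E) {f : V → ℝ}
    (hf : Integrable f) : Integrable fun x => sgnInd E x * f x := by
  refine hf.norm.mono' ((measurable_sgnInd hE).aestronglyMeasurable.mul hf.1)
    (.of_forall fun x => ?_)
  rw [norm_mul, norm_eq_abs (sgnInd E x), abs_sgnInd, one_mul]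

variable {X : R^N → R^N} {L L₂ : NNReal}

lemma norm_taylor_le (hX : ContDiff ℝ ∞ X) (hL₂ : LipschitzWith L₂ (fderiv ℝ X)) (p x : V) :
    ‖X x - X p - fderiv ℝ X p (x - p)‖ ≤ L₂ * ‖x - p‖ ^ 2 := by
  have h1 := (convex_closedBall p ‖x - p‖).norm_image_sub_le_of_norm_hasFDerivWithin_le' (𝕜 := ℝ)
    (f := X) (f' := fderiv ℝ X) (C := L₂ * ‖x - p‖) (φ := fderiv ℝ X p)
    (fun z _ => (hX.differentiable (by simp) z).hasFDerivAt.hasFDerivWithinAt)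
    (fun z hz => by
      rw [← dist_eq_norm]
      exact (hL₂.dist_le_mul z p).trans (mul_le_mul_of_nonneg_left hz L₂.2))
    (Metric.mem_closedBall_self (norm_nonneg _)) (y := x) (by simp [dist_eq_norm])
  linarith [sq ‖x - p‖]

/-- The parameters at two points symmetric with respect to `p` are close. -/
lemma norm_pairParam_reflection_le (hX : ContDiff ℝ ∞ X) (hL : LipschitzWith L X)
    (hL₂ : LipschitzWith L₂ (fderiv ℝ X)) (δ : ℝ) (p x : V) :
    ‖pairParam X δ (x, p) - pairParam X δ (p + p - x, p)‖ ≤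
      (2 * L₂ + 4 * L * L₂) * ‖x - p‖ := by
  set w := x - p with hw
  have hx' : p + p - x - p = -w := by rw [hw]; abel
  have hn : ‖-w‖ = ‖w‖ := norm_neg w
  set U := X x - X p
  set V' := X (p + p - x) - X p
  -- The linear parts of the increments of `X` at the two reflected points cancel in the sum, and
  -- each difference of parameters below contains this sum or a difference of `DX`.
  have hUV : ‖U + V'‖ ≤ 2 * L₂ * ‖w‖ ^ 2 := by
    have h1 := norm_taylor_le hX hL₂ p x
    have h2 := norm_taylor_le hX hL₂ p (p + p - x)
    rw [hx', map_neg, hn] at h2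
    have h3 := norm_add_le (X x - X p - fderiv ℝ X p (x - p))
      (X (p + p - x) - X p - -fderiv ℝ X p w)
    rw [show X x - X p - fderiv ℝ X p (x - p) + (X (p + p - x) - X p - -fderiv ℝ X p w) = U + V' by
      simp only [U, V', hw]; abel] at h3
    linarith
  have hU : ‖U - V'‖ ≤ 2 * L * ‖w‖ := by
    have h1 : U - V' = X x - X (p + p - x) := by simp only [U, V']; abel
    have h2 := hL.dist_le_mul x (p + p - x)
    rw [dist_eq_norm, dist_eq_norm, show x - (p + p - x) = w + w by rw [hw]; abel] at h2
    rw [h1]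
    have := norm_add_le w w
    nlinarith [L.2]
  set d := ‖w‖ ^ 2 + δ ^ 2
  have hd0 : 0 ≤ d := by positivity
  have hwd : ‖w‖ ^ 2 ≤ d := le_add_of_nonneg_right (sq_nonneg δ)
  have hw0 := norm_nonneg w
  have hp1 : (0 : ℝ) ≤ L * L₂ * ‖w‖ := by positivity
  have hp2 : (0 : ℝ) ≤ L₂ * ‖w‖ := by positivity
  have hb : |⟪w, U⟫ / d - ⟪-w, V'⟫ / d| ≤ (2 * L₂ + 4 * L * L₂) * ‖w‖ := by
    rw [inner_neg_left, ← sub_div, sub_neg_eq_add, ← inner_add_right, abs_div, abs_of_nonneg hd0]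
    refine div_le_of_le_mul₀ hd0 (by positivity) ?_
    have h1 := (abs_real_inner_le_norm w (U + V')).trans (mul_le_mul_of_nonneg_left hUV hw0)
    have h2 := mul_le_mul_of_nonneg_left hwd (by linarith : 0 ≤ (2 * L₂ + 4 * L * L₂) * ‖w‖)
    nlinarith [mul_nonneg hp1 (sq_nonneg ‖w‖)]
  have hc : |‖U‖ ^ 2 / d - ‖V'‖ ^ 2 / d| ≤ (2 * L₂ + 4 * L * L₂) * ‖w‖ := by
    rw [← sub_div, abs_div, abs_of_nonneg hd0]
    refine div_le_of_le_mul₀ hd0 (by positivity) ?_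
    have h0 : ‖U‖ ^ 2 - ‖V'‖ ^ 2 = ⟪U - V', U + V'⟫ := by
      rw [inner_sub_left, inner_add_right, inner_add_right, real_inner_self_eq_norm_sq,
        real_inner_self_eq_norm_sq, real_inner_comm V' U]; ring
    rw [h0]
    have h1 := (abs_real_inner_le_norm (U - V') (U + V')).trans
      (mul_le_mul hU hUV (norm_nonneg _) (by positivity))
    have h2 := mul_le_mul_of_nonneg_left hwd (by linarith : 0 ≤ (2 * L₂ + 4 * L * L₂) * ‖w‖)
    nlinarith [mul_nonneg hp2 (sq_nonneg ‖w‖)]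
  have hD : ‖fderiv ℝ X x - fderiv ℝ X (p + p - x)‖ ≤ (2 * L₂ + 4 * L * L₂) * ‖w‖ := by
    have h2 := hL₂.dist_le_mul x (p + p - x)
    rw [dist_eq_norm, dist_eq_norm, show x - (p + p - x) = w + w by rw [hw]; abel] at h2
    have := mul_le_mul_of_nonneg_left (norm_add_le w w) L₂.2
    simp only [NNReal.val_eq_coe] at this
    linarith
  simp only [pairParam, Prod.norm_def, Prod.fst_sub, Prod.snd_sub, hx', hn, sub_self, norm_zero]
  exact max_le hb (max_le hc (max_le hD (by positivity)))

lemma convex_pairParamSet (L : ℝ) : Convex ℝ (pairParamSet N L) :=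
  (convex_Icc _ _).prod ((convex_Icc _ _).prod
    ((convex_closedBall _ _).prod (convex_closedBall _ _)))

lemma sgnInd_image {Φ : V → V} (hΦ : Function.Injective Φ) (E : Set V) (x : V) :
    sgnInd (Φ '' E) (Φ x) = sgnInd E x := by
  by_cases hx : x ∈ E
  · rw [sgnInd_of_mem hx, sgnInd_of_mem (mem_image_of_mem Φ hx)]
  · rw [sgnInd_of_notMem hx, sgnInd_of_notMem (by rwa [hΦ.mem_set_image])]

/-- Multiplying the curvature at the moved point by the Jacobian at `p` produces the same
`pairWeight` as for the perimeter; the factor is divided out at the end. -/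
lemma smoothedCurvature_shift (hX : ContDiff ℝ ∞ X) (hL : LipschitzWith L X) {t : ℝ}
    (ht : |t| * L ≤ 1 / 4) (hdet : ∀ x, 0 < (1 + t • fderiv ℝ X x).det) (s : ℝ) (E : Set V) (δ : ℝ)
    (p : V) :
    smoothedCurvature s (shift X t '' E) δ (shift X t p) * (1 + t • fderiv ℝ X p).det =
      ∫ x, sgnInd E x * (kern (N + s) δ (x - p) *
        pairWeight ((N + s) / 2) (t, pairParam X δ (x, p))) := by
  obtain ⟨Φ, hΦ, -⟩ := exists_shift_homeomorph hX hL (ht.trans (by norm_num))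
  have hΦ' : shift X t = Φ := funext fun x => (hΦ x).symm
  have hinj : Function.Injective (shift X t) := hΦ' ▸ Φ.injective
  have h1 := integral_image_eq_integral_abs_det_fderiv_smul volume MeasurableSet.univ
    (fun x _ => (hasFDerivAt_shift (t := t) hX x).hasFDerivWithinAt) hinj.injOn
    fun x => sgnInd (shift X t '' E) x *
      kern (N + s) δ (x - shift X t p)
  rw [image_univ, (hΦ' ▸ Φ.surjective : Function.Surjective (shift X t)).range_eq, setIntegral_univ,
    setIntegral_univ] at h1
  rw [smoothedCurvature, h1, ← integral_mul_const]
  refine integral_congr_ae (.of_forall fun x => ?_)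
  simp only [smul_eq_mul]
  rw [← kern_shift hL ht (N + s) δ (x, p), sgnInd_image hinj,
    abs_of_pos (hdet x)]
  ring

lemma pairWeight_zero (γ : ℝ) (θ : ℝ × ℝ × (V →L[ℝ] V) × (V →L[ℝ] V)) :
    pairWeight γ (0, θ) = 1 := by
  obtain ⟨P, hP, hP0, -⟩ := exists_det_polynomial θ.2.2.1
  obtain ⟨Q, hQ, hQ0, -⟩ := exists_det_polynomial θ.2.2.2
  rw [pairWeight, hP, hQ, hP0, hQ0, mul_one, mul_one]
  simp only [mul_zero, zero_mul, add_zero, ne_eq, OfNat.ofNat_ne_zero, not_false_eq_true, zero_pow]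
  rw [regularPower_eq (by norm_num), Real.one_rpow]

/-- The first variation of the regularized curvature along a flow. -/
lemma HasSmoothBoundary.integral_first_variation (hE : HasSmoothBoundary E)
    {s : ℝ} (hs0 : 0 < s)
    (hArea : Integrable (fun x : V => (1 + ‖x‖) ^ (-(N + s))) (area E))
    (hX : ContDiff ℝ ∞ X) (hXc : HasCompactSupport X) (hL : LipschitzWith L X) {h : V → ℝ}
    (hXh : ∀ x ∈ frontier E, X x = h x • nu E x) {p : V} (hp : p ∈ frontier E)
    {δ : ℝ} (hδ : 0 < δ) (hc : Integrable fun x =>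
      sgnInd E x * kern (N + s) δ (x - p)) :
    Integrable (fun x => sgnInd E x * (kern (N + s) δ (x - p) *
      timeDeriv (pairWeight ((N + s) / 2)) (0, pairParam X δ (x, p)))) ∧
    ∫ x, sgnInd E x * (kern (N + s) δ (x - p) *
      timeDeriv (pairWeight ((N + s) / 2)) (0, pairParam X δ (x, p))) =
      2 * smoothedJacobi s E h δ p + divergence X p * smoothedCurvature s E δ p := by
  have hk := contDiff_kern (N := N) (N + s) hδ
  have he := kern_neg (N := N) (N + s) δ
  obtain ⟨g1, g2, g3⟩ := hE.signed_gauss_kernel hs0 hArea hδ p (X p)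
  set k : V → ℝ := kern (N + s) δ with hkdef
  have hX0 : ∀ x ∉ tsupport X, X x = 0 := fun x hx => image_eq_zero_of_notMem_tsupport hx
  have hZ : ContDiff ℝ 1 fun x => k (x - p) • X x :=
    ((hk.comp (contDiff_id.sub contDiff_const)).smul hX).of_le (by simp)
  have hZc : HasCompactSupport fun x => k (x - p) • X x := hXc.mono fun y hy h0 => hy (by simp [h0])
  have i1 := integrable_sgnInd_mul hE.1.measurableSet (integrable_divergence hZ hZc)
  -- The linear term splits into the divergence of `k (x - p) X x`, a derivative of the kernel in
  -- the fixed direction `X p`, and a multiple of the curvature integrand. Gauss' formulas apply to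
  -- the first two.
  have hpt : ∀ x, sgnInd E x * (k (x - p) *
      timeDeriv (pairWeight ((N + s) / 2)) (0, pairParam X δ (x, p))) =
      sgnInd E x * divergence (fun x => k (x - p) • X x) x +
        (sgnInd E x * fderiv ℝ k (p - x) (X p) +
          divergence X p * (sgnInd E x * k (x - p))) := fun x => by
    rw [(kern_mul_timeDeriv hX hL _ hδ x p).1, divergence_kernel_smul hk hX, kernelFlux,
      ← hkdef, ← neg_sub x p, fderiv_neg_of_even hk he, map_sub]
    ring
  simp_rw [hpt]
  have i2 : Integrable fun x => sgnInd E x * fderiv ℝ k (p - x) (X p) +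
      divergence X p * (sgnInd E x * k (x - p)) := g1.add (hc.const_mul _)
  refine ⟨i1.add i2, ?_⟩
  rw [integral_add i1 i2, integral_add g1 (hc.const_mul _), integral_const_mul,
    hE.signed_divergence_theorem hZ hZc, g3]
  have i3 : Integrable (fun x => ⟪k (x - p) • X x, nu E x⟫) (area E) :=
    hE.integrable_surface (hZ.continuous.continuousOn.inner hE.continuousOn_exteriorNormal)
      hXc.isCompact fun x _ hx => by simp [hX0 x hx]
  have hJ : smoothedJacobi s E h δ p = (∫ x, ⟪k (x - p) • X x, nu E x⟫
      ∂(area E)) - ∫ x, k (x - p) * ⟪nu E x, X p⟫ ∂(area E) := by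
    rw [smoothedJacobi, ← integral_sub i3 g2]
    refine integral_congr_ae ?_
    filter_upwards [ae_mem_frontier E] with x hx
    rw [hXh x hx, hXh p hp, inner_smul_left, inner_smul_left, real_inner_self_eq_norm_sq,
      hE.norm_exteriorNormal hx, inner_smul_right, real_inner_comm]
    simp only [conj_trivial]
    ring
  rw [hJ, smoothedCurvature]
  ring

/-- The derivative of the fractional mean curvature along a compactly supported flow. -/
lemma HasSmoothBoundary.hasDerivAt_curvature_shift (hE : HasSmoothBoundary E)
    {s : ℝ} (hs0 : 0 < s) (hs1 : s < 1)
    (hArea : Integrable (fun x : V => (1 + ‖x‖) ^ (-(N + s))) (area E))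
    (hX : ContDiff ℝ ∞ X) (hXc : HasCompactSupport X) (hL : LipschitzWith L X) {h : V → ℝ}
    (hh : SmoothOnSurface (frontier E) h) {B : ℝ} (hB : ∀ x ∈ frontier E, |h x| ≤ B)
    (hXh : ∀ x ∈ frontier E, X x = h x • nu E x) {p : V} (hp : p ∈ frontier E) :
    HasDerivAt (fun t => fractionalMeanCurvature s (shift X t '' E) (shift X t p))
      (2 * fractionalJacobi s E h p) 0 := by
  obtain ⟨L₂, hL₂⟩ := ((hX.fderiv_right (m := ((⊤ : ℕ∞) : WithTop ℕ∞)) (by simp)).of_le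
    (m := 1) (by simp)).lipschitzWith_of_hasCompactSupport (hXc.fderiv (𝕜 := ℝ)) (by simp)
  obtain ⟨ρ, hρ, C, hC, hQ⟩ := hE.exists_quadraticContact hp
  have hQp := hQ p (mem_ball_self hρ) hp
  obtain ⟨ρ₁, hρ₁, B₁, hcurv⟩ := hE.curvature_estimates hs0 hs1 hp
  obtain ⟨-, hlim, -, hint⟩ := hcurv p (mem_ball_self hρ₁) hp
  obtain ⟨ρ₂, hρ₂, B₂, hjac⟩ := hE.jacobi_estimates hs0 hs1 hArea hh hB hp
  obtain ⟨-, hlimJ, -⟩ := hjac p (mem_ball_self hρ₂) hp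
  set γ := (N + s) / 2 with hγ
  have hM := contDiff_pairWeight (N := N) γ
  obtain ⟨A, hA, htay⟩ := exists_taylor_time hM (isCompact_pairParamSet (N := N) L)
    (convex_pairParamSet L)
  obtain ⟨t₀, ht₀, hdet⟩ := exists_det_pos (N := N) L
  obtain ⟨P, hP, hP0, hP1, -⟩ := exists_det_polynomial (fderiv ℝ X p)
  set H := fun t => fractionalMeanCurvature s (shift X t '' E) (shift X t p)
  set J := fractionalJacobi s E h p
  set D := 2 * J + divergence X p * H 0
  have hshift0 : shift X 0 = id := funext fun x => by simp [shift]
  have hH0 : H 0 = fractionalMeanCurvature s E p := by simp [H, hshift0]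
  -- One constant for two bounds on the Taylor remainder: `O(t²)` for its size, and `O(t² ‖x - p‖)`
  -- for its difference at points reflected through `p`.
  set q : ℝ := 1 + (2 * L₂ + 4 * L * L₂) with hq
  have hq1 : 1 ≤ q := by rw [hq]; exact le_add_of_nonneg_right (by positivity)
  set Q : ℝ := (A * q * (2 * C * crossSection N + volume.real (ball (0 : V) 1))) *
      (ρ ^ (1 - s) + (N + s) * (ρ ^ (1 - s) / (1 - s))) +
    A * q * (1 + (1 + ‖p‖) / ρ) ^ (N + s) * ∫ x : V, (1 + ‖x‖) ^ (-(N + s)) with hQdef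
  -- The estimate is proved for the smoothed kernels with a constant independent of `δ`, then `δ →
  -- 0` at fixed `t`.
  have key : ∀ᶠ t in 𝓝 (0 : ℝ), |H t * P.eval t - H 0 - t * D| ≤ Q * t ^ 2 := by
    filter_upwards [eventually_small L ht₀] with t ⟨ht1, ht2, ht3⟩
    have ht2' : |t| * (L : ℝ) ≤ 1 / 2 := ht2.trans (by norm_num)
    have hEt := (isNormalPerturbation_shift hE hX hL ht2' hXh).smooth
    have hpt : shift X t p ∈ frontier (shift X t '' E) := by
      rw [frontier_shift_image hX hL ht2']; exact mem_image_of_mem _ hp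
    obtain ⟨ρ₃, hρ₃, B₃, hcurv'⟩ := hEt.curvature_estimates hs0 hs1 hpt
    have hlim' := (hcurv' _ (mem_ball_self hρ₃) hpt).2.1
    have hl := ((hlim'.mul_const (P.eval t)).sub (hlim)).sub
      (((hlimJ.const_mul 2).add (hlim.const_mul (divergence X p))).const_mul t)
    rw [← hH0] at hl
    refine le_of_tendsto hl.abs ?_
    filter_upwards [self_mem_nhdsWithin] with δ (hδ : 0 < δ)
    obtain ⟨j1, j2⟩ := hE.integral_first_variation hs0 hArea hX hXc hL hXh hp hδ (hint δ hδ)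
    have hcont : ∀ {G : ℝ × _ → ℝ} (_ : Continuous G) (τ : ℝ),
        AEStronglyMeasurable (fun x => G (τ, pairParam X δ (x, p))) (volume : Measure V) := by
      intro G hG τ
      have hXc' := hX.continuous
      have hDX : Continuous (fderiv ℝ X) := hX.continuous_fderiv (by simp)
      have hθ : Continuous fun x : V => pairParam X δ (x, p) := by
        have hd : ∀ x : V, ‖x - p‖ ^ 2 + δ ^ 2 ≠ 0 := fun x => by positivity
        unfold pairParam
        refine Continuous.prodMk (Continuous.div (by fun_prop) (by fun_prop) hd)
          (Continuous.prodMk (Continuous.div (by fun_prop) (by fun_prop) hd)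
            (Continuous.prodMk hDX
              (continuous_const : Continuous fun _ : V => fderiv ℝ X p)))
      exact (hG.comp (continuous_const.prodMk hθ)).aestronglyMeasurable
    set rem : V → ℝ := fun x => pairWeight γ (t, pairParam X δ (x, p)) -
      pairWeight γ (0, pairParam X δ (x, p)) -
        t * timeDeriv (pairWeight γ) (0, pairParam X δ (x, p)) with hrem
    have hremm : AEStronglyMeasurable rem volume :=
      ((hcont hM.continuous t).sub (hcont hM.continuous 0)).sub
        ((hcont (contDiff_timeDeriv hM).continuous 0).const_mul t)
    have hAq : 0 ≤ A * q * t ^ 2 := by positivity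
    have hremb : ∀ x, |rem x| ≤ A * q * t ^ 2 := fun x =>
      ((htay t (abs_le.1 ht3)).1 _ (pairParam_mem hL δ (x, p))).trans (by
        nlinarith [mul_nonneg hA.le (sq_nonneg t)])
    have hremo : ∀ x, |rem x - rem (p + p - x)| ≤ A * q * t ^ 2 * ‖x - p‖ := fun x => by
      refine ((htay t (abs_le.1 ht3)).2 _ (pairParam_mem hL δ (x, p)) _
        (pairParam_mem hL δ (p + p - x, p))).trans ?_
      have h1 := mul_le_mul_of_nonneg_left (norm_pairParam_reflection_le hX hL hL₂ δ p x)
        (by positivity : 0 ≤ A * t ^ 2)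
      refine h1.trans ?_
      have : 0 ≤ A * t ^ 2 * ‖x - p‖ := by positivity
      rw [hq]
      linarith
    obtain ⟨-, -, hpv⟩ := exists_principalValue (μ := (volume : Measure V)) (p := p) hρ hs0 hs1
      (integrable_japanese hs0) (f := fun x => sgnInd E x * rem x)
      ((measurable_sgnInd hE.1.measurableSet).aestronglyMeasurable.mul hremm) hAq
      (.of_forall fun x => by
        rw [abs_mul, abs_sgnInd, one_mul]; exact hremb x)
      (fun r hr hrρ => hQp.integral_sgnInd_mul_le hC hremm hAq hremb hremo hr hrρ)
    obtain ⟨i3, hrem_le⟩ := hpv δ hδ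
    have hdec : smoothedCurvature s (shift X t '' E) δ (shift X t p) * P.eval t =
        smoothedCurvature s E δ p + t * (2 * smoothedJacobi s E h δ p +
          divergence X p * smoothedCurvature s E δ p) +
        ∫ x, sgnInd E x * rem x * kern (N + s) δ (x - p) := by
      rw [← hP, smoothedCurvature_shift hX hL ht2
        (fun x => hdet t ht1 _ (norm_fderiv_le_of_lipschitzWith hL x)), ← j2, ← integral_const_mul]
      conv_rhs => rw [smoothedCurvature]
      have j3 : Integrable fun x => sgnInd E x * kern (N + s) δ (x - p) +
          t * (sgnInd E x * (kern (N + s) δ (x - p) *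
            timeDeriv (pairWeight γ) (0, pairParam X δ (x, p)))) := (hint δ hδ).add (j1.const_mul t)
      rw [← integral_add (hint δ hδ) (j1.const_mul t), ← integral_add j3 i3]
      refine integral_congr_ae (.of_forall fun x => ?_)
      simp only [hrem, pairWeight_zero]
      ring
    rw [hdec]
    refine le_trans (le_of_eq ?_) (hrem_le.trans (le_of_eq ?_))
    · congr 1; ring
    · rw [hQdef]; ring
  -- This is the curvature times the Jacobian at `p`; the quotient rule will remove the term `div X
  -- · H 0` of `D`.
  have hHP : HasDerivAt (fun t => H t * P.eval t) D 0 := by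
    rw [hasDerivAt_iff_isLittleO_nhds_zero]
    refine Asymptotics.IsBigO.trans_isLittleO (g := fun t : ℝ => t ^ 2) ?_ ?_
    · refine Asymptotics.IsBigO.of_bound Q ?_
      filter_upwards [key] with t ht
      rw [norm_eq_abs, norm_of_nonneg (sq_nonneg t), zero_add, hP0, mul_one, smul_eq_mul]
      exact ht
    · exact Asymptotics.isLittleO_pow_id one_lt_two
  have hPd := P.hasDerivAt 0
  have hP0' : P.eval 0 ≠ 0 := by rw [hP0]; exact one_ne_zero
  have hfin := hHP.div hPd hP0'
  rw [hP0, hP1, ← traceCLM_apply, ← divergence_eq] at hfin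
  refine (hfin.congr_of_eventuallyEq ?_).congr_deriv ?_
  · filter_upwards [P.continuous.continuousAt.eventually_ne hP0'] with t ht
    simp only [Pi.div_apply]
    rw [mul_div_cancel_right₀ _ ht]
  · simp only [D]; ring

end CurvatureFlow

/-! ### Curvature bounds forced by the existence of perturbations -/

section PerturbationFamily

variable {E : Set R^N} {h : R^N → ℝ}

/-- The differential of a normal displacement is never vertical on tangent vectors. -/
lemma IsNormalPerturbation.eq_zero_of_fderiv_eq_smul {F : Set V} {t : ℝ}
    (H : IsNormalPerturbation E h t F) (hE : HasSmoothBoundary E) {x : V} (hx : x ∈ frontier E)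
    {D : V →L[ℝ] V} (hD : HasFDerivWithinAt (Ψ E h t) D (frontier E) x) {v : V}
    (hv : ⟪v, nu E x⟫ = 0) {c : ℝ} (hc : D v = c • nu E x) : v = 0 := by
  have hy := H.bijOn.mapsTo hx
  obtain ⟨φ, hφ⟩ := H.smooth.2 _ hy
  have h1 : HasFDerivWithinAt (φ ∘ Ψ E h t)
      ((fderiv ℝ φ (Ψ E h t x)).comp D) (frontier E) x :=
    (hφ.differentiable _).hasFDerivAt.comp_hasFDerivWithinAt x hD
  -- A defining function of `F` vanishes along the displaced surface, so its derivative in the image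
  -- direction `c ν` is zero. The two normals having positive inner product, `c = 0`, and the
  -- immersion condition concludes.
  have h2 : HasFDerivWithinAt (φ ∘ Ψ E h t) (0 : V →L[ℝ] ℝ) (frontier E) x := by
    refine (hasFDerivWithinAt_const (0 : ℝ) x _).congr_of_eventuallyEq ?_ hφ.2.1
    filter_upwards [hD.continuousWithinAt.eventually hφ.frontier_iff, self_mem_nhdsWithin]
      with z hz hzE using hz.1 (H.bijOn.mapsTo hzE)
  have h3 := hE.fderiv_eq_on_tangent hx h1 h2 hv
  rw [ContinuousLinearMap.comp_apply, hc, map_smul, hφ.fderiv_eq, zero_apply, smul_eq_mul] at h3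
  have h4 := mul_pos hφ.gradient_norm_pos (H.normal x hx)
  have hc0 : c = 0 := (mul_eq_zero.1 h3).resolve_right h4.ne'
  rw [hc0, zero_smul] at hc
  refine H.immersion x hx v hv ?_
  rw [← hc]
  exact hE.fderiv_eq_on_tangent hx hD.differentiableWithinAt.hasFDerivWithinAt hD hv

/-- A smooth field extending `h ν` near a boundary point. -/
lemma exists_local_field
    (hh : SmoothOnSurface (frontier E) h) {x : V} (hx : x ∈ frontier E) {n : V → V}
    (hn : ContDiff ℝ ∞ n) (hnE : ∀ᶠ z in 𝓝 x, z ∈ frontier E → nu E z = n z) :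
    ∃ g : V → ℝ, ContDiff ℝ ∞ g ∧ g x = h x ∧
      (∀ᶠ z in 𝓝 x, z ∈ frontier E → h z • nu E z = g z • n z) ∧
      ∀ t, HasFDerivWithinAt (Ψ E h t)
        (1 + t • fderiv ℝ (fun z => g z • n z) x) (frontier E) x := by
  obtain ⟨g, hg, hgE⟩ := hh x hx
  have hev : ∀ᶠ z in 𝓝 x, z ∈ frontier E → h z • nu E z = g z • n z := by
    filter_upwards [eventually_nhdsWithin_iff.1 hgE, hnE] with z h1 h2 hz
    rw [h1 hz, h2 hz]
  refine ⟨g, hg, (hgE.self_of_nhdsWithin hx).symm, hev, fun t => ?_⟩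
  have hX : ContDiff ℝ ∞ fun z => g z • n z := hg.smul hn
  refine (hasFDerivAt_shift (t := t) hX x).hasFDerivWithinAt.congr_of_eventuallyEq ?_ ?_
  · filter_upwards [self_mem_nhdsWithin, hev.filter_mono nhdsWithin_le_nhds] with z hz h1
    exact normalDisplacement_eq_shift (h1 hz).symm
  · exact normalDisplacement_eq_shift (hev.self_of_nhds hx).symm

/-- Unit length makes the differential of the normal tangential. It is symmetric since on tangent
vectors it is the Hessian of a defining function divided by the norm of the gradient. -/
lemma HasSmoothBoundary.inner_fderiv_normal (hE : HasSmoothBoundary E) {x : V}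
    (hx : x ∈ frontier E) {n : V → V} (hn : ContDiff ℝ ∞ n)
    (hnE : ∀ᶠ z in 𝓝 x, z ∈ frontier E → nu E z = n z) {v : V}
    (hv : ⟪v, nu E x⟫ = 0) :
    ⟪fderiv ℝ n x v, nu E x⟫ = 0 ∧ ∀ w : V, ⟪w, nu E x⟫ = 0 →
      ⟪fderiv ℝ n x v, w⟫ = ⟪fderiv ℝ n x w, v⟫ := by
  have hnd := (hn.differentiable (by simp) x).hasFDerivAt
  have hnx := hnE.self_of_nhds hx
  constructor
  · have h1 := (hnd.inner ℝ hnd).hasFDerivWithinAt (s := frontier E)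
    have h2 : HasFDerivWithinAt (fun z => ⟪n z, n z⟫) (0 : V →L[ℝ] ℝ) (frontier E) x := by
      refine (hasFDerivWithinAt_const (1 : ℝ) x _).congr_of_eventuallyEq ?_ ?_
      · filter_upwards [self_mem_nhdsWithin, hnE.filter_mono nhdsWithin_le_nhds] with z hz h1
        rw [← h1 hz, real_inner_self_eq_norm_sq, hE.norm_exteriorNormal hz, one_pow]
      · rw [← hnx, real_inner_self_eq_norm_sq, hE.norm_exteriorNormal hx, one_pow]
    have h3 := hE.fderiv_eq_on_tangent hx h1 h2 hv
    simp only [ContinuousLinearMap.comp_apply, ContinuousLinearMap.prod_apply,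
      fderivInnerCLM_apply, zero_apply] at h3
    rw [hnx]
    linarith [real_inner_comm (n x) (fderiv ℝ n x v)]
  · intro w hw
    obtain ⟨φ, hφ⟩ := hE.2 x hx
    have hgr := contDiff_gradient hφ.1
    have hGd := (hgr.differentiable (by simp) x).hasFDerivAt
    set a : V → ℝ := fun z => ⟪gradient φ z, n z⟫
    have ha := hGd.inner ℝ hnd
    have hax : a x = ‖gradient φ x‖ := by
      simp only [a]
      rw [← hnx, inner_gradient_left, hφ.fderiv_eq, real_inner_self_eq_norm_sq,
        hE.norm_exteriorNormal hx]; ring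
    have hev : ∀ᶠ z in 𝓝[frontier E] x, gradient φ z = a z • n z := by
      filter_upwards [self_mem_nhdsWithin, hnE.filter_mono nhdsWithin_le_nhds,
        hφ.eventually.filter_mono nhdsWithin_le_nhds,
        hφ.frontier_iff.filter_mono nhdsWithin_le_nhds] with z hz h1 h2 h3
      have hz' := h2 (h3.1 hz)
      have h4 : gradient φ z = ‖gradient φ z‖ • n z := by
        rw [← h1 hz, hz'.exteriorNormal_eq, smul_smul, mul_inv_cancel₀ hz'.gradient_norm_pos.ne',
          one_smul]
      have h5 : a z = ‖gradient φ z‖ := by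
        simp only [a]
        rw [← h1 hz, inner_gradient_left, hz'.fderiv_eq, real_inner_self_eq_norm_sq,
          hE.norm_exteriorNormal hz]; ring
      rw [h5]; exact h4
    have key : ∀ u u' : V, ⟪u, nu E x⟫ = 0 → ⟪u', nu E x⟫ = 0 →
        fderiv ℝ (fderiv ℝ φ) x u u' = ‖gradient φ x‖ * ⟪fderiv ℝ n x u, u'⟫ := by
      intro u u' hu hu'
      have h1 := hE.fderiv_eq_on_tangent hx hGd.hasFDerivWithinAt
        ((ha.smul hnd).hasFDerivWithinAt.congr_of_eventuallyEq hev (hev.self_of_nhdsWithin hx)) hu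
      have h2 : fderiv ℝ (fderiv ℝ φ) x u u' = ⟪fderiv ℝ (gradient φ) x u, u'⟫ := by
        have e1 : HasFDerivAt (fun z => ⟪gradient φ z, u'⟫) _ x :=
          hGd.inner ℝ (hasFDerivAt_const u' x)
        have e2 : HasFDerivAt (fun z => fderiv ℝ φ z u') _ x :=
          (differentiable_fderiv hφ.1 x).hasFDerivAt.clm_apply (hasFDerivAt_const u' x)
        simp only [inner_gradient_left] at e1
        have e3 := congrArg (fun T : V →L[ℝ] ℝ => T u) (e2.unique e1)
        simpa using e3
      rw [h2, h1]
      simp only [add_apply, smul_apply, ContinuousLinearMap.smulRight_apply, inner_add_left,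
        inner_smul_left, conj_trivial]
      rw [show ⟪n x, u'⟫ = 0 by rw [← hnx, real_inner_comm]; exact hu', mul_zero, add_zero,
        ← hax]
    have h1 := key v w hv hw
    rw [fderiv_fderiv_comm hφ.1, key w v hw hv] at h1
    exact (mul_left_cancel₀ hφ.gradient_norm_pos.ne' h1).symm

/-- The curvatures are controlled by the inverse of the length of the admissible perturbations. -/
lemma HasSmoothBoundary.norm_fderiv_normal_le (hE : HasSmoothBoundary E)
    (hh : SmoothOnSurface (frontier E) h) {t₁ : ℝ} (ht₁ : 0 < t₁)
    (hF : ∀ τ : ℝ, |τ| ≤ t₁ → ∃ F, IsNormalPerturbation E h τ F) {x : V} (hx : x ∈ frontier E)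
    {n : V → V} (hn : ContDiff ℝ ∞ n)
    (hnE : ∀ᶠ z in 𝓝 x, z ∈ frontier E → nu E z = n z) {v : V}
    (hv : ⟪v, nu E x⟫ = 0) : |h x| * ‖fderiv ℝ n x v‖ ≤ t₁⁻¹ * ‖v‖ := by
  have hI := fun {v : V} (hv : ⟪v, nu E x⟫ = 0) => hE.inner_fderiv_normal hx hn hnE hv
  obtain ⟨g, hg, hgx, hgE, hD⟩ := exists_local_field hh hx hn hnE
  have hnx := hnE.self_of_nhds hx
  have hν : ⟪nu E x, nu E x⟫ = 1 := by
    rw [real_inner_self_eq_norm_sq, hE.norm_exteriorNormal hx, one_pow]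
  set ν := nu E x with hνdef
  set S := fderiv ℝ n x
  set π : V →L[ℝ] V := 1 - (innerSL ℝ ν).smulRight ν with hπ
  have hπa : ∀ u, π u = u - ⟪ν, u⟫ • ν := fun u => by simp [hπ]
  have hπν : ∀ u, ⟪π u, ν⟫ = 0 := fun u => by
    rw [hπa, inner_sub_left, inner_smul_left, hν, real_inner_comm u ν]; simp
  have hπs : ∀ u w, ⟪w, ν⟫ = 0 → ⟪π u, w⟫ = ⟪u, w⟫ := fun u w hw => by
    rw [hπa, inner_sub_left, inner_smul_left, real_inner_comm w ν, hw]; simp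
  have hπT : ∀ u, ⟪u, ν⟫ = 0 → π u = u := fun u hu => by
    rw [hπa, real_inner_comm, hu, zero_smul, sub_zero]
  -- The shape operator, extended by zero in the normal direction, is symmetric on the whole space
  -- and has an orthonormal eigenbasis there.
  set A : V →ₗ[ℝ] V := (S.comp π : V →L[ℝ] V).toLinearMap
  have hAa : ∀ u, A u = S (π u) := fun u => rfl
  have hAν : ∀ u, ⟪A u, ν⟫ = 0 := fun u => (hI (hπν u)).1
  have hA : A.IsSymmetric := fun u w => calc
    ⟪A u, w⟫ = ⟪π w, A u⟫ := by rw [hπs w (A u) (hAν u), real_inner_comm]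
    _ = ⟪π u, A w⟫ := by rw [hAa, hAa, real_inner_comm, (hI (hπν u)).2 _ (hπν w), real_inner_comm]
    _ = ⟪u, A w⟫ := hπs u (A w) (hAν w)
  have hfin : Module.finrank ℝ V = N := finrank_euclideanSpace_fin
  set b := hA.eigenvectorBasis hfin
  set l := hA.eigenvalues hfin
  have hb : ∀ i, A (b i) = l i • b i := fun i => hA.apply_eigenvectorBasis hfin i
  -- If an eigenvalue violated the bound, then at the admissible time `-1 / (h l)` the differential
  -- of the displacement would send this principal direction to a multiple of the normal.
  have hl : ∀ i, |h x| * |l i| ≤ t₁⁻¹ := by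
    intro i
    by_contra hlt
    rw [not_le] at hlt
    have hne : h x * l i ≠ 0 := fun h0 => by
      rw [← abs_mul, h0, abs_zero] at hlt
      exact absurd hlt (not_lt.2 (by positivity))
    have hli : l i ≠ 0 := right_ne_zero_of_mul hne
    have hbν : ⟪b i, ν⟫ = 0 := by
      have h1 := hAν (b i)
      rw [hb, inner_smul_left] at h1
      exact (mul_eq_zero.1 h1).resolve_left hli
    obtain ⟨F, H⟩ := hF (-(h x * l i)⁻¹) (by
      rw [abs_neg, abs_inv, abs_mul]
      exact (inv_le_comm₀ (by rw [← abs_mul]; exact abs_pos.2 hne) ht₁).2 hlt.le)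
    have hSb : S (b i) = l i • b i := by rw [← hb, hAa, hπT _ hbν]
    have hX : HasFDerivAt (fun z => g z • n z) _ x :=
      (hg.differentiable (by simp) x).hasFDerivAt.smul (hn.differentiable (by simp) x).hasFDerivAt
    have hDx := hD (-(h x * l i)⁻¹)
    rw [hX.fderiv] at hDx
    have h0 := H.eq_zero_of_fderiv_eq_smul hE hx hDx hbν
      (c := -(h x * l i)⁻¹ * fderiv ℝ g x (b i)) (by
        change b i + (-(h x * l i)⁻¹) • (g x • S (b i) + fderiv ℝ g x (b i) • n x) = _
        rw [hSb, hgx, ← hnx, smul_add, smul_smul (h x), smul_smul, neg_mul, inv_mul_cancel₀ hne,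
          smul_smul, neg_one_smul]
        abel)
    have h1 := b.orthonormal.1 i
    rw [h0, norm_zero] at h1
    exact zero_ne_one h1
  have hAv : A v = S v := by rw [hAa, hπT v hv]
  rw [← hAv]
  have h1 := b.sum_sq_norm_inner_right (A v)
  have h2 := b.sum_sq_norm_inner_right v
  have h3 : ∀ i, ⟪b i, A v⟫ = l i * ⟪b i, v⟫ := fun i => by
    rw [← hA (b i) v, hb, inner_smul_left]; simp
  refine abs_le_of_sq_le_sq' ?_ (by positivity) |>.2
  rw [mul_pow, mul_pow, ← h1, ← h2, Finset.mul_sum, Finset.mul_sum]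
  refine Finset.sum_le_sum fun i _ => ?_
  rw [h3, norm_mul, mul_pow, ← mul_assoc, ← mul_pow]
  exact mul_le_mul_of_nonneg_right (pow_le_pow_left₀ (by positivity) (hl i) 2) (sq_nonneg _)

end PerturbationFamily

/-! ### Points gained or lost are swept by the boundary -/

section Sweeping

variable {E : Set R^N} {h : R^N → ℝ}

lemma norm_normalDisplacement_sub_le (hE : HasSmoothBoundary E) {M : ℝ}
    (hM : ∀ x ∈ frontier E, |h x| ≤ M) (t : ℝ) {x : V} (hx : x ∈ frontier E) :
    ‖Ψ E h t x - x‖ ≤ |t| * M := by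
  rw [normalDisplacement, add_sub_cancel_left, norm_smul, hE.norm_exteriorNormal hx, mul_one,
    norm_eq_abs, abs_mul]
  exact mul_le_mul_of_nonneg_left (hM x hx) (abs_nonneg _)

/-- A point off the boundary is joined, off the boundary, to points on a transversal line through
a boundary point. -/
lemma HasSmoothBoundary.exists_compact_path {F : Set V} (hF : HasSmoothBoundary F) {q e z : V}
    (hq : q ∈ frontier F) (he : 0 < ⟪nu F q, e⟫)
    (hseg : ∀ r ∈ Ico (0 : ℝ) 1, z + r • (q - z) ∉ frontier F) {a₀ : ℝ} (ha₀ : 0 < a₀) :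
    ∃ a ∈ Ioc 0 a₀, ∃ T : Set V, IsCompact T ∧ IsPreconnected T ∧ z ∈ T ∧ Disjoint T (frontier F) ∧
      ((z ∈ F ∧ q - a • e ∈ T) ∨ (z ∉ F ∧ q + a • e ∈ T)) := by
  obtain ⟨φ, hφ⟩ := hF.2 q hq
  obtain ⟨a, ⟨ha0, haa⟩, δ, hδ, hbox⟩ := hφ.exists_box he (hφ.2.2.2.and hφ.frontier_iff) ha₀
  obtain ⟨r, hr, hw⟩ : ∃ r ∈ Ico (0 : ℝ) 1, z + r • (q - z) ∈ ball q δ := by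
    have h1 : Tendsto (fun r : ℝ => z + r • (q - z)) (𝓝[<] 1) (𝓝 q) := by
      have : Continuous fun r : ℝ => z + r • (q - z) := by fun_prop
      simpa using this.continuousWithinAt (s := Iio 1) (x := 1) |>.tendsto
    obtain ⟨r, hr1, hr2⟩ := ((h1.eventually (ball_mem_nhds q hδ)).and
      (Ioo_mem_nhdsLT (zero_lt_one' ℝ))).exists
    exact ⟨r, ⟨hr2.1.le, hr2.2⟩, hr1⟩
  set w := z + r • (q - z) with hwdef
  have hwf : w ∉ frontier F := hseg r hr
  obtain ⟨hneg, hpos, hwU, hmw⟩ := hbox w hw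
  have hw0 := hwU 0 ⟨by linarith, ha0.le⟩
  simp only [zero_smul, add_zero] at hw0
  have hz1 : ∀ x ∈ segment ℝ z w, x ∉ frontier F := by
    intro x hx
    rw [segment_eq_image'] at hx
    obtain ⟨θ, hθ, rfl⟩ := hx
    have : z + θ • (w - z) = z + (θ * r) • (q - z) := by
      rw [hwdef, add_sub_cancel_left, smul_smul]
    change z + θ • (w - z) ∉ _
    rw [this]
    exact hseg _ ⟨mul_nonneg hθ.1 hr.1, by nlinarith [hθ.1, hθ.2, hr.1, hr.2]⟩
  have hzw : z ∈ F ↔ w ∈ F := mem_iff_of_isPreconnected hF.1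
    (convex_segment z w).isPreconnected hz1 (left_mem_segment ℝ z w) (right_mem_segment ℝ z w)
  have hcs : ∀ x y : V, IsCompact (segment ℝ x y) := fun x y => by
    rw [segment_eq_image']
    exact isCompact_Icc.image (by fun_prop)
  -- the path through `w + b • e`
  have key : ∀ b : ℝ, |b| = a → (∀ r ∈ uIcc 0 b, φ (w + r • e) ≠ 0) →
      (∀ x ∈ ball q δ, φ (x + b • e) ≠ 0) →
      ∃ T : Set V, IsCompact T ∧ IsPreconnected T ∧ z ∈ T ∧ Disjoint T (frontier F) ∧
        q + b • e ∈ T := by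
    intro b hb h1 h2
    have hba := abs_le.1 hb.le
    refine ⟨segment ℝ z w ∪ (segment ℝ w (w + b • e) ∪ segment ℝ (w + b • e) (q + b • e)),
      (hcs _ _).union ((hcs _ _).union (hcs _ _)), ?_, Or.inl (left_mem_segment ℝ z w), ?_,
      Or.inr (Or.inr (right_mem_segment ℝ _ _))⟩
    · exact (convex_segment _ _).isPreconnected.union w (right_mem_segment ℝ _ _)
        (Or.inl (left_mem_segment ℝ _ _)) ((convex_segment _ _).isPreconnected.union (w + b • e)
        (right_mem_segment ℝ _ _) (left_mem_segment ℝ _ _) (convex_segment _ _).isPreconnected)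
    · rw [Set.disjoint_left]
      rintro x (hx | hx | hx)
      · exact hz1 x hx
      · rw [segment_eq_image'] at hx
        obtain ⟨θ, hθ, rfl⟩ := hx
        change w + θ • (w + b • e - w) ∉ _
        rw [add_sub_cancel_left, smul_smul]
        have h3 : θ * b ∈ uIcc 0 b := by
          rcases le_total 0 b with hb0 | hb0
          · rw [uIcc_of_le hb0]; exact ⟨mul_nonneg hθ.1 hb0, by nlinarith [hθ.2]⟩
          · rw [uIcc_of_ge hb0]; exact ⟨by nlinarith [hθ.2], mul_nonpos_of_nonneg_of_nonpos hθ.1 hb0⟩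
        rw [(hwU _ (uIcc_subset_Icc ⟨by linarith, ha0.le⟩ hba h3)).2]
        exact h1 _ h3
      · have h4 : ∃ y, ‖y - q‖ ≤ ‖w - q‖ ∧ x = y + b • e := by
          rw [segment_eq_image'] at hx
          obtain ⟨θ, hθ, rfl⟩ := hx
          refine ⟨w + θ • (q - w), ?_, by module⟩
          rw [show w + θ • (q - w) - q = (1 - θ) • (w - q) by module, norm_smul,
            norm_of_nonneg (by linarith [hθ.2])]
          nlinarith [norm_nonneg (w - q), hθ.1]
        obtain ⟨y, hy, rfl⟩ := h4
        have hyδ : y ∈ ball q δ := by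
          rw [mem_ball, dist_eq_norm] at hw ⊢; exact hy.trans_lt hw
        rw [((hbox y hyδ).2.2.1 b hba).2]
        exact h2 y hyδ
  refine ⟨a, ⟨ha0, haa⟩, ?_⟩
  by_cases hzF : z ∈ F
  · have hφw : φ w < 0 := hw0.1.1 (hzw.1 hzF)
    obtain ⟨T, h1, h2, h3, h4, h5⟩ := key (-a) (by rw [abs_neg, abs_of_pos ha0]) (fun r hr => by
      rw [uIcc_of_ge (by linarith)] at hr
      have := hmw.monotoneOn ⟨hr.1, by linarith [hr.2]⟩ ⟨by linarith, ha0.le⟩ hr.2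
      simp only [zero_smul, add_zero] at this
      exact (this.trans_lt hφw).ne) (fun x hx => (hbox x hx).1.ne)
    exact ⟨T, h1, h2, h3, h4, Or.inl ⟨hzF, by rwa [neg_smul, ← sub_eq_add_neg] at h5⟩⟩
  · have hφw : 0 < φ w := by
      refine lt_of_le_of_ne (not_lt.1 fun h0 => hzF (hzw.2 (hw0.1.2 h0))) (Ne.symm fun h0 => ?_)
      exact hwf (hw0.2.2 h0)
    obtain ⟨T, h1, h2, h3, h4, h5⟩ := key a (abs_of_pos ha0) (fun r hr => by
      rw [uIcc_of_le ha0.le] at hr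
      have := hmw.monotoneOn ⟨by linarith, ha0.le⟩ ⟨by linarith [hr.1], hr.2⟩ hr.1
      simp only [zero_smul, add_zero] at this
      exact (hφw.trans_le this).ne') (fun x hx => (hbox x hx).2.1.ne')
    exact ⟨T, h1, h2, h3, h4, Or.inr ⟨hzF, h5⟩⟩

/-- The nearby perturbations cross a normal line of `∂E` near a boundary point only once. -/
lemma eventually_frontier_normal_line (hE : HasSmoothBoundary E)
    (hh : SmoothOnSurface (frontier E) h) {M : ℝ} (hM : ∀ x ∈ frontier E, |h x| ≤ M)
    {F : ℝ → Set V} {τ₀ : ℝ} (hF : ∀ᶠ τ in 𝓝 τ₀, IsNormalPerturbation E h τ (F τ))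
    {x₀ : V} (hx₀ : x₀ ∈ frontier E) :
    ∃ a > 0, ∀ᶠ τ in 𝓝 τ₀, ∀ r ∈ Icc (-a) a,
      (Ψ E h τ₀ x₀ + r • nu E x₀ ∈ frontier (F τ) ↔
        r = (τ - τ₀) * h x₀) := by
  have H₀ := hF.self_of_nhds
  obtain ⟨n, hn, hnE⟩ := hE.exists_normal_extension hx₀
  obtain ⟨g, hg, hgx, hgE, hD⟩ := exists_local_field hh hx₀ hn hnE
  set ν := nu E x₀ with hνdef
  set q := Ψ E h τ₀ x₀ with hqdef
  have hν1 : ‖ν‖ = 1 := hE.norm_exteriorNormal hx₀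
  have hshift : ∀ τ, ∀ x ∈ frontier E, Ψ E h τ x =
      Ψ E h τ₀ x + ((τ - τ₀) * h x) • nu E x := fun τ x _ => by
    simp only [normalDisplacement]; module
  have hclose : ∀ τ, ∀ x ∈ frontier E,
      ‖Ψ E h τ x - Ψ E h τ₀ x‖ ≤ |τ - τ₀| * M := by
    intro τ x hx
    rw [hshift τ x hx, add_sub_cancel_left, norm_smul, hE.norm_exteriorNormal hx, mul_one,
      norm_eq_abs, abs_mul]
    exact mul_le_mul_of_nonneg_left (hM x hx) (abs_nonneg _)
  have hM0 : 0 ≤ M := (abs_nonneg _).trans (hM x₀ hx₀)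
  -- local injectivity of the tangential component
  obtain ⟨ε, hε, hloc⟩ : ∃ ε > 0, ∀ᶠ τ in 𝓝 τ₀, ∀ y ∈ frontier E, ‖y - x₀‖ < ε → ∀ c : ℝ,
      Ψ E h τ y - Ψ E h τ x₀ = c • ν → y = x₀ := by
    set X : V → V := fun z => g z • n z
    have hXd : HasFDerivAt X (fderiv ℝ X x₀) x₀ :=
      ((hg.smul hn).differentiable (by simp) x₀).hasFDerivAt
    set X' := fderiv ℝ X x₀
    obtain ⟨φ, hφ⟩ := hE.2 x₀ hx₀
    set D : V →L[ℝ] V := 1 + τ₀ • X' with hDdef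
    set P : V →L[ℝ] V := 1 - (innerSL ℝ ν).smulRight ν with hP
    have hPν : ∀ c : ℝ, P (c • ν) = 0 := fun c => by
      simp [hP, hν1]
    have hPn : ∀ u, ‖P u‖ ≤ 2 * ‖u‖ := fun u => by
      have h1 : P u = u - ⟪ν, u⟫ • ν := by simp [hP]
      rw [h1]
      refine (norm_sub_le _ _).trans ?_
      rw [norm_smul, hν1, mul_one, norm_eq_abs]
      have := abs_real_inner_le_norm ν u
      rw [hν1, one_mul] at this
      linarith
    -- `Λ u` records the component of `D u` orthogonal to `ν` and the failure of `u` to be tangent.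
    -- Its injectivity, in finite dimension, bounds it below, so injectivity survives small
    -- nonlinear errors.
    set Λ : V →L[ℝ] V × ℝ := (P.comp D).prod (fderiv ℝ φ x₀)
    have hinj : Function.Injective Λ.toLinearMap := by
      refine (injective_iff_map_eq_zero Λ.toLinearMap).2 fun u hu => ?_
      have hu1 : P (D u) = 0 := congrArg Prod.fst hu
      have hu2 : fderiv ℝ φ x₀ u = 0 := congrArg Prod.snd hu
      rw [hφ.fderiv_eq] at hu2
      refine H₀.eq_zero_of_fderiv_eq_smul hE hx₀ (hD τ₀)
        (by rw [real_inner_comm]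
            exact (mul_eq_zero.1 hu2).resolve_left hφ.gradient_norm_pos.ne')
        (c := ⟪ν, D u⟫) ?_
      have h1 : P (D u) = D u - ⟪ν, D u⟫ • ν := by simp [hP]
      exact sub_eq_zero.1 (h1 ▸ hu1)
    obtain ⟨K, hK, hanti⟩ := Λ.toLinearMap.exists_antilipschitzWith (LinearMap.ker_eq_bot.2 hinj)
    have hK' : (0 : ℝ) < K := hK
    have hbound : ∀ u, ‖u‖ ≤ K * max ‖P (D u)‖ |fderiv ℝ φ x₀ u| := fun u => by
      have := hanti.le_mul_norm_sub u 0
      simp only [map_zero, add_zero, norm_neg] at this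
      exact this
    -- With this `η` and the bound required of `|τ - τ₀|`, the two error terms cost at most `‖u‖ /
    -- 4` each, so `‖u‖ ≤ ‖u‖ / 2`.
    set η : ℝ := 1 / (8 * K * (|τ₀| + 2)) with hη
    have hη0 : 0 < η := by positivity
    have hKη : 8 * (K * (|τ₀| + 2) * η) = 1 := by rw [hη]; field_simp
    have e1 : ∀ᶠ y in 𝓝 x₀, ‖X y - X x₀ - X' (y - x₀)‖ ≤ η * ‖y - x₀‖ :=
      hXd.isLittleO.def hη0
    have e2 : ∀ᶠ y in 𝓝 x₀, ‖φ y - φ x₀ - fderiv ℝ φ x₀ (y - x₀)‖ ≤ η * ‖y - x₀‖ :=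
      (hφ.differentiable x₀).hasFDerivAt.isLittleO.def hη0
    obtain ⟨ε, hε, hU⟩ := eventually_nhds_iff_ball.1
      ((e1.and e2).and (hgE.and hφ.frontier_iff))
    refine ⟨ε, hε, ?_⟩
    have e3 : ∀ᶠ τ in 𝓝 τ₀, |τ - τ₀| < min 1 (1 / (8 * K * (‖X'‖ + 1))) :=
      ball_mem_nhds τ₀ (by positivity)
    filter_upwards [e3] with τ hτ y hy hyε c hc
    obtain ⟨⟨h1, h2⟩, h3, h4⟩ := hU y (by rwa [mem_ball, dist_eq_norm])
    rw [h4.1 hy, hφ.2.1, sub_zero, zero_sub, norm_neg, norm_eq_abs] at h2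
    set u := y - x₀ with hu
    have hτ1 : |τ| ≤ |τ₀| + 1 := by
      have := abs_sub_abs_le_abs_sub τ τ₀
      linarith [hτ.trans_le (min_le_left _ _)]
    have hτ2 : K * |τ - τ₀| * (8 * (‖X'‖ + 1)) ≤ 1 := by
      have := (hτ.trans_le (min_le_right _ _)).le
      rw [le_div_iff₀ (by positivity)] at this
      linarith
    have hDu : D u = c • ν - (τ • (X y - X x₀ - X' u) + (τ - τ₀) • X' u) := by
      rw [← hc, normalDisplacement_eq_shift (X := X) (h3 hy).symm,
        normalDisplacement_eq_shift (X := X) (hgE.self_of_nhds hx₀).symm]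
      simp only [shift, hDdef, hu, add_apply, smul_apply, one_apply_eq_self]
      module
    have hPD : ‖P (D u)‖ ≤ 2 * ((|τ₀| + 1) * (η * ‖u‖) + |τ - τ₀| * (‖X'‖ * ‖u‖)) := by
      rw [hDu, map_sub, hPν, zero_sub, norm_neg]
      refine (hPn _).trans (mul_le_mul_of_nonneg_left ((norm_add_le _ _).trans ?_) (by norm_num))
      rw [norm_smul, norm_smul, norm_eq_abs, norm_eq_abs]
      gcongr
      exact X'.le_opNorm u
    have h5 : max ‖P (D u)‖ |fderiv ℝ φ x₀ u| ≤
        2 * ((|τ₀| + 2) * (η * ‖u‖) + |τ - τ₀| * (‖X'‖ * ‖u‖)) := by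
      refine max_le (hPD.trans ?_) (h2.trans ?_)
      · gcongr; norm_num
      · have : 0 ≤ |τ - τ₀| * (‖X'‖ * ‖u‖) := by positivity
        nlinarith [mul_nonneg hη0.le (norm_nonneg u), abs_nonneg τ₀,
          mul_nonneg (abs_nonneg τ₀) (mul_nonneg hη0.le (norm_nonneg u))]
    have h6 : ‖u‖ ≤ (1 / 2) * ‖u‖ := by
      refine (hbound u).trans ((mul_le_mul_of_nonneg_left h5 hK'.le).trans ?_)
      have h7 : K * |τ - τ₀| * ‖X'‖ ≤ 1 / 8 := by
        nlinarith [mul_nonneg hK'.le (abs_nonneg (τ - τ₀))]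
      nlinarith [norm_nonneg u]
    have h8 : ‖u‖ = 0 := le_antisymm (by linarith) (norm_nonneg u)
    exact sub_eq_zero.1 (norm_eq_zero.1 h8)
  -- points of the surface far from the base point
  obtain ⟨d, hd, hfar⟩ : ∃ d > 0, ∀ y ∈ frontier E, ε ≤ ‖y - x₀‖ →
      d ≤ ‖Ψ E h τ₀ y - q‖ := by
    -- Each point moves by at most `|τ₀| M`, so beyond this distance the displaced points are at
    -- least `1` apart; what remains is compact.
    set R := 2 * (|τ₀| * M) + 1
    set Kc := (frontier E ∩ closedBall x₀ R) \ ball x₀ ε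
    have hKc : IsCompact Kc :=
      ((isCompact_closedBall x₀ R).inter_left isClosed_frontier).diff isOpen_ball
    have hcont : ContinuousOn (fun y => ‖Ψ E h τ₀ y - q‖) (frontier E) := by
      have h1 := hh.continuousOn
      have h2 := hE.continuousOn_exteriorNormal
      unfold normalDisplacement
      fun_prop
    obtain ⟨d, hd, hdK⟩ : ∃ d > 0, ∀ y ∈ Kc, d ≤ ‖Ψ E h τ₀ y - q‖ := by
      rcases Kc.eq_empty_or_nonempty with h0 | h0
      · exact ⟨1, one_pos, by simp [h0]⟩
      · obtain ⟨y, hy, hmin⟩ := hKc.exists_isMinOn h0 (hcont.mono fun y hy => hy.1.1)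
        refine ⟨_, norm_pos_iff.2 (sub_ne_zero.2 fun h1 => hy.2 ?_), fun z hz => hmin hz⟩
        rw [H₀.bijOn.injOn hy.1.1 hx₀ h1]
        exact mem_ball_self hε
    refine ⟨min d 1, by positivity, fun y hy hyε => ?_⟩
    by_cases hyR : ‖y - x₀‖ ≤ R
    · refine (min_le_left _ _).trans (hdK y ⟨⟨hy, ?_⟩, ?_⟩)
      · rwa [mem_closedBall, dist_eq_norm]
      · rwa [mem_ball, dist_eq_norm, not_lt]
    · refine (min_le_right _ _).trans ?_
      have h1 := fun w => norm_normalDisplacement_sub_le (x := w) hE hM τ₀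
      have h2 : ‖y - x₀‖ ≤ ‖Ψ E h τ₀ y - q‖ +
          ‖Ψ E h τ₀ y - y‖ + ‖q - x₀‖ := by
        have : y - x₀ = (Ψ E h τ₀ y - q) - (Ψ E h τ₀ y - y) +
          (q - x₀) := by abel
        rw [this]
        exact (norm_add_le _ _).trans (add_le_add_left (norm_sub_le _ _) _)
      linarith [h1 y hy, h1 x₀ hx₀]
  refine ⟨d / 4, by positivity, ?_⟩
  have e4 : ∀ᶠ τ in 𝓝 τ₀, |τ - τ₀| < d / (4 * (M + 1)) :=
    ball_mem_nhds τ₀ (by positivity)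
  filter_upwards [hF, hloc, e4] with τ hτF hτ hτd r hr
  have hq' : Ψ E h τ x₀ = q + ((τ - τ₀) * h x₀) • ν := hshift τ x₀ hx₀
  constructor
  · intro hmem
    obtain ⟨y, hy, hyq⟩ := hτF.bijOn.surjOn hmem
    have hyx : y = x₀ := by
      refine hτ y hy ?_ (r - (τ - τ₀) * h x₀) (by rw [hyq, hq']; module)
      by_contra hlt
      have h1 := hfar y hy (not_lt.1 hlt)
      have h2 := hclose τ y hy
      have h3 : ‖Ψ E h τ₀ y - q‖ ≤
          ‖Ψ E h τ y - Ψ E h τ₀ y‖ + |r| := by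
        rw [norm_sub_rev (Ψ E h τ y), hyq]
        have : Ψ E h τ₀ y - q =
          (Ψ E h τ₀ y - (q + r • ν)) + r • ν := by abel
        nth_rw 1 [this]
        refine (norm_add_le _ _).trans ?_
        rw [norm_smul, hν1, mul_one, norm_eq_abs]
      rw [lt_div_iff₀ (by positivity)] at hτd
      have h4 : |r| ≤ d / 4 := abs_le.2 hr
      nlinarith [abs_nonneg (τ - τ₀)]
    rw [hyx, hq', add_right_inj] at hyq
    exact (smul_left_injective ℝ (norm_ne_zero_iff.1 (by rw [hν1]; exact one_ne_zero)) hyq).symm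
  · rintro rfl
    rw [← hq']
    exact hτF.bijOn.mapsTo hx₀

/-- Membership in the perturbed sets is locally constant in time away from their boundaries. -/
lemma eventually_mem_perturbation_iff (hE : HasSmoothBoundary E)
    (hh : SmoothOnSurface (frontier E) h) {M : ℝ} (hM : ∀ x ∈ frontier E, |h x| ≤ M)
    (hne : (frontier E).Nonempty)
    {F : ℝ → Set V} {τ₀ : ℝ} (hF : ∀ᶠ τ in 𝓝 τ₀, IsNormalPerturbation E h τ (F τ))
    {z : V} (hz : z ∉ frontier (F τ₀)) : ∀ᶠ τ in 𝓝 τ₀, (z ∈ F τ ↔ z ∈ F τ₀) := by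
  have H₀ := hF.self_of_nhds
  obtain ⟨y₀, hy₀⟩ := hne
  obtain ⟨q, hq, -, hseg⟩ := exists_segment_to_frontier (z := z) (H₀.bijOn.mapsTo hy₀)
  obtain ⟨x₀, hx₀, rfl⟩ := H₀.bijOn.surjOn hq
  obtain ⟨a₀, ha₀, hline⟩ := eventually_frontier_normal_line hE hh hM hF hx₀
  obtain ⟨a, ha, T, hTc, hTp, hzT, hTd, hT⟩ := H₀.smooth.exists_compact_path hq
    (H₀.normal x₀ hx₀) (fun r hr => hseg r hr hz) ha₀
  have hM0 : 0 ≤ M := (abs_nonneg _).trans (hM x₀ hx₀)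
  -- The path keeps a positive distance from the boundary at time `τ₀`, which moves by at most `|τ -
  -- τ₀| M`, so nearby boundaries miss it. The end of the path lies on a normal line, where the
  -- single crossing decides.
  obtain ⟨d, hd, hdT⟩ := Metric.exists_pos_forall_lt_edist hTc isClosed_frontier hTd
  have e1 : ∀ᶠ τ in 𝓝 τ₀, |τ - τ₀| < min (d : ℝ) a / (M + 1) :=
    ball_mem_nhds τ₀ (by have := ha.1; have : (0 : ℝ) < d := hd; positivity)
  filter_upwards [hF, hline, e1] with τ hτF hτ hτd
  rw [lt_div_iff₀ (by positivity)] at hτd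
  have hτM : |τ - τ₀| * M < min (d : ℝ) a := by nlinarith [abs_nonneg (τ - τ₀)]
  have hTτ : ∀ w ∈ T, w ∉ frontier (F τ) := by
    intro w hw hwτ
    obtain ⟨y, hy, rfl⟩ := hτF.bijOn.surjOn hwτ
    have h1 := hdT _ hw _ (H₀.bijOn.mapsTo hy)
    rw [edist_dist, dist_eq_norm, ← ENNReal.ofReal_coe_nnreal,
      ENNReal.ofReal_lt_ofReal_iff_of_nonneg d.coe_nonneg] at h1
    have h2 : Ψ E h τ y - Ψ E h τ₀ y =
        ((τ - τ₀) * h y) • nu E y := by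
      simp only [normalDisplacement]; module
    rw [h2, norm_smul, hE.norm_exteriorNormal hy, mul_one, norm_eq_abs, abs_mul] at h1
    have h3 := mul_le_mul_of_nonneg_left (hM y hy) (abs_nonneg (τ - τ₀))
    linarith [min_le_left (d : ℝ) a]
  have hc : |(τ - τ₀) * h x₀| < a := by
    rw [abs_mul]
    exact (mul_le_mul_of_nonneg_left (hM x₀ hx₀) (abs_nonneg _)).trans_lt
      (hτM.trans_le (min_le_right _ _))
  rw [abs_lt] at hc
  have hn : 0 < ⟪nu (F τ) (Ψ E h τ₀ x₀ +
      ((τ - τ₀) * h x₀) • nu E x₀), nu E x₀⟫ := by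
    have := hτF.normal x₀ hx₀
    rwa [show Ψ E h τ x₀ = Ψ E h τ₀ x₀ +
      ((τ - τ₀) * h x₀) • nu E x₀ by simp only [normalDisplacement]; module] at this
  have hcross := fun r (hr : r ∈ Icc (-a₀) a₀) => hτF.smooth.mem_iff_of_crossing
    (z := Ψ E h τ₀ x₀) (e := nu E x₀) (r₀ := -a₀) (r₁ := a₀)
    ⟨by linarith [ha.2], by linarith [ha.2]⟩ hτ hn hr
  have hiff := fun w (hw : w ∈ T) => mem_iff_of_isPreconnected hτF.smooth.1 hTp hTτ hzT hw
  rcases hT with ⟨hzF, hT⟩ | ⟨hzF, hT⟩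
  · refine iff_of_true ((hiff _ hT).2 ?_) hzF
    rw [sub_eq_add_neg, ← neg_smul, hcross (-a) ⟨by linarith [ha.2], by linarith [ha.1]⟩]
    linarith
  · refine iff_of_false (fun h1 => ?_) hzF
    have h2 := (hiff _ hT).1 h1
    rw [hcross a ⟨by linarith [ha.1], ha.2⟩] at h2
    linarith

/-- Points gained or lost by a normal perturbation are swept by the moving boundary. -/
lemma exists_normalDisplacement_eq (hE : HasSmoothBoundary E)
    (hh : SmoothOnSurface (frontier E) h) {M : ℝ} (hM : ∀ x ∈ frontier E, |h x| ≤ M)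
    (hne : (frontier E).Nonempty) {F : ℝ → Set V} {t₁ : ℝ}
    (hF : ∀ τ : ℝ, |τ| < t₁ → IsNormalPerturbation E h τ (F τ)) {t : ℝ} (ht : |t| < t₁) {z : V}
    (hz : ¬(z ∈ F t ↔ z ∈ F 0)) :
    ∃ x ∈ frontier E, ∃ τ, |τ| ≤ |t| ∧ z = Ψ E h τ x := by
  by_contra! hcon
  have hτt : ∀ τ ∈ uIcc 0 t, |τ| ≤ |t| := fun τ hτ => by
    have := abs_sub_left_of_mem_uIcc hτ
    simpa using this
  refine hz ?_
  have hloc : ∀ τ₀ ∈ uIcc 0 t, ∀ᶠ τ in 𝓝 τ₀, (z ∈ F τ ↔ z ∈ F τ₀) := by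
    intro τ₀ hτ₀
    have h1 := hτt τ₀ hτ₀
    refine eventually_mem_perturbation_iff hE hh hM hne ?_ fun hzf => ?_
    · filter_upwards [(continuous_abs.tendsto τ₀).eventually_lt_const (h1.trans_lt ht)] with τ hτ
        using hF τ hτ
    · obtain ⟨x, hx, hxz⟩ := (hF τ₀ (h1.trans_lt ht)).bijOn.surjOn hzf
      exact hcon x hx τ₀ h1 hxz.symm
  classical
  -- For a point never met by the moving boundary, membership is locally constant in time, hence
  -- constant on the time interval.
  have hcont : ContinuousOn (fun τ => decide (z ∈ F τ)) (uIcc 0 t) := fun τ₀ hτ₀ => by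
    refine ContinuousAt.continuousWithinAt
      ((continuousAt_const (y := decide (z ∈ F τ₀))).congr ?_)
    filter_upwards [hloc τ₀ hτ₀] with τ hτ using decide_eq_decide.2 hτ.symm
  exact decide_eq_decide.1
    (isPreconnected_uIcc.constant hcont right_mem_uIcc left_mem_uIcc)

end Sweeping

/-! ### Volume of the swept region -/

section SweepVolume

variable {E : Set R^N} {h : R^N → ℝ}

/-- The region swept by the part `A` of `∂E` under the normal displacements up to time `|t|`. -/
def normalSweep (E : Set R^N) (h : R^N → ℝ)
    (A : Set R^N) (t : ℝ) : Set R^N :=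
  {z | ∃ x ∈ A, ∃ τ, |τ| ≤ |t| ∧ z = Ψ E h τ x}

/-- The sweep is contained in the image of a cylinder over a piece of the tangent plane, of height
proportional to `|t|`, under `(y, l) ↦ G y + l n (G y)` with `G` the local graph. The Lipschitz
constant is the same at all points, because the existence of perturbations up to time `t₁` bounds
`|h| ‖Dν‖`; no uniform bound on the curvature of `∂E` is needed. -/
lemma HasSmoothBoundary.exists_volume_normalSweep_le (hE : HasSmoothBoundary E)
    (hh : SmoothOnSurface (frontier E) h) {M : ℝ} (hM : ∀ x ∈ frontier E, |h x| ≤ M) {t₁ : ℝ}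
    (ht₁ : 0 < t₁) (ht₁' : t₁ ≤ 1) (hF : ∀ τ : ℝ, |τ| ≤ t₁ → ∃ F, IsNormalPerturbation E h τ F)
    {x₀ : V} (hx₀ : x₀ ∈ frontier E) :
    ∃ ρ > 0, ∀ A ⊆ frontier E ∩ ball x₀ ρ, ∀ t, |t| ≤ t₁ →
      volume (normalSweep E h A t) ≤ ofReal (7 ^ N * (2 * (M + 1)) * |t|) *
        euclideanHausdorffMeasure (N - 1) A := by
  obtain ⟨n, hn, hnE⟩ := hE.exists_normal_extension hx₀
  have hS := fun {v : V} => hE.norm_fderiv_normal_le hh ht₁ hF hx₀ hn hnE (v := v)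
  obtain ⟨φ, hφ⟩ := hE.2 x₀ hx₀
  have hst := (hn.contDiffAt (x := x₀)).hasStrictFDerivAt (by simp)
  have he := hE.norm_exteriorNormal hx₀
  set S := fderiv ℝ n x₀
  set e := nu E x₀ with hedef
  -- `η`, `ε` and `κ` absorb in turn the error of differentiability of `n`, the slope of the graph
  -- and the oscillation of `h`. They depend on `x₀`, but only the radius `ρ` is affected.
  set η : ℝ := 1 / (8 * (|h x₀| + 1)) with hη
  have hη0 : 0 < η := by positivity
  have hηh : |h x₀| * η ≤ 1 / 8 := by
    rw [hη, mul_one_div, div_le_div_iff₀ (by positivity) (by norm_num)]; linarith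
  have hη1 : η ≤ 1 := by
    rw [hη, div_le_one (by positivity)]; linarith [abs_nonneg (h x₀)]
  set ε : ℝ := η / (‖S‖ + 1) with hε
  have hε0 : 0 < ε := by positivity
  have hεS : ε * ‖S‖ ≤ η := by
    rw [hε, div_mul_eq_mul_div, div_le_iff₀ (by positivity)]; nlinarith [norm_nonneg S]
  have hε1 : ε ≤ 1 := by
    rw [hε, div_le_one (by positivity)]; linarith [norm_nonneg S]
  obtain ⟨r₁, hr₁, g, hg, hgr⟩ := hφ.exists_lipschitz_graph (ε := ⟨ε, hε0.le⟩) hε0 hε1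
  set κ : ℝ := 1 / (4 * (‖S‖ + 3)) with hκ
  have hκ0 : 0 < κ := by positivity
  have hκS : κ * (‖S‖ + 3) = 1 / 4 := by rw [hκ]; field_simp
  have hκ1 : κ ≤ 1 := by nlinarith [norm_nonneg S]
  have hst' : ∀ᶠ y : V × V in 𝓝 x₀ ×ˢ 𝓝 x₀, ‖n y.1 - n y.2 - S (y.1 - y.2)‖ ≤ η * ‖y.1 - y.2‖ := by
    rw [← nhds_prod_eq]; exact hst.isLittleO.def hη0
  obtain ⟨r₂, hr₂, hst'⟩ := (Metric.nhds_basis_ball.prod_self.eventually_iff).1 hst'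
  obtain ⟨r₃, hr₃, hn₃⟩ := eventually_nhds_iff_ball.1 hnE
  obtain ⟨r₄, hr₄, hh₄⟩ := Metric.continuousWithinAt_iff.1 (hh.continuousOn x₀ hx₀) κ hκ0
  set ρ := min (min r₁ r₂) (min r₃ r₄)
  refine ⟨ρ, by positivity, fun A hA t ht => ?_⟩
  set P : V → (ℝ ∙ e)ᗮ := fun x => projLine e (x - x₀)
  have hAE : ∀ x ∈ A, x ∈ frontier E := fun x hx => (hA hx).1
  have hAρ : ∀ x ∈ A, x ∈ ball x₀ ρ := fun x hx => (hA hx).2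
  have hA₁ : ∀ x ∈ A, x = x₀ + P x + g (P x) • e := fun x hx =>
    hgr x ⟨hAE x hx, ball_subset_ball ((min_le_left _ _).trans (min_le_left _ _)) (hAρ x hx)⟩
  have hAν : ∀ x ∈ A, nu E x = n x := fun x hx =>
    hn₃ x (ball_subset_ball ((min_le_right _ _).trans (min_le_left _ _)) (hAρ x hx))
      (hAE x hx)
  set m := |h x₀| + κ
  have hAh : ∀ x ∈ A, |h x| ≤ m := fun x hx => by
    have h1 := hh₄ (hAE x hx)
      (ball_subset_ball ((min_le_right _ _).trans (min_le_right _ _)) (hAρ x hx))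
    rw [Real.dist_eq] at h1
    linarith [abs_sub_abs_le_abs_sub (h x) (h x₀)]
  -- the graph map and its Lipschitz bounds
  set G : (ℝ ∙ e)ᗮ → V := fun y => x₀ + y + g y • e
  have hGP : ∀ x ∈ A, G (P x) = x := fun x hx => (hA₁ x hx).symm
  have hgl : ∀ y y', |g y - g y'| ≤ ε * ‖y - y'‖ := fun y y' => by
    have := hg.dist_le_mul y y'
    rwa [Real.dist_eq, dist_eq_norm] at this
  have hGl : ∀ y y', ‖G y - G y'‖ ≤ 2 * ‖y - y'‖ := fun y y' => by
    have h1 : G y - G y' = ((y - y' : (ℝ ∙ e)ᗮ) : V) + (g y - g y') • e := by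
      simp only [G, Submodule.coe_sub]; module
    rw [h1]
    refine (norm_add_le _ _).trans ?_
    rw [norm_smul, he, mul_one, norm_eq_abs]
    have := hgl y y'
    have h2 : ‖((y - y' : (ℝ ∙ e)ᗮ) : V)‖ = ‖y - y'‖ := rfl
    nlinarith [norm_nonneg (y - y')]
  -- The tangential part of `x - x'` is handled by the curvature bound and the rest by the small
  -- constants; together they give `(1 + t₁ / 2) ‖x - x'‖`.
  have hnl : ∀ x ∈ A, ∀ x' ∈ A, m * |t| * ‖n x - n x'‖ ≤ 2 * ‖x - x'‖ := by
    intro x hx x' hx'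
    set u := x - x'
    have h1 : ‖n x - n x' - S u‖ ≤ η * ‖u‖ := hst' (x := (x, x'))
      ⟨ball_subset_ball ((min_le_left _ _).trans (min_le_right _ _)) (hAρ x hx),
        ball_subset_ball ((min_le_left _ _).trans (min_le_right _ _)) (hAρ x' hx')⟩
    have h2 : u = ((P x - P x' : (ℝ ∙ e)ᗮ) : V) + (g (P x) - g (P x')) • e := by
      simp only [u, Submodule.coe_sub]
      nth_rw 1 [hA₁ x hx, hA₁ x' hx']
      module
    set v : V := ((P x - P x' : (ℝ ∙ e)ᗮ) : V)
    have hPu : ‖P x - P x'‖ ≤ ‖u‖ := by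
      simp only [P, u]
      rw [← map_sub, sub_sub_sub_cancel_right]
      exact norm_projLine_le _
    have hv : ‖v‖ ≤ ‖u‖ := hPu
    have h3 : ‖n x - n x'‖ ≤ ‖S v‖ + 2 * η * ‖u‖ := by
      have h4 : n x - n x' = (n x - n x' - S u) + (S v + (g (P x) - g (P x')) • S e) := by
        have h5 := congrArg S h2
        rw [map_add, map_smul] at h5
        rw [h5]; abel
      rw [h4]
      refine (norm_add_le _ _).trans ?_
      have h5 := norm_add_le (S v) ((g (P x) - g (P x')) • S e)
      rw [norm_smul, norm_eq_abs] at h5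
      have h6 : |g (P x) - g (P x')| * ‖S e‖ ≤ η * ‖u‖ := by
        have h7 := S.le_opNorm e
        rw [he, mul_one] at h7
        calc _ ≤ (ε * ‖u‖) * ‖S‖ := mul_le_mul ((hgl _ _).trans
              (mul_le_mul_of_nonneg_left hPu hε0.le)) h7 (norm_nonneg _) (by positivity)
          _ = (ε * ‖S‖) * ‖u‖ := by ring
          _ ≤ _ := by gcongr
      linarith
    have h4 : |h x₀| * ‖S v‖ ≤ t₁⁻¹ * ‖v‖ := hS (inner_orthogonal_span _)
    have h5 : ‖S v‖ ≤ ‖S‖ * ‖u‖ := (S.le_opNorm v).trans (by gcongr)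
    have h6 : m * ‖n x - n x'‖ ≤ (t₁⁻¹ + 1 / 2) * ‖u‖ := by
      calc m * ‖n x - n x'‖ ≤ m * (‖S v‖ + 2 * η * ‖u‖) := by gcongr
        _ = |h x₀| * ‖S v‖ + 2 * (|h x₀| * η) * ‖u‖ + κ * (‖S v‖ + 2 * η * ‖u‖) := by
          simp only [m]; ring
        _ ≤ t₁⁻¹ * ‖u‖ + 2 * (1 / 8) * ‖u‖ + κ * (‖S‖ * ‖u‖ + 2 * 1 * ‖u‖) := by
          have := h4.trans (mul_le_mul_of_nonneg_left hv (inv_pos.2 ht₁).le)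
          gcongr
        _ = (t₁⁻¹ + 1 / 4 + (κ * (‖S‖ + 3) - κ)) * ‖u‖ := by ring
        _ ≤ _ := by
          rw [hκS]
          exact mul_le_mul_of_nonneg_right (by linarith) (norm_nonneg _)
    calc m * |t| * ‖n x - n x'‖ = |t| * (m * ‖n x - n x'‖) := by ring
      _ ≤ t₁ * ((t₁⁻¹ + 1 / 2) * ‖u‖) := mul_le_mul ht h6 (by positivity) ht₁.le
      _ = (1 + t₁ / 2) * ‖u‖ := by field_simp
      _ ≤ _ := by gcongr; linarith
  -- the sweep as a Lipschitz image of a cylinder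
  set f : V → V := fun z =>
    G ((lineEquiv e he x₀).symm z).1 + ((lineEquiv e he x₀).symm z).2 •
      n (G ((lineEquiv e he x₀).symm z).1)
  set Q := (P '' A) ×ˢ Icc (-(m * |t|)) (m * |t|)
  have hsub : normalSweep E h A t ⊆ f '' (lineEquiv e he x₀ '' Q) := by
    rintro z ⟨x, hx, τ, hτ, rfl⟩
    refine ⟨_, ⟨(P x, τ * h x), ⟨⟨x, hx, rfl⟩, abs_le.1 ?_⟩, rfl⟩, ?_⟩
    · rw [abs_mul, mul_comm]
      exact mul_le_mul (hAh x hx) hτ (abs_nonneg _) (by positivity)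
    · simp only [f, MeasurableEquiv.symm_apply_apply, hGP x hx, normalDisplacement, hAν x hx]
  -- With `D` the distance in the cylinder, the three terms of the difference contribute `2D`, `D`
  -- and `4D`.
  have hlip : LipschitzOnWith 7 f (lineEquiv e he x₀ '' Q) := by
    refine LipschitzOnWith.of_dist_le_mul ?_
    rintro _ ⟨⟨_, l⟩, ⟨⟨x, hx, rfl⟩, hl⟩, rfl⟩ _ ⟨⟨_, l'⟩, ⟨⟨x', hx', rfl⟩, hl'⟩, rfl⟩
    simp only [f, MeasurableEquiv.symm_apply_apply, dist_eq_norm]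
    rw [hGP x hx, hGP x' hx', lineEquiv_apply, lineEquiv_apply]
    set D := ‖x₀ + (P x : V) + l • e - (x₀ + (P x' : V) + l' • e)‖ with hD
    have hD2 : D ^ 2 = ‖P x - P x'‖ ^ 2 + (l - l') ^ 2 := by
      rw [← norm_sq_line he, hD]
      congr 2
      rw [Submodule.coe_sub]; module
    have hD0 : 0 ≤ D := norm_nonneg _
    have hD3 : ‖P x - P x'‖ ≤ D := abs_le_of_sq_le_sq' (by nlinarith) hD0 |>.2
    have hD4 : |l - l'| ≤ D := abs_le.2 (abs_le_of_sq_le_sq' (by nlinarith [sq_nonneg ‖P x - P x'‖]) hD0)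
    have h1 : ‖x - x'‖ ≤ 2 * D := by
      have := hGl (P x) (P x')
      rw [hGP x hx, hGP x' hx'] at this
      linarith
    have h2 : x + l • n x - (x' + l' • n x') = (x - x') + ((l - l') • n x + l' • (n x - n x')) := by
      module
    rw [h2]
    refine (norm_add_le _ _).trans ?_
    have h3 := norm_add_le ((l - l') • n x) (l' • (n x - n x'))
    rw [norm_smul, norm_smul, ← hAν x hx, hE.norm_exteriorNormal (hAE x hx), mul_one,
      norm_eq_abs, norm_eq_abs, hAν x hx] at h3
    have h4 : |l'| * ‖n x - n x'‖ ≤ 2 * ‖x - x'‖ :=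
      (mul_le_mul_of_nonneg_right (abs_le.2 hl') (norm_nonneg _)).trans (hnl x hx x' hx')
    have h5 : ((7 : NNReal) : ℝ) = 7 := rfl
    rw [h5]
    linarith
  have hPl : LipschitzOnWith 1 P A := by
    refine LipschitzOnWith.of_dist_le_mul fun x _ y _ => ?_
    rw [dist_eq_norm, dist_eq_norm, NNReal.coe_one, one_mul]
    simp only [P]
    rw [← map_sub, sub_sub_sub_cancel_right]
    exact norm_projLine_le _
  have h1 := LipschitzOnWith.euclideanHausdorffMeasure_image_le hPl (N - 1)
  rw [ENNReal.coe_one, one_pow, one_mul, ← volume_orthogonal_eq he] at h1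
  have h2 := LipschitzOnWith.euclideanHausdorffMeasure_image_le hlip (Module.finrank ℝ V)
  rw [InnerProductSpace.euclideanHausdorffMeasure_eq_volume, volume_image_lineEquiv_prod,
    Real.volume_Icc, finrank_euclideanSpace_fin] at h2
  have hm : m ≤ M + 1 := add_le_add (hM x₀ hx₀) hκ1
  have hM0 : 0 ≤ M := (abs_nonneg _).trans (hM x₀ hx₀)
  refine (measure_mono hsub).trans (h2.trans ?_)
  have h7 : ((7 : NNReal) : ℝ≥0∞) ^ N = ofReal (7 ^ N) := by
    rw [ENNReal.ofReal_pow (by norm_num)]; norm_num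
  rw [h7, mul_comm (volume _), ← mul_assoc, ← ofReal_mul (by positivity), mul_assoc (7 ^ N)]
  gcongr
  nlinarith [abs_nonneg t]

/-- The distant boundary is cut into countably many pieces of diameter at most `1`, each in the
range of a local volume bound. On the sweep of a piece the kernel is at most `2^β` times its value
at any point `x` of the piece, because the displacements add up to at most `2` while `‖x - p‖ ≥ 4`.
-/
lemma HasSmoothBoundary.setLIntegral_normalSweep_le (hE : HasSmoothBoundary E)
    (hh : SmoothOnSurface (frontier E) h) {M : ℝ} (hM : ∀ x ∈ frontier E, |h x| ≤ M) {t₁ : ℝ}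
    (ht₁ : 0 < t₁) (ht₁' : t₁ ≤ 1) (hF : ∀ τ : ℝ, |τ| ≤ t₁ → ∃ F, IsNormalPerturbation E h τ F)
    {p q : V} (hp : p ∈ frontier E) (hpq : ‖q - p‖ ≤ 1 / 2) {r β : ℝ} (hr : 4 ≤ r) (hβ : 0 ≤ β)
    {t : ℝ} (ht : |t| ≤ t₁) (htM : |t| * M ≤ 1 / 2) :
    ∫⁻ z in normalSweep E h (frontier E ∩ (ball p r)ᶜ) t,
        ofReal (1 / ‖z - q‖ ^ β) ≤
      ofReal (7 ^ N * (2 * (M + 1)) * |t|) * ofReal (2 ^ β) *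
        ∫⁻ x in (ball p r)ᶜ, ofReal (1 / ‖x - p‖ ^ β) ∂(area E) := by
  choose! ρ hρ hvol using fun x hx =>
    hE.exists_volume_normalSweep_le hh hM ht₁ ht₁' hF (x₀ := x) hx
  set K := ofReal (7 ^ N * (2 * (M + 1)) * |t|)
  obtain ⟨T, hTE, hTc, hTu⟩ := TopologicalSpace.countable_cover_nhdsWithin (s := frontier E)
    (f := fun x => ball x (min (ρ x) (1 / 2)))
    (fun x hx => mem_nhdsWithin_of_mem_nhds (ball_mem_nhds x (by
      have := hρ x hx; positivity)))
  have hTne : T.Nonempty := by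
    obtain ⟨x, hx, -⟩ := mem_iUnion₂.1 (hTu hp)
    exact ⟨x, hx⟩
  obtain ⟨c, rfl⟩ := hTc.exists_eq_range hTne
  set B : ℕ → Set V := fun n => ball (c n) (min (ρ (c n)) (1 / 2))
  set A : ℕ → Set V := fun n => (ball p r)ᶜ ∩ frontier E ∩ disjointed B n
  have hAm : ∀ n, MeasurableSet (A n) := fun n =>
    (measurableSet_ball.compl.inter isClosed_frontier.measurableSet).inter
      (MeasurableSet.disjointed (fun n => measurableSet_ball) n)
  have hAB : ∀ n, A n ⊆ B n := fun n => inter_subset_right.trans (disjointed_subset B n)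
  have hAd : Pairwise (Function.onFun Disjoint A) := fun i j hij =>
    (disjoint_disjointed B hij).mono inter_subset_right inter_subset_right
  have hAu : (⋃ n, A n) = (ball p r)ᶜ ∩ frontier E := by
    rw [← inter_iUnion, iUnion_disjointed]
    refine inter_eq_left.2 fun x hx => ?_
    obtain ⟨_, ⟨n, rfl⟩, hn⟩ := mem_iUnion₂.1 (hTu hx.2)
    exact mem_iUnion.2 ⟨n, hn⟩
  have hsub : normalSweep E h (frontier E ∩ (ball p r)ᶜ) t ⊆ ⋃ n, normalSweep E h (A n) t := by
    rintro z ⟨x, hx, τ, hτ, rfl⟩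
    obtain ⟨n, hn⟩ := mem_iUnion.1 (hAu.symm ▸ (show x ∈ (ball p r)ᶜ ∩ frontier E from
      ⟨hx.2, hx.1⟩) : x ∈ ⋃ n, A n)
    exact mem_iUnion.2 ⟨n, x, hn, τ, hτ, rfl⟩
  have hσ : ∫⁻ x in (ball p r)ᶜ, ofReal (1 / ‖x - p‖ ^ β) ∂(area E) =
      ∑' n, ∫⁻ x in A n, ofReal (1 / ‖x - p‖ ^ β)
        ∂(euclideanHausdorffMeasure (N - 1)) := by
    rw [surfaceMeasure, Measure.restrict_restrict measurableSet_ball.compl, ← hAu,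
      lintegral_iUnion hAm hAd]
  rw [hσ, ← ENNReal.tsum_mul_left]
  refine (lintegral_mono_set hsub).trans ((lintegral_iUnion_le _ _).trans
    (ENNReal.tsum_le_tsum fun n => ?_))
  set b := ⨆ z ∈ normalSweep E h (A n) t, ofReal (1 / ‖z - q‖ ^ β)
  have hb : ∀ x ∈ A n, b ≤ ofReal (2 ^ β) * ofReal (1 / ‖x - p‖ ^ β) := by
    intro x hx
    refine iSup₂_le ?_
    rintro z ⟨x', hx', τ, hτ, rfl⟩
    rw [← ofReal_mul (by positivity), mul_one_div]
    have h1 := mem_ball.1 (hAB n hx)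
    have h2 := mem_ball.1 (hAB n hx')
    have h3 : ‖x - x'‖ ≤ 1 := by
      rw [← dist_eq_norm]
      linarith [dist_triangle_right x x' (c n), min_le_right (ρ (c n)) (1 / 2)]
    have h4 : 4 ≤ ‖x - p‖ := by
      have := hx.1.1
      rw [mem_compl_iff, mem_ball, dist_eq_norm, not_lt] at this
      linarith
    have h5 : ‖(τ * h x') • nu E x'‖ ≤ 1 / 2 := by
      rw [norm_smul, hE.norm_exteriorNormal hx'.1.2, mul_one, norm_eq_abs, abs_mul]
      exact (mul_le_mul hτ (hM x' hx'.1.2) (abs_nonneg _) (abs_nonneg _)).trans htM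
    have h6 : ‖x - p‖ ≤ 2 * ‖Ψ E h τ x' - q‖ := by
      have h7 : x - p = (Ψ E h τ x' - q) + (x - x') -
          (τ * h x') • nu E x' + (q - p) := by
        simp only [normalDisplacement]; abel
      have h8 : ‖x - p‖ ≤ ‖Ψ E h τ x' - q‖ + ‖x - x'‖ +
          ‖(τ * h x') • nu E x'‖ + ‖q - p‖ := by
        nth_rw 1 [h7]
        exact (norm_add_le _ _).trans (add_le_add_left ((norm_sub_le _ _).trans
          (add_le_add_left (norm_add_le _ _) _)) _)
      linarith
    refine ofReal_le_ofReal ?_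
    rw [div_le_div_iff₀ (Real.rpow_pos_of_pos (by linarith) _)
      (Real.rpow_pos_of_pos (by linarith) _), one_mul, ← Real.mul_rpow (by norm_num) (norm_nonneg _)]
    exact Real.rpow_le_rpow (norm_nonneg _) h6 hβ
  calc ∫⁻ z in normalSweep E h (A n) t, ofReal (1 / ‖z - q‖ ^ β)
      ≤ ∫⁻ z in normalSweep E h (A n) t, b :=
        setLIntegral_mono measurable_const fun z hz => le_iSup₂ (f := fun z
          (_ : z ∈ normalSweep E h (A n) t) => ofReal (1 / ‖z - q‖ ^ β)) z hz
    _ = b * volume (normalSweep E h (A n) t) := setLIntegral_const _ _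
    _ ≤ b * (K * euclideanHausdorffMeasure (N - 1) (A n)) := by
        gcongr
        exact hvol (c n) (hTE (mem_range_self n)) (A n) (fun x hx => ⟨hx.1.2,
          ball_subset_ball (min_le_left _ _) (hAB n hx)⟩) t ht
    _ = K * ∫⁻ x in A n, b ∂(euclideanHausdorffMeasure (N - 1)) := by
        rw [setLIntegral_const]; ring
    _ ≤ K * ∫⁻ x in A n, ofReal (2 ^ β) * ofReal (1 / ‖x - p‖ ^ β)
          ∂(euclideanHausdorffMeasure (N - 1)) := by
        gcongr 1
        exact setLIntegral_mono' (hAm n) hb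
    _ = _ := by
        rw [lintegral_const_mul' _ _ ofReal_ne_top, mul_assoc]

end SweepVolume

/-! ### The curvature for bounded perturbations -/

section CurvatureVariation

variable {E : Set R^N} {h : R^N → ℝ}

lemma enorm_principalValue_sub_le {μ : Measure V} {p : V} {f g : V → ℝ}
    (hf : HasPrincipalValue μ p f) (hg : HasPrincipalValue μ p g) :
    ‖principalValue μ p f - principalValue μ p g‖ₑ ≤ ∫⁻ x, ‖f x - g x‖ₑ ∂μ := by
  have h1 := ((tendsto_nhds_limUnder hf.2).sub (tendsto_nhds_limUnder hg.2)).enorm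
  refine le_of_tendsto h1 ?_
  filter_upwards [self_mem_nhdsWithin] with δ hδ
  rw [← integral_sub (hf.1 δ hδ) (hg.1 δ hδ)]
  exact (enorm_integral_le_lintegral_enorm _).trans (setLIntegral_le_lintegral _ _)

/-- Tails of a finite integral tend to zero; `4 ≤ r` is the range of the sweep estimate. -/
lemma exists_lintegral_compl_ball_le {s : ℝ} (hs0 : 0 < s)
    (hArea : Integrable (fun x : V => (1 + ‖x‖) ^ (-(N + s))) (area E)) (p : V)
    {ε : ℝ} (hε : 0 < ε) :
    ∃ r, 4 ≤ r ∧ ∫⁻ x in (ball p r)ᶜ, ofReal (1 / ‖x - p‖ ^ (N + s))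
      ∂(area E) ≤ ofReal ε := by
  set f : V → ℝ≥0∞ := fun x => ofReal (1 / ‖x - p‖ ^ (N + s))
  have hfm : Measurable f := by fun_prop
  set ν := (area E).restrict (ball p 1)ᶜ
  have hfin : ∫⁻ x in (ball p 1)ᶜ, f x ∂(area E) ≠ ⊤ := by
    have h1 := hArea.const_mul ((1 + (1 + ‖p‖) / 1) ^ (N + s))
    refine ne_top_of_le_ne_top h1.lintegral_lt_top.ne ((setLIntegral_mono' measurableSet_ball.compl
      fun x hx => ofReal_le_ofReal ?_).trans (setLIntegral_le_lintegral _ _))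
    exact one_div_norm_rpow_le (by positivity) one_pos hx
  have hlim : Tendsto (fun n : ℕ => ∫⁻ x in (ball p (n : ℝ))ᶜ, f x ∂ν) atTop (𝓝 0) := by
    have h1 : Tendsto (fun n : ℕ => (ν.withDensity f) (ball p (n : ℝ))ᶜ) atTop
        (𝓝 ((ν.withDensity f) (⋂ n : ℕ, (ball p (n : ℝ))ᶜ))) := by
      refine tendsto_measure_iInter_atTop
        (fun n => measurableSet_ball.compl.nullMeasurableSet) (fun m n hmn => ?_) ⟨0, ?_⟩
      · exact compl_subset_compl.2 (ball_subset_ball (by exact_mod_cast hmn))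
      · refine ne_top_of_le_ne_top ?_ (measure_mono (subset_univ _))
        rw [withDensity_apply _ MeasurableSet.univ, Measure.restrict_univ]
        exact hfin
    rw [← compl_iUnion, Metric.iUnion_ball_nat, compl_univ, measure_empty] at h1
    refine h1.congr fun n => ?_
    rw [withDensity_apply _ measurableSet_ball.compl]
  obtain ⟨n, hn1, hn2⟩ := ((hlim.eventually_lt_const (ENNReal.ofReal_pos.2 hε)).and
    (eventually_ge_atTop 4)).exists
  refine ⟨n, by exact_mod_cast hn2, le_trans (le_of_eq ?_) hn1.le⟩
  rw [Measure.restrict_restrict measurableSet_ball.compl, inter_eq_left.2]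
  exact compl_subset_compl.2 (ball_subset_ball (by
    have : (4 : ℝ) ≤ n := by exact_mod_cast hn2
    linarith))

/-- Perturbations by functions that agree near `p` agree near the displaced point. -/
lemma IsNormalPerturbation.mem_iff_of_ball {h' : V → ℝ} {t : ℝ} {F F' : Set V}
    (H : IsNormalPerturbation E h t F) (H' : IsNormalPerturbation E h' t F')
    (hE : HasSmoothBoundary E) {M : ℝ} (hM : ∀ x ∈ frontier E, |h x| ≤ M)
    (hM' : ∀ x ∈ frontier E, |h' x| ≤ M) (htM : |t| * M ≤ 1 / 2) {p : V} (hp : p ∈ frontier E)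
    {r : ℝ} (heq : ∀ x ∈ ball p (2 * r + 1), h' x = h x) {z : V}
    (hz : z ∈ ball (Ψ E h t p) r) : z ∈ F ↔ z ∈ F' := by
  have hpp := norm_normalDisplacement_sub_le hE hM t hp
  have key : ∀ g : V → ℝ, (∀ x ∈ frontier E, |g x| ≤ M) → ∀ y ∈ frontier E,
      Ψ E g t y ∈ ball (Ψ E h t p) (2 * r) →
      y ∈ ball p (2 * r + 1) := by
    intro g hg y hy hyb
    rw [mem_ball, dist_eq_norm] at hyb ⊢
    have h1 := norm_normalDisplacement_sub_le hE hg t hy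
    have h2 : y - p = (Ψ E g t y - Ψ E h t p) -
      (Ψ E g t y - y) + (Ψ E h t p - p) := by abel
    rw [h2]
    have h3 := norm_sub_le (Ψ E g t y - Ψ E h t p)
      (Ψ E g t y - y)
    exact (norm_add_le _ _).trans_lt (by linarith)
  have hdisp : ∀ y ∈ ball p (2 * r + 1),
      Ψ E h' t y = Ψ E h t y := fun y hy => by
    rw [normalDisplacement, normalDisplacement, heq y hy]
  have hfr : ∀ x ∈ ball (Ψ E h t p) (2 * r),
      (x ∈ frontier F ↔ x ∈ frontier F') := by
    intro x hx
    constructor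
    · intro hxF
      obtain ⟨y, hy, rfl⟩ := H.bijOn.surjOn hxF
      rw [← hdisp y (key h hM y hy hx)]
      exact H'.bijOn.mapsTo hy
    · intro hxF
      obtain ⟨y, hy, rfl⟩ := H'.bijOn.surjOn hxF
      rw [hdisp y (key h' hM' y hy hx)]
      exact H.bijOn.mapsTo hy
  refine HasSmoothBoundary.mem_iff_of_ball H.smooth.1 H'.smooth.1 (H.bijOn.mapsTo hp) hfr
    (fun x hx hxF => ?_) hz
  obtain ⟨y, hy, rfl⟩ := H.bijOn.surjOn hxF
  have hn := H'.normal y hy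
  rw [hdisp y (key h hM y hy hx)] at hn
  refine H.smooth.eventually_mem_iff H'.smooth hxF ?_ (H.normal y hy) hn
  filter_upwards [isOpen_ball.mem_nhds hx] with w hw using hfr w hw

/-- Only the symmetric difference of the two sets matters, and there the signs differ by `2`. -/
lemma enorm_fractionalMeanCurvature_sub_le {s : ℝ} {F F' S : Set V} {q : V}
    (hF : HasPrincipalValue volume q (curvatureIntegrand s F q))
    (hF' : HasPrincipalValue volume q (curvatureIntegrand s F' q))
    (hS : ∀ z, ¬(z ∈ F ↔ z ∈ F') → z ∈ S) :
    ‖fractionalMeanCurvature s F q - fractionalMeanCurvature s F' q‖ₑ ≤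
      ofReal 2 * ∫⁻ z in S, ofReal (1 / ‖z - q‖ ^ (N + s)) := by
  refine (enorm_principalValue_sub_le hF hF').trans ?_
  rw [← lintegral_const_mul' _ _ ofReal_ne_top]
  refine (lintegral_mono fun z => ?_).trans (lintegral_indicator_le _ S)
  by_cases hz : z ∈ F ↔ z ∈ F'
  · have : curvatureIntegrand s F q z = curvatureIntegrand s F' q z := by
      by_cases hzF : z ∈ F
      · simp [curvatureIntegrand, hzF, hz.1 hzF]
      · simp [curvatureIntegrand, hzF, mt hz.2 hzF]
    simp [this]
  · rw [indicator_of_mem (hS z hz), ← ofReal_norm, norm_eq_abs, curvatureIntegrand,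
      curvatureIntegrand, ← sub_div, abs_div, abs_of_nonneg (rpow_nonneg (norm_nonneg _) _)]
    rw [← ofReal_mul (by norm_num), mul_one_div]
    refine ofReal_le_ofReal (div_le_div_of_nonneg_right ?_
      (rpow_nonneg (norm_nonneg _) _))
    have h3 := abs_sgnInd F z
    have h4 := abs_sgnInd F' z
    have h5 := abs_sub (sgnInd F z) (sgnInd F' z)
    exact h5.trans (by rw [h3, h4]; norm_num)

lemma enorm_fractionalJacobi_sub_le {s : ℝ} {h' : V → ℝ} {p : V}
    (hJ : FractionalJacobiExists s E h p) (hJ' : FractionalJacobiExists s E h' p)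
    {M : ℝ} (hM0 : 0 ≤ M) (hM : ∀ x ∈ frontier E, |h' x - h x| ≤ M) {r : ℝ} (hr : 0 < r)
    (heq : ∀ x ∈ ball p r, h' x = h x) :
    ‖fractionalJacobi s E h' p - fractionalJacobi s E h p‖ₑ ≤ ofReal M *
      ∫⁻ x in (ball p r)ᶜ, ofReal (1 / ‖x - p‖ ^ (N + s))
        ∂(area E) := by
  have hp : h' p = h p := heq p (mem_ball_self hr)
  rw [fractionalJacobi, fractionalJacobi, hp, add_sub_add_right_eq_sub]
  refine (enorm_principalValue_sub_le hJ'.1 hJ.1).trans ?_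
  rw [← lintegral_const_mul' _ _ ofReal_ne_top,
    ← lintegral_indicator measurableSet_ball.compl]
  refine lintegral_mono_ae ?_
  filter_upwards [ae_restrict_mem isClosed_frontier.measurableSet] with x hx
  rw [jacobiIntegrand₁, jacobiIntegrand₁, hp, ← sub_div, sub_sub_sub_cancel_right, norm_sub_rev]
  by_cases hxb : x ∈ ball p r
  · simp [heq x hxb]
  · rw [indicator_of_mem (mem_compl hxb), ← ofReal_norm, norm_eq_abs, abs_div,
      abs_of_nonneg (rpow_nonneg (norm_nonneg _) _), ← ofReal_mul hM0, mul_one_div]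
    exact ofReal_le_ofReal (div_le_div_of_nonneg_right (hM x hx)
      (rpow_nonneg (norm_nonneg _) _))

/-- A normal perturbation is compared with the one by a truncated function. -/
lemma HasSmoothBoundary.enorm_curvature_sub_le (hE : HasSmoothBoundary E) {s : ℝ} (hs0 : 0 < s)
    (hs1 : s < 1) {h' : V → ℝ} (hh : SmoothOnSurface (frontier E) h)
    (hh' : SmoothOnSurface (frontier E) h') {M : ℝ} (hM : ∀ x ∈ frontier E, |h x| ≤ M)
    (hle : ∀ x ∈ frontier E, ∃ c ∈ Icc (0 : ℝ) 1, h' x = c * h x) {p : V} (hp : p ∈ frontier E)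
    {r : ℝ} (hr : 4 ≤ r) (heq : ∀ x ∈ ball p (2 * (r + 1) + 1), h' x = h x)
    {F F' : ℝ → Set V} {t₁ : ℝ} (ht₁ : 0 < t₁) (ht₁' : t₁ ≤ 1)
    (hF : ∀ τ : ℝ, |τ| ≤ t₁ → IsNormalPerturbation E h τ (F τ))
    {t₂ : ℝ} (hF' : ∀ τ : ℝ, |τ| < t₂ → IsNormalPerturbation E h' τ (F' τ)) {t : ℝ}
    (ht : |t| < t₁) (ht' : |t| < t₂) (htM : |t| * M ≤ 1 / 2) :
    ‖fractionalMeanCurvature s (F t) (Ψ E h t p) -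
        fractionalMeanCurvature s (F' t) (Ψ E h t p)‖ₑ ≤
      ofReal 2 * (ofReal (7 ^ N * (2 * (M + 1)) * |t|) * ofReal (2 ^ (N + s)) *
        ∫⁻ x in (ball p r)ᶜ, ofReal (1 / ‖x - p‖ ^ (N + s))
          ∂(area E)) := by
  have hne : (frontier E).Nonempty := ⟨p, hp⟩
  have hM' : ∀ x ∈ frontier E, |h' x| ≤ M := fun x hx => by
    obtain ⟨c, hc, hcx⟩ := hle x hx
    rw [hcx, abs_mul, abs_of_nonneg hc.1]
    exact (mul_le_of_le_one_left (abs_nonneg _) hc.2).trans (hM x hx)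
  have Ht := hF t ht.le
  have Ht' := hF' t ht'
  have hpd : Ψ E h' t p = Ψ E h t p := by
    rw [normalDisplacement, normalDisplacement, heq p (mem_ball_self (by linarith))]
  have hq := Ht.bijOn.mapsTo hp
  have hq' := Ht'.bijOn.mapsTo hp
  rw [hpd] at hq'
  obtain ⟨ρ, hρ, B, hB⟩ := Ht.smooth.curvature_estimates hs0 hs1 hq
  obtain ⟨ρ', hρ', B', hB'⟩ := Ht'.smooth.curvature_estimates hs0 hs1 hq'
  have h00 : F' 0 = F 0 := by
    have h1 := hF' 0 (by rw [abs_zero]; exact (abs_nonneg t).trans_lt ht')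
    have h2 : Ψ E h' 0 = Ψ E h 0 := by
      funext x; simp [normalDisplacement]
    exact IsNormalPerturbation.unique hne (h := h) (t := 0)
      ⟨h1.smooth, h2 ▸ h1.bijOn, h2 ▸ h1.immersion, h2 ▸ h1.normal⟩
      (hF 0 (by rw [abs_zero]; exact ht₁.le))
  -- The families agree at time `0`, so a point that distinguishes them at time `t` has changed side
  -- in one of them. What `h' = c h` with `c ∈ [0, 1]` sweeps at time `τ` is swept by `h` at time `τ
  -- c`.
  have hsw : ∀ z, ¬(z ∈ F t ↔ z ∈ F' t) → z ∈ normalSweep E h (frontier E) t := by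
    intro z hz
    by_cases hz0 : z ∈ F t ↔ z ∈ F 0
    · have hz1 : ¬(z ∈ F' t ↔ z ∈ F' 0) := fun h1 => hz (by rw [hz0, h1, h00])
      obtain ⟨x, hx, τ, hτ, rfl⟩ := exists_normalDisplacement_eq hE hh' hM' hne hF' ht' hz1
      obtain ⟨c, hc, hcx⟩ := hle x hx
      refine ⟨x, hx, τ * c, ?_, ?_⟩
      · rw [abs_mul, abs_of_nonneg hc.1]
        exact (mul_le_of_le_one_right (abs_nonneg _) hc.2).trans hτ
      · rw [normalDisplacement, normalDisplacement, hcx, mul_assoc]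
    · obtain ⟨x, hx, τ, hτ, rfl⟩ := exists_normalDisplacement_eq hE hh hM hne
        (fun τ hτ => hF τ hτ.le) ht hz0
      exact ⟨x, hx, τ, hτ, rfl⟩
  have hpp := norm_normalDisplacement_sub_le hE hM t hp
  refine (enorm_fractionalMeanCurvature_sub_le (hB _ (mem_ball_self hρ) hq).1
    (hB' _ (mem_ball_self hρ') hq').1
    (S := normalSweep E h (frontier E ∩ (ball p r)ᶜ) t) fun z hz => ?_).trans ?_
  -- A starting point within `r` of `p` would end within `r + 1` of the displaced `p`, where the two
  -- sets agree.
  · obtain ⟨x, hx, τ, hτ, rfl⟩ := hsw z hz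
    refine ⟨x, ⟨hx, fun hxp => hz ?_⟩, τ, hτ, rfl⟩
    refine Ht.mem_iff_of_ball Ht' hE hM hM' htM hp heq ?_
    rw [mem_ball, dist_eq_norm] at hxp ⊢
    have h1 := norm_normalDisplacement_sub_le hE hM τ hx
    have hM0 : 0 ≤ M := (abs_nonneg _).trans (hM p hp)
    have h2 : |τ| * M ≤ 1 / 2 := (mul_le_mul_of_nonneg_right hτ hM0).trans htM
    have h3 : Ψ E h τ x - Ψ E h t p =
      (Ψ E h τ x - x) + (x - p) - (Ψ E h t p - p) := by abel
    rw [h3]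
    have h4 := norm_add_le (Ψ E h τ x - x) (x - p)
    exact (norm_sub_le _ _).trans_lt (by linarith)
  · gcongr
    exact hE.setLIntegral_normalSweep_le hh hM ht₁ ht₁' (fun τ hτ => ⟨_, hF τ hτ⟩) hp
      (hpp.trans htM) hr (by positivity) ht.le htM

/-- Truncate `h` to a compactly supported `h'` equal to `h` in a large ball around `p`; its
perturbations come from a compactly supported flow, whose derivative is known. The truncation
changes the curvature at time `t` by at most a constant times `|t|` times a tail of the surface
integral of `‖x - p‖^(-N-s)`, and the Jacobi operator at `p` by at most `M` times that tail, which
is as small as desired. -/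
lemma HasSmoothBoundary.hasDerivAt_curvature (hE : HasSmoothBoundary E) {s : ℝ} (hs0 : 0 < s)
    (hs1 : s < 1)
    (hArea : Integrable (fun x : V => (1 + ‖x‖) ^ (-(N + s))) (area E))
    (hh : SmoothOnSurface (frontier E) h) {M : ℝ} (hM : ∀ x ∈ frontier E, |h x| ≤ M)
    {F : ℝ → Set V} (hF : ∀ᶠ t in 𝓝 (0 : ℝ), IsNormalPerturbation E h t (F t)) {p : V}
    (hp : p ∈ frontier E) :
    HasDerivAt (fun t => fractionalMeanCurvature s (F t) (Ψ E h t p))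
      (2 * fractionalJacobi s E h p) 0 := by
  have hM0 : 0 ≤ M := (abs_nonneg _).trans (hM p hp)
  obtain ⟨t₀, ht₀, hF₀⟩ := eventually_nhds_iff_ball.1 hF
  set t₁ := min (t₀ / 2) 1
  have ht₁ : 0 < t₁ := by positivity
  have hF₁ : ∀ τ : ℝ, |τ| ≤ t₁ → IsNormalPerturbation E h τ (F τ) := fun τ hτ => by
    refine hF₀ τ ?_
    rw [mem_ball, dist_zero_right, norm_eq_abs]
    linarith [hτ.trans (min_le_left _ _)]
  rw [hasDerivAt_iff_isLittleO, Asymptotics.isLittleO_iff]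
  intro ε hε
  set C₁ : ℝ := 2 * (7 ^ N * (2 * (M + 1)) * 2 ^ (N + s)) with hC₁
  have hC₁0 : 0 < C₁ := by positivity
  -- Leaves `ε / 3` for the changes of the curvature and of the derivative together; the truncated
  -- flow takes another `ε / 3`.
  set η : ℝ := ε / (3 * (C₁ + 2 * M))
  have hη : 0 < η := by positivity
  have hηε : (C₁ + 2 * M) * η = ε / 3 := by simp only [η]; field_simp
  obtain ⟨r, hr, hT⟩ := exists_lintegral_compl_ball_le hs0 hArea p hη
  -- truncation
  set ζ : ContDiffBump p := ⟨2 * (r + 1) + 1, 2 * (r + 1) + 2, by linarith, by linarith⟩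
  set h' : V → ℝ := fun x => ζ x * h x
  -- The radius is the one that `IsNormalPerturbation.mem_iff_of_ball` requires for agreement of the
  -- sets within `r + 1` of the displaced point.
  have hζ : ∀ x ∈ ball p (2 * (r + 1) + 1), h' x = h x := fun x hx => by
    simp only [h']
    rw [ζ.one_of_mem_closedBall (ball_subset_closedBall hx), one_mul]
  have hle : ∀ x ∈ frontier E, ∃ c ∈ Icc (0 : ℝ) 1, h' x = c * h x :=
    fun x _ => ⟨ζ x, ⟨ζ.nonneg, ζ.le_one⟩, rfl⟩
  have hM' : ∀ x ∈ frontier E, |h' x| ≤ M := fun x hx => by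
    obtain ⟨c, hc, hcx⟩ := hle x hx
    rw [hcx, abs_mul, abs_of_nonneg hc.1]
    exact (mul_le_of_le_one_left (abs_nonneg _) hc.2).trans (hM x hx)
  have hdiff : ∀ x ∈ frontier E, |h' x - h x| ≤ M := fun x hx => by
    obtain ⟨c, hc, hcx⟩ := hle x hx
    rw [hcx, show c * h x - h x = (c - 1) * h x by ring, abs_mul]
    exact (mul_le_of_le_one_left (abs_nonneg _) (abs_le.2 ⟨by linarith [hc.1], by linarith [hc.2]⟩)
      ).trans (hM x hx)
  have hh' : SmoothOnSurface (frontier E) h' := fun x hx => by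
    obtain ⟨g, hg, hgx⟩ := hh x hx
    refine ⟨fun z => ζ z * g z, ζ.contDiff.mul hg, ?_⟩
    filter_upwards [hgx] with z hz
    simp only [h', hz]
  have hc : CompactlySupportedIn (frontier E) univ h' := by
    refine ⟨frontier E ∩ closedBall p (2 * (r + 1) + 2),
      (isCompact_closedBall _ _).inter_left isClosed_frontier, fun x hx => ⟨hx.1, mem_univ x⟩,
      fun x hx hxK => ?_⟩
    have : ζ x = 0 := ζ.zero_of_le_dist (not_lt.1 fun h1 => hxK ⟨hx, h1.le⟩)
    simp only [h', this, zero_mul]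
  obtain ⟨X, hX, hXc, -, hXh⟩ := hE.exists_field hh' isOpen_univ hc
  obtain ⟨L, hL⟩ := (hX.of_le (m := 1) (by simp)).lipschitzWith_of_hasCompactSupport hXc (by simp)
  have hder := hE.hasDerivAt_curvature_shift hs0 hs1 hArea hX hXc hL hh' hM' hXh hp
  rw [hasDerivAt_iff_isLittleO, Asymptotics.isLittleO_iff] at hder
  set F' : ℝ → Set V := fun τ => shift X τ '' E
  set t₂ : ℝ := 1 / (2 * (L + 1))
  have ht₂ : 0 < t₂ := by positivity
  have hF' : ∀ τ : ℝ, |τ| < t₂ → IsNormalPerturbation E h' τ (F' τ) := fun τ hτ => by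
    refine isNormalPerturbation_shift hE hX hL ?_ hXh
    have := (lt_div_iff₀ (by positivity)).1 hτ
    nlinarith [abs_nonneg τ, L.2]
  -- the two comparison estimates
  have hJ : |fractionalJacobi s E h' p - fractionalJacobi s E h p| ≤ M * η := by
    obtain ⟨ρ, hρ, B, hB⟩ := hE.jacobi_estimates hs0 hs1 hArea hh hM hp
    obtain ⟨ρ', hρ', B', hB'⟩ := hE.jacobi_estimates hs0 hs1 hArea hh' hM' hp
    have h1 := (enorm_fractionalJacobi_sub_le (hB p (mem_ball_self hρ) hp).1
      (hB' p (mem_ball_self hρ') hp).1 hM0 hdiff (r := r) (by linarith)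
      fun x hx => hζ x (ball_subset_ball (by linarith) hx)).trans
      (mul_le_mul_right hT _)
    rw [← ofReal_norm, ← ofReal_mul hM0] at h1
    exact (ENNReal.ofReal_le_ofReal_iff (by positivity)).1 h1
  have hcomp : ∀ t, |t| < min (min t₁ t₂) (1 / (2 * (M + 1))) →
      |fractionalMeanCurvature s (F t) (Ψ E h t p) -
        fractionalMeanCurvature s (F' t) (shift X t p)| ≤ C₁ * η * |t| := by
    intro t ht
    have htM : |t| * M ≤ 1 / 2 := by
      have := (lt_div_iff₀ (by positivity)).1 (ht.trans_le (min_le_right _ _))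
      nlinarith [abs_nonneg t]
    have h1 := (hE.enorm_curvature_sub_le hs0 hs1 hh hh' hM hle hp hr hζ ht₁ (min_le_right _ _) hF₁
      hF' (ht.trans_le ((min_le_left _ _).trans (min_le_left _ _)))
      (ht.trans_le ((min_le_left _ _).trans (min_le_right _ _))) htM).trans
      (mul_le_mul_right (mul_le_mul_right hT _) _)
    rw [← ofReal_mul (by positivity), ← ofReal_mul (by positivity),
      ← ofReal_mul (by positivity), ← ofReal_norm] at h1
    have h3 := (ENNReal.ofReal_le_ofReal_iff (by positivity)).1 h1
    have h4 : Ψ E h t p = shift X t p := by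
      rw [← normalDisplacement_eq_shift (hXh p hp), normalDisplacement, normalDisplacement,
        hζ p (mem_ball_self (by linarith))]
    rw [← h4]
    refine h3.trans (le_of_eq ?_)
    rw [hC₁]; ring
  have hev : ∀ᶠ t in 𝓝 (0 : ℝ), |t| < min (min t₁ t₂) (1 / (2 * (M + 1))) := by
    have h1 : (0 : ℝ) < min (min t₁ t₂) (1 / (2 * (M + 1))) := by positivity
    filter_upwards [ball_mem_nhds (0 : ℝ) h1] with t ht
    rwa [mem_ball, dist_zero_right, norm_eq_abs] at ht
  -- At `t = 0` the comparison is exact, so both curvatures have the same initial value.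
  have h0 := hcomp 0 hev.self_of_nhds
  rw [abs_zero, mul_zero] at h0
  have h0' := sub_eq_zero.1 (abs_eq_zero.1 (le_antisymm h0 (abs_nonneg _)))
  filter_upwards [hev, hder (by positivity : (0 : ℝ) < ε / 3)] with t ht htd
  simp only [sub_zero, smul_eq_mul, norm_eq_abs] at htd ⊢
  rw [h0']
  set a := fractionalMeanCurvature s (F t) (Ψ E h t p)
  set b := fractionalMeanCurvature s (F' t) (shift X t p)
  set c := fractionalMeanCurvature s (F' 0) (shift X 0 p)
  set J := fractionalJacobi s E h p
  set J' := fractionalJacobi s E h' p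
  have h1 : a - c - t * (2 * J) = (a - b) + (b - c - t * (2 * J')) + 2 * (t * (J' - J)) := by ring
  rw [h1]
  refine (abs_add_le _ _).trans ?_
  have h2 := abs_add_le (a - b) (b - c - t * (2 * J'))
  have h3 : |2 * (t * (J' - J))| ≤ 2 * (|t| * (M * η)) := by
    rw [abs_mul, abs_mul, abs_two]
    gcongr
  have h4 := hcomp t ht
  have h5 : C₁ * η * |t| + 2 * (|t| * (M * η)) = ε / 3 * |t| := by rw [← hηε]; ring
  nlinarith [mul_nonneg hε.le (abs_nonneg t)]

end CurvatureVariation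

end NonlocalSurface

/-! ### The two variation formulas -/

theorem mainTheorem8 (N : ℕ) (hN : 1 ≤ N) (s : ℝ) (hs0 : 0 < s) (hs1 : s < 1)
    (E : Set (EuclideanSpace ℝ (Fin N))) (hE : HasSmoothBoundary E)
    (hArea : Integrable (fun x : EuclideanSpace ℝ (Fin N) => (1 + ‖x‖) ^ (-((N : ℝ) + s)))
      (surfaceMeasure E)) :
    -- second variation of the localized perimeter
    (∀ Ω : Set (EuclideanSpace ℝ (Fin N)), IsOpen Ω → Bornology.IsBounded Ω →
      ∀ h : EuclideanSpace ℝ (Fin N) → ℝ, SmoothOnSurface (frontier E) h →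
        CompactlySupportedIn (frontier E) Ω h →
        -- the objects in the formula are well defined
        (∀ᶠ t in 𝓝 (0 : ℝ), ∃ F, IsNormalPerturbation E h t F) ∧
        (∀ p ∈ frontier E, HasPrincipalValue volume p (curvatureIntegrand s E p) ∧
          FractionalJacobiExists s E h p) ∧
        Integrable (fun p => fractionalJacobi s E h p * h p) (surfaceMeasure E) ∧
        Integrable (fun p => h p ^ 2 * meanCurvature E p * fractionalMeanCurvature s E p)
          (surfaceMeasure E) ∧
        -- the formula
        ∀ Et : ℝ → Set (EuclideanSpace ℝ (Fin N)),
          (∀ᶠ t in 𝓝 (0 : ℝ), IsNormalPerturbation E h t (Et t)) →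
          (∀ᶠ t in 𝓝 (0 : ℝ), fractionalPerimeter s (Et t) Ω ≠ ⊤ ∧
            DifferentiableAt ℝ (fun τ => (fractionalPerimeter s (Et τ) Ω).toReal) t) ∧
          HasDerivAt (deriv fun τ => (fractionalPerimeter s (Et τ) Ω).toReal)
            (-2 * (∫ p, fractionalJacobi s E h p * h p ∂(surfaceMeasure E))
              - ∫ p, h p ^ 2 * meanCurvature E p * fractionalMeanCurvature s E p
                  ∂(surfaceMeasure E)) 0) ∧
    -- first derivative of the fractional mean curvature
    (∀ h : EuclideanSpace ℝ (Fin N) → ℝ, SmoothOnSurface (frontier E) h →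
      (∃ M : ℝ, ∀ x ∈ frontier E, |h x| ≤ M) →
      ∀ Et : ℝ → Set (EuclideanSpace ℝ (Fin N)),
        (∀ᶠ t in 𝓝 (0 : ℝ), IsNormalPerturbation E h t (Et t)) →
        ∀ p ∈ frontier E,
          (∀ᶠ t in 𝓝 (0 : ℝ), HasPrincipalValue volume (normalDisplacement E h t p)
            (curvatureIntegrand s (Et t) (normalDisplacement E h t p))) ∧
          FractionalJacobiExists s E h p ∧
          HasDerivAt
            (fun t => fractionalMeanCurvature s (Et t) (normalDisplacement E h t p))
            (2 * fractionalJacobi s E h p) 0) := by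
  refine ⟨fun Ω hΩ hΩb h hh hc => ?_, ?_⟩
  · obtain ⟨X, hX, hXc, hXΩ, hXh⟩ := hE.exists_field hh hΩ hc
    obtain ⟨L, hL⟩ := (hX.of_le (m := 1) (by simp)).lipschitzWith_of_hasCompactSupport hXc (by simp)
    obtain ⟨hex, iJ, iC, hlim⟩ := hE.tendsto_second_variation hs0 hs1 hArea hX hXc hh hXh
    have hX0 : ∀ x ∉ Ω, X x = 0 := fun x hx => image_eq_zero_of_notMem_tsupport fun h => hx (hXΩ h)
    have hpert := (eventually_small L one_pos).mono fun t ht =>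
      isNormalPerturbation_shift hE hX hL (ht.2.1.trans (by norm_num)) hXh
    refine ⟨hpert.mono fun t ht => ⟨_, ht⟩, hex, iJ, iC, fun Et hEt => ?_⟩
    obtain ⟨q, hd1, hd2, hq⟩ := hE.second_derivative_perimeter hX hL hΩ hΩb hs0 hs1 hX0
    -- The limit of the regularized second derivatives is evaluated in two ways: by dominated
    -- convergence on pairs, and on the surface.
    have hqe : q = _ := tendsto_nhds_unique hq (hlim.congr' (by
      filter_upwards [self_mem_nhdsWithin] with δ hδ
      rw [← hE.regularized_second_variation hs0 hArea hX hXc hXΩ hXh hδ]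
      refine integral_congr_ae (Eventually.of_forall fun z => ?_)
      exact (kern_mul_timeDeriv hX hL _ hδ z.1 z.2).2.symm))
    rw [← hqe]
    have hper : ∀ᶠ t in 𝓝 (0 : ℝ), fractionalPerimeter s (Et t) Ω =
        fractionalPerimeter s (shift X t '' E) Ω := by
      -- Without boundary the perturbation is not unique, but every admissible set then has empty
      -- boundary and zero perimeter.
      rcases (frontier E).eq_empty_or_nonempty with hemp | hne
      · filter_upwards [hEt, hpert] with t h1 h2
        have hfr : ∀ F, IsNormalPerturbation E h t F → frontier F = ∅ := fun F hF => by
          rw [← hF.bijOn.image_eq, hemp, image_empty]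
        rw [fractionalPerimeter_eq_zero s h1.smooth.1 (hfr _ h1),
          fractionalPerimeter_eq_zero s h2.smooth.1 (hfr _ h2)]
      · filter_upwards [hEt, hpert] with t h1 h2
        rw [h1.unique hne h2]
    have hper' : (fun τ => (fractionalPerimeter s (Et τ) Ω).toReal) =ᶠ[𝓝 0]
        fun τ => (fractionalPerimeter s (shift X τ '' E) Ω).toReal :=
      hper.mono fun t ht => by simp only [ht]
    refine ⟨?_, hd2.congr_of_eventuallyEq hper'.deriv⟩
    filter_upwards [hd1, hper, hper'.eventually_nhds] with t h1 h2 h3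
    exact ⟨h2 ▸ h1.1, h1.2.congr_of_eventuallyEq h3⟩
  rintro h hh ⟨M, hM⟩ Et hEt p hp
  obtain ⟨ρ, hρ, B, hB⟩ := hE.jacobi_estimates hs0 hs1 hArea hh hM hp
  refine ⟨?_, (hB p (Metric.mem_ball_self hρ) hp).1, hE.hasDerivAt_curvature hs0 hs1 hArea hh hM hEt hp⟩
  filter_upwards [hEt] with t ht
  have hq := ht.bijOn.mapsTo hp
  obtain ⟨ρ', hρ', B', hB'⟩ := ht.smooth.curvature_estimates hs0 hs1 hq
  exact (hB' _ (Metric.mem_ball_self hρ') hq).1
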